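/- For a string $S$ over a totally ordered alphabet, let $BWT(S)$ be the last column of the matrix of lexicographically sorted circular shifts of $S$, and let $\rho(S)$ be the number of runs (maximal unary substrings) of $S$. In the problem \emph{Constrained Alphabet Ordering} (CAO) one is given $d\ge 1$ nonempty strings $T_0,\dots,T_{d-1}$ over the alphabet $\{0,\dots,\sigma-1\}$ of total length $N=|T_0|+\dots+|T_{d-1}|$, and has to find an ordering (permutation) $\pi$ of $\{0,\dots,d-1\}$ such that, with the symbols ordered by $\$_{\pi(0)}\prec\$_{\pi(1)}\prec\dots\prec\$_{\pi(d-1)}\prec 0\prec\dots\prec\sigma-1$, the number $\rho(BWT(T_0\$_0T_1\$_1\cdots T_{d-1}\$_{d-1}))$ is minimum among all permutations. Theorem. CAO can be solved in optimal $O(N)$ time in the word-RAM model over polynomially bounded integer alphabets. That is: (1) There is a word-RAM program $P$ such that for every $a\in\mathbb N$ there are $b,C\in\mathbb N$ for which $P$, on every instance with $\sigma\le (N+1)^a$ and on every machine with word length $w\ge b\log_2(N+1)$ bits, halts after at most $C\cdot N$ steps and outputs an optimal ordering $\pi$. (2) Linear time is optimal: for all $a,b\in\mathbb N$, if some word-RAM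 program solves CAO, on all instances with $\sigma\le (N+1)^a$ and all machines with word length $w\ge b\log_2(N+1)$, in at most $f(N)$ steps, then $f(N)=\Omega(N)$. -/

import Mathlib

/-! Runs, the Burrows-Wheeler transform, and the problem Constrained Alphabet Ordering (CAO). -/

namespace CAO

/-- The number of runs (maximal unary substrings) of a string: collapse every block of equal
consecutive symbols to a single symbol and count what is left. -/
def numRuns {α : Type} [DecidableEq α] (l : List α) : ℕ :=
  (l.destutter (· ≠ ·)).length

/-- The Burrows-Wheeler transform of `l` with respect to the ordering of the symbols by the
(injective) `rank`: sort the circular shifts of `l` lexicographically and read off the last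
column from top to bottom. -/
def bwt {α : Type} (rank : α → ℕ) (l : List α) : List α :=
  (((List.range l.length).map l.rotate).mergeSort
    (fun x y => decide (x.map rank ≤ y.map rank))).filterMap List.getLast?

/-- An instance: `d ≥ 1` nonempty strings over the alphabet `{0, …, σ - 1}`. Repetitions among
the strings are allowed. -/
structure Instance where
  d : ℕ
  σ : ℕ
  T : Fin d → List (Fin σ)
  d_pos : 0 < d
  T_ne_nil : ∀ i, T i ≠ []

namespace Instance

variable (I : Instance)

/-- The total length `N` of the strings. -/
def size : ℕ := ∑ i, (I.T i).length

/-- The symbols of the text: `Sum.inl i` is the special symbol `$_i`, `Sum.inr c` is the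
letter `c`. -/
abbrev Sym : Type := Fin I.d ⊕ Fin I.σ

/-- The text `T_0 $_0 T_1 $_1 … T_{d-1} $_{d-1}`. -/
def text : List I.Sym :=
  (List.ofFn fun i => (I.T i).map Sum.inr ++ [Sum.inl i]).flatten

/-- The ordering `$_{π(0)} ≺ $_{π(1)} ≺ … ≺ $_{π(d-1)} ≺ 0 ≺ … ≺ σ - 1`, as the position of
each symbol in it. -/
def rank (π : Equiv.Perm (Fin I.d)) : I.Sym → ℕ :=
  Sum.elim (fun j => (π.symm j : ℕ)) (fun c => I.d + (c : ℕ))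

/-- The number of runs of the Burrows-Wheeler transform of the text under the ordering `π`. -/
def runs (π : Equiv.Perm (Fin I.d)) : ℕ := numRuns (bwt (I.rank π) I.text)

/-- The ordering `π` minimises the number of runs. -/
def IsOptimal (π : Equiv.Perm (Fin I.d)) : Prop := ∀ π', I.runs π ≤ I.runs π'

end Instance

/-! The machine model: a word RAM with words of `w` bits and structured control flow. A program
is a fixed finite object, so it can name only finitely many registers and arrays; every
operation on words, including an indirect memory access, has unit cost. -/

/-- Operations on words; results are reduced modulo `2 ^ w`, `sub` is truncated at `0`, and the
comparisons return `0` or `1`. -/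
inductive BinOp where
  | add | sub | mul | div | mod | lt | eq

/-- The value of an operation before the reduction modulo `2 ^ w`. -/
def BinOp.apply : BinOp → ℕ → ℕ → ℕ
  | add, x, y => x + y
  | sub, x, y => x - y
  | mul, x, y => x * y
  | div, x, y => x / y
  | mod, x, y => x % y
  | lt, x, y => if x < y then 1 else 0
  | eq, x, y => if x = y then 1 else 0

/-- Expressions; `load A e` is the content of cell number `e` of the array `A`. -/
inductive Expr where
  | const (n : ℕ)
  | reg (x : ℕ)
  | load (A : ℕ) (e : Expr)
  | op (o : BinOp) (e₁ e₂ : Expr)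

/-- Programs. `store A i e` writes the value of `e` into cell number `i` of the array `A`; a test
succeeds if its value is not `0`. -/
inductive Prog where
  | skip
  | assign (x : ℕ) (e : Expr)
  | store (A : ℕ) (i e : Expr)
  | seq (p q : Prog)
  | ite (e : Expr) (p q : Prog)
  | loop (e : Expr) (p : Prog)

/-- A memory state: the contents of the registers and of the cells of the arrays. -/
structure State where
  reg : ℕ → ℕ
  arr : ℕ → ℕ → ℕ

/-- The value of an expression on a machine with `w`-bit words. -/
def Expr.eval (w : ℕ) (s : State) : Expr → ℕ
  | const n => n % 2 ^ w
  | reg x => s.reg x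
  | load A e => s.arr A (e.eval w s)
  | op o e₁ e₂ => o.apply (e₁.eval w s) (e₂.eval w s) % 2 ^ w

/-- The time to evaluate an expression: one step for each of its nodes. -/
def Expr.cost : Expr → ℕ
  | const _ => 1
  | reg _ => 1
  | load _ e => e.cost + 1
  | op _ e₁ e₂ => e₁.cost + e₂.cost + 1

/-- Write the value `v` into the register `x`. -/
def State.setReg (s : State) (x v : ℕ) : State :=
  { s with reg := Function.update s.reg x v }

/-- Write the value `v` into cell `i` of the array `A`. -/
def State.setArr (s : State) (A i v : ℕ) : State :=
  { s with arr := Function.update s.arr A (Function.update (s.arr A) i v) }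

/-- `Exec w p s t s'`: on a machine with `w`-bit words, the program `p` started in the state `s`
halts after exactly `t` steps in the state `s'`. -/
inductive Exec (w : ℕ) : Prog → State → ℕ → State → Prop where
  | skip (s : State) : Exec w Prog.skip s 1 s
  | assign (s : State) (x : ℕ) (e : Expr) :
      Exec w (Prog.assign x e) s (e.cost + 1) (s.setReg x (e.eval w s))
  | store (s : State) (A : ℕ) (i e : Expr) :
      Exec w (Prog.store A i e) s (i.cost + e.cost + 1) (s.setArr A (i.eval w s) (e.eval w s))
  | seq {p q : Prog} {s s₁ s₂ : State} {t₁ t₂ : ℕ} (hp : Exec w p s t₁ s₁)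
      (hq : Exec w q s₁ t₂ s₂) : Exec w (Prog.seq p q) s (t₁ + t₂) s₂
  | ite_true {e : Expr} {p q : Prog} {s s₁ : State} {t : ℕ} (he : e.eval w s ≠ 0)
      (hp : Exec w p s t s₁) : Exec w (Prog.ite e p q) s (e.cost + 1 + t) s₁
  | ite_false {e : Expr} {p q : Prog} {s s₁ : State} {t : ℕ} (he : e.eval w s = 0)
      (hq : Exec w q s t s₁) : Exec w (Prog.ite e p q) s (e.cost + 1 + t) s₁
  | loop_true {e : Expr} {p : Prog} {s s₁ s₂ : State} {t₁ t₂ : ℕ} (he : e.eval w s ≠ 0)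
      (hp : Exec w p s t₁ s₁) (hl : Exec w (Prog.loop e p) s₁ t₂ s₂) :
      Exec w (Prog.loop e p) s (e.cost + 1 + t₁ + t₂) s₂
  | loop_false {e : Expr} {p : Prog} {s : State} (he : e.eval w s = 0) :
      Exec w (Prog.loop e p) s (e.cost + 1) s

/-- The initial state on the input `I`: the registers `0, 1, 2` hold `d`, `N`, `σ`, the array `0`
holds the concatenation `T_0 T_1 … T_{d-1}`, the array `1` holds the lengths
`|T_0|, …, |T_{d-1}|`, and everything else is `0`. -/
def Instance.init (I : Instance) : State where
  reg
    | 0 => I.d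
    | 1 => I.size
    | 2 => I.σ
    | _ => 0
  arr
    | 0 => fun j => ((List.ofFn I.T).flatten.map Fin.val).getD j 0
    | 1 => fun j => (List.ofFn fun i => (I.T i).length).getD j 0
    | _ => fun _ => 0

/-- The state `s` holds the ordering `π` as output: the array `2` starts with
`π(0), …, π(d-1)`. -/
def Instance.Outputs (I : Instance) (s : State) (π : Equiv.Perm (Fin I.d)) : Prop :=
  ∀ i : Fin I.d, s.arr 2 i = π i

/-- The program `P` solves CAO in time `f`: on every input of total length `N` with `σ ≤ (N+1)^a`,
on every machine whose word length `w` satisfies `w ≥ b log₂(N+1)`, it halts after at most `f N`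
steps and outputs an ordering of the special symbols that minimises the number of runs. -/
def SolvesInTime (P : Prog) (a b : ℕ) (f : ℕ → ℕ) : Prop :=
  ∀ I : Instance, I.σ ≤ (I.size + 1) ^ a → ∀ w : ℕ, (I.size + 1) ^ b ≤ 2 ^ w →
    ∃ (t : ℕ) (s : State) (π : Equiv.Perm (Fin I.d)),
      Exec w P I.init t s ∧ t ≤ f I.size ∧ I.Outputs s π ∧ I.IsOptimal π

end CAO

/-! ### The machine -/

namespace CAO

/-! Compare two rotations up to the end of the strings in which they start. If these suffixes
differ, the comparison is decided by two letters or by a special symbol against a letter, whatever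
the ordering of the special symbols. If they are equal, the two special symbols decide. So the
positions of the text fall into blocks of equal suffixes, the order of the blocks is fixed, and an
ordering `π` only sorts each block by the strings to which its positions belong
(`Layout.rotate_lt_of_precedes`, `Layout.runs_eq`). The transform lists the preceding symbols block
by block, and special symbols occur only once each (`Layout.sy_eq_iff`).

A block needs at least as many runs as it has distinct symbols, and a run is saved at a boundary
only when the last symbol of a block equals the first symbol of the next one. The only conflict is
that a block with several symbols cannot begin and end with the same symbol without spending an
extra run. A scan of the boundaries therefore keeps at most two admissible symbols for each of them
(`Greedy`): two always leave an alternative, one may block the next boundary. The number of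
boundaries with a candidate bounds the net saving (`Greedy.card_le`, `Blocks.le_changes`), and a
scan in the opposite direction selects compatible candidates that attain it (`Choice.spec`,
`Blocks.changes_le`).

The desired orders of the symbols in the different blocks can all be realised by one `π`. The
positions of a block that are preceded by one given letter form, shifted back by one, a block again;
so the blocks are the nodes of the trie of the reversed strings, and any ordering of the children of
every node is induced by an ordering of the strings. Concretely, every letter is replaced by a label
that encodes its desired place in its block, and the reversed strings are sorted by these labels
(`Layout.exists_isOptimal`).

Both the blocks and the final ordering come from sorting label sequences along linked lists. This is
done by the skew algorithm: nodes whose position is not divisible by 3 are at most two thirds of all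
nodes, triples of labels become the labels of a smaller instance (`Reduced.key_lt_key_iff`), and the
ranks of the sampled nodes determine all ranks (`Reduced.isRank`). No merging is needed, because a
rank is a number of smaller nodes and can be added up over the classes modulo 3. Everything is
reduced to ranking pairs of small numbers in linear time (`run_rankBy`); the recursion becomes two
loops over a stack of windows (`run_sufRank`). Letters up to `(N+1)^a` are first replaced by their
ranks with a radix sort of at most `a + 1` passes (`run_radixSort`).

For the lower bound, one step changes at most one memory cell, while an ordering of `n` strings has
`n - 1` nonzero entries that must be written over zeros (`SolvesInTime.le`). -/

instance (n : ℕ) : OfNat Expr n := ⟨.const n⟩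
instance : Add Expr := ⟨.op .add⟩
instance : Sub Expr := ⟨.op .sub⟩
instance : Mul Expr := ⟨.op .mul⟩
instance : Div Expr := ⟨.op .div⟩
instance : Mod Expr := ⟨.op .mod⟩

/-- The expression that tests `e₁ < e₂`. -/
def Expr.less (e₁ e₂ : Expr) : Expr := .op .lt e₁ e₂

/-- The expression that tests `e₁ = e₂`. -/
def Expr.same (e₁ e₂ : Expr) : Expr := .op .eq e₁ e₂

infixr:30 " ;; " => Prog.seq

section Eval

variable {w : ℕ} {s : State}

@[simp] theorem eval_reg (x : ℕ) : (Expr.reg x).eval w s = s.reg x := rfl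

@[simp] theorem eval_load (A : ℕ) (e : Expr) :
    (Expr.load A e).eval w s = s.arr A (e.eval w s) := rfl

@[simp] theorem eval_add (a b : Expr) :
    (a + b).eval w s = (a.eval w s + b.eval w s) % 2 ^ w := rfl

@[simp] theorem eval_sub (a b : Expr) :
    (a - b).eval w s = (a.eval w s - b.eval w s) % 2 ^ w := rfl

@[simp] theorem eval_mul (a b : Expr) :
    (a * b).eval w s = (a.eval w s * b.eval w s) % 2 ^ w := rfl

@[simp] theorem eval_div (a b : Expr) :
    (a / b).eval w s = (a.eval w s / b.eval w s) % 2 ^ w := rfl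

@[simp] theorem eval_mod (a b : Expr) :
    (a % b).eval w s = (a.eval w s % b.eval w s) % 2 ^ w := rfl

@[simp] theorem eval_zero : (0 : Expr).eval w s = 0 := Nat.zero_mod _

variable [hw : Fact (8 ≤ 2 ^ w)]

/-- The standing assumption `8 ≤ 2 ^ w` protects the small literals and the results of tests from
reduction modulo `2 ^ w`. -/
theorem small_mod {n : ℕ} (h : n < 8) : n % 2 ^ w = n := Nat.mod_eq_of_lt (h.trans_le hw.out)

@[simp] theorem eval_one : (1 : Expr).eval w s = 1 := small_mod (by norm_num)

@[simp] theorem eval_two : (2 : Expr).eval w s = 2 := small_mod (by norm_num)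

@[simp] theorem eval_three : (3 : Expr).eval w s = 3 := small_mod (by norm_num)

@[simp] theorem eval_less (a b : Expr) :
    (a.less b).eval w s = if a.eval w s < b.eval w s then 1 else 0 := by
  change (if _ then 1 else 0) % 2 ^ w = _
  apply small_mod; split_ifs <;> norm_num

@[simp] theorem eval_same (a b : Expr) :
    (a.same b).eval w s = if a.eval w s = b.eval w s then 1 else 0 := by
  change (if _ then 1 else 0) % 2 ^ w = _
  apply small_mod; split_ifs <;> norm_num

end Eval

@[simp] theorem State.setReg_reg (s : State) (x v y : ℕ) :
    (s.setReg x v).reg y = if y = x then v else s.reg y := by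
  simp [State.setReg, Function.update_apply]

@[simp] theorem State.setReg_arr (s : State) (x v : ℕ) : (s.setReg x v).arr = s.arr := rfl

@[simp] theorem State.setArr_reg (s : State) (A i v : ℕ) : (s.setArr A i v).reg = s.reg := rfl

theorem State.setArr_arr (s : State) (A i v B : ℕ) :
    (s.setArr A i v).arr B = if B = A then Function.update (s.arr A) i v else s.arr B := by
  simp [State.setArr, Function.update_apply]

@[simp] theorem State.setArr_arr_apply (s : State) (A i v B j : ℕ) :
    (s.setArr A i v).arr B j = if B = A ∧ j = i then v else s.arr B j := by
  by_cases h : B = A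
  · subst h; simp [State.setArr, Function.update_apply]
  · simp [State.setArr_arr, h]

/-- Does the program contain an assignment to the register `x`? -/
def Prog.writesReg : Prog → ℕ → Bool
  | .skip, _ => false
  | .assign y _, x => x == y
  | .store _ _ _, _ => false
  | .seq p q, x => p.writesReg x || q.writesReg x
  | .ite _ p q, x => p.writesReg x || q.writesReg x
  | .loop _ p, x => p.writesReg x

/-- Does the program contain a write to the array `A`? -/
def Prog.writesArr : Prog → ℕ → Bool
  | .skip, _ => false
  | .assign _ _, _ => false
  | .store B _ _, A => A == B
  | .seq p q, A => p.writesArr A || q.writesArr A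
  | .ite _ p q, A => p.writesArr A || q.writesArr A
  | .loop _ p, A => p.writesArr A

/-- Frame rule: the hypothesis is a computable check of the program text, so for concrete programs
and registers it is discharged by `rfl`. -/
theorem Exec.reg_eq {w : ℕ} {p : Prog} {s s' : State} {t : ℕ} (h : Exec w p s t s') {x : ℕ}
    (hx : p.writesReg x = false) : s'.reg x = s.reg x := by
  induction h <;> simp_all [Prog.writesReg]

theorem Exec.arr_eq {w : ℕ} {p : Prog} {s s' : State} {t : ℕ} (h : Exec w p s t s') {A : ℕ}
    (hA : p.writesArr A = false) : s'.arr A = s.arr A := by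
  induction h <;> simp_all [Prog.writesArr, State.setArr_arr]

/-- All words of the state are smaller than `2 ^ w`. -/
structure WF (w : ℕ) (s : State) : Prop where
  reg : ∀ x, s.reg x < 2 ^ w
  arr : ∀ A i, s.arr A i < 2 ^ w

theorem WF.eval {w : ℕ} {s : State} (hs : WF w s) (e : Expr) : e.eval w s < 2 ^ w := by
  cases e with
  | const n => exact Nat.mod_lt _ (by positivity)
  | reg x => exact hs.reg x
  | load A e => exact hs.arr _ _
  | op o a b => exact Nat.mod_lt _ (by positivity)

theorem WF.setReg {w : ℕ} {s : State} (hs : WF w s) {x v : ℕ} (hv : v < 2 ^ w) :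
    WF w (s.setReg x v) :=
  ⟨fun y => by rw [State.setReg_reg]; split_ifs; exacts [hv, hs.reg y], hs.arr⟩

theorem WF.setArr {w : ℕ} {s : State} (hs : WF w s) {A i v : ℕ} (hv : v < 2 ^ w) :
    WF w (s.setArr A i v) :=
  ⟨hs.reg, fun B j => by rw [State.setArr_arr_apply]; split_ifs; exacts [hv, hs.arr B j]⟩

/-- Arithmetic results are reduced and loads only copy existing words. The invariant later allows
reductions of stored words to be dropped. -/
theorem Exec.wf {w : ℕ} {p : Prog} {s s' : State} {t : ℕ} (h : Exec w p s t s') (hs : WF w s) :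
    WF w s' := by
  induction h with
  | skip => exact hs
  | assign => exact hs.setReg (hs.eval _)
  | store => exact hs.setArr (hs.eval _)
  | seq _ _ h₁ h₂ => exact h₂ (h₁ hs)
  | ite_true _ _ h => exact h hs
  | ite_false _ _ h => exact h hs
  | loop_true _ _ _ h₁ h₂ => exact h₂ (h₁ hs)
  | loop_false => exact hs

/-- The program `p` leads from `s` to `s'` in at most `T` steps. -/
def Run (w : ℕ) (p : Prog) (T : ℕ) (s s' : State) : Prop := ∃ t ≤ T, Exec w p s t s'

namespace Run

variable {w : ℕ} {p q : Prog} {s s' s'' : State} {T T' : ℕ}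

theorem reg_eq (h : Run w p T s s') {x : ℕ} (hx : p.writesReg x = false) :
    s'.reg x = s.reg x := by
  obtain ⟨t, -, h⟩ := h
  exact h.reg_eq hx

theorem arr_eq (h : Run w p T s s') {A : ℕ} (hA : p.writesArr A = false) :
    s'.arr A = s.arr A := by
  obtain ⟨t, -, h⟩ := h
  exact h.arr_eq hA

theorem wf (h : Run w p T s s') (hs : WF w s) : WF w s' := by
  obtain ⟨t, -, h⟩ := h
  exact h.wf hs

theorem mono (h : Run w p T s s') (hT : T ≤ T') : Run w p T' s s' := by
  obtain ⟨t, ht, h⟩ := h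
  exact ⟨t, ht.trans hT, h⟩

theorem seq (h : Run w p T s s') (h' : Run w q T' s' s'') : Run w (p ;; q) (T + T') s s'' := by
  obtain ⟨t, ht, h⟩ := h
  obtain ⟨t', ht', h'⟩ := h'
  exact ⟨t + t', by omega, .seq h h'⟩

theorem assign (s : State) (x : ℕ) (e : Expr) :
    Run w (.assign x e) (e.cost + 1) s (s.setReg x (e.eval w s)) := ⟨_, le_rfl, .assign s x e⟩

theorem store (s : State) (A : ℕ) (i e : Expr) :
    Run w (.store A i e) (i.cost + e.cost + 1) s (s.setArr A (i.eval w s) (e.eval w s)) :=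
  ⟨_, le_rfl, .store s A i e⟩

end Run

/-- The effect of a program without loops. -/
def Prog.den (w : ℕ) : Prog → State → State
  | .skip, s => s
  | .assign x e, s => s.setReg x (e.eval w s)
  | .store A i e, s => s.setArr A (i.eval w s) (e.eval w s)
  | .seq p q, s => q.den w (p.den w s)
  | .ite e p q, s => if e.eval w s = 0 then q.den w s else p.den w s
  | .loop _ _, s => s

/-- Is the program free of loops? -/
def Prog.flat : Prog → Bool
  | .seq p q => p.flat && q.flat
  | .ite _ p q => p.flat && q.flat
  | .loop _ _ => false
  | _ => true

/-- A bound for the running time of a program without loops. -/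
def Prog.time : Prog → ℕ
  | .skip => 1
  | .assign _ e => e.cost + 1
  | .store _ i e => i.cost + e.cost + 1
  | .seq p q => p.time + q.time
  | .ite e p q => e.cost + 1 + (p.time + q.time)
  | .loop _ _ => 0

/-- Without loops the final state is a function of the initial one, so the effect of a loop body can
be computed by `simp` instead of by building derivations. The time bound pays for both branches of a
test. -/
theorem run_flat {w : ℕ} {p : Prog} (hp : p.flat = true) (s : State) :
    Run w p p.time s (p.den w s) := by
  induction p generalizing s with
  | skip => exact ⟨_, le_rfl, .skip s⟩
  | assign x e => exact Run.assign ..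
  | store A i e => exact Run.store ..
  | seq p q ihp ihq =>
    simp only [Prog.flat, Bool.and_eq_true] at hp
    exact (ihp hp.1 s).seq (ihq hp.2 _)
  | ite e p q ihp ihq =>
    simp only [Prog.flat, Bool.and_eq_true] at hp
    by_cases he : e.eval w s = 0
    · obtain ⟨t, ht, h⟩ := ihq hp.2 s
      refine ⟨e.cost + 1 + t, by simp only [Prog.time]; omega, ?_⟩
      simp only [Prog.den, he, if_true]
      exact .ite_false he h
    · obtain ⟨t, ht, h⟩ := ihp hp.1 s
      refine ⟨e.cost + 1 + t, by simp only [Prog.time]; omega, ?_⟩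
      simp only [Prog.den, he, if_false]
      exact .ite_true he h
  | loop => simp [Prog.flat] at hp

/-- A loop that preserves an invariant and pays for its steps with a potential. -/
theorem run_loop {w : ℕ} {e : Expr} {p : Prog} (Inv : State → Prop) (Φ : State → ℕ)
    (step : ∀ s, Inv s → e.eval w s ≠ 0 →
      ∃ s' T, Run w p T s s' ∧ Inv s' ∧ T + e.cost + 1 + Φ s' ≤ Φ s)
    (s : State) (hs : Inv s) :
    ∃ s', Run w (.loop e p) (Φ s + e.cost + 1) s s' ∧ Inv s' ∧ e.eval w s' = 0 := by
  induction h : Φ s using Nat.strong_induction_on generalizing s with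
  | _ n ih =>
    by_cases he : e.eval w s = 0
    · exact ⟨s, ⟨_, by omega, .loop_false he⟩, hs, he⟩
    · obtain ⟨s₁, T, ⟨t, ht, h₁⟩, hI, hΦ⟩ := step s hs he
      obtain ⟨s₂, ⟨t₂, ht₂, h₂⟩, hI₂, he₂⟩ := ih (Φ s₁) (by omega) s₁ hI rfl
      exact ⟨s₂, ⟨_, by omega, .loop_true he h₁ h₂⟩, hI₂, he₂⟩

/-- The loop that runs `p` with `1, 2, …` up to the value of the register `m` in register `x`. -/
def Prog.upto (x m : ℕ) (p : Prog) : Prog :=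
  .assign x 0 ;; .loop ((Expr.reg x).less (.reg m)) (.assign x (.reg x + 1) ;; p)

/-- The counter is incremented before the body, hence the value `i + 1` in round `i`. As the loop
itself writes the counter, the invariant must not depend on it (`hreg`); whatever the body does not
write still has its initial value. Each round pays 8 steps for test and increment, and 6 pay for the
initial assignment and the last test. -/
theorem run_upto {w : ℕ} [hw : Fact (8 ≤ 2 ^ w)] {x m : ℕ} {p : Prog} {n T : ℕ} {s₀ : State}
    (hwf : WF w s₀) (hn : s₀.reg m = n)
    (hxm : x ≠ m) (hx : p.writesReg x = false) (hm : p.writesReg m = false)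
    (Inv : ℕ → State → Prop)
    (hreg : ∀ i s v, Inv i s → Inv i (s.setReg x v)) (h₀ : Inv 0 s₀)
    (step : ∀ i < n, ∀ s, WF w s → s.reg x = i + 1 →
      (∀ y, y ≠ x → p.writesReg y = false → s.reg y = s₀.reg y) →
      (∀ A, p.writesArr A = false → s.arr A = s₀.arr A) → Inv i s →
      ∃ s', Run w p T s s' ∧ Inv (i + 1) s') :
    ∃ s', Run w (.upto x m p) (n * (T + 8) + 6) s₀ s' ∧ Inv n s' := by
  have hn' : n < 2 ^ w := hn ▸ hwf.reg m
  obtain ⟨s', hrun, ⟨⟨hwf', hm', -, -, hI⟩, hle⟩, he⟩ := run_loop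
    (w := w) (e := (Expr.reg x).less (.reg m)) (p := .assign x (.reg x + 1) ;; p)
    (fun s => (WF w s ∧ s.reg m = n ∧
      (∀ y, y ≠ x → p.writesReg y = false → s.reg y = s₀.reg y) ∧
      (∀ A, p.writesArr A = false → s.arr A = s₀.arr A) ∧ Inv (s.reg x) s) ∧ s.reg x ≤ n)
    (fun s => (n - s.reg x) * (T + 8)) (by
      rintro s ⟨⟨hwf, hm', hr, ha, hI⟩, hle⟩ he
      simp only [eval_less, eval_reg, ne_eq, ite_eq_right_iff, one_ne_zero, imp_false,
        not_not, hm'] at he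
      have hev : (Expr.reg x + 1).eval w s = s.reg x + 1 := by
        simp only [eval_add, eval_reg, eval_one]
        exact Nat.mod_eq_of_lt (by omega)
      obtain ⟨s', hrun, hI'⟩ := step (s.reg x) he (s.setReg x (s.reg x + 1))
        (hwf.setReg (by omega)) (by simp) (fun y hy hp => by simp [hy, hr y hy hp])
        (fun A hA => by simp [ha A hA]) (hreg _ _ _ hI)
      have hx' : s'.reg x = s.reg x + 1 := by rw [hrun.reg_eq hx]; simp
      refine ⟨s', 4 + T, ?_, ⟨⟨?_, ?_, ?_, ?_, by rwa [hx']⟩, by omega⟩, ?_⟩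
      · refine Run.seq ?_ hrun
        rw [← hev]
        exact Run.assign ..
      · exact hrun.wf (hwf.setReg (by omega))
      · rw [hrun.reg_eq hm]; simp [hxm.symm, hm']
      · intro y hy hp
        rw [hrun.reg_eq hp]; simp [hy, hr y hy hp]
      · intro A hA
        rw [hrun.arr_eq hA]; simp [ha A hA]
      · have : n - s.reg x = (n - s'.reg x) + 1 := by omega
        rw [this, add_mul, one_mul]
        change 4 + T + 3 + 1 + _ ≤ _
        omega)
    (s₀.setReg x 0)
    ⟨⟨hwf.setReg (by positivity), by simp [hxm.symm, hn], fun y hy _ => by simp [hy],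
      fun A _ => rfl, by simpa using hreg _ _ 0 h₀⟩, by simp⟩
  have hx' : s'.reg x = n := by
    simp only [eval_less, eval_reg, ite_eq_right_iff, one_ne_zero, imp_false, not_lt, hm'] at he
    omega
  refine ⟨s', ?_, hx' ▸ hI⟩
  have := (Run.assign (w := w) s₀ x 0).seq (q := .loop ((Expr.reg x).less (.reg m))
    (.assign x (.reg x + 1) ;; p)) (by simpa only [eval_zero] using hrun)
  refine this.mono ?_
  simp only [State.setReg_reg, if_true, Nat.sub_zero]
  change 1 + 1 + (n * (T + 8) + 3 + 1) ≤ _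
  omega

/-- `run_upto` for bodies without loops. -/
theorem run_upto_flat {w : ℕ} [hw : Fact (8 ≤ 2 ^ w)] {x m : ℕ} {p : Prog} {n : ℕ} {s₀ : State}
    (hwf : WF w s₀) (hn : s₀.reg m = n) (hp : p.flat = true)
    (hxm : x ≠ m) (hx : p.writesReg x = false) (hm : p.writesReg m = false)
    (Inv : ℕ → State → Prop)
    (hreg : ∀ i s v, Inv i s → Inv i (s.setReg x v)) (h₀ : Inv 0 s₀)
    (step : ∀ i < n, ∀ s, WF w s → s.reg x = i + 1 →
      (∀ y, y ≠ x → p.writesReg y = false → s.reg y = s₀.reg y) →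
      (∀ A, p.writesArr A = false → s.arr A = s₀.arr A) → Inv i s →
      Inv (i + 1) (p.den w s)) :
    ∃ s', Run w (.upto x m p) (n * (p.time + 8) + 6) s₀ s' ∧ Inv n s' :=
  run_upto hwf hn hxm hx hm Inv hreg h₀ fun i hi s h₁ h₂ h₃ h₄ h₅ =>
    ⟨_, run_flat hp s, step i hi s h₁ h₂ h₃ h₄ h₅⟩

/-- The loop that sets cell `i` of `A` to `e`, for all `x = 1, …, m`. -/
def Prog.fill (x m A : ℕ) (i e : Expr) : Prog := .upto x m (.store A i e)

/-- Injectivity of the target cells keeps earlier values from being overwritten. The expressions may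
even read `A` itself, as long as they read only cells that are not targets. -/
theorem run_fill {w : ℕ} [hw : Fact (8 ≤ 2 ^ w)] {x m A n : ℕ} {i e : Expr} {s₀ : State}
    (hwf : WF w s₀) (hn : s₀.reg m = n) (hxm : x ≠ m) (g v : ℕ → ℕ)
    (hg : Set.InjOn g (Set.Icc 1 n))
    (hev : ∀ k ∈ Set.Icc 1 n, ∀ s, s.reg x = k → (∀ y, y ≠ x → s.reg y = s₀.reg y) →
      (∀ B, B ≠ A → s.arr B = s₀.arr B) →
      (∀ j, (∀ k ∈ Set.Icc 1 n, g k ≠ j) → s.arr A j = s₀.arr A j) → WF w s →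
      i.eval w s = g k ∧ e.eval w s = v k) :
    ∃ s', Run w (.fill x m A i e) (n * (i.cost + e.cost + 9) + 6) s₀ s' ∧
      (∀ k ∈ Set.Icc 1 n, s'.arr A (g k) = v k) ∧
      (∀ j, (∀ k ∈ Set.Icc 1 n, g k ≠ j) → s'.arr A j = s₀.arr A j) := by
  obtain ⟨s', hrun, h₁, h₂⟩ := run_upto_flat (p := .store A i e) hwf hn rfl hxm rfl rfl
    (fun c s => (∀ k ∈ Set.Icc 1 c, s.arr A (g k) = v k) ∧
      ∀ j, (∀ k ∈ Set.Icc 1 n, g k ≠ j) → s.arr A j = s₀.arr A j)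
    (fun _ _ _ h => h) ⟨fun k hk => by simp at hk, fun _ _ => rfl⟩ (by
      rintro c hc s hs hx hr ha ⟨h₁, h₂⟩
      obtain ⟨hi, he⟩ := hev (c + 1) ⟨by omega, by omega⟩ s hx
        (fun y hy => hr y hy rfl) (fun B hB => ha B (by simpa [Prog.writesArr] using hB)) h₂ hs
      simp only [Prog.den, hi, he, State.setArr_arr_apply, true_and]
      refine ⟨fun k hk => ?_, fun j hj => ?_⟩
      · obtain ⟨hk₁, hk₂⟩ := hk
        by_cases h : k = c + 1
        · simp [h]
        · have : g k ≠ g (c + 1) := fun hh => h (hg ⟨hk₁, by omega⟩ ⟨by omega, by omega⟩ hh)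
          rw [if_neg this]
          exact h₁ k ⟨hk₁, by omega⟩
      · rw [if_neg fun hh => hj (c + 1) ⟨by omega, by omega⟩ hh.symm]
        exact h₂ j hj)
  exact ⟨s', hrun, h₁, h₂⟩

@[simp] theorem Prog.writesReg_upto (x m y : ℕ) (p : Prog) :
    (Prog.upto x m p).writesReg y = (y == x || (y == x || p.writesReg y)) := rfl

@[simp] theorem Prog.writesArr_upto (x m A : ℕ) (p : Prog) :
    (Prog.upto x m p).writesArr A = p.writesArr A := by
  simp [Prog.upto, Prog.writesArr]

@[simp] theorem cost_add (a b : Expr) : (a + b).cost = a.cost + b.cost + 1 := rfl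
@[simp] theorem cost_sub (a b : Expr) : (a - b).cost = a.cost + b.cost + 1 := rfl
@[simp] theorem cost_mul (a b : Expr) : (a * b).cost = a.cost + b.cost + 1 := rfl
@[simp] theorem cost_div (a b : Expr) : (a / b).cost = a.cost + b.cost + 1 := rfl
@[simp] theorem cost_mod (a b : Expr) : (a % b).cost = a.cost + b.cost + 1 := rfl
@[simp] theorem cost_less (a b : Expr) : (a.less b).cost = a.cost + b.cost + 1 := rfl
@[simp] theorem cost_same (a b : Expr) : (a.same b).cost = a.cost + b.cost + 1 := rfl
@[simp] theorem cost_reg (x : ℕ) : (Expr.reg x).cost = 1 := rfl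
@[simp] theorem cost_load (A : ℕ) (e : Expr) : (Expr.load A e).cost = e.cost + 1 := rfl
@[simp] theorem cost_zero : (0 : Expr).cost = 1 := rfl
@[simp] theorem cost_one : (1 : Expr).cost = 1 := rfl
@[simp] theorem cost_two : (2 : Expr).cost = 1 := rfl
@[simp] theorem cost_three : (3 : Expr).cost = 1 := rfl

end CAO

/-! ### Ranking pairs of numbers -/

namespace CAO

open Finset

/-- The pair of keys of `q` is lexicographically smaller than that of `p`. -/
def LexLT (K₁ K₂ : ℕ → ℕ) (q p : ℕ) : Prop := K₁ q < K₁ p ∨ K₁ q = K₁ p ∧ K₂ q < K₂ p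

instance (K₁ K₂ : ℕ → ℕ) (q p : ℕ) : Decidable (LexLT K₁ K₂ q p) := by
  unfold LexLT; infer_instance

/-- The total weight of the `q ∈ {1, …, n}` with a smaller pair of keys than `p`. -/
def lexCount (n : ℕ) (K₁ K₂ W : ℕ → ℕ) (p : ℕ) : ℕ :=
  ∑ q ∈ Icc 1 n with LexLT K₁ K₂ q p, W q

/-- Fill the array `C` with `C[v] = ∑ W[q]`, over all `q` with `K[q] < v`. -/
def prefixSums (K W C : ℕ) : Prog :=
  .store C 0 0 ;; .fill 11 10 C (.reg 11) 0 ;;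
  .upto 11 10 (.store C (.load K (.reg 11) + 1)
    (.load C (.load K (.reg 11) + 1) + .load W (.reg 11))) ;;
  .upto 11 10 (.store C (.reg 11) (.load C (.reg 11) + .load C (.reg 11 - 1)))

theorem sum_Icc_one_succ_filter (P : ℕ → Prop) [DecidablePred P] (W : ℕ → ℕ) (i : ℕ) :
    ∑ q ∈ Icc 1 (i + 1) with P q, W q =
      (∑ q ∈ Icc 1 i with P q, W q) + if P (i + 1) then W (i + 1) else 0 := by
  rw [sum_filter, sum_filter, sum_Icc_succ_top (by omega)]

/-- The weight of `q` is added to the cell after its key, so that the inclusive prefix sums become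
sums over strictly smaller keys. The bound on the total weight rules out overflow in all partial
sums. -/
theorem run_prefixSums {w : ℕ} [hw : Fact (8 ≤ 2 ^ w)] {K W C n : ℕ} {s₀ : State}
    (hwf : WF w s₀) (hn : s₀.reg 10 = n) (hKC : K ≠ C) (hWC : W ≠ C)
    (hK : ∀ q ∈ Icc 1 n, s₀.arr K q ≤ n) (hnw : n + 1 < 2 ^ w)
    (hW : ∑ q ∈ Icc 1 n, s₀.arr W q < 2 ^ w) :
    ∃ s', Run w (prefixSums K W C) (60 * (n + 1)) s₀ s' ∧
      ∀ v ≤ n, s'.arr C v = ∑ q ∈ Icc 1 n with s₀.arr K q < v, s₀.arr W q := by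
  have hr₁ := Run.store (w := w) s₀ C 0 0
  set s₁ := s₀.setArr C _ _ with hs₁
  have hwf₁ := hr₁.wf hwf
  obtain ⟨s₂, hr₂, h₂, h₂'⟩ := run_fill (w := w) (x := 11) (m := 10) (A := C) (n := n)
    (i := .reg 11) (e := 0) hwf₁ hn (by norm_num) id (fun _ => 0) (Function.injective_id.injOn)
    (fun k hk s hx hr _ _ _ => ⟨by simp [hx], by simp⟩)
  have hwf₂ := hr₂.wf hwf₁
  have hz : ∀ v ≤ n, s₂.arr C v = 0 := by
    intro v hv
    rcases Nat.eq_zero_or_pos v with rfl | h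
    · rw [h₂' 0 (by simp +contextual; omega), hs₁]; simp
    · exact h₂ v ⟨h, hv⟩
  have hK₂ : s₂.arr K = s₀.arr K := by
    rw [hr₂.arr_eq (by simpa [Prog.fill, Prog.writesArr] using hKC), hs₁, State.setArr_arr,
      if_neg hKC]
  have hW₂ : s₂.arr W = s₀.arr W := by
    rw [hr₂.arr_eq (by simpa [Prog.fill, Prog.writesArr] using hWC), hs₁, State.setArr_arr,
      if_neg hWC]
  have hn₂ : s₂.reg 10 = n := by rw [hr₂.reg_eq (by rfl)]; exact hn
  obtain ⟨s₃, hr₃, h₃⟩ := run_upto_flat (w := w) (x := 11) (m := 10)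
    (p := .store C (.load K (.reg 11) + 1)
      (.load C (.load K (.reg 11) + 1) + .load W (.reg 11))) hwf₂ hn₂ rfl (by norm_num) rfl rfl
    (fun i s => ∀ v ≤ n, s.arr C v = ∑ q ∈ Icc 1 i with s₀.arr K q + 1 = v, s₀.arr W q)
    (fun _ _ _ h => h) (fun v hv => by simp [hz v hv]) (by
      intro i hi s hs hx hr ha hI v hv
      have hKs : s.arr K = s₀.arr K := by
        rw [ha K (by simpa [Prog.writesArr] using hKC), hK₂]
      have hWs : s.arr W = s₀.arr W := by
        rw [ha W (by simpa [Prog.writesArr] using hWC), hW₂]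
      have hk := hK (i + 1) (by simp; omega)
      simp only [Prog.den, eval_add, eval_load, eval_reg, hx, hKs, hWs, eval_one,
        State.setArr_arr_apply, true_and]
      rw [Nat.mod_eq_of_lt (by omega : s₀.arr K (i + 1) + 1 < 2 ^ w), sum_Icc_one_succ_filter]
      by_cases h : v = s₀.arr K (i + 1) + 1
      · rw [if_pos h, if_pos h.symm, ← h, hI v hv, Nat.mod_eq_of_lt]
        refine lt_of_le_of_lt ?_ hW
        have : s₀.arr W (i + 1) = if s₀.arr K (i + 1) + 1 = v then s₀.arr W (i + 1) else 0 := by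
          rw [if_pos h.symm]
        rw [this, ← sum_Icc_one_succ_filter]
        exact sum_le_sum_of_subset ((filter_subset _ _).trans
          (Icc_subset_Icc le_rfl (by omega)))
      · rw [if_neg h, if_neg (Ne.symm h), add_zero, hI v hv])
  have hwf₃ := hr₃.wf hwf₂
  have hn₃ : s₃.reg 10 = n := by rw [hr₃.reg_eq (by rfl), hn₂]
  obtain ⟨s₄, hr₄, h₄⟩ := run_upto_flat (w := w) (x := 11) (m := 10)
    (p := .store C (.reg 11) (.load C (.reg 11) + .load C (.reg 11 - 1))) hwf₃ hn₃ rfl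
    (by norm_num) rfl rfl
    (fun i s => ∀ v ≤ n, s.arr C v = if v ≤ i then ∑ q ∈ Icc 1 n with s₀.arr K q < v, s₀.arr W q
      else ∑ q ∈ Icc 1 n with s₀.arr K q + 1 = v, s₀.arr W q)
    (fun _ _ _ h => h) (by
      intro v hv
      rw [h₃ v hv]
      split_ifs with h
      · obtain rfl : v = 0 := by omega
        simp
      · rfl) (by
      intro i hi s hs hx hr ha hI v hv
      have hsub : (i + 1 - 1) % 2 ^ w = i := by
        rw [Nat.add_sub_cancel]; exact Nat.mod_eq_of_lt (by omega)
      simp only [Prog.den, eval_add, eval_sub, eval_load, eval_reg, hx, eval_one,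
        State.setArr_arr_apply, true_and, hsub]
      by_cases h : v = i + 1
      · subst h
        rw [if_pos rfl, hI _ hv, hI i (by omega), if_neg (by omega), if_pos le_rfl, if_pos le_rfl]
        have : ∑ q ∈ Icc 1 n with s₀.arr K q < i + 1, s₀.arr W q =
            ∑ q ∈ Icc 1 n with s₀.arr K q + 1 = i + 1, s₀.arr W q +
            ∑ q ∈ Icc 1 n with s₀.arr K q < i, s₀.arr W q := by
          rw [← sum_union]
          · congr 1
            ext q
            simp only [mem_filter, mem_union]
            constructor
            · rintro ⟨h, h'⟩
              rcases Nat.lt_succ_iff_lt_or_eq.1 h' with h' | h'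
              · exact Or.inr ⟨h, h'⟩
              · exact Or.inl ⟨h, by omega⟩
            · rintro (⟨h, h'⟩ | ⟨h, h'⟩) <;> exact ⟨h, by omega⟩
          · rw [disjoint_filter]
            intro q _ h; omega
        rw [← this]
        exact Nat.mod_eq_of_lt (lt_of_le_of_lt (sum_le_sum_of_subset (filter_subset _ _)) hW)
      · rw [if_neg h, hI v hv]
        by_cases h' : v ≤ i
        · rw [if_pos h', if_pos (by omega)]
        · rw [if_neg h', if_neg (by omega)])
  refine ⟨s₄, (hr₁.seq (hr₂.seq (hr₃.seq hr₄))).mono ?_, fun v hv => ?_⟩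
  · simp only [Prog.time, cost_add, cost_sub, cost_load, cost_reg, cost_one, cost_zero]; omega
  · rw [h₄ v hv, if_pos hv]

end CAO

/-! ### Stable counting sort, and weighted ranks of pairs in linear time -/

namespace CAO

open Finset

section Position

variable {α : Type*} [LinearOrder α] (n : ℕ) (f : ℕ → α)

/-- The position of `q` when `1, …, n` are sorted by `f`. -/
def position (q : ℕ) : ℕ := #{q' ∈ Icc 1 n | f q' ≤ f q}

variable {n f}

theorem position_mem {q : ℕ} (hq : q ∈ Icc 1 n) : position n f q ∈ Icc 1 n := by
  rw [mem_Icc]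
  constructor
  · exact card_pos.2 ⟨q, mem_filter.2 ⟨hq, le_rfl⟩⟩
  · exact (card_filter_le _ _).trans (by simp)

theorem position_lt {q q' : ℕ} (hq' : q' ∈ Icc 1 n) (h : f q < f q') :
    position n f q < position n f q' := by
  refine card_lt_card ⟨fun x hx => ?_, fun hsub => ?_⟩
  · rw [mem_filter] at hx ⊢
    exact ⟨hx.1, hx.2.trans h.le⟩
  · exact absurd (mem_filter.1 (hsub (mem_filter.2 ⟨hq', le_rfl⟩))).2 (not_le.2 h)

theorem position_le_iff {q q' : ℕ} (hq : q ∈ Icc 1 n) :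
    position n f q ≤ position n f q' ↔ f q ≤ f q' := by
  constructor
  · intro h
    by_contra! hlt
    exact absurd h (not_le.2 (position_lt hq hlt))
  · intro h
    exact card_le_card fun x hx => by
      rw [mem_filter] at hx ⊢
      exact ⟨hx.1, hx.2.trans h⟩

theorem position_injOn (hf : Set.InjOn f (Set.Icc 1 n)) :
    Set.InjOn (position n f) (Set.Icc 1 n) := by
  intro q hq q' hq' h
  apply hf hq hq'
  simp only [Set.mem_Icc, ← mem_Icc] at hq hq'
  exact le_antisymm ((position_le_iff hq).1 h.le) ((position_le_iff hq').1 h.ge)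

theorem position_surj (hf : Set.InjOn f (Set.Icc 1 n)) {i : ℕ} (hi : i ∈ Icc 1 n) :
    ∃ q ∈ Icc 1 n, position n f q = i := by
  have h : (Icc 1 n).image (position n f) = Icc 1 n := by
    apply eq_of_subset_of_card_le
    · intro x hx
      obtain ⟨q, hq, rfl⟩ := mem_image.1 hx
      exact position_mem hq
    · rw [card_image_of_injOn (by simpa using position_injOn hf)]
  rw [← h] at hi
  simpa using hi

end Position

/-- Breaking ties by the index makes the sorted positions distinct and the sort stable. -/
theorem toLex_pair_injective (K : ℕ → ℕ) :
    Function.Injective fun q => toLex (K q, q) := fun a b h => by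
  simpa using (congrArg (fun x => (ofLex x).2) h)

/-- Sort `1, …, n` by the keys in the array `11` into the array `15`. -/
def sortByKey : Prog :=
  .fill 11 10 19 (.reg 11) 1 ;; prefixSums 11 19 14 ;;
  .upto 11 10 (.store 14 (.load 11 (.reg 11)) (.load 14 (.load 11 (.reg 11)) + 1) ;;
    .store 15 (.load 14 (.load 11 (.reg 11))) (.reg 11))

/-- Counting sort: cell `v` of the array `14` starts with the number of keys below `v` and is
incremented for every element with key `v`, so it always shows the last position used in that
bucket. -/
theorem run_sortByKey {w : ℕ} [hw : Fact (8 ≤ 2 ^ w)] {n : ℕ} {s₀ : State}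
    (hwf : WF w s₀) (hn : s₀.reg 10 = n)
    (hK : ∀ q ∈ Icc 1 n, s₀.arr 11 q ≤ n) (hnw : n + 1 < 2 ^ w) :
    ∃ s', Run w sortByKey (100 * (n + 1)) s₀ s' ∧
      ∀ q ∈ Icc 1 n, s'.arr 15 (position n (fun q => toLex (s₀.arr 11 q, q)) q) = q := by
  set K := s₀.arr 11 with hKdef
  obtain ⟨s₁, hr₁, h₁, -⟩ := run_fill (w := w) (x := 11) (m := 10) (A := 19) (n := n)
    (i := .reg 11) (e := 1) hwf hn (by norm_num) id (fun _ => 1) (Function.injective_id.injOn)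
    (fun k hk s hx hr _ _ _ => ⟨by simp [hx], by simp⟩)
  have hwf₁ := hr₁.wf hwf
  have hn₁ : s₁.reg 10 = n := by rw [hr₁.reg_eq (by rfl), hn]
  have hK₁ : s₁.arr 11 = K := hr₁.arr_eq (by rfl)
  have hsum : ∀ P : ℕ → Prop, [DecidablePred P] →
      ∑ q ∈ Icc 1 n with P q, s₁.arr 19 q = #{q ∈ Icc 1 n | P q} := by
    intro P _
    rw [card_eq_sum_ones]
    apply sum_congr rfl
    intro q hq
    exact h₁ q (by simpa using (mem_filter.1 hq).1)
  obtain ⟨s₂, hr₂, h₂⟩ := run_prefixSums (w := w) (K := 11) (W := 19) (C := 14) hwf₁ hn₁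
    (by norm_num) (by norm_num) (by rwa [hK₁]) hnw (by
      have := hsum (fun _ => True)
      simp only [filter_true] at this
      rw [this]; simp; omega)
  have hwf₂ := hr₂.wf hwf₁
  have hn₂ : s₂.reg 10 = n := by rw [hr₂.reg_eq (by rfl), hn₁]
  have hK₂ : s₂.arr 11 = K := by rw [hr₂.arr_eq (by rfl), hK₁]
  -- In the stable order, `i + 1` is preceded by all smaller keys and by the equal keys among the
  -- indices already processed.
  have hpos : ∀ i < n, position n (fun q => toLex (K q, q)) (i + 1) =
      #{q ∈ Icc 1 n | K q < K (i + 1)} + #{q ∈ Icc 1 i | K q = K (i + 1)} + 1 := by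
    intro i hi
    have hd : Disjoint {q ∈ Icc 1 n | K q < K (i + 1)}
        (insert (i + 1) {q ∈ Icc 1 i | K q = K (i + 1)}) := by
      rw [disjoint_left]
      intro q
      simp only [mem_filter, mem_insert]
      rintro ⟨-, h⟩ (rfl | ⟨-, h'⟩) <;> omega
    rw [add_assoc, ← card_insert_of_notMem (a := i + 1) (by simp), ← card_union_of_disjoint hd]
    unfold position
    congr 1
    ext q
    simp only [mem_filter, mem_union, mem_insert, Prod.Lex.toLex_le_toLex, mem_Icc]
    constructor
    · rintro ⟨hq, h | ⟨h, h'⟩⟩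
      · exact Or.inl ⟨hq, h⟩
      · rcases Nat.lt_or_ge i q with h'' | h''
        · exact Or.inr (Or.inl (by omega))
        · exact Or.inr (Or.inr ⟨⟨hq.1, h''⟩, h⟩)
    · rintro (⟨hq, h⟩ | rfl | ⟨hq, h⟩)
      · exact ⟨hq, Or.inl h⟩
      · exact ⟨⟨by omega, by omega⟩, Or.inr ⟨rfl, le_rfl⟩⟩
      · exact ⟨⟨hq.1, by omega⟩, Or.inr ⟨h, by omega⟩⟩
  obtain ⟨s₃, hr₃, -, h₃⟩ := run_upto_flat (w := w) (x := 11) (m := 10)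
    (p := .store 14 (.load 11 (.reg 11)) (.load 14 (.load 11 (.reg 11)) + 1) ;;
      .store 15 (.load 14 (.load 11 (.reg 11))) (.reg 11)) hwf₂ hn₂ rfl (by norm_num) rfl rfl
    (fun i s => (∀ v ≤ n, s.arr 14 v = #{q ∈ Icc 1 n | K q < v} + #{q ∈ Icc 1 i | K q = v}) ∧
      ∀ q ∈ Icc 1 i, s.arr 15 (position n (fun q => toLex (K q, q)) q) = q)
    (fun _ _ _ h => h) ⟨fun v hv => by simp [h₂ v hv, hsum, hK₁], by simp⟩ (by
      rintro i hi s hs hx hr ha ⟨hI, hI'⟩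
      have hKs : s.arr 11 = K := by rw [ha 11 rfl, hK₂]
      have hk := hK (i + 1) (by simp; omega)
      have hp := hpos i hi
      have hpm := position_mem (f := fun q => toLex (K q, q)) (n := n) (q := i + 1)
        (by simp; omega)
      simp only [mem_Icc] at hpm
      simp only [Prog.den, eval_add, eval_load, eval_reg, hx, hKs, eval_one,
        State.setArr_arr_apply, State.setArr_reg, true_and, hI _ hk, ← hp,
        Nat.mod_eq_of_lt (by omega : position n (fun q => toLex (K q, q)) (i + 1) < 2 ^ w)]
      norm_num [hKs]
      refine ⟨fun v hv => ?_, fun q hq₁ hq₂ => ?_⟩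
      · have := sum_Icc_one_succ_filter (fun q => K q = v) (fun _ => 1) i
        simp only [← card_eq_sum_ones] at this
        rw [this]
        by_cases h : v = K (i + 1)
        · rw [if_pos h, if_pos h.symm, h, hp]; rfl
        · rw [if_neg h, if_neg (Ne.symm h), hI v hv]; rfl
      · by_cases h : q = i + 1
        · simp [h]
        · rw [if_neg, hI' q (by simp; omega)]
          intro hh
          exact h (position_injOn (toLex_pair_injective K).injOn ⟨hq₁, by omega⟩
            ⟨by omega, by omega⟩ hh))
  refine ⟨s₃, (hr₁.seq (hr₂.seq hr₃)).mono ?_, h₃⟩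
  simp only [Prog.time, cost_add, cost_load, cost_reg, cost_one]; omega

/-- Rank the pairs of keys in the arrays `10` and `11` with the weights in the array `12`; the
result is in the array `13`. -/
def rankPairs : Prog :=
  sortByKey ;; prefixSums 10 12 16 ;; .store 17 0 0 ;; .fill 11 10 17 (.reg 11) 0 ;;
  .upto 11 10 (.assign 12 (.load 15 (.reg 11)) ;; .assign 13 (.load 10 (.reg 12)) ;;
    .ite ((Expr.load 17 (.reg 13)).same (.load 11 (.reg 12) + 1)) .skip
      (.store 18 (.reg 13) (.load 16 (.reg 13)) ;;
        .store 17 (.reg 13) (.load 11 (.reg 12) + 1)) ;;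
    .store 13 (.reg 12) (.load 18 (.reg 13) + 1) ;;
    .store 16 (.reg 13) (.load 16 (.reg 13) + .load 12 (.reg 12))) ;;
  .store 13 0 0

theorem sum_weights_le {n : ℕ} {W : ℕ → ℕ} (hW : ∀ q ∈ Icc 1 n, W q ≤ 1) (P : ℕ → Prop)
    [DecidablePred P] : ∑ q ∈ Icc 1 n with P q, W q ≤ n := by
  calc ∑ q ∈ Icc 1 n with P q, W q ≤ ∑ q ∈ Icc 1 n, W q :=
        sum_le_sum_of_subset (filter_subset _ _)
    _ ≤ ∑ q ∈ Icc 1 n, 1 := sum_le_sum hW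
    _ = n := by simp

theorem lexCount_eq {n : ℕ} (K₁ K₂ W : ℕ → ℕ) (p : ℕ) :
    lexCount n K₁ K₂ W p = ∑ q ∈ Icc 1 n with K₁ q < K₁ p, W q +
      ∑ q ∈ Icc 1 n with K₁ q = K₁ p ∧ K₂ q < K₂ p, W q := by
  rw [lexCount, ← sum_union, ← filter_or]
  · rfl
  · rw [disjoint_filter]
    intro q _ h; omega

/-- The indices are visited by increasing second key. For a first key `k`, the array `16` holds the
weight of the smaller first keys plus that of the visited indices with first key `k`. The array `18`
holds a snapshot of this number, taken when the current second key first appeared with `k`; the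
array `17` stores that second key plus one, and 0 as long as `k` has not appeared. Equal pairs use
the same snapshot and hence get equal ranks. -/
theorem run_rankPairs {w : ℕ} [hw : Fact (8 ≤ 2 ^ w)] {n : ℕ} {s₀ : State}
    (hwf : WF w s₀) (hn : s₀.reg 10 = n)
    (hK₁ : ∀ q ∈ Icc 1 n, s₀.arr 10 q ≤ n) (hK₂ : ∀ q ∈ Icc 1 n, s₀.arr 11 q ≤ n)
    (hW : ∀ q ∈ Icc 1 n, s₀.arr 12 q ≤ 1) (hnw : n + 1 < 2 ^ w) :
    ∃ s', Run w rankPairs (300 * (n + 1)) s₀ s' ∧ s'.arr 13 0 = 0 ∧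
      ∀ q ∈ Icc 1 n, s'.arr 13 q = lexCount n (s₀.arr 10) (s₀.arr 11) (s₀.arr 12) q + 1 := by
  set K₁ := s₀.arr 10 with hK₁def
  set K₂ := s₀.arr 11 with hK₂def
  set W := s₀.arr 12 with hWdef
  set pos := position n (fun q => toLex (K₂ q, q)) with hpos
  obtain ⟨s₁, hr₁, h₁⟩ := run_sortByKey hwf hn hK₂ hnw
  have hwf₁ := hr₁.wf hwf
  have hn₁ : s₁.reg 10 = n := by rw [hr₁.reg_eq (by rfl), hn]
  have hK₁₁ : s₁.arr 10 = K₁ := hr₁.arr_eq (by rfl)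
  have hW₁ : s₁.arr 12 = W := hr₁.arr_eq (by rfl)
  obtain ⟨s₂, hr₂, h₂⟩ := run_prefixSums (w := w) (K := 10) (W := 12) (C := 16) hwf₁ hn₁
    (by norm_num) (by norm_num) (by rwa [hK₁₁]) hnw (by
      rw [hW₁]
      have := sum_weights_le hW (fun _ => True)
      simp only [filter_true] at this
      omega)
  rw [hK₁₁, hW₁] at h₂
  have hwf₂ := hr₂.wf hwf₁
  have hr₃ := Run.store (w := w) s₂ 17 0 0
  set s₃ := s₂.setArr 17 _ _ with hs₃
  have hwf₃ := hr₃.wf hwf₂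
  have hn₃ : s₃.reg 10 = n := by rw [hr₃.reg_eq (by rfl), hr₂.reg_eq (by rfl), hn₁]
  obtain ⟨s₄, hr₄, h₄, h₄'⟩ := run_fill (w := w) (x := 11) (m := 10) (A := 17) (n := n)
    (i := .reg 11) (e := 0) hwf₃ hn₃ (by norm_num) id (fun _ => 0) (Function.injective_id.injOn)
    (fun k hk s hx hr _ _ _ => ⟨by simp [hx], by simp⟩)
  have hwf₄ := hr₄.wf hwf₃
  have hn₄ : s₄.reg 10 = n := by rw [hr₄.reg_eq (by rfl), hn₃]
  have hz : ∀ v ≤ n, s₄.arr 17 v = 0 := by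
    intro v hv
    rcases Nat.eq_zero_or_pos v with rfl | h
    · rw [h₄' 0 (by simp +contextual; omega), hs₃]; simp
    · exact h₄ v ⟨h, hv⟩
  have frame : ∀ A, A ≠ 17 → A ≠ 16 → sortByKey.writesArr A = false → s₄.arr A = s₀.arr A := by
    intro A h17 h16 h
    rw [hr₄.arr_eq (by simpa [Prog.fill, Prog.writesArr] using h17),
      hr₃.arr_eq (by simpa [Prog.writesArr] using h17),
      hr₂.arr_eq (by simpa [prefixSums, Prog.fill, Prog.writesArr] using h16), hr₁.arr_eq h]
  have hK₁₄ : s₄.arr 10 = K₁ := frame 10 (by norm_num) (by norm_num) (by rfl)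
  have hK₂₄ : s₄.arr 11 = K₂ := frame 11 (by norm_num) (by norm_num) (by rfl)
  have hW₄ : s₄.arr 12 = W := frame 12 (by norm_num) (by norm_num) (by rfl)
  have hO₄ : ∀ q ∈ Icc 1 n, s₄.arr 15 (pos q) = q := by
    rw [hr₄.arr_eq (by rfl), hr₃.arr_eq (by rfl), hr₂.arr_eq (by rfl)]; exact h₁
  have hA₄ : ∀ v ≤ n, s₄.arr 16 v = ∑ q ∈ Icc 1 n with K₁ q < v, W q := by
    rw [hr₄.arr_eq (by rfl), hr₃.arr_eq (by rfl)]; exact h₂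
  set body : Prog := .assign 12 (.load 15 (.reg 11)) ;; .assign 13 (.load 10 (.reg 12)) ;;
    .ite ((Expr.load 17 (.reg 13)).same (.load 11 (.reg 12) + 1)) .skip
      (.store 18 (.reg 13) (.load 16 (.reg 13)) ;;
        .store 17 (.reg 13) (.load 11 (.reg 12) + 1)) ;;
    .store 13 (.reg 12) (.load 18 (.reg 13) + 1) ;;
    .store 16 (.reg 13) (.load 16 (.reg 13) + .load 12 (.reg 12)) with hbody
  obtain ⟨s₅, hr₅, -, -, -, -, h₅⟩ := run_upto_flat (w := w) (x := 11) (m := 10)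
    (p := body) hwf₄ hn₄ rfl (by norm_num) rfl rfl
    (fun i s =>
      (∀ k ≤ n, s.arr 16 k = ∑ q ∈ Icc 1 n with K₁ q < k, W q +
        ∑ q ∈ Icc 1 n with pos q ≤ i ∧ K₁ q = k, W q) ∧
      (∀ k ≤ n, s.arr 17 k = 0 ∨ s.arr 18 k = ∑ q ∈ Icc 1 n with K₁ q < k, W q +
        ∑ q ∈ Icc 1 n with K₁ q = k ∧ K₂ q + 1 < s.arr 17 k, W q) ∧
      (∀ q ∈ Icc 1 n, pos q ≤ i → K₂ q + 1 ≤ s.arr 17 (K₁ q)) ∧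
      (∀ q ∈ Icc 1 n, i < pos q → ∀ k ≤ n, s.arr 17 k ≤ K₂ q + 1) ∧
      (∀ q ∈ Icc 1 n, pos q ≤ i → s.arr 13 q = lexCount n K₁ K₂ W q + 1))
    (fun _ _ _ h => h)
    (by
      have hp0 : ∀ q ∈ Icc 1 n, ¬ pos q ≤ 0 := fun q hq h => by
        have := (mem_Icc.1 (position_mem (f := fun q => toLex (K₂ q, q)) hq)).1
        exact absurd (this.trans h) (by norm_num)
      refine ⟨fun k hk => ?_, fun k hk => Or.inl (hz k hk), fun q hq h => absurd h (hp0 q hq),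
        fun q hq _ k hk => by simp [hz k hk], fun q hq h => absurd h (hp0 q hq)⟩
      rw [hA₄ k hk, filter_false_of_mem (s := Icc 1 n) (p := fun q => pos q ≤ 0 ∧ K₁ q = k)
        fun q hq h => hp0 q hq h.1, sum_empty, add_zero])
    (by
      rintro i hi s hs hx hr ha ⟨hA, hB, hC, hD, hE⟩
      have hKs₁ : s.arr 10 = K₁ := by rw [ha 10 rfl, hK₁₄]
      have hKs₂ : s.arr 11 = K₂ := by rw [ha 11 rfl, hK₂₄]
      have hWs : s.arr 12 = W := by rw [ha 12 rfl, hW₄]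
      obtain ⟨p, hp, hpi⟩ := position_surj (toLex_pair_injective K₂).injOn
        (show i + 1 ∈ Icc 1 n by simp; omega)
      have hOs : s.arr 15 (i + 1) = p := by rw [ha 15 rfl, ← hpi]; exact hO₄ p hp
      change pos p = i + 1 at hpi
      have hkn := hK₁ p hp
      have hvn := hK₂ p hp
      set k := K₁ p with hk
      set v := K₂ p with hv
      have hle : ∀ q ∈ Icc 1 n, pos q ≤ i + 1 → K₂ q ≤ v := by
        intro q hq h
        rw [← hpi] at h
        have := (position_le_iff hq).1 h
        rw [Prod.Lex.toLex_le_toLex] at this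
        omega
      have hlt : ∀ q ∈ Icc 1 n, K₂ q < v → pos q ≤ i := by
        intro q hq h
        have : pos q < pos p := position_lt hp (by
          rw [Prod.Lex.toLex_lt_toLex]; exact Or.inl h)
        omega
      have hge : ∀ q ∈ Icc 1 n, i < pos q → v ≤ K₂ q := by
        intro q hq h
        by_contra! hh
        exact absurd (hlt q hq hh) (by omega)
      have hpos1 : ∀ q ∈ Icc 1 n, pos q ≤ i + 1 → q = p ∨ pos q ≤ i := by
        intro q hq h
        rcases Nat.lt_or_ge i (pos q) with h' | h'
        · left
          refine position_injOn (toLex_pair_injective K₂).injOn (by simpa using hq)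
            (by simpa using hp) ?_
          change pos q = pos p
          omega
        · exact Or.inr h'
      have htgt : lexCount n K₁ K₂ W p ≤ n := sum_weights_le hW _
      -- The second key is new for this first key. So what has been visited with the same first key
      -- has a smaller second key, and by the order of the visits nothing with a smaller second key
      -- is missing.
      have hnew : s.arr 17 k ≠ v + 1 → s.arr 16 k = lexCount n K₁ K₂ W p := by
        intro h
        have := hD p hp (by omega) k hkn
        rw [hA k hkn, lexCount_eq]
        congr 1
        apply sum_congr _ fun _ _ => rfl
        apply filter_congr
        intro q hq
        constructor
        · rintro ⟨h₁, h₂⟩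
          have := hC q hq h₁
          rw [h₂] at this
          exact ⟨h₂, by omega⟩
        · rintro ⟨h₁, h₂⟩
          exact ⟨hlt q hq h₂, h₁⟩
      have hold : s.arr 17 k = v + 1 → s.arr 18 k = lexCount n K₁ K₂ W p := by
        intro h
        rcases hB k hkn with h' | h'
        · omega
        · rw [h', lexCount_eq, h]
          simp only [Nat.add_lt_add_iff_right]
          rfl
      have hacc : s.arr 16 k + W p = ∑ q ∈ Icc 1 n with K₁ q < k, W q +
          ∑ q ∈ Icc 1 n with pos q ≤ i + 1 ∧ K₁ q = k, W q := by
        rw [hA k hkn, add_assoc]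
        congr 1
        have : {q ∈ Icc 1 n | pos q ≤ i + 1 ∧ K₁ q = k} =
            insert p {q ∈ Icc 1 n | pos q ≤ i ∧ K₁ q = k} := by
          ext q
          simp only [mem_filter, mem_insert]
          constructor
          · rintro ⟨hq, h₁, h₂⟩
            rcases hpos1 q hq h₁ with h | h
            · exact Or.inl h
            · exact Or.inr ⟨hq, h, h₂⟩
          · rintro (rfl | ⟨hq, h₁, h₂⟩)
            · exact ⟨hp, hpi.le, rfl⟩
            · exact ⟨hq, by omega, h₂⟩
        rw [this, sum_insert (by simp [hpi]), add_comm]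
      have hacc_lt : s.arr 16 k + W p < 2 ^ w := by
        rw [hacc, ← sum_union, ← filter_or]
        · exact (sum_weights_le hW _).trans_lt (by omega)
        · rw [disjoint_filter]
          intro q _ h; omega
      obtain ⟨f16, f17, f18, f13⟩ :
          (∀ j, (body.den w s).arr 16 j = if j = k then s.arr 16 k + W p else s.arr 16 j) ∧
          (∀ j, (body.den w s).arr 17 j = if j = k then v + 1 else s.arr 17 j) ∧
          (∀ j, (body.den w s).arr 18 j = if j = k then lexCount n K₁ K₂ W p else s.arr 18 j) ∧
          (∀ j, (body.den w s).arr 13 j =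
            if j = p then lexCount n K₁ K₂ W p + 1 else s.arr 13 j) := by
        have hm1 : (v + 1) % 2 ^ w = v + 1 := Nat.mod_eq_of_lt (by omega)
        have hm2 : (lexCount n K₁ K₂ W p + 1) % 2 ^ w = lexCount n K₁ K₂ W p + 1 :=
          Nat.mod_eq_of_lt (by omega)
        have hm3 := Nat.mod_eq_of_lt hacc_lt
        by_cases h : s.arr 17 k = v + 1
        · have := hold h
          refine ⟨fun j => ?_, fun j => ?_, fun j => ?_, fun j => ?_⟩ <;>
          simp [hbody, Prog.den, hx, hOs, hKs₁, hKs₂, hWs, ← hk, ← hv, hm1, h, this, hm2, hm3]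
          · rintro rfl; exact h
          · rintro rfl; exact this
        · have := hnew h
          rw [this] at hm3
          refine ⟨fun j => ?_, fun j => ?_, fun j => ?_, fun j => ?_⟩ <;>
          simp [hbody, Prog.den, hx, hOs, hKs₁, hKs₂, hWs, ← hk, ← hv, hm1, h, this, hm2, hm3]
      refine ⟨fun j hj => ?_, fun j hj => ?_, fun q hq h => ?_, fun q hq h j hj => ?_,
        fun q hq h => ?_⟩
      · rw [f16]
        by_cases h : j = k
        · rw [if_pos h, hacc, h]
        · rw [if_neg h, hA j hj]
          congr 1
          apply sum_congr _ fun _ _ => rfl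
          apply filter_congr
          intro q hq
          constructor
          · rintro ⟨h₁, h₂⟩; exact ⟨by omega, h₂⟩
          · rintro ⟨h₁, h₂⟩
            rcases hpos1 q hq h₁ with rfl | h'
            · exact absurd h₂.symm h
            · exact ⟨h', h₂⟩
      · rw [f17, f18]
        by_cases h : j = k
        · right
          simp only [h, if_true, Nat.add_lt_add_iff_right]
          exact lexCount_eq ..
        · simp only [if_neg h]
          exact hB j hj
      · rw [f17]
        split_ifs with h'
        · have := hle q hq h; omega
        · rcases hpos1 q hq h with rfl | h''
          · exact absurd rfl h'
          · exact hC q hq h''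
      · rw [f17]
        split_ifs with h'
        · have := hge q hq (by omega); omega
        · exact hD q hq (by omega) j hj
      · rw [f13]
        split_ifs with h'
        · rw [h']
        · rcases hpos1 q hq h with rfl | h''
          · exact absurd rfl h'
          · exact hE q hq h'')
  have hr₆ := Run.store (w := w) s₅ 13 0 0
  refine ⟨_, (hr₁.seq (hr₂.seq (hr₃.seq (hr₄.seq (hr₅.seq hr₆))))).mono ?_, ?_, fun q hq => ?_⟩
  · simp only [hbody, Prog.time, cost_add, cost_load, cost_reg, cost_one, cost_zero, cost_same]
    omega
  · simp
  · have := mem_Icc.1 hq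
    rw [State.setArr_arr_apply, if_neg (by simp; omega)]
    have := position_mem (f := fun q => toLex (K₂ q, q)) hq
    exact h₅ q hq (by simpa using (mem_Icc.1 this).2)

/-- Rank `1, …, n` by the pairs of values of `k₁` and `k₂`, with the weights `e`, where all
expressions refer to the register `11`, and write the result to the array `A`. -/
def rankBy (k₁ k₂ e : Expr) (A : ℕ) : Prog :=
  .fill 11 10 10 (.reg 11) k₁ ;; .fill 11 10 11 (.reg 11) k₂ ;; .fill 11 10 12 (.reg 11) e ;;
  rankPairs ;; .fill 11 10 A (.reg 11) (.load 13 (.reg 11)) ;; .store A 0 0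

/-- The expression `e` has the value `f i` whenever the register `11` contains `i`, for
`i = 1, …, n`, in all states that agree with `s₀` outside of the work space of `rankPairs`. -/
def Computes (w : ℕ) (s₀ : State) (n : ℕ) (e : Expr) (f : ℕ → ℕ) : Prop :=
  ∀ i ∈ Icc 1 n, ∀ s, s.reg 11 = i → (∀ y, y ∉ ({11, 12, 13} : Finset ℕ) → s.reg y = s₀.reg y) →
    (∀ B, B ∉ Icc 10 19 → s.arr B = s₀.arr B) → e.eval w s = f i

/-- Keys and weights are copied to the work space before `A` is written, so the expressions may
refer to the old content of `A`. Cell 0 is set to 0 because it represents the end of a list, which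
has to rank below every node. -/
theorem run_rankBy {w : ℕ} [hw : Fact (8 ≤ 2 ^ w)] {n A : ℕ} {k₁ k₂ e : Expr} {s₀ : State}
    {f₁ f₂ W : ℕ → ℕ} (hwf : WF w s₀) (hn : s₀.reg 10 = n) (hA : A ∉ Icc 10 19)
    (hk₁ : Computes w s₀ n k₁ f₁) (hk₂ : Computes w s₀ n k₂ f₂) (he : Computes w s₀ n e W)
    (hf₁ : ∀ q ∈ Icc 1 n, f₁ q ≤ n) (hf₂ : ∀ q ∈ Icc 1 n, f₂ q ≤ n)
    (hW : ∀ q ∈ Icc 1 n, W q ≤ 1) (hnw : n + 1 < 2 ^ w) :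
    ∃ s', Run w (rankBy k₁ k₂ e A) ((350 + k₁.cost + k₂.cost + e.cost) * (n + 1)) s₀ s' ∧
      s'.arr A 0 = 0 ∧ (∀ q ∈ Icc 1 n, s'.arr A q = lexCount n f₁ f₂ W q + 1) := by
  have key : ∀ (B : ℕ) (e : Expr) (f : ℕ → ℕ) (s : State), B ∈ Icc 10 19 →
      Computes w s₀ n e f → WF w s →
      (∀ y, y ∉ ({11, 12, 13} : Finset ℕ) → s.reg y = s₀.reg y) →
      (∀ B, B ∉ Icc 10 19 → s.arr B = s₀.arr B) →
      ∃ s', Run w (.fill 11 10 B (.reg 11) e) (n * (1 + e.cost + 9) + 6) s s' ∧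
        ∀ q ∈ Icc 1 n, s'.arr B q = f q := by
    intro B e f s hB he hs hr ha
    obtain ⟨s', hr', h', -⟩ := run_fill (w := w) (x := 11) (m := 10) (A := B) (n := n)
      (i := .reg 11) (e := e) hs (by rw [hr 10 (by decide), hn]) (by norm_num) id f
      (Function.injective_id.injOn) (by
        intro k hk s₁ hx hr₁ ha₁ _ _
        refine ⟨by simp [hx], he k (by simpa using hk) s₁ hx (fun y hy => ?_) (fun C hC => ?_)⟩
        · rw [hr₁ y (by rintro rfl; simp at hy), hr y hy]
        · rw [ha₁ C (by rintro rfl; exact hC hB), ha C hC])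
    exact ⟨s', hr', fun q hq => h' q (by simpa using hq)⟩
  have mem : ∀ {B C : ℕ}, C ∉ Icc 10 19 → B ∈ Icc 10 19 → C ≠ B := by
    rintro B C hC hB rfl; exact hC hB
  have hA' := hA
  rw [mem_Icc] at hA'
  have mem' : ∀ {B : ℕ}, B ∈ Icc 10 19 → (B == A) = false := fun hB => by
    simpa using (mem hA hB).symm
  obtain ⟨s₁, hr₁, h₁⟩ := key 10 k₁ f₁ s₀ (by simp) hk₁ hwf (fun _ _ => rfl) (fun _ _ => rfl)
  have fr₁ : ∀ y, y ∉ ({11, 12, 13} : Finset ℕ) → s₁.reg y = s₀.reg y := fun y hy =>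
    hr₁.reg_eq (by simp at hy; simp [Prog.fill, Prog.writesReg, hy])
  have fa₁ : ∀ B, B ∉ Icc 10 19 → s₁.arr B = s₀.arr B := fun B hB =>
    hr₁.arr_eq (by simpa [Prog.fill, Prog.writesArr] using mem hB (by simp))
  obtain ⟨s₂, hr₂, h₂⟩ := key 11 k₂ f₂ s₁ (by simp) hk₂ (hr₁.wf hwf) fr₁ fa₁
  have fr₂ : ∀ y, y ∉ ({11, 12, 13} : Finset ℕ) → s₂.reg y = s₀.reg y := fun y hy => by
    rw [hr₂.reg_eq (by simp at hy; simp [Prog.fill, Prog.writesReg, hy]), fr₁ y hy]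
  have fa₂ : ∀ B, B ∉ Icc 10 19 → s₂.arr B = s₀.arr B := fun B hB => by
    rw [hr₂.arr_eq (by simpa [Prog.fill, Prog.writesArr] using mem hB (by simp)), fa₁ B hB]
  have hwf₂ := hr₂.wf (hr₁.wf hwf)
  obtain ⟨s₃, hr₃, h₃⟩ := key 12 e W s₂ (by simp) he hwf₂ fr₂ fa₂
  have hwf₃ := hr₃.wf hwf₂
  have e₁ : ∀ q ∈ Icc 1 n, s₃.arr 10 q = f₁ q := by
    rw [hr₃.arr_eq (by rfl), hr₂.arr_eq (by rfl)]; exact h₁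
  have e₂ : ∀ q ∈ Icc 1 n, s₃.arr 11 q = f₂ q := by
    rw [hr₃.arr_eq (by rfl)]; exact h₂
  obtain ⟨s₄, hr₄, -, h₄⟩ := run_rankPairs hwf₃ (n := n)
    (by rw [hr₃.reg_eq (by rfl), fr₂ 10 (by decide), hn])
    (fun q hq => by rw [e₁ q hq]; exact hf₁ q hq) (fun q hq => by rw [e₂ q hq]; exact hf₂ q hq)
    (fun q hq => by rw [h₃ q hq]; exact hW q hq) hnw
  have hwf₄ := hr₄.wf hwf₃
  have hn₄ : s₄.reg 10 = n := by
    rw [hr₄.reg_eq (by rfl), hr₃.reg_eq (by rfl), fr₂ 10 (by decide), hn]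
  obtain ⟨s₅, hr₅, h₅, -⟩ := run_fill (w := w) (x := 11) (m := 10) (A := A) (n := n)
      (i := .reg 11) (e := .load 13 (.reg 11)) hwf₄ hn₄ (by norm_num) id (s₄.arr 13)
      (Function.injective_id.injOn) (by
        intro k hk s₁ hx hr₁ ha₁ _ _
        exact ⟨by simp [hx], by simp [hx, ha₁ 13 (mem hA (by simp)).symm]⟩)
  have hr₆ := Run.store (w := w) s₅ A 0 0
  refine ⟨_, (hr₁.seq (hr₂.seq (hr₃.seq (hr₄.seq (hr₅.seq hr₆))))).mono ?_, by simp, ?_⟩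
  · simp only [cost_load, cost_reg, cost_zero]
    ring_nf; omega
  · intro q hq
    have := mem_Icc.1 hq
    rw [State.setArr_arr_apply, if_neg (by simp; omega)]
    refine (h₅ q (by simpa using hq)).trans ((h₄ q hq).trans ?_)
    congr 1
    refine sum_congr (filter_congr fun x hx => ?_) fun x hx => h₃ x (mem_filter.1 hx).1
    rw [LexLT, LexLT, e₁ x hx, e₁ q hq, e₂ x hx, e₂ q hq]

theorem Run.rankBy_arr {w T : ℕ} {k₁ k₂ e : Expr} {A : ℕ} {s s' : State}
    (h : Run w (rankBy k₁ k₂ e A) T s s') {B : ℕ} (hB : B ∉ Icc 10 19) (hA : B ≠ A) :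
    s'.arr B = s.arr B := by
  apply h.arr_eq
  have mem : ∀ {C : ℕ}, C ∈ Icc 10 19 → B ≠ C := by rintro C hC rfl; exact hB hC
  simp only [mem_Icc] at mem
  simp [rankBy, rankPairs, sortByKey, prefixSums, Prog.fill, Prog.writesArr, hA, mem]

theorem Run.rankBy_reg {w T : ℕ} {k₁ k₂ e : Expr} {A : ℕ} {s s' : State}
    (h : Run w (rankBy k₁ k₂ e A) T s s') {x : ℕ} (hx : x ∉ ({11, 12, 13} : Finset ℕ)) :
    s'.reg x = s.reg x := by
  apply h.reg_eq
  simp only [mem_insert, mem_singleton, not_or] at hx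
  simp [rankBy, rankPairs, sortByKey, prefixSums, Prog.fill, Prog.writesReg, hx]

end CAO

/-! ### Ranking the nodes of linked lists: the combinatorics of the recursion -/

namespace CAO

open Finset

/-- Sequences of numbers, in lexicographic order. -/
def LexSeq : Type := Lex (ℕ → ℕ)

noncomputable instance : LinearOrder LexSeq := inferInstanceAs (LinearOrder (Lex (ℕ → ℕ)))

/-- The sequence of the labels that are read along the pointers `NX` from the node `p`. -/
def key (T NX : ℕ → ℕ) (p : ℕ) : LexSeq := toLex fun k => T (NX^[k] p)

theorem key_lt_iff_exists {T NX : ℕ → ℕ} {p q : ℕ} : key T NX p < key T NX q ↔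
    ∃ k, (∀ j < k, T (NX^[j] p) = T (NX^[j] q)) ∧ T (NX^[k] p) < T (NX^[k] q) := Iff.rfl

theorem key_eq_iff_forall {T NX : ℕ → ℕ} {p q : ℕ} : key T NX p = key T NX q ↔
    ∀ k, T (NX^[k] p) = T (NX^[k] q) := funext_iff

theorem key_lt_iff {T NX : ℕ → ℕ} {p q : ℕ} : key T NX p < key T NX q ↔
    T p < T q ∨ T p = T q ∧ key T NX (NX p) < key T NX (NX q) := by
  simp only [key_lt_iff_exists, ← Function.iterate_succ_apply]
  constructor
  · rintro ⟨k, h, h'⟩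
    cases k with
    | zero => exact Or.inl h'
    | succ k => exact Or.inr ⟨h 0 (by omega), k, fun j hj => h (j + 1) (by omega), h'⟩
  · rintro (h | ⟨h, k, h₁, h₂⟩)
    · exact ⟨0, fun j hj => absurd hj (by omega), h⟩
    · refine ⟨k + 1, fun j hj => ?_, h₂⟩
      cases j with
      | zero => exact h
      | succ j => exact h₁ j (by omega)

theorem key_eq_iff {T NX : ℕ → ℕ} {p q : ℕ} : key T NX p = key T NX q ↔
    T p = T q ∧ key T NX (NX p) = key T NX (NX q) := by
  simp only [key_eq_iff_forall, ← Function.iterate_succ_apply]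
  constructor
  · exact fun h => ⟨h 0, fun k => h (k + 1)⟩
  · rintro ⟨h, h'⟩ k
    cases k with
    | zero => exact h
    | succ k => exact h' k

/-! ### Ranks as numbers of smaller nodes -/

section Count

variable {α : Type*} [LinearOrder α] {n : ℕ} {K : ℕ → α} {P : ℕ → Prop} [DecidablePred P]

/-- The number of nodes with property `P` and a smaller key than `p`. -/
def cnt (n : ℕ) (K : ℕ → α) (P : ℕ → Prop) [DecidablePred P] (p : ℕ) : ℕ :=
  #{q ∈ Icc 1 n | P q ∧ K q < K p}

theorem cnt_le_of_le {p q : ℕ} (h : K p ≤ K q) : cnt n K P p ≤ cnt n K P q :=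
  card_le_card fun x hx => by
    rw [mem_filter] at hx ⊢
    exact ⟨hx.1, hx.2.1, hx.2.2.trans_le h⟩

theorem cnt_lt_of_lt {p q : ℕ} (hp : p ∈ Icc 1 n) (hP : P p) (h : K p < K q) :
    cnt n K P p < cnt n K P q := by
  refine card_lt_card ⟨fun x hx => ?_, fun hsub => ?_⟩
  · rw [mem_filter] at hx ⊢
    exact ⟨hx.1, hx.2.1, hx.2.2.trans h⟩
  · exact lt_irrefl _ (mem_filter.1 (hsub (mem_filter.2 ⟨hp, hP, h⟩))).2.2

theorem cnt_lt_iff {p q : ℕ} (hp : p ∈ Icc 1 n) (hP : P p) :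
    cnt n K P p < cnt n K P q ↔ K p < K q :=
  ⟨fun h => by
    by_contra! h'
    exact absurd h (not_lt.2 (cnt_le_of_le h')), cnt_lt_of_lt hp hP⟩

/-- Ranks that count the smaller nodes with property `P` are ordered as the keys are. -/
theorem lt_iff_of_cnt {f : ℕ → ℕ} (hf₀ : f 0 = 0)
    (hf : ∀ p ∈ Icc 1 n, P p → f p = cnt n K P p + 1) (hK : ∀ p ∈ Icc 1 n, K 0 < K p)
    {p q : ℕ} (hp : p ≤ n) (hq : q ≤ n) (hPp : p ≠ 0 → P p) (hPq : q ≠ 0 → P q) :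
    f p < f q ↔ K p < K q := by
  rcases Nat.eq_zero_or_pos p with rfl | hp₀ <;> rcases Nat.eq_zero_or_pos q with rfl | hq₀
  · simp
  · have : q ∈ Icc 1 n := mem_Icc.2 ⟨hq₀, hq⟩
    simp [hf₀, hf q this (hPq hq₀.ne'), hK q this]
  · have : p ∈ Icc 1 n := mem_Icc.2 ⟨hp₀, hp⟩
    simp [hf₀, (hK p this).le]
  · have h₁ : p ∈ Icc 1 n := mem_Icc.2 ⟨hp₀, hp⟩
    have h₂ : q ∈ Icc 1 n := mem_Icc.2 ⟨hq₀, hq⟩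
    rw [hf p h₁ (hPp hp₀.ne'), hf q h₂ (hPq hq₀.ne'), Nat.add_lt_add_iff_right,
      cnt_lt_iff h₁ (hPp hp₀.ne')]

theorem lexCount_eq_cnt {K₁ K₂ W : ℕ → ℕ} {p : ℕ}
    (hW : ∀ q ∈ Icc 1 n, W q = if P q then 1 else 0)
    (h : ∀ q ∈ Icc 1 n, P q → (LexLT K₁ K₂ q p ↔ K q < K p)) :
    lexCount n K₁ K₂ W p = cnt n K P p := by
  rw [lexCount, cnt, card_eq_sum_ones, sum_filter, sum_filter]
  refine sum_congr rfl fun q hq => ?_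
  rw [hW q hq]
  by_cases hP : P q
  · simp [hP, h q hq hP]
  · simp [hP]

/-- This additivity over complementary classes replaces the merging step of the skew algorithm. -/
theorem cnt_add_cnt {Q : ℕ → Prop} [DecidablePred Q] {p : ℕ}
    (h : ∀ q ∈ Icc 1 n, (P q ↔ ¬ Q q)) : cnt n K P p + cnt n K Q p = cnt n K (fun _ => True) p := by
  rw [cnt, cnt, cnt, ← card_union_of_disjoint, ← filter_or]
  · congr 1
    refine filter_congr fun q hq => ?_
    have := h q hq
    tauto
  · rw [disjoint_filter]
    intro q hq h₁ h₂
    exact (h q hq).1 h₁.1 h₂.1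

end Count

section LexLT

variable {K₁ K₂ : ℕ → ℕ} {p q r : ℕ}

theorem lexLT_iff : LexLT K₁ K₂ q p ↔ toLex (K₁ q, K₂ q) < toLex (K₁ p, K₂ p) := by
  rw [Prod.Lex.toLex_lt_toLex]; rfl

end LexLT

/-- Linked lists on the nodes `1, …, n`: labels `T`, successors `NX` (with `0` for the end of a
list) and positions `POS` in the lists. -/
structure Chain (n : ℕ) (T NX POS : ℕ → ℕ) : Prop where
  T_zero : T 0 = 0
  NX_zero : NX 0 = 0
  T_mem : ∀ p ∈ Icc 1 n, T p ∈ Icc 1 n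
  NX_le : ∀ p ∈ Icc 1 n, NX p ≤ n
  pos_next : ∀ p ∈ Icc 1 n, NX p ≠ 0 → POS (NX p) = POS p + 1
  pos_pred : ∀ p ∈ Icc 1 n, POS p ≠ 0 → ∃ q ∈ Icc 1 n, NX q = p

/-- The lists `T'`, `NX'`, `POS'` consist of the nodes `p` with `POS p % 3 ≠ 0`, renamed by
`ID`, and their labels are the ranks of the triples of labels. -/
structure Reduced (n : ℕ) (T NX POS : ℕ → ℕ) (n' : ℕ) (T' NX' POS' ID SRC : ℕ → ℕ) : Prop where
  src : ∀ p ∈ Icc 1 n', SRC p ∈ Icc 1 n ∧ POS (SRC p) % 3 ≠ 0 ∧ ID (SRC p) = p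
  id : ∀ p ∈ Icc 1 n, POS p % 3 ≠ 0 → ID p ∈ Icc 1 n' ∧ SRC (ID p) = p
  id_zero : ID 0 = 0
  id_le : ∀ p ∈ Icc 1 n, ID p ≤ n'
  T_zero : T' 0 = 0
  NX_zero : NX' 0 = 0
  label : ∃ r W : ℕ → ℕ, r 0 = 0 ∧
    (∀ p ∈ Icc 1 n, r p = lexCount n T (fun q => T (NX q)) (fun _ => 1) p + 1) ∧
    (∀ p ∈ Icc 1 n, W p = if POS p % 3 ≠ 0 then 1 else 0) ∧
    ∀ p ∈ Icc 1 n', T' p = lexCount n T (fun q => r (NX q)) W (SRC p) + 1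
  next : ∀ p ∈ Icc 1 n', NX' p = ID (NX (NX (NX (SRC p))))
  pos : ∀ p ∈ Icc 1 n', POS' p = POS (SRC p) / 3

/-! ### The size of the sample -/

namespace Chain

variable {n : ℕ} {T NX POS : ℕ → ℕ} (h : Chain n T NX POS)

include h

theorem NX_le' {p : ℕ} (hp : p ≤ n) : NX p ≤ n := by
  rcases Nat.eq_zero_or_pos p with rfl | hp₀
  · simp [h.NX_zero]
  · exact h.NX_le p (mem_Icc.2 ⟨hp₀, hp⟩)

theorem mem_of_NX {p : ℕ} (hp : p ≤ n) (h₀ : NX p ≠ 0) : p ∈ Icc 1 n := by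
  rcases Nat.eq_zero_or_pos p with rfl | hp₀
  · exact absurd h.NX_zero h₀
  · exact mem_Icc.2 ⟨hp₀, hp⟩

theorem pos_next' {p : ℕ} (hp : p ≤ n) (h₀ : NX p ≠ 0) : POS (NX p) = POS p + 1 :=
  h.pos_next p (h.mem_of_NX hp h₀) h₀

theorem key_zero_lt {p : ℕ} (hp : p ∈ Icc 1 n) : key T NX 0 < key T NX p := by
  rw [key_lt_iff, h.T_zero]
  exact Or.inl (mem_Icc.1 (h.T_mem p hp)).1

theorem pos_next₃ {p : ℕ} (hp : p ≤ n) (h₀ : NX (NX (NX p)) ≠ 0) :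
    POS (NX (NX (NX p))) = POS p + 3 := by
  have h₁ : NX (NX p) ≠ 0 := fun h' => h₀ (by rw [h', h.NX_zero])
  have h₂ : NX p ≠ 0 := fun h' => h₁ (by rw [h', h.NX_zero])
  rw [h.pos_next' (h.NX_le' (h.NX_le' hp)) h₀, h.pos_next' (h.NX_le' hp) h₁, h.pos_next' hp h₂]

/-- A node whose position is 1 or 2 modulo 3 has a nonzero position and thus a predecessor, so the
successor map sends the previous class onto at least the whole of this one. Injectivity of the
successor map is not needed. -/
theorem card_class_succ_le (c : ℕ) (hc : c < 2) :
    #{p ∈ Icc 1 n | POS p % 3 = c + 1} ≤ #{p ∈ Icc 1 n | POS p % 3 = c} := by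
  refine le_trans (card_le_card (t := {p ∈ Icc 1 n | POS p % 3 = c}.image NX) ?_) card_image_le
  intro p hp
  rw [mem_filter] at hp
  obtain ⟨hp, hc'⟩ := hp
  obtain ⟨q, hq, rfl⟩ := h.pos_pred p hp (by omega)
  have hpos := h.pos_next q hq (by have := (mem_Icc.1 hp).1; omega)
  exact mem_image_of_mem _ (mem_filter.2 ⟨hq, by omega⟩)

/-- Class 0 is the largest of the three, so leaving it out discards at least a third. In particular
a nonempty instance always shrinks, and the recursion can run down to zero nodes without a separate
base case. -/
theorem card_sampled_le : 3 * #{p ∈ Icc 1 n | POS p % 3 ≠ 0} ≤ 2 * n := by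
  have h₀ := h.card_class_succ_le 0 (by norm_num)
  have h₁ := h.card_class_succ_le 1 (by norm_num)
  have h₂ := card_filter_add_card_filter_not (s := Icc 1 n) (fun p => POS p % 3 = 0)
  have h₃ : {p ∈ Icc 1 n | POS p % 3 ≠ 0} =
      {p ∈ Icc 1 n | POS p % 3 = 0 + 1} ∪ {p ∈ Icc 1 n | POS p % 3 = 1 + 1} := by
    rw [← filter_or]
    exact filter_congr fun p _ => by omega
  have h₄ := card_union_le {p ∈ Icc 1 n | POS p % 3 = 0 + 1} {p ∈ Icc 1 n | POS p % 3 = 1 + 1}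
  rw [← h₃] at h₄
  simp only [Nat.card_Icc] at h₂
  simp only [ne_eq, zero_add] at h₀ h₁ h₄ ⊢
  omega

end Chain

/-- Ranks of pairs of labels, with `0` for the end of a list, are ordered as the pairs are. -/
theorem lt_iff_of_lexCount {n : ℕ} {K₁ K₂ W f : ℕ → ℕ} {P : ℕ → Prop} [DecidablePred P]
    (hf₀ : f 0 = 0) (hf : ∀ p ∈ Icc 1 n, P p → f p = lexCount n K₁ K₂ W p + 1)
    (hW : ∀ p ∈ Icc 1 n, W p = if P p then 1 else 0)
    (hK₀ : K₁ 0 = 0) (hK : ∀ p ∈ Icc 1 n, 1 ≤ K₁ p)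
    {p q : ℕ} (hp : p ≤ n) (hq : q ≤ n) (hPp : p ≠ 0 → P p) (hPq : q ≠ 0 → P q) :
    f p < f q ↔ toLex (K₁ p, K₂ p) < toLex (K₁ q, K₂ q) := by
  refine lt_iff_of_cnt (n := n) (K := fun p => toLex (K₁ p, K₂ p)) (P := P) hf₀
    (fun p hp h => ?_) (fun p hp => ?_) hp hq hPp hPq
  · rw [hf p hp h, lexCount_eq_cnt hW fun q _ _ => lexLT_iff]
  · rw [Prod.Lex.toLex_lt_toLex, hK₀]
    exact Or.inl (hK p hp)

theorem eq_iff_of_lt_iff {α β : Type*} [LinearOrder α] [LinearOrder β] {a b : α} {c d : β}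
    (h₁ : a < b ↔ c < d) (h₂ : b < a ↔ d < c) : a = b ↔ c = d := by
  rw [le_antisymm_iff, le_antisymm_iff, ← not_lt, ← not_lt, ← not_lt, ← not_lt, h₁, h₂]

/-! ### The reduced lists sort the sampled nodes correctly -/

namespace Reduced

variable {n n' : ℕ} {T NX POS T' NX' POS' ID SRC : ℕ → ℕ} (hc : Chain n T NX POS)
  (h : Reduced n T NX POS n' T' NX' POS' ID SRC)

include h

theorem card_eq : n' = #{p ∈ Icc 1 n | POS p % 3 ≠ 0} := by
  have : #(Icc 1 n') = #{p ∈ Icc 1 n | POS p % 3 ≠ 0} := by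
    refine card_nbij' SRC ID (fun p hp => ?_) (fun p hp => ?_) (fun p hp => ?_) (fun p hp => ?_)
    · have := h.src p hp; exact mem_filter.2 ⟨this.1, this.2.1⟩
    · obtain ⟨hp, hp'⟩ := mem_filter.1 hp; exact (h.id p hp hp').1
    · exact (h.src p hp).2.2
    · obtain ⟨hp, hp'⟩ := mem_filter.1 hp; exact (h.id p hp hp').2
  simpa using this

include hc

theorem size_le : 3 * n' ≤ 2 * n := by
  rw [h.card_eq]; exact hc.card_sampled_le

/-- The ranks of the triples of labels. -/
theorem exists_name : ∃ f : ℕ → ℕ, f 0 = 0 ∧ (∀ p ∈ Icc 1 n', T' p = f (SRC p)) ∧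
    (∀ p ∈ Icc 1 n, POS p % 3 ≠ 0 → f p ∈ Icc 1 n') ∧
    ∀ p q, p ≤ n → q ≤ n → (p ≠ 0 → POS p % 3 ≠ 0) → (q ≠ 0 → POS q % 3 ≠ 0) →
      (f p < f q ↔ toLex (T p, toLex (T (NX p), T (NX (NX p)))) <
        toLex (T q, toLex (T (NX q), T (NX (NX q))))) := by
  obtain ⟨r, W, hr₀, hr, hW, hT'⟩ := h.label
  have hT : ∀ p ∈ Icc 1 n, 1 ≤ T p := fun p hp => (mem_Icc.1 (hc.T_mem p hp)).1
  have hrlt : ∀ p q, p ≤ n → q ≤ n →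
      (r p < r q ↔ toLex (T p, T (NX p)) < toLex (T q, T (NX q))) := fun p q hp hq =>
    lt_iff_of_lexCount (P := fun _ => True) hr₀ (fun p hp _ => hr p hp) (fun p hp => by simp)
      hc.T_zero hT hp hq (fun _ => trivial) (fun _ => trivial)
  -- The end of a list receives the name 0, below the names of all nodes. Since `r` ranks pairs, a
  -- pair of a label and an `r`-value compares as a triple of labels.
  set f : ℕ → ℕ := fun p => if p = 0 then 0 else lexCount n T (fun q => r (NX q)) W p + 1 with hf
  have hf' : ∀ p ∈ Icc 1 n, f p = lexCount n T (fun q => r (NX q)) W p + 1 := fun p hp => by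
    have := (mem_Icc.1 hp).1
    simp only [hf]
    rw [if_neg (by omega)]
  refine ⟨f, if_pos rfl, fun p hp => ?_, fun p hp hpos => ?_, fun p q hp hq hPp hPq => ?_⟩
  · rw [hf' _ (h.src p hp).1, hT' p hp]
  -- Only sampled nodes carry weight, so their names are at most the number of sampled nodes, as the
  -- smaller instance requires of its labels.
  · rw [mem_Icc, hf' p hp, h.card_eq,
      lexCount_eq_cnt (P := fun p => POS p % 3 ≠ 0) hW fun q _ _ => lexLT_iff]
    refine ⟨by omega, ?_⟩
    rw [Nat.add_one_le_iff]
    refine card_lt_card ⟨fun x hx => ?_, fun hsub => ?_⟩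
    · rw [mem_filter] at hx ⊢
      exact ⟨hx.1, hx.2.1⟩
    · exact lt_irrefl _ (mem_filter.1 (hsub (mem_filter.2 ⟨hp, hpos⟩))).2.2
  · rw [lt_iff_of_lexCount (f := f) (P := fun p => POS p % 3 ≠ 0) (if_pos rfl) (fun p hp _ => hf' p hp) hW
      hc.T_zero hT hp hq hPp hPq]
    have h₁ := hrlt (NX p) (NX q) (hc.NX_le' hp) (hc.NX_le' hq)
    rw [Prod.Lex.toLex_lt_toLex, Prod.Lex.toLex_lt_toLex, h₁]

/-- Three old steps raise the position by 3 and so stay in the class modulo 3: the target is sampled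
again or is the end of the list, to which both sides assign 0. -/
theorem src_next {p : ℕ} (hp : p ≤ n') :
    NX' p ≤ n' ∧ (if NX' p = 0 then 0 else SRC (NX' p)) =
      NX (NX (NX (if p = 0 then 0 else SRC p))) := by
  rcases Nat.eq_zero_or_pos p with rfl | hp₀
  · simp [h.NX_zero, hc.NX_zero]
  · have hp' : p ∈ Icc 1 n' := mem_Icc.2 ⟨hp₀, hp⟩
    obtain ⟨hs₁, hs₂, hs₃⟩ := h.src p hp'
    rw [if_neg hp₀.ne', h.next p hp']
    have hle := hc.NX_le' (hc.NX_le' (hc.NX_le' (mem_Icc.1 hs₁).2))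
    by_cases h₀ : NX (NX (NX (SRC p))) = 0
    · simp [h₀, h.id_zero]
    · have := hc.pos_next₃ (mem_Icc.1 hs₁).2 h₀
      obtain ⟨h₁, h₂⟩ := h.id _ (mem_Icc.2 ⟨Nat.pos_of_ne_zero h₀, hle⟩) (by omega)
      rw [mem_Icc] at h₁
      rw [if_neg (by omega), h₂]
      exact ⟨h₁.2, rfl⟩

theorem chain : Chain n' T' NX' POS' where
  T_zero := h.T_zero
  NX_zero := h.NX_zero
  T_mem p hp := by
    obtain ⟨f, -, hf, hf', -⟩ := h.exists_name hc
    rw [hf p hp]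
    exact hf' _ (h.src p hp).1 (h.src p hp).2.1
  NX_le p hp := (h.src_next hc (mem_Icc.1 hp).2).1
  pos_next p hp h₀ := by
    have hp' := mem_Icc.1 hp
    obtain ⟨h₁, h₂⟩ := h.src_next hc hp'.2
    rw [if_neg h₀, if_neg (by omega)] at h₂
    have hmem : NX' p ∈ Icc 1 n' := mem_Icc.2 ⟨Nat.pos_of_ne_zero h₀, h₁⟩
    have h₃ := (mem_Icc.1 (h.src _ hmem).1).1
    rw [h.pos _ hmem, h.pos p hp, h₂, hc.pos_next₃ (mem_Icc.1 (h.src p hp).1).2 (by omega)]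
    omega
  -- A nonzero new position means an old position of at least 3, so three predecessors can be taken,
  -- and the third one lies in the same class.
  pos_pred p hp h₀ := by
    obtain ⟨hs₁, hs₂, hs₃⟩ := h.src p hp
    rw [h.pos p hp] at h₀
    obtain ⟨a, ha, ha'⟩ := hc.pos_pred _ hs₁ (by omega)
    have pa := hc.pos_next a ha (by have := (mem_Icc.1 hs₁).1; omega)
    obtain ⟨b, hb, hb'⟩ := hc.pos_pred a ha (by rw [ha'] at pa; omega)
    have pb := hc.pos_next b hb (by have := (mem_Icc.1 ha).1; omega)
    obtain ⟨c, hc', hcc⟩ := hc.pos_pred b hb (by rw [ha'] at pa; rw [hb'] at pb; omega)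
    have pc := hc.pos_next c hc' (by have := (mem_Icc.1 hb).1; omega)
    rw [ha'] at pa; rw [hb'] at pb; rw [hcc] at pc
    obtain ⟨h₁, h₂⟩ := h.id c hc' (by omega)
    exact ⟨ID c, h₁, by rw [h.next _ h₁, h₂, hcc, hb', ha', hs₃]⟩

/-- Label number `k` of a new sequence names the old labels `3k`, `3k + 1` and `3k + 2`, and names
compare as these triples do. Hence the first differing name contains the first differing label. Past
the end, both kinds of sequences continue with zeros, so lists whose length is not a multiple of 3
need no special treatment. -/
theorem key_lt_key_iff {p q : ℕ} (hp : p ∈ Icc 1 n') (hq : q ∈ Icc 1 n') :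
    key T' NX' p < key T' NX' q ↔ key T NX (SRC p) < key T NX (SRC q) := by
  obtain ⟨f, hf₀, hf, -, hlt⟩ := h.exists_name hc
  set σ : ℕ → ℕ := fun p => if p = 0 then 0 else SRC p with hσ
  have hit : ∀ p ≤ n', ∀ k, NX'^[k] p ≤ n' ∧ σ (NX'^[k] p) = NX^[3 * k] (σ p) := by
    intro p hp k
    induction k with
    | zero => exact ⟨hp, rfl⟩
    | succ k ih =>
      rw [Function.iterate_succ_apply']
      obtain ⟨h₁, h₂⟩ := h.src_next hc ih.1
      refine ⟨h₁, h₂.trans ?_⟩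
      change NX (NX (NX (σ _))) = _
      rw [ih.2]
      simp only [← Function.iterate_succ_apply', Nat.succ_eq_add_one]
      rfl
  have hσf : ∀ p ≤ n', T' p = f (σ p) := by
    intro p hp
    rcases Nat.eq_zero_or_pos p with rfl | hp₀
    · simp [hσ, hf₀, h.T_zero]
    · simp only [hσ, if_neg hp₀.ne']
      exact hf p (mem_Icc.2 ⟨hp₀, hp⟩)
  have hσle : ∀ p ≤ n', σ p ≤ n ∧ (σ p ≠ 0 → POS (σ p) % 3 ≠ 0) := by
    intro p hp
    rcases Nat.eq_zero_or_pos p with rfl | hp₀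
    · simp [hσ]
    · simp only [hσ, if_neg hp₀.ne']
      have := h.src p (mem_Icc.2 ⟨hp₀, hp⟩)
      exact ⟨(mem_Icc.1 this.1).2, fun _ => this.2.1⟩
  have hfeq : ∀ p ≤ n', ∀ q ≤ n', (f (σ p) = f (σ q) ↔
      toLex (T (σ p), toLex (T (NX (σ p)), T (NX (NX (σ p))))) =
        toLex (T (σ q), toLex (T (NX (σ q)), T (NX (NX (σ q)))))) := fun p hp q hq =>
    eq_iff_of_lt_iff
      (hlt _ _ (hσle p hp).1 (hσle q hq).1 (hσle p hp).2 (hσle q hq).2)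
      (hlt _ _ (hσle q hq).1 (hσle p hp).1 (hσle q hq).2 (hσle p hp).2)
  have main : ∀ p ≤ n', ∀ q ≤ n', key T' NX' p < key T' NX' q →
      key T NX (σ p) < key T NX (σ q) := by
    intro p hp q hq hk
    obtain ⟨k, h₁, h₂⟩ := key_lt_iff_exists.1 hk
    clear hk
    induction k generalizing p q with
    | zero =>
      simp only [Function.iterate_zero, id_eq] at h₂
      rw [hσf p hp, hσf q hq, hlt _ _ (hσle p hp).1 (hσle q hq).1 (hσle p hp).2 (hσle q hq).2,
        Prod.Lex.toLex_lt_toLex, Prod.Lex.toLex_lt_toLex] at h₂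
      rw [key_lt_iff, key_lt_iff (p := NX _), key_lt_iff (p := NX (NX _))]
      tauto
    | succ k ih =>
      have e := h₁ 0 (by omega)
      simp only [Function.iterate_zero, id_eq] at e
      rw [hσf p hp, hσf q hq, hfeq p hp q hq] at e
      simp only [EmbeddingLike.apply_eq_iff_eq, Prod.mk.injEq] at e
      have hp₁ := hit p hp 1
      have hq₁ := hit q hq 1
      have := ih (NX' p) hp₁.1 (NX' q) hq₁.1 (fun j hj => by
        simpa using h₁ (j + 1) (by omega)) (by simpa using h₂)
      have e₁ : σ (NX' p) = NX (NX (NX (σ p))) := hp₁.2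
      have e₂ : σ (NX' q) = NX (NX (NX (σ q))) := hq₁.2
      rw [e₁, e₂] at this
      rw [key_lt_iff, key_lt_iff (p := NX _), key_lt_iff (p := NX (NX _))]
      tauto
  have maineq : ∀ p ≤ n', ∀ q ≤ n', key T' NX' p = key T' NX' q →
      key T NX (σ p) = key T NX (σ q) := by
    intro p hp q hq hk
    rw [key_eq_iff_forall] at hk ⊢
    intro k
    have e := hk (k / 3)
    have hp₁ := hit p hp (k / 3)
    have hq₁ := hit q hq (k / 3)
    rw [hσf _ hp₁.1, hσf _ hq₁.1, hfeq _ hp₁.1 _ hq₁.1, hp₁.2, hq₁.2] at e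
    simp only [EmbeddingLike.apply_eq_iff_eq, Prod.mk.injEq, ← Function.iterate_succ_apply'] at e
    have : k = 3 * (k / 3) ∨ k = 3 * (k / 3) + 1 ∨ k = 3 * (k / 3) + 1 + 1 := by omega
    rcases this with h | h | h <;> rw [h]
    · exact e.1
    · exact e.2.1
    · exact e.2.2
  have hp' := mem_Icc.1 hp
  have hq' := mem_Icc.1 hq
  have sp : σ p = SRC p := if_neg (by omega)
  have sq : σ q = SRC q := if_neg (by omega)
  rw [← sp, ← sq]
  refine ⟨main p hp'.2 q hq'.2, fun hk => ?_⟩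
  -- For a linear order, preserving `<` and `=` is enough to get the converse.
  rcases lt_trichotomy (key T' NX' p) (key T' NX' q) with h' | h' | h'
  · exact h'
  · exact absurd (maineq p hp'.2 q hq'.2 h') hk.ne
  · exact absurd (main q hq'.2 p hp'.2 h') hk.not_gt

end Reduced

/-- The rank of a node of linked lists in the lexicographic order of the label sequences, with
`0` for the end of a list. -/
def IsRank (n : ℕ) (T NX R : ℕ → ℕ) : Prop :=
  R 0 = 0 ∧ ∀ p ∈ Icc 1 n, R p = cnt n (key T NX) (fun _ => True) p + 1

/-- Extending the ranks of the sampled nodes to all nodes. -/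
theorem Reduced.isRank {n n' : ℕ} {T NX POS T' NX' POS' ID SRC R' RA X X₀ Y Y₂ Z R : ℕ → ℕ}
    {W₁ W₂ W₃ W₄ W₅ : ℕ → ℕ}
    (hc : Chain n T NX POS) (h : Reduced n T NX POS n' T' NX' POS' ID SRC)
    (hR' : IsRank n' T' NX' R')
    (hRA₀ : RA 0 = 0) (hRA : ∀ p ∈ Icc 1 n, RA p = R' (ID p))
    (hW₁ : ∀ p ∈ Icc 1 n, W₁ p = if POS p % 3 ≠ 2 then 1 else 0)
    (hW₂ : ∀ p ∈ Icc 1 n, W₂ p = if POS p % 3 = 0 then 1 else 0)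
    (hW₃ : ∀ p ∈ Icc 1 n, W₃ p = if POS p % 3 ≠ 1 then 1 else 0)
    (hW₄ : ∀ p ∈ Icc 1 n, W₄ p = if POS p % 3 = 2 then 1 else 0)
    (hW₅ : ∀ p ∈ Icc 1 n, W₅ p = if POS p % 3 = 1 then 1 else 0)
    (hX' : X 0 = 0) (hX : ∀ p ∈ Icc 1 n, X p = lexCount n T (fun q => RA (NX q)) W₁ p + 1)
    (hX₀ : ∀ p ∈ Icc 1 n, X₀ p = lexCount n T (fun q => RA (NX q)) W₂ p + 1)
    (hY : ∀ p ∈ Icc 1 n, Y p = lexCount n T (fun q => X (NX q)) W₃ p + 1)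
    (hY₂ : ∀ p ∈ Icc 1 n, Y₂ p = lexCount n T (fun q => X (NX q)) W₄ p + 1)
    (hZ : ∀ p ∈ Icc 1 n, Z p = lexCount n RA (fun _ => 0) W₅ p + 1)
    (hR₀ : R 0 = 0)
    (hR : ∀ p ∈ Icc 1 n, R p = if POS p % 3 = 0 then X p + Y₂ p - 1
      else if POS p % 3 = 1 then RA p + X₀ p - 1 else Y p + Z p - 1) :
    IsRank n T NX R := by
  have hK₀ : ∀ p ∈ Icc 1 n, key T NX 0 < key T NX p := fun p hp => hc.key_zero_lt hp
  -- `SRC` and `ID` are order-preserving bijections between the new nodes and the sampled ones, so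
  -- the recursive rank counts the smaller sampled nodes.
  have hRAcnt : ∀ p ∈ Icc 1 n, POS p % 3 ≠ 0 →
      RA p = cnt n (key T NX) (fun p => POS p % 3 ≠ 0) p + 1 := by
    intro p hp hpos
    obtain ⟨h₁, h₂⟩ := h.id p hp hpos
    rw [hRA p hp, hR'.2 _ h₁]
    congr 1
    refine card_nbij' SRC ID (fun q hq => ?_) (fun q hq => ?_) (fun q hq => ?_) (fun q hq => ?_)
    · obtain ⟨hq₁, -, hq₂⟩ := mem_filter.1 hq
      rw [h.key_lt_key_iff hc hq₁ h₁, h₂] at hq₂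
      have := h.src q hq₁
      exact mem_filter.2 ⟨this.1, this.2.1, hq₂⟩
    · obtain ⟨hq₁, hq₂, hq₃⟩ := mem_filter.1 hq
      obtain ⟨h₃, h₄⟩ := h.id q hq₁ hq₂
      refine mem_filter.2 ⟨h₃, trivial, ?_⟩
      rw [h.key_lt_key_iff hc h₃ h₁, h₂, h₄]
      exact hq₃
    · exact (h.src q (mem_filter.1 hq).1).2.2
    · obtain ⟨hq₁, hq₂, hq₃⟩ := mem_filter.1 hq
      exact (h.id q hq₁ hq₂).2
  have hRAlt : ∀ p q, p ≤ n → q ≤ n → (p ≠ 0 → POS p % 3 ≠ 0) → (q ≠ 0 → POS q % 3 ≠ 0) →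
      (RA p < RA q ↔ key T NX p < key T NX q) := fun p q hp hq hPp hPq =>
    lt_iff_of_cnt hRA₀ hRAcnt hK₀ hp hq hPp hPq
  have hnext : ∀ p ∈ Icc 1 n, NX p ≠ 0 → POS (NX p) = POS p + 1 := hc.pos_next
  have hle : ∀ p ∈ Icc 1 n, NX p ≤ n := hc.NX_le
  -- The successors of nodes in the classes 0 and 1 are in the classes 1 and 2 or are the end: all
  -- of these are ordered by `RA`.
  have hlexX : ∀ p ∈ Icc 1 n, ∀ q ∈ Icc 1 n, POS p % 3 ≠ 2 → POS q % 3 ≠ 2 →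
      (LexLT T (fun q => RA (NX q)) q p ↔ key T NX q < key T NX p) := by
    intro p hp q hq hPp hPq
    rw [LexLT, key_lt_iff, hRAlt _ _ (hle q hq) (hle p hp)
      (fun h₀ => by have := hnext q hq h₀; omega) (fun h₀ => by have := hnext p hp h₀; omega)]
  have hXcnt : ∀ p ∈ Icc 1 n, POS p % 3 ≠ 2 →
      X p = cnt n (key T NX) (fun p => POS p % 3 ≠ 2) p + 1 := fun p hp hP => by
    rw [hX p hp, lexCount_eq_cnt hW₁ fun q hq hQ => hlexX p hp q hq hP hQ]
  have hX₀cnt : ∀ p ∈ Icc 1 n, POS p % 3 ≠ 2 →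
      X₀ p = cnt n (key T NX) (fun p => POS p % 3 = 0) p + 1 := fun p hp hP => by
    rw [hX₀ p hp, lexCount_eq_cnt hW₂ fun q hq hQ => hlexX p hp q hq hP (by omega)]
  have hXlt : ∀ p q, p ≤ n → q ≤ n → (p ≠ 0 → POS p % 3 ≠ 2) → (q ≠ 0 → POS q % 3 ≠ 2) →
      (X p < X q ↔ key T NX p < key T NX q) := fun p q hp hq hPp hPq =>
    lt_iff_of_cnt hX' hXcnt hK₀ hp hq hPp hPq
  -- The successors of nodes in the classes 0 and 2 are in the classes 1 and 0 or are the end, where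
  -- the rank `X` just obtained decides. With `RA` and `X`, every pair of classes is now comparable.
  have hlexY : ∀ p ∈ Icc 1 n, ∀ q ∈ Icc 1 n, POS p % 3 ≠ 1 → POS q % 3 ≠ 1 →
      (LexLT T (fun q => X (NX q)) q p ↔ key T NX q < key T NX p) := by
    intro p hp q hq hPp hPq
    rw [LexLT, key_lt_iff, hXlt _ _ (hle q hq) (hle p hp)
      (fun h₀ => by have := hnext q hq h₀; omega) (fun h₀ => by have := hnext p hp h₀; omega)]
  have hYcnt : ∀ p ∈ Icc 1 n, POS p % 3 ≠ 1 →
      Y p = cnt n (key T NX) (fun p => POS p % 3 ≠ 1) p + 1 := fun p hp hP => by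
    rw [hY p hp, lexCount_eq_cnt hW₃ fun q hq hQ => hlexY p hp q hq hP hQ]
  have hY₂cnt : ∀ p ∈ Icc 1 n, POS p % 3 ≠ 1 →
      Y₂ p = cnt n (key T NX) (fun p => POS p % 3 = 2) p + 1 := fun p hp hP => by
    rw [hY₂ p hp, lexCount_eq_cnt hW₄ fun q hq hQ => hlexY p hp q hq hP (by omega)]
  have hZcnt : ∀ p ∈ Icc 1 n, POS p % 3 ≠ 0 →
      Z p = cnt n (key T NX) (fun p => POS p % 3 = 1) p + 1 := fun p hp hP => by
    rw [hZ p hp, lexCount_eq_cnt (K := key T NX) hW₅ fun q hq hQ => ?_]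
    rw [LexLT, hRAlt _ _ (mem_Icc.1 hq).2 (mem_Icc.1 hp).2 (fun _ => by omega) fun _ => hP]
    simp
  refine ⟨hR₀, fun p hp => ?_⟩
  rw [hR p hp]
  -- In each case the first summand counts the smaller nodes of two classes, that of `p` among them,
  -- and the second one those of the third class. Both summands contain an extra 1, hence the
  -- subtraction.
  split_ifs with h₀ h₁
  · rw [hXcnt p hp (by omega), hY₂cnt p hp (by omega),
      ← cnt_add_cnt (P := fun p => POS p % 3 ≠ 2) (Q := fun p => POS p % 3 = 2) fun q _ => Iff.rfl]
    omega
  · rw [hRAcnt p hp (by omega), hX₀cnt p hp (by omega),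
      ← cnt_add_cnt (P := fun p => POS p % 3 ≠ 0) (Q := fun p => POS p % 3 = 0) fun q _ => Iff.rfl]
    omega
  · rw [hYcnt p hp (by omega), hZcnt p hp (by omega),
      ← cnt_add_cnt (P := fun p => POS p % 3 ≠ 1) (Q := fun p => POS p % 3 = 1) fun q _ => Iff.rfl]
    omega

end CAO

/-! ### Ranking the nodes of linked lists: the program -/

namespace CAO

open Finset

/-- The content of cell `e` of the window of the array `A` that starts at the base in
register `20`. -/
def cell (A : ℕ) (e : Expr) : Expr := .load A (.reg 20 + e)

@[simp] theorem cost_cell (A : ℕ) (e : Expr) : (cell A e).cost = e.cost + 3 := by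
  simp [cell]; omega

theorem eval_cell {w : ℕ} {s : State} {A B i : ℕ} {e : Expr} (hB : s.reg 20 = B)
    (he : e.eval w s = i) (h : B + i < 2 ^ w) : (cell A e).eval w s = s.arr A (B + i) := by
  simp [cell, hB, he, Nat.mod_eq_of_lt h]

/-- The window of the array `A` that starts at `B`. -/
def State.win (s : State) (A B : ℕ) : ℕ → ℕ := fun p => s.arr A (B + p)

/-- The expression for the class of the current node. -/
def classExpr : Expr := cell 22 (.reg 11) % 3

@[simp] theorem cost_classExpr : classExpr.cost = 6 := rfl

theorem eval_classExpr {w : ℕ} [hw : Fact (8 ≤ 2 ^ w)] {s : State} {B i : ℕ} (hB : s.reg 20 = B)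
    (hi : s.reg 11 = i) (h : B + i < 2 ^ w) : classExpr.eval w s = s.win 22 B i % 3 := by
  rw [classExpr, eval_mod, eval_cell (i := i) hB (by simp [hi]) h, eval_three]
  exact small_mod (by omega)

/-- One step down: rank the triples of labels and build the lists of the sampled nodes behind the
window of the current lists. -/
def reduceProg : Prog :=
  rankBy (cell 20 (.reg 11)) (cell 20 (cell 21 (.reg 11))) 1 33 ;;
  rankBy (cell 20 (.reg 11)) (.load 33 (cell 21 (.reg 11))) (Expr.less 0 classExpr) 33 ;;
  (.assign 24 (.reg 20 + .reg 10 + 1) ;; .assign 23 0 ;; .store 24 (.reg 20) 0) ;;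
  .upto 11 10 (.ite classExpr
    (.assign 23 (.reg 23 + 1) ;; .store 24 (.reg 20 + .reg 11) (.reg 23) ;;
      .store 23 (.reg 24 + .reg 23) (.reg 11))
    (.store 24 (.reg 20 + .reg 11) 0)) ;;
  (.store 26 (.reg 21) (.reg 10) ;; .store 27 (.reg 21) (.reg 20) ;;
    .assign 21 (.reg 21 + 1) ;; .assign 10 (.reg 23) ;;
    .store 20 (.reg 24) 0 ;; .store 21 (.reg 24) 0) ;;
  .fill 11 10 20 (.reg 24 + .reg 11) (.load 33 (.load 23 (.reg 24 + .reg 11))) ;;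
  .fill 11 10 22 (.reg 24 + .reg 11) (cell 22 (.load 23 (.reg 24 + .reg 11)) / 3) ;;
  .fill 11 10 21 (.reg 24 + .reg 11)
    (cell 24 (cell 21 (cell 21 (cell 21 (.load 23 (.reg 24 + .reg 11)))))) ;;
  .assign 20 (.reg 24)

/-- New names are handed out consecutively from a counter in register `23`. Nodes outside of the
sample get the name 0, so that every name read later is at most the new size. -/
theorem run_sampling {w : ℕ} [hw : Fact (8 ≤ 2 ^ w)] {n B : ℕ} {s₀ : State}
    (hwf : WF w s₀) (hn : s₀.reg 10 = n) (hB : s₀.reg 20 = B) (hB' : s₀.reg 24 = B + n + 1)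
    (h₀ : s₀.reg 23 = 0) (hbound : B + 2 * n + 4 < 2 ^ w) :
    ∃ s', Run w (.upto 11 10 (.ite classExpr
        (.assign 23 (.reg 23 + 1) ;; .store 24 (.reg 20 + .reg 11) (.reg 23) ;;
          .store 23 (.reg 24 + .reg 23) (.reg 11))
        (.store 24 (.reg 20 + .reg 11) 0))) (50 * (n + 1)) s₀ s' ∧
      s'.reg 23 ≤ n ∧
      (∀ j ∈ Icc 1 (s'.reg 23), s'.win 23 (B + n + 1) j ∈ Icc 1 n ∧
        s₀.win 22 B (s'.win 23 (B + n + 1) j) % 3 ≠ 0 ∧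
        s'.win 24 B (s'.win 23 (B + n + 1) j) = j) ∧
      (∀ p ∈ Icc 1 n, s₀.win 22 B p % 3 ≠ 0 → s'.win 24 B p ∈ Icc 1 (s'.reg 23) ∧
        s'.win 23 (B + n + 1) (s'.win 24 B p) = p) ∧
      (∀ p ∈ Icc 1 n, s'.win 24 B p ≤ s'.reg 23) ∧
      (∀ j ≤ B, s'.arr 24 j = s₀.arr 24 j) ∧ (∀ j < B + n + 1, s'.arr 23 j = s₀.arr 23 j) := by
  obtain ⟨s', hr, h₁, h₂, h₃, h₄, h₅, h₆⟩ := run_upto_flat (w := w) (x := 11) (m := 10)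
    (p := .ite classExpr
        (.assign 23 (.reg 23 + 1) ;; .store 24 (.reg 20 + .reg 11) (.reg 23) ;;
          .store 23 (.reg 24 + .reg 23) (.reg 11))
        (.store 24 (.reg 20 + .reg 11) 0)) hwf hn rfl (by norm_num) rfl rfl
    (fun i s => s.reg 23 ≤ i ∧
      (∀ j ∈ Icc 1 (s.reg 23), s.win 23 (B + n + 1) j ∈ Icc 1 i ∧
        s₀.win 22 B (s.win 23 (B + n + 1) j) % 3 ≠ 0 ∧
        s.win 24 B (s.win 23 (B + n + 1) j) = j) ∧
      (∀ p ∈ Icc 1 i, s₀.win 22 B p % 3 ≠ 0 → s.win 24 B p ∈ Icc 1 (s.reg 23) ∧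
        s.win 23 (B + n + 1) (s.win 24 B p) = p) ∧
      (∀ p ∈ Icc 1 i, s.win 24 B p ≤ s.reg 23) ∧
      (∀ j ≤ B, s.arr 24 j = s₀.arr 24 j) ∧ (∀ j < B + n + 1, s.arr 23 j = s₀.arr 23 j))
    (fun i s v h => by
      rw [State.setReg_reg, if_neg (by norm_num)]; exact h)
    (by simp [h₀]) (by
      rintro i hi s hs hx hr ha ⟨h₁, h₂, h₃, h₄, h₅, h₆⟩
      have r20 : s.reg 20 = B := by rw [hr 20 (by norm_num) rfl, hB]
      have r24 : s.reg 24 = B + n + 1 := by rw [hr 24 (by norm_num) rfl, hB']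
      have a22 : s.arr 22 = s₀.arr 22 := ha 22 rfl
      have hcl : classExpr.eval w s = s₀.win 22 B (i + 1) % 3 := by
        rw [eval_classExpr r20 hx (by omega)]
        simp only [State.win, a22]
      have m₁ : (B + (i + 1)) % 2 ^ w = B + (i + 1) := Nat.mod_eq_of_lt (by omega)
      set b : Prog := .ite classExpr
        (.assign 23 (.reg 23 + 1) ;; .store 24 (.reg 20 + .reg 11) (.reg 23) ;;
          .store 23 (.reg 24 + .reg 23) (.reg 11))
        (.store 24 (.reg 20 + .reg 11) 0) with hb
      by_cases h : s₀.win 22 B (i + 1) % 3 = 0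
      · rw [h] at hcl
        have f23 : (b.den w s).reg 23 = s.reg 23 := by simp [hb, Prog.den, hcl]
        have g23 : (b.den w s).arr 23 = s.arr 23 := by
          simp [hb, Prog.den, hcl, State.setArr_arr]
        have g24 : ∀ j, (b.den w s).arr 24 j = if j = B + (i + 1) then 0 else s.arr 24 j := by
          simp [hb, Prog.den, hcl, r20, hx, m₁]
        rw [f23]
        simp only [State.win, g23, g24, add_right_inj] at h h₂ h₃ h₄ ⊢
        refine ⟨by omega, fun j hj => ?_, fun p hp hpos => ?_, fun p hp => ?_, fun j hj => ?_, h₆⟩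
        · obtain ⟨h₁', h₂', h₃'⟩ := h₂ j hj
          have := mem_Icc.1 h₁'
          refine ⟨mem_Icc.2 ⟨this.1, by omega⟩, h₂', ?_⟩
          rw [if_neg (by omega)]; exact h₃'
        · have := mem_Icc.1 hp
          have hne : p ≠ i + 1 := by rintro rfl; exact hpos h
          rw [if_neg hne]
          exact h₃ p (mem_Icc.2 ⟨this.1, by omega⟩) hpos
        · have := mem_Icc.1 hp
          split_ifs with h'
          · omega
          · exact h₄ p (mem_Icc.2 ⟨this.1, by omega⟩)
        · rw [if_neg (by omega)]; exact h₅ j hj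
      · have m₂ : (s.reg 23 + 1) % 2 ^ w = s.reg 23 + 1 := Nat.mod_eq_of_lt (by omega)
        have m₃ : (B + n + 1 + (s.reg 23 + 1)) % 2 ^ w = B + n + 1 + (s.reg 23 + 1) :=
          Nat.mod_eq_of_lt (by omega)
        rw [← hcl] at h
        have f23 : (b.den w s).reg 23 = s.reg 23 + 1 := by simp [hb, Prog.den, h, m₂]
        have g23 : ∀ j, (b.den w s).arr 23 j =
            if j = B + n + 1 + (s.reg 23 + 1) then i + 1 else s.arr 23 j := by
          simp [hb, Prog.den, h, r24, m₂, m₃, hx]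
        have g24 : ∀ j, (b.den w s).arr 24 j =
            if j = B + (i + 1) then s.reg 23 + 1 else s.arr 24 j := by
          simp [hb, Prog.den, h, r20, hx, m₁, m₂]
        rw [hcl] at h
        rw [f23]
        simp only [State.win, g23, g24, add_right_inj] at h h₂ h₃ h₄ ⊢
        refine ⟨by omega, fun j hj => ?_, fun p hp hpos => ?_, fun p hp => ?_, fun j hj => ?_,
          fun j hj => ?_⟩
        · by_cases hj' : j = s.reg 23 + 1
          · simp only [hj', if_true]
            exact ⟨mem_Icc.2 ⟨by omega, le_rfl⟩, h, trivial⟩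
          · have := mem_Icc.1 hj
            obtain ⟨h₁', h₂', h₃'⟩ := h₂ j (mem_Icc.2 ⟨this.1, by omega⟩)
            have := mem_Icc.1 h₁'
            simp only [if_neg hj']
            refine ⟨mem_Icc.2 ⟨this.1, by omega⟩, h₂', ?_⟩
            rw [if_neg (by omega)]; exact h₃'
        · have := mem_Icc.1 hp
          by_cases hp' : p = i + 1
          · simp only [hp', if_true, and_true]
            exact mem_Icc.2 ⟨by omega, le_rfl⟩
          · obtain ⟨h₁', h₂'⟩ := h₃ p (mem_Icc.2 ⟨this.1, by omega⟩) hpos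
            have := mem_Icc.1 h₁'
            simp only [if_neg hp']
            exact ⟨mem_Icc.2 ⟨this.1, by omega⟩, by rw [if_neg (by omega)]; exact h₂'⟩
        · have := mem_Icc.1 hp
          split_ifs with h'
          · exact le_rfl
          · have := h₄ p (mem_Icc.2 ⟨this.1, by omega⟩)
            omega
        · rw [if_neg (by omega)]; exact h₅ j hj
        · rw [if_neg (by omega)]; exact h₆ j hj)
  refine ⟨s', hr.mono ?_, h₁, h₂, h₃, h₄, h₅, h₆⟩
  simp only [Prog.time, cost_add, cost_reg, cost_one, cost_zero, cost_classExpr]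
  omega

/-- A level with `n` nodes occupies `n + 1` cells of each array, with cell 0 standing for the end of
a list, and the next level starts directly behind it. Thus the old level survives for the way up,
and only its size and base are pushed on the stack in the arrays `26` and `27`. -/
theorem run_reduceProg {w : ℕ} [hw : Fact (8 ≤ 2 ^ w)] {n B l : ℕ} {s₀ : State}
    (hwf : WF w s₀) (hn : s₀.reg 10 = n) (hB : s₀.reg 20 = B) (hl : s₀.reg 21 = l)
    (hc : Chain n (s₀.win 20 B) (s₀.win 21 B) (s₀.win 22 B))
    (hbound : B + 2 * n + 4 < 2 ^ w) (hlw : l + 1 < 2 ^ w) :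
    ∃ s', Run w reduceProg (2000 * (n + 1)) s₀ s' ∧ s'.reg 21 = l + 1 ∧ s'.reg 20 = B + n + 1 ∧
      Reduced n (s₀.win 20 B) (s₀.win 21 B) (s₀.win 22 B) (s'.reg 10) (s'.win 20 (B + n + 1))
        (s'.win 21 (B + n + 1)) (s'.win 22 (B + n + 1)) (s'.win 24 B) (s'.win 23 (B + n + 1)) ∧
      s'.arr 26 = Function.update (s₀.arr 26) l n ∧ s'.arr 27 = Function.update (s₀.arr 27) l B ∧
      (∀ A, A = 20 ∨ A = 21 ∨ A = 22 ∨ A = 23 → ∀ j < B + n + 1, s'.arr A j = s₀.arr A j) ∧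
      (∀ j < B, s'.arr 24 j = s₀.arr 24 j) := by
  have hNX : ∀ p ≤ n, s₀.win 21 B p ≤ n := fun p hp => hc.NX_le' hp
  have hT : ∀ p ≤ n, s₀.win 20 B p ≤ n := fun p hp => by
    rcases Nat.eq_zero_or_pos p with rfl | hp₀
    · rw [hc.T_zero]; omega
    · exact (mem_Icc.1 (hc.T_mem p (mem_Icc.2 ⟨hp₀, hp⟩))).2
  have ev : ∀ (i : ℕ) (A : ℕ) (e : Expr) (s : State), s.reg 20 = B →
      e.eval w s = i → i ≤ n → (cell A e).eval w s = s.win A B i := fun i A e s h₁ h₂ h₃ =>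
    eval_cell h₁ h₂ (by omega)
  -- the ranks of the pairs
  obtain ⟨s₁, hr₁, hz₁, h₁⟩ := run_rankBy (w := w) (n := n) (A := 33)
    (k₁ := cell 20 (.reg 11)) (k₂ := cell 20 (cell 21 (.reg 11))) (e := 1) (s₀ := s₀)
    (f₁ := s₀.win 20 B) (f₂ := fun q => s₀.win 20 B (s₀.win 21 B q)) (W := fun _ => 1)
    hwf hn (by decide)
    (fun i hi s hx hr ha => by
      rw [ev i 20 (.reg 11) s (by rw [hr 20 (by decide), hB]) hx (mem_Icc.1 hi).2]
      simp only [State.win, ha 20 (by decide)])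
    (fun i hi s hx hr ha => by
      have h20 : s.reg 20 = B := by rw [hr 20 (by decide), hB]
      have h21 : s.win 21 B = s₀.win 21 B := by
        funext p; simp only [State.win, ha 21 (by decide)]
      have := hNX i (mem_Icc.1 hi).2
      rw [ev _ 20 _ s h20 (ev i 21 (.reg 11) s h20 hx (mem_Icc.1 hi).2) (by rwa [h21]), h21]
      simp only [State.win, ha 20 (by decide)])
    (fun i hi s hx hr ha => by simp)
    (fun q hq => hT q (mem_Icc.1 hq).2) (fun q hq => hT _ (hNX q (mem_Icc.1 hq).2))
    (fun q hq => le_rfl) (by omega)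
  have hwf₁ := hr₁.wf hwf
  have fr₁ : ∀ x, x ∉ ({11, 12, 13} : Finset ℕ) → s₁.reg x = s₀.reg x := fun x hx =>
    hr₁.rankBy_reg hx
  have fa₁ : ∀ A, A ∉ Icc 10 19 → A ≠ 33 → s₁.arr A = s₀.arr A := fun A hA h =>
    hr₁.rankBy_arr hA h
  set r := s₁.arr 33 with hr
  have hrle : ∀ p ≤ n, r p ≤ n := by
    intro p hp
    rcases Nat.eq_zero_or_pos p with rfl | hp₀
    · rw [hz₁]; omega
    · have hp' : p ∈ Icc 1 n := mem_Icc.2 ⟨hp₀, hp⟩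
      rw [h₁ p hp', lexCount_eq_cnt (P := fun _ => True)
        (K := fun p => toLex (s₀.win 20 B p, s₀.win 20 B (s₀.win 21 B p)))
        (fun q _ => (if_pos trivial).symm) (fun q _ _ => lexLT_iff), Nat.add_one_le_iff]
      calc _ < #(Icc 1 n) := card_lt_card ⟨filter_subset _ _, fun hsub =>
            lt_irrefl _ (mem_filter.1 (hsub hp')).2.2⟩
        _ = n := by simp
  -- the ranks of the triples
  set W : ℕ → ℕ := fun p => if s₀.win 22 B p % 3 ≠ 0 then 1 else 0 with hW
  obtain ⟨s₂, hr₂, hz₂, h₂⟩ := run_rankBy (w := w) (n := n) (A := 33)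
    (k₁ := cell 20 (.reg 11)) (k₂ := .load 33 (cell 21 (.reg 11)))
    (e := Expr.less 0 classExpr) (s₀ := s₁)
    (f₁ := s₀.win 20 B) (f₂ := fun q => r (s₀.win 21 B q)) (W := W)
    hwf₁ (by rw [fr₁ 10 (by decide), hn]) (by decide)
    (fun i hi s hx hr ha => by
      rw [ev i 20 (.reg 11) s (by rw [hr 20 (by decide), fr₁ 20 (by decide), hB]) hx (mem_Icc.1 hi).2]
      simp only [State.win, ha 20 (by decide), fa₁ 20 (by decide) (by decide)])
    (fun i hi s hx hr ha => by
      have h20 : s.reg 20 = B := by rw [hr 20 (by decide), fr₁ 20 (by decide), hB]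
      have h21 : s.win 21 B = s₀.win 21 B := by
        funext p; simp only [State.win, ha 21 (by decide), fa₁ 21 (by decide) (by decide)]
      rw [eval_load, ev i 21 (.reg 11) s h20 hx (mem_Icc.1 hi).2, h21, ha 33 (by decide)])
    (fun i hi s hx hr ha => by
      have h20 : s.reg 20 = B := by rw [hr 20 (by decide), fr₁ 20 (by decide), hB]
      have h22 : s.win 22 B = s₀.win 22 B := by
        funext p; simp only [State.win, ha 22 (by decide), fa₁ 22 (by decide) (by decide)]
      have := mem_Icc.1 hi
      rw [eval_less, eval_zero, eval_classExpr h20 hx (by omega), h22]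
      simp only [hW, Nat.pos_iff_ne_zero])
    (fun q hq => hT q (mem_Icc.1 hq).2) (fun q hq => hrle _ (hNX q (mem_Icc.1 hq).2))
    (fun q hq => by simp only [hW]; split_ifs <;> omega) (by omega)
  have hwf₂ := hr₂.wf hwf₁
  have fr₂ : ∀ x, x ∉ ({11, 12, 13} : Finset ℕ) → s₂.reg x = s₀.reg x := fun x hx => by
    rw [hr₂.rankBy_reg hx, fr₁ x hx]
  have fa₂ : ∀ A, A ∉ Icc 10 19 → A ≠ 33 → s₂.arr A = s₀.arr A := fun A hA h => by
    rw [hr₂.rankBy_arr hA h, fa₁ A hA h]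
  -- the sampled nodes
  set s₃ := ((s₂.setReg 24 (B + n + 1)).setReg 23 0).setArr 24 B 0 with hs₃
  have hr₃ : Run w (.assign 24 (.reg 20 + .reg 10 + 1) ;; .assign 23 0 ;;
      .store 24 (.reg 20) 0) 20 s₂ s₃ := by
    have := run_flat (w := w) (p := .assign 24 (.reg 20 + .reg 10 + 1) ;; .assign 23 0 ;;
      .store 24 (.reg 20) 0) rfl s₂
    have e : (Prog.den w (.assign 24 (.reg 20 + .reg 10 + 1) ;; .assign 23 0 ;;
        .store 24 (.reg 20) 0) s₂) = s₃ := by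
      simp only [Prog.den, eval_add, eval_reg, eval_one, eval_zero, fr₂ 20 (by decide),
        fr₂ 10 (by decide), hB, hn, State.setReg_reg, Nat.reduceEqDiff, if_false, hs₃,
        Nat.mod_eq_of_lt (show B + n < 2 ^ w by omega),
        Nat.mod_eq_of_lt (show B + n + 1 < 2 ^ w by omega)]
    rw [e] at this
    exact this.mono (by decide)
  have hwf₃ : WF w s₃ := hr₃.wf hwf₂
  have fr₃ : ∀ x, x ∉ ({11, 12, 13, 23, 24} : Finset ℕ) → s₃.reg x = s₀.reg x := fun x hx => by
    simp only [mem_insert, mem_singleton, not_or] at hx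
    simp only [hs₃, State.setArr_reg, State.setReg_reg, hx, if_false]
    exact fr₂ x (by simp [hx])
  have fa₃ : ∀ A, A ∉ Icc 10 19 → A ≠ 33 → A ≠ 24 → s₃.arr A = s₀.arr A := fun A hA h h' => by
    rw [hs₃, State.setArr_arr, if_neg h']; exact fa₂ A hA h
  obtain ⟨s₄, hr₄, hcnt, hsrc, hid, hidle, hid₀, hsrc₀⟩ := run_sampling (w := w) (n := n) (B := B)
    hwf₃ (by rw [fr₃ 10 (by decide), hn]) (by rw [fr₃ 20 (by decide), hB]) (by simp [hs₃])
    (by simp [hs₃]) hbound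
  have hwf₄ := hr₄.wf hwf₃
  set m := s₄.reg 23 with hm
  have e22 : s₃.win 22 B = s₀.win 22 B := by
    funext p; simp only [State.win, fa₃ 22 (by decide) (by decide) (by decide)]
  rw [e22] at hsrc hid
  set SRC := s₄.win 23 (B + n + 1) with hSRC
  set ID := s₄.win 24 B with hID
  have fr₄ : ∀ x, x ∉ ({11, 12, 13, 23, 24} : Finset ℕ) → s₄.reg x = s₀.reg x := fun x hx => by
    rw [hr₄.reg_eq, fr₃ x hx]
    simp only [mem_insert, mem_singleton, not_or] at hx
    simp [Prog.writesReg, hx]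
  have r24₄ : s₄.reg 24 = B + n + 1 := by rw [hr₄.reg_eq (by rfl)]; simp [hs₃]
  have fa₄ : ∀ A, A ∉ Icc 10 19 → A ≠ 33 → A ≠ 24 → A ≠ 23 → s₄.arr A = s₀.arr A :=
    fun A hA h h' h'' => by
      rw [hr₄.arr_eq, fa₃ A hA h h']
      simp [Prog.writesArr, h', h'']
  have a33₄ : s₄.arr 33 = s₂.arr 33 := by rw [hr₄.arr_eq (by rfl)]; rfl
  set push : Prog := .store 26 (.reg 21) (.reg 10) ;; .store 27 (.reg 21) (.reg 20) ;;
    .assign 21 (.reg 21 + 1) ;; .assign 10 (.reg 23) ;;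
    .store 20 (.reg 24) 0 ;; .store 21 (.reg 24) 0 with hpush
  have hr₅ := run_flat (w := w) (p := push) rfl s₄
  set s₅ := push.den w s₄ with hs₅
  have hs₅' : s₅ = (((((s₄.setArr 26 l n).setArr 27 l B).setReg 21 (l + 1)).setReg 10 m).setArr
      20 (B + n + 1) 0).setArr 21 (B + n + 1) 0 := by
    simp only [hs₅, hpush, Prog.den, eval_add, eval_reg, eval_one, eval_zero, fr₄ 20 (by decide),
        fr₄ 10 (by decide), fr₄ 21 (by decide), hB, hn, hl, State.setReg_reg, State.setArr_reg,
        Nat.reduceEqDiff, if_false, r24₄, Nat.mod_eq_of_lt hlw, ← hm]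
  have hwf₅ := hr₅.wf hwf₄
  have fr₅ : s₅.reg 10 = m ∧ s₅.reg 20 = B ∧ s₅.reg 24 = B + n + 1 := by
    simp [hs₅', r24₄, fr₄ 20 (by decide), hB]
  have a23₅ : s₅.arr 23 = s₄.arr 23 := hr₅.arr_eq rfl
  have a24₅ : s₅.arr 24 = s₄.arr 24 := hr₅.arr_eq rfl
  have a22₅ : s₅.arr 22 = s₀.arr 22 := by
    rw [hr₅.arr_eq rfl, fa₄ 22 (by decide) (by decide) (by decide) (by decide)]
  have a33₅ : s₅.arr 33 = s₂.arr 33 := by rw [hr₅.arr_eq rfl, a33₄]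
  have a20₅ : ∀ j, s₅.arr 20 j = if j = B + n + 1 then 0 else s₀.arr 20 j := fun j => by
    rw [hs₅']
    simp [fa₄ 20 (by decide) (by decide) (by decide) (by decide)]
  have a21₅ : ∀ j, s₅.arr 21 j = if j = B + n + 1 then 0 else s₀.arr 21 j := fun j => by
    rw [hs₅']
    simp [fa₄ 21 (by decide) (by decide) (by decide) (by decide)]
  have inj : Set.InjOn (fun k => B + n + 1 + k) (Set.Icc 1 m) := fun a _ b _ h => by
    simpa using h
  -- new labels
  obtain ⟨s₆, hr₆, h₆, h₆'⟩ := run_fill (w := w) (x := 11) (m := 10) (A := 20) (n := m)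
    (i := .reg 24 + .reg 11) (e := .load 33 (.load 23 (.reg 24 + .reg 11))) hwf₅ fr₅.1
    (by norm_num) (fun k => B + n + 1 + k) (fun k => s₂.arr 33 (SRC k)) inj (by
      rintro k ⟨hk₁, hk₂⟩ s hx hr ha - -
      have e : (.reg 24 + .reg 11 : Expr).eval w s = B + n + 1 + k := by
        simp only [eval_add, eval_reg, hx, hr 24 (by norm_num), fr₅.2.2]
        exact Nat.mod_eq_of_lt (by omega)
      refine ⟨e, ?_⟩
      rw [eval_load, eval_load, e, ha 33 (by norm_num), ha 23 (by norm_num), a33₅, a23₅]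
      rfl)
  have hwf₆ := hr₆.wf hwf₅
  have r₆ : s₆.reg 10 = m ∧ s₆.reg 20 = B ∧ s₆.reg 24 = B + n + 1 := by
    rw [hr₆.reg_eq (by rfl), hr₆.reg_eq (by rfl), hr₆.reg_eq (by rfl)]; exact fr₅
  -- new positions
  obtain ⟨s₇, hr₇, h₇, h₇'⟩ := run_fill (w := w) (x := 11) (m := 10) (A := 22) (n := m)
    (i := .reg 24 + .reg 11) (e := cell 22 (.load 23 (.reg 24 + .reg 11)) / 3) hwf₆ r₆.1
    (by norm_num) (fun k => B + n + 1 + k) (fun k => s₀.win 22 B (SRC k) / 3) inj (by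
      rintro k ⟨hk₁, hk₂⟩ s hx hr ha ha' hs
      have e : (.reg 24 + .reg 11 : Expr).eval w s = B + n + 1 + k := by
        simp only [eval_add, eval_reg, hx, hr 24 (by norm_num), r₆.2.2]
        exact Nat.mod_eq_of_lt (by omega)
      have hmem := mem_Icc.1 (hsrc k (mem_Icc.2 ⟨hk₁, hk₂⟩)).1
      have e' : (.load 23 (.reg 24 + .reg 11) : Expr).eval w s = SRC k := by
        rw [eval_load, e, ha 23 (by norm_num), hr₆.arr_eq (by rfl), a23₅]
        rfl
      refine ⟨e, ?_⟩
      rw [eval_div, ev _ 22 _ s (by rw [hr 20 (by norm_num), r₆.2.1]) e' hmem.2, eval_three]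
      -- The array that is being filled is also read, but only in the old window, which lies
      -- strictly before the new one.
      have : s.win 22 B (SRC k) = s₀.win 22 B (SRC k) := by
        simp only [State.win]
        rw [ha' _ (fun k' _ => by omega), hr₆.arr_eq (by rfl), a22₅]
      rw [← this]
      exact Nat.mod_eq_of_lt ((Nat.div_le_self _ _).trans_lt (hs.arr _ _)))
  have hwf₇ := hr₇.wf hwf₆
  have r₇ : s₇.reg 10 = m ∧ s₇.reg 20 = B ∧ s₇.reg 24 = B + n + 1 := by
    rw [hr₇.reg_eq (by rfl), hr₇.reg_eq (by rfl), hr₇.reg_eq (by rfl)]; exact r₆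
  -- new successors
  obtain ⟨s₈, hr₈, h₈, h₈'⟩ := run_fill (w := w) (x := 11) (m := 10) (A := 21) (n := m)
    (i := .reg 24 + .reg 11)
    (e := cell 24 (cell 21 (cell 21 (cell 21 (.load 23 (.reg 24 + .reg 11)))))) hwf₇ r₇.1
    (by norm_num) (fun k => B + n + 1 + k)
    (fun k => ID (s₀.win 21 B (s₀.win 21 B (s₀.win 21 B (SRC k))))) inj (by
      rintro k ⟨hk₁, hk₂⟩ s hx hr ha ha' hs
      have e : (.reg 24 + .reg 11 : Expr).eval w s = B + n + 1 + k := by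
        simp only [eval_add, eval_reg, hx, hr 24 (by norm_num), r₇.2.2]
        exact Nat.mod_eq_of_lt (by omega)
      have hmem := mem_Icc.1 (hsrc k (mem_Icc.2 ⟨hk₁, hk₂⟩)).1
      have e' : (.load 23 (.reg 24 + .reg 11) : Expr).eval w s = SRC k := by
        rw [eval_load, e, ha 23 (by norm_num), hr₇.arr_eq (by rfl), hr₆.arr_eq (by rfl), a23₅]
        rfl
      refine ⟨e, ?_⟩
      have h20 : s.reg 20 = B := by rw [hr 20 (by norm_num), r₇.2.1]
      have h21 : ∀ p ≤ n, s.win 21 B p = s₀.win 21 B p := by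
        intro p hp
        simp only [State.win]
        rw [ha' _ (fun k' _ => by omega), hr₇.arr_eq (by rfl), hr₆.arr_eq (by rfl), a21₅,
          if_neg (by omega)]
      have g₁ := ev _ 21 _ s h20 e' hmem.2
      rw [h21 _ hmem.2] at g₁
      have l₁ := hNX _ hmem.2
      have g₂ := ev _ 21 _ s h20 g₁ l₁
      rw [h21 _ l₁] at g₂
      have l₂ := hNX _ l₁
      have g₃ := ev _ 21 _ s h20 g₂ l₂
      rw [h21 _ l₂] at g₃
      rw [ev _ 24 _ s h20 g₃ (hNX _ l₂)]
      simp only [State.win, hID]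
      rw [ha 24 (by norm_num), hr₇.arr_eq (by rfl), hr₆.arr_eq (by rfl), a24₅])
  have hwf₈ := hr₈.wf hwf₇
  have hr₉ := Run.assign (w := w) s₈ 20 (.reg 24)
  set s₉ := s₈.setReg 20 _ with hs₉
  have r₈ : s₈.reg 10 = m ∧ s₈.reg 20 = B ∧ s₈.reg 24 = B + n + 1 := by
    rw [hr₈.reg_eq (by rfl), hr₈.reg_eq (by rfl), hr₈.reg_eq (by rfl)]; exact r₇
  have out20 : ∀ j, (∀ k ∈ Set.Icc 1 m, B + n + 1 + k ≠ j) → s₉.arr 20 j = s₅.arr 20 j := by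
    intro j hj
    change s₈.arr 20 j = _
    rw [hr₈.arr_eq (by rfl), hr₇.arr_eq (by rfl), h₆' j hj]
  have out21 : ∀ j, (∀ k ∈ Set.Icc 1 m, B + n + 1 + k ≠ j) → s₉.arr 21 j = s₅.arr 21 j := by
    intro j hj
    change s₈.arr 21 j = _
    rw [h₈' j hj, hr₇.arr_eq (by rfl), hr₆.arr_eq (by rfl)]
  have out22 : ∀ j, (∀ k ∈ Set.Icc 1 m, B + n + 1 + k ≠ j) → s₉.arr 22 j = s₅.arr 22 j := by
    intro j hj
    change s₈.arr 22 j = _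
    rw [hr₈.arr_eq (by rfl), h₇' j hj, hr₆.arr_eq (by rfl)]
  have a23₉ : s₉.arr 23 = s₄.arr 23 := by
    change s₈.arr 23 = _
    rw [hr₈.arr_eq (by rfl), hr₇.arr_eq (by rfl), hr₆.arr_eq (by rfl), a23₅]
  have a24₉ : s₉.arr 24 = s₄.arr 24 := by
    change s₈.arr 24 = _
    rw [hr₈.arr_eq (by rfl), hr₇.arr_eq (by rfl), hr₆.arr_eq (by rfl), a24₅]
  have w23 : s₉.win 23 (B + n + 1) = SRC := by
    rw [hSRC]; funext p; simp only [State.win, a23₉]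
  have w24 : s₉.win 24 B = ID := by
    rw [hID]; funext p; simp only [State.win, a24₉]
  have r₉ : s₉.reg 10 = m := by simp [hs₉, r₈.1]
  refine ⟨s₉, (hr₁.seq (hr₂.seq (hr₃.seq (hr₄.seq (hr₅.seq (hr₆.seq (hr₇.seq
    (hr₈.seq hr₉)))))))).mono ?_, ?_, ?_, ?_, ?_, ?_, ?_, ?_⟩
  · simp only [hpush, Prog.time, cost_add, cost_load, cost_reg, cost_zero, cost_one, cost_cell,
      cost_div, cost_three, cost_less, cost_classExpr]
    have h₁ := Nat.mul_le_mul_right (1 + 1 + 1 + (1 + 1 + 1 + 1 + 3 + 3 + 3 + 3) + 9) hcnt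
    have h₂ := Nat.mul_le_mul_right (1 + 1 + 1 + (1 + 1 + 1 + 1 + 3 + 1 + 1) + 9) hcnt
    have h₃ := Nat.mul_le_mul_right (1 + 1 + 1 + (1 + 1 + 1 + 1 + 1) + 9) hcnt
    omega
  · change s₈.reg 21 = _
    rw [hr₈.reg_eq (by rfl), hr₇.reg_eq (by rfl), hr₆.reg_eq (by rfl), hs₅']
    simp
  · simp [hs₉, r₈.2.2]
  · rw [w23, w24, r₉]
    refine ⟨hsrc, hid, ?_, hidle, ?_, ?_, ⟨r, W, hz₁, h₁, fun p _ => rfl, ?_⟩, ?_, ?_⟩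
    · exact (hid₀ B le_rfl).trans (by simp [hs₃])
    · change s₉.arr 20 (B + n + 1 + 0) = 0
      rw [out20 _ (by rintro k ⟨hk, -⟩; omega), a20₅]; simp
    · change s₉.arr 21 (B + n + 1 + 0) = 0
      rw [out21 _ (by rintro k ⟨hk, -⟩; omega), a21₅]; simp
    · intro p hp
      change s₈.arr 20 _ = _
      rw [hr₈.arr_eq (by rfl), hr₇.arr_eq (by rfl), h₆ p (by simpa using hp)]
      exact h₂ _ (hsrc p hp).1
    · intro p hp
      exact h₈ p (by simpa using hp)
    · intro p hp
      change s₈.arr 22 _ = _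
      rw [hr₈.arr_eq (by rfl)]
      exact h₇ p (by simpa using hp)
  · change s₈.arr 26 = _
    rw [hr₈.arr_eq (by rfl), hr₇.arr_eq (by rfl), hr₆.arr_eq (by rfl), hs₅']
    simp [State.setArr_arr, fa₄ 26 (by decide) (by decide) (by decide) (by decide)]
  · change s₈.arr 27 = _
    rw [hr₈.arr_eq (by rfl), hr₇.arr_eq (by rfl), hr₆.arr_eq (by rfl), hs₅']
    simp [State.setArr_arr, fa₄ 27 (by decide) (by decide) (by decide) (by decide)]
  · rintro A (rfl | rfl | rfl | rfl) j hj
    · rw [out20 j (by rintro k ⟨hk, -⟩; omega), a20₅, if_neg (by omega)]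
    · rw [out21 j (by rintro k ⟨hk, -⟩; omega), a21₅, if_neg (by omega)]
    · rw [out22 j (by rintro k ⟨hk, -⟩; omega), a22₅]
    · rw [a23₉, hsrc₀ j hj, fa₃ 23 (by decide) (by decide) (by decide)]
  · intro j hj
    rw [a24₉, hid₀ j hj.le, hs₃]
    simp [hj.ne, fa₂ 24 (by decide) (by decide)]

end CAO

/-! ### The way up: from the ranks of the sampled nodes to all ranks -/

namespace CAO

open Finset

/-- One step up: extend the ranks of the sampled nodes to all nodes. -/
def expandProg : Prog :=
  (.assign 24 (.reg 20) ;; .assign 21 (.reg 21 - 1) ;; .assign 20 (.load 27 (.reg 21)) ;;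
    .assign 10 (.load 26 (.reg 21)) ;; .store 28 0 0) ;;
  .fill 11 10 28 (.reg 11) (.load 25 (.reg 24 + cell 24 (.reg 11))) ;;
  rankBy (cell 20 (.reg 11)) (.load 28 (cell 21 (.reg 11))) (1 - classExpr.same 2) 29 ;;
  rankBy (cell 20 (.reg 11)) (.load 28 (cell 21 (.reg 11))) (classExpr.same 0) 30 ;;
  rankBy (cell 20 (.reg 11)) (.load 29 (cell 21 (.reg 11))) (1 - classExpr.same 1) 31 ;;
  rankBy (cell 20 (.reg 11)) (.load 29 (cell 21 (.reg 11))) (classExpr.same 2) 32 ;;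
  rankBy (.load 28 (.reg 11)) 0 (classExpr.same 1) 33 ;;
  .fill 11 10 25 (.reg 20 + .reg 11)
    (classExpr.same 0 * (.load 29 (.reg 11) + .load 32 (.reg 11) - 1) +
      classExpr.same 1 * (.load 28 (.reg 11) + .load 30 (.reg 11) - 1) +
      classExpr.same 2 * (.load 31 (.reg 11) + .load 33 (.reg 11) - 1)) ;;
  .store 25 (.reg 20) 0

theorem cnt_lt_of_mem {α : Type*} [LinearOrder α] {n p : ℕ} {K : ℕ → α} (P : ℕ → Prop)
    [DecidablePred P] (hp : p ∈ Icc 1 n) : cnt n K P p < n := by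
  calc _ < #(Icc 1 n) := card_lt_card ⟨filter_subset _ _, fun hsub =>
        lt_irrefl _ (mem_filter.1 (hsub hp)).2.2⟩
    _ = n := by simp

theorem lexCount_lt {n p : ℕ} {K₁ K₂ W : ℕ → ℕ} (hW : ∀ q ∈ Icc 1 n, W q ≤ 1)
    (hp : p ∈ Icc 1 n) : lexCount n K₁ K₂ W p < n := by
  calc lexCount n K₁ K₂ W p ≤ ∑ q ∈ Icc 1 n with LexLT K₁ K₂ q p, 1 :=
        sum_le_sum fun q hq => hW q (mem_filter.1 hq).1
    _ = cnt n (fun p => toLex (K₁ p, K₂ p)) (fun _ => True) p := by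
        rw [← lexCount_eq_cnt (W := fun _ => 1) (fun _ _ => (if_pos trivial).symm)
          (fun q _ _ => lexLT_iff)]
        rfl
    _ < n := cnt_lt_of_mem _ hp

theorem IsRank.le {n p : ℕ} {T NX R : ℕ → ℕ} (h : IsRank n T NX R) (hp : p ≤ n) : R p ≤ n := by
  rcases Nat.eq_zero_or_pos p with rfl | hp₀
  · rw [h.1]; omega
  · have hp' : p ∈ Icc 1 n := mem_Icc.2 ⟨hp₀, hp⟩
    rw [h.2 p hp']
    exact cnt_lt_of_mem _ hp'

/-- The arrays `28` to `33` hold the functions `RA`, `X`, `X₀`, `Y`, `Y₂` and `Z` of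
`Reduced.isRank`. The case distinction by the class is made without branching, by multiplying each
case with a test of value 0 or 1. -/
theorem run_expandProg {w : ℕ} [hw : Fact (8 ≤ 2 ^ w)] {n n' B B' l : ℕ} {s₀ : State}
    (hwf : WF w s₀) (hB' : s₀.reg 20 = B') (hl : s₀.reg 21 = l + 1)
    (hn : s₀.arr 26 l = n) (hB : s₀.arr 27 l = B)
    (hc : Chain n (s₀.win 20 B) (s₀.win 21 B) (s₀.win 22 B))
    (hred : Reduced n (s₀.win 20 B) (s₀.win 21 B) (s₀.win 22 B) n' (s₀.win 20 B')
        (s₀.win 21 B') (s₀.win 22 B') (s₀.win 24 B) (s₀.win 23 B'))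
    (hR : IsRank n' (s₀.win 20 B') (s₀.win 21 B') (s₀.win 25 B'))
    (hbound : B + 10 * n + 10 < 2 ^ w) (hbound' : B' + n < 2 ^ w) :
    ∃ s', Run w expandProg (5000 * (n + 1)) s₀ s' ∧ s'.reg 21 = l ∧ s'.reg 20 = B ∧
      s'.reg 10 = n ∧ IsRank n (s₀.win 20 B) (s₀.win 21 B) (s'.win 25 B) := by
  have hNX : ∀ p ≤ n, s₀.win 21 B p ≤ n := fun p hp => hc.NX_le' hp
  have hT : ∀ p ≤ n, s₀.win 20 B p ≤ n := fun p hp => by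
    rcases Nat.eq_zero_or_pos p with rfl | hp₀
    · rw [hc.T_zero]; omega
    · exact (mem_Icc.1 (hc.T_mem p (mem_Icc.2 ⟨hp₀, hp⟩))).2
  have hn'n : n' ≤ n := by have := hred.size_le hc; omega
  set pop : Prog := .assign 24 (.reg 20) ;; .assign 21 (.reg 21 - 1) ;;
    .assign 20 (.load 27 (.reg 21)) ;; .assign 10 (.load 26 (.reg 21)) ;; .store 28 0 0 with hpop
  have hr₁ := run_flat (w := w) (p := pop) rfl s₀
  set s₁ := pop.den w s₀ with hs₁
  have hlw : l % 2 ^ w = l := by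
    have := hwf.reg 21
    exact Nat.mod_eq_of_lt (by omega)
  have hs₁' : s₁ = ((((s₀.setReg 24 B').setReg 21 l).setReg 20 B).setReg 10 n).setArr 28 0 0 := by
    simp [hs₁, hpop, Prog.den, hB', hl, hlw, hn, hB]
  have hwf₁ := hr₁.wf hwf
  have r₁ : s₁.reg 10 = n ∧ s₁.reg 20 = B ∧ s₁.reg 24 = B' ∧ s₁.reg 21 = l := by simp [hs₁']
  have fa₁ : ∀ A, A ≠ 28 → s₁.arr A = s₀.arr A := fun A hA => by
    simp [hs₁', State.setArr_arr, hA]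
  -- the ranks of the sampled nodes
  obtain ⟨s₂, hr₂, h₂, h₂'⟩ := run_fill (w := w) (x := 11) (m := 10) (A := 28) (n := n)
    (i := .reg 11) (e := .load 25 (.reg 24 + cell 24 (.reg 11))) hwf₁ r₁.1
    (by norm_num) id (fun p => s₀.win 25 B' (s₀.win 24 B p)) Function.injective_id.injOn (by
      rintro p ⟨hp₁, hp₂⟩ s hx hr ha - -
      have hid := hred.id_le p (mem_Icc.2 ⟨hp₁, hp₂⟩)
      refine ⟨by simp [hx], ?_⟩
      rw [eval_load, eval_add, eval_reg, hr 24 (by norm_num), r₁.2.2.1,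
        eval_cell (i := p) (by rw [hr 20 (by norm_num), r₁.2.1]) (by simp [hx]) (by omega),
        ha 24 (by norm_num), ha 25 (by norm_num), fa₁ 24 (by norm_num), fa₁ 25 (by norm_num)]
      change s₀.arr 25 ((B' + s₀.win 24 B p) % 2 ^ w) = _
      rw [Nat.mod_eq_of_lt (by omega)]
      rfl)
  have hwf₂ := hr₂.wf hwf₁
  have r₂ : s₂.reg 10 = n ∧ s₂.reg 20 = B ∧ s₂.reg 21 = l := by
    rw [hr₂.reg_eq (by rfl), hr₂.reg_eq (by rfl), hr₂.reg_eq (by rfl)]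
    exact ⟨r₁.1, r₁.2.1, r₁.2.2.2⟩
  have fa₂ : ∀ A, A ≠ 28 → s₂.arr A = s₀.arr A := fun A hA => by
    rw [hr₂.arr_eq (by simpa [Prog.fill, Prog.writesArr] using hA), fa₁ A hA]
  set RA := s₂.arr 28 with hRAdef
  have hRA₀ : RA 0 = 0 := by
    rw [h₂' 0 (by rintro k ⟨hk, -⟩; simp; omega), hs₁']; simp
  have hRA : ∀ p ∈ Icc 1 n, RA p = s₀.win 25 B' (s₀.win 24 B p) := fun p hp =>
    h₂ p (by simpa using hp)
  have hRAle : ∀ p ≤ n, RA p ≤ n := by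
    intro p hp
    rcases Nat.eq_zero_or_pos p with rfl | hp₀
    · exact hRA₀.le.trans (Nat.zero_le n)
    · have hp' : p ∈ Icc 1 n := mem_Icc.2 ⟨hp₀, hp⟩
      rw [hRA p hp']
      exact (hR.le (hred.id_le p hp')).trans hn'n
  -- evaluation of expressions in the states that follow
  set Frm : State → Prop := fun s => s.reg 10 = n ∧ s.reg 20 = B ∧ s.reg 21 = l ∧
    s.arr 20 = s₀.arr 20 ∧ s.arr 21 = s₀.arr 21 ∧ s.arr 22 = s₀.arr 22 ∧ s.arr 28 = RA with hF
  have evA : ∀ (A i : ℕ) (e : Expr) (s : State), s.reg 20 = B → s.arr A = s₀.arr A →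
      e.eval w s = i → i ≤ n → (cell A e).eval w s = s₀.win A B i := fun A i e s h₁ h₂ h₃ h₄ => by
    rw [eval_cell h₁ h₃ (by omega), h₂]; rfl
  have cT : ∀ s, Frm s → Computes w s n (cell 20 (.reg 11)) (s₀.win 20 B) :=
    fun s hs i hi s' hx hr ha =>
      evA 20 i (.reg 11) s' (by rw [hr 20 (by decide), hs.2.1])
        (by rw [ha 20 (by decide), hs.2.2.2.1]) hx (mem_Icc.1 hi).2
  have cNX : ∀ A s, A ∉ Icc 10 19 → Frm s → Computes w s n (.load A (cell 21 (.reg 11)))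
      (fun p => s.arr A (s₀.win 21 B p)) := fun A s hA hs i hi s' hx hr ha => by
    rw [eval_load, evA 21 i (.reg 11) s' (by rw [hr 20 (by decide), hs.2.1])
        (by rw [ha 21 (by decide), hs.2.2.2.2.1]) hx (mem_Icc.1 hi).2, ha A hA]
  have cC : ∀ s, Frm s → Computes w s n classExpr (fun p => s₀.win 22 B p % 3) :=
    fun s hs i hi s' hx hr ha => by
      have := mem_Icc.1 hi
      rw [eval_classExpr (B := B) (by rw [hr 20 (by decide), hs.2.1]) hx (by omega)]
      simp only [State.win, ha 22 (by decide), hs.2.2.2.2.2.1]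
  have cEq : ∀ s, Frm s → ∀ (e : Expr) (v : ℕ), (∀ s, e.eval w s = v) →
      Computes w s n (classExpr.same e) (fun p => if s₀.win 22 B p % 3 = v then 1 else 0) :=
    fun s hs e v he i hi s' hx hr ha => by
      rw [eval_same, cC s hs i hi s' hx hr ha, he]
  have cNe : ∀ s, Frm s → ∀ (e : Expr) (v : ℕ), (∀ s, e.eval w s = v) →
      Computes w s n (1 - classExpr.same e)
        (fun p => if s₀.win 22 B p % 3 ≠ v then 1 else 0) :=
    fun s hs e v he i hi s' hx hr ha => by
      rw [eval_sub, cEq s hs e v he i hi s' hx hr ha, eval_one]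
      by_cases h : s₀.win 22 B i % 3 = v
      · simp [h]
      · simp only [h, if_false, ne_eq, not_false_eq_true, if_true, Nat.sub_zero]
        exact small_mod (by norm_num)
  have step : ∀ (A : ℕ) (k₁ k₂ e : Expr) (s : State) (f₁ f₂ W : ℕ → ℕ), WF w s → Frm s →
      29 ≤ A → Computes w s n k₁ f₁ → Computes w s n k₂ f₂ → Computes w s n e W →
      (∀ p ≤ n, f₁ p ≤ n) → (∀ p ≤ n, f₂ p ≤ n) → (∀ p, W p ≤ 1) →
      ∃ s', Run w (rankBy k₁ k₂ e A) ((350 + k₁.cost + k₂.cost + e.cost) * (n + 1)) s s' ∧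
        WF w s' ∧ Frm s' ∧ (∀ A', 29 ≤ A' → A' ≠ A → s'.arr A' = s.arr A') ∧
        s'.arr A 0 = 0 ∧ (∀ p ∈ Icc 1 n, s'.arr A p = lexCount n f₁ f₂ W p + 1) ∧
        ∀ p ≤ n, s'.arr A p ≤ n := by
    intro A k₁ k₂ e s f₁ f₂ W hs hFs hA hk₁ hk₂ he hf₁ hf₂ hW
    have hA' : A ∉ Icc 10 19 := by simp only [mem_Icc, not_and]; omega
    obtain ⟨s', hr, hz, h⟩ := run_rankBy hs hFs.1 hA' hk₁ hk₂ he
      (fun q hq => hf₁ q (mem_Icc.1 hq).2) (fun q hq => hf₂ q (mem_Icc.1 hq).2)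
      (fun q _ => hW q) (by omega)
    refine ⟨s', hr, hr.wf hs, ?_, fun A' h₁ h₂ => hr.rankBy_arr (by simp; omega) h₂, hz, h, ?_⟩
    · obtain ⟨f₁, f₂, f₃, f₄, f₅, f₆, f₇⟩ := hFs
      simp only [hF]
      rw [hr.rankBy_reg (by decide), hr.rankBy_reg (by decide), hr.rankBy_reg (by decide),
        hr.rankBy_arr (by decide) (by omega), hr.rankBy_arr (by decide) (by omega),
        hr.rankBy_arr (by decide) (by omega), hr.rankBy_arr (by decide) (by omega)]
      exact ⟨f₁, f₂, f₃, f₄, f₅, f₆, f₇⟩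
    · intro p hp
      rcases Nat.eq_zero_or_pos p with rfl | hp₀
      · rw [hz]; omega
      · have hp' : p ∈ Icc 1 n := mem_Icc.2 ⟨hp₀, hp⟩
        rw [h p hp']
        exact lexCount_lt (fun q _ => hW q) hp'
  have ite_le : ∀ P : Prop, [Decidable P] → (if P then 1 else 0) ≤ 1 := fun P _ => by
    split_ifs <;> omega
  have hF₂ : Frm s₂ := ⟨r₂.1, r₂.2.1, r₂.2.2, fa₂ 20 (by norm_num), fa₂ 21 (by norm_num),
    fa₂ 22 (by norm_num), rfl⟩
  obtain ⟨s₃, hr₃, hwf₃, hF₃, fa₃, hz₃, h₃, hle₃⟩ := step 29 _ _ _ s₂ _ _ _ hwf₂ hF₂ (by norm_num)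
    (cT s₂ hF₂) (cNX 28 s₂ (by decide) hF₂) (cNe s₂ hF₂ 2 2 fun s => eval_two)
    (fun p hp => hT p hp) (fun p hp => hRAle _ (hNX p hp)) (fun p => ite_le _)
  obtain ⟨s₄, hr₄, hwf₄, hF₄, fa₄, hz₄, h₄, hle₄⟩ := step 30 _ _ _ s₃ _ _ _ hwf₃ hF₃ (by norm_num)
    (cT s₃ hF₃) (cNX 28 s₃ (by decide) hF₃) (cEq s₃ hF₃ 0 0 fun s => eval_zero)
    (fun p hp => hT p hp) (fun p hp => by rw [hF₃.2.2.2.2.2.2]; exact hRAle _ (hNX p hp))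
    (fun p => ite_le _)
  have x₄ : s₄.arr 29 = s₃.arr 29 := fa₄ 29 (by norm_num) (by norm_num)
  obtain ⟨s₅, hr₅, hwf₅, hF₅, fa₅, hz₅, h₅, hle₅⟩ := step 31 _ _ _ s₄ _ _ _ hwf₄ hF₄ (by norm_num)
    (cT s₄ hF₄) (cNX 29 s₄ (by decide) hF₄) (cNe s₄ hF₄ 1 1 fun s => eval_one)
    (fun p hp => hT p hp) (fun p hp => by rw [x₄]; exact hle₃ _ (hNX p hp))
    (fun p => ite_le _)
  have x₅ : s₅.arr 29 = s₃.arr 29 := by rw [fa₅ 29 (by norm_num) (by norm_num), x₄]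
  obtain ⟨s₆, hr₆, hwf₆, hF₆, fa₆, hz₆, h₆, hle₆⟩ := step 32 _ _ _ s₅ _ _ _ hwf₅ hF₅ (by norm_num)
    (cT s₅ hF₅) (cNX 29 s₅ (by decide) hF₅) (cEq s₅ hF₅ 2 2 fun s => eval_two)
    (fun p hp => hT p hp) (fun p hp => by rw [x₅]; exact hle₃ _ (hNX p hp))
    (fun p => ite_le _)
  obtain ⟨s₇, hr₇, hwf₇, hF₇, fa₇, hz₇, h₇, hle₇⟩ := step 33 (.load 28 (.reg 11)) 0 _ s₆ RA
    (fun _ => 0) _ hwf₆ hF₆ (by norm_num)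
    (fun i hi s' hx hr ha => by simp [hx, ha 28 (by decide), hF₆.2.2.2.2.2.2])
    (fun i hi s' hx hr ha => by simp)
    (cEq s₆ hF₆ 1 1 fun s => eval_one)
    (fun p hp => hRAle p hp) (fun p hp => by omega)
    (fun p => ite_le _)
  -- all ranks
  set v : ℕ → ℕ := fun p => if s₀.win 22 B p % 3 = 0 then s₃.arr 29 p + s₆.arr 32 p - 1
      else if s₀.win 22 B p % 3 = 1 then RA p + s₄.arr 30 p - 1
      else s₅.arr 31 p + s₇.arr 33 p - 1 with hv
  obtain ⟨s₈, hr₈, h₈, -⟩ := run_fill (w := w) (x := 11) (m := 10) (A := 25) (n := n)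
    (i := .reg 20 + .reg 11)
    (e := classExpr.same 0 * (.load 29 (.reg 11) + .load 32 (.reg 11) - 1) +
      classExpr.same 1 * (.load 28 (.reg 11) + .load 30 (.reg 11) - 1) +
      classExpr.same 2 * (.load 31 (.reg 11) + .load 33 (.reg 11) - 1)) hwf₇ hF₇.1
    (by norm_num) (fun p => B + p) v (fun a _ b _ h => by simpa using h) (by
      rintro p ⟨hp₁, hp₂⟩ s hx hr ha - -
      have h20 : s.reg 20 = B := by rw [hr 20 (by norm_num), hF₇.2.1]
      refine ⟨by
        simp only [eval_add, eval_reg, h20, hx]; exact Nat.mod_eq_of_lt (by omega), ?_⟩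
      have hcl : classExpr.eval w s = s₀.win 22 B p % 3 := by
        rw [eval_classExpr h20 hx (by omega)]
        simp only [State.win, ha 22 (by norm_num), hF₇.2.2.2.2.2.1]
      have a28 : s.arr 28 p = RA p := by rw [ha 28 (by norm_num), hF₇.2.2.2.2.2.2]
      have a29 : s.arr 29 p = s₃.arr 29 p := by
        rw [ha 29 (by norm_num), fa₇ 29 (by norm_num) (by norm_num),
          fa₆ 29 (by norm_num) (by norm_num), x₅]
      have a30 : s.arr 30 p = s₄.arr 30 p := by
        rw [ha 30 (by norm_num), fa₇ 30 (by norm_num) (by norm_num),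
          fa₆ 30 (by norm_num) (by norm_num), fa₅ 30 (by norm_num) (by norm_num)]
      have a31 : s.arr 31 p = s₅.arr 31 p := by
        rw [ha 31 (by norm_num), fa₇ 31 (by norm_num) (by norm_num),
          fa₆ 31 (by norm_num) (by norm_num)]
      have a32 : s.arr 32 p = s₆.arr 32 p := by
        rw [ha 32 (by norm_num), fa₇ 32 (by norm_num) (by norm_num)]
      have a33 : s.arr 33 p = s₇.arr 33 p := by rw [ha 33 (by norm_num)]
      have b₁ := hRAle p hp₂
      have b₂ := hle₃ p hp₂
      have b₃ := hle₄ p hp₂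
      have b₄ := hle₅ p hp₂
      have b₅ := hle₆ p hp₂
      have b₆ := hle₇ p hp₂
      have ev : ∀ (E₁ E₂ : ℕ), E₁ ≤ n → E₂ ≤ n →
          ((E₁ + E₂) % 2 ^ w - 1) % 2 ^ w = E₁ + E₂ - 1 := fun E₁ E₂ h₁ h₂ => by
        rw [Nat.mod_eq_of_lt (by omega), Nat.mod_eq_of_lt (by omega)]
      have m₁ : (s₃.arr 29 p + s₆.arr 32 p - 1) % 2 ^ w = s₃.arr 29 p + s₆.arr 32 p - 1 :=
        Nat.mod_eq_of_lt (by omega)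
      have m₂ : (RA p + s₄.arr 30 p - 1) % 2 ^ w = RA p + s₄.arr 30 p - 1 :=
        Nat.mod_eq_of_lt (by omega)
      have m₃ : (s₅.arr 31 p + s₇.arr 33 p - 1) % 2 ^ w = s₅.arr 31 p + s₇.arr 33 p - 1 :=
        Nat.mod_eq_of_lt (by omega)
      have : s₀.win 22 B p % 3 = 0 ∨ s₀.win 22 B p % 3 = 1 ∨ s₀.win 22 B p % 3 = 2 := by omega
      simp only [eval_add, eval_mul, eval_same, eval_sub, eval_load, eval_reg, eval_zero,
        eval_one, eval_two, hx, hcl, a28, a29, a30, a31, a32, a33, ev _ _ b₁ b₃, ev _ _ b₂ b₅,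
        ev _ _ b₄ b₆, hv]
      rcases this with h | h | h <;> simp [h, m₁, m₂, m₃])
  have hr₉ := Run.store (w := w) s₈ 25 (.reg 20) 0
  have r₈ : s₈.reg 20 = B ∧ s₈.reg 21 = l ∧ s₈.reg 10 = n := by
    rw [hr₈.reg_eq (by rfl), hr₈.reg_eq (by rfl), hr₈.reg_eq (by rfl)]
    exact ⟨hF₇.2.1, hF₇.2.2.1, hF₇.1⟩
  set s₉ := s₈.setArr 25 _ _ with hs₉
  refine ⟨s₉, (hr₁.seq (hr₂.seq (hr₃.seq (hr₄.seq (hr₅.seq (hr₆.seq (hr₇.seq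
    (hr₈.seq hr₉)))))))).mono ?_, r₈.2.1, r₈.1, r₈.2.2, ?_⟩
  · simp only [hpop, Prog.time, cost_add, cost_load, cost_reg, cost_zero, cost_one, cost_cell,
      cost_sub, cost_two, cost_same, cost_classExpr, cost_mul]
    omega
  · refine Reduced.isRank (X₀ := s₄.arr 30) (Y := s₅.arr 31) (Y₂ := s₆.arr 32) hc hred hR hRA₀ hRA (fun p _ => rfl) (fun p _ => rfl) (fun p _ => rfl)
      (fun p _ => rfl) (fun p _ => rfl) hz₃ h₃ ?_ ?_ ?_ h₇ ?_ ?_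
    · rw [hF₃.2.2.2.2.2.2] at h₄; exact h₄
    · rw [x₄] at h₅; exact h₅
    · rw [x₅] at h₆; exact h₆
    · simp [State.win, hs₉, r₈.1]
    · intro p hp
      have := mem_Icc.1 hp
      have e : s₉.win 25 B p = s₈.arr 25 (B + p) := by
        simp [State.win, hs₉, r₈.1]; omega
      rw [e, h₈ p (by simpa using hp)]

end CAO

/-! ### The recursion as two loops over a stack of levels -/

namespace CAO

open Finset

section Congr

variable {n : ℕ} {T NX POS T₂ NX₂ POS₂ : ℕ → ℕ}

theorem lexCount_congr {K₁ K₂ W K₁' K₂' W' : ℕ → ℕ} {p : ℕ} (hp : p ∈ Icc 1 n)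
    (h₁ : ∀ q ∈ Icc 1 n, K₁ q = K₁' q) (h₂ : ∀ q ∈ Icc 1 n, K₂ q = K₂' q)
    (hW : ∀ q ∈ Icc 1 n, W q = W' q) : lexCount n K₁ K₂ W p = lexCount n K₁' K₂' W' p := by
  refine sum_congr (filter_congr fun q hq => ?_) fun q hq => hW q (mem_filter.1 hq).1
  rw [LexLT, LexLT, h₁ p hp, h₁ q hq, h₂ p hp, h₂ q hq]

theorem Chain.congr (h : Chain n T NX POS) (hT : ∀ p ≤ n, T₂ p = T p)
    (hNX : ∀ p ≤ n, NX₂ p = NX p) (hPOS : ∀ p ∈ Icc 1 n, POS₂ p = POS p) :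
    Chain n T₂ NX₂ POS₂ where
  T_zero := by rw [hT 0 (Nat.zero_le n), h.T_zero]
  NX_zero := by rw [hNX 0 (Nat.zero_le n), h.NX_zero]
  T_mem p hp := by rw [hT p (mem_Icc.1 hp).2]; exact h.T_mem p hp
  NX_le p hp := by rw [hNX p (mem_Icc.1 hp).2]; exact h.NX_le p hp
  pos_next p hp h₀ := by
    rw [hNX p (mem_Icc.1 hp).2] at h₀ ⊢
    rw [hPOS p hp, hPOS _ (mem_Icc.2 ⟨Nat.pos_of_ne_zero h₀, h.NX_le p hp⟩), h.pos_next p hp h₀]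
  pos_pred p hp h₀ := by
    rw [hPOS p hp] at h₀
    obtain ⟨q, hq, hq'⟩ := h.pos_pred p hp h₀
    exact ⟨q, hq, by rw [hNX q (mem_Icc.1 hq).2, hq']⟩

theorem Reduced.congr {n' : ℕ} {T' NX' POS' ID SRC T₂' NX₂' POS₂' ID₂ SRC₂ : ℕ → ℕ}
    (hc : Chain n T NX POS)
    (h : Reduced n T NX POS n' T' NX' POS' ID SRC) (hT : ∀ p ≤ n, T₂ p = T p)
    (hNX : ∀ p ≤ n, NX₂ p = NX p) (hPOS : ∀ p ≤ n, POS₂ p = POS p)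
    (hT' : ∀ p ≤ n', T₂' p = T' p) (hNX' : ∀ p ≤ n', NX₂' p = NX' p)
    (hPOS' : ∀ p ≤ n', POS₂' p = POS' p) (hID : ∀ p ≤ n, ID₂ p = ID p)
    (hSRC : ∀ p ≤ n', SRC₂ p = SRC p) :
    Reduced n T₂ NX₂ POS₂ n' T₂' NX₂' POS₂' ID₂ SRC₂ where
  src p hp := by
    obtain ⟨h₁, h₂, h₃⟩ := h.src p hp
    rw [hSRC p (mem_Icc.1 hp).2, hPOS _ (mem_Icc.1 h₁).2, hID _ (mem_Icc.1 h₁).2]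
    exact ⟨h₁, h₂, h₃⟩
  id p hp hpos := by
    rw [hPOS p (mem_Icc.1 hp).2] at hpos
    obtain ⟨h₁, h₂⟩ := h.id p hp hpos
    rw [hID p (mem_Icc.1 hp).2, hSRC _ (mem_Icc.1 h₁).2]
    exact ⟨h₁, h₂⟩
  id_zero := by rw [hID 0 (Nat.zero_le n), h.id_zero]
  id_le p hp := by rw [hID p (mem_Icc.1 hp).2]; exact h.id_le p hp
  T_zero := by rw [hT' 0 (Nat.zero_le n'), h.T_zero]
  NX_zero := by rw [hNX' 0 (Nat.zero_le n'), h.NX_zero]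
  label := by
    obtain ⟨r, W, h₁, h₂, h₃, h₄⟩ := h.label
    refine ⟨r, W, h₁, fun p hp => ?_, fun p hp => ?_, fun p hp => ?_⟩
    · rw [h₂ p hp, lexCount_congr hp (fun q hq => (hT q (mem_Icc.1 hq).2).symm)
        (fun q hq => ?_) fun _ _ => rfl]
      rw [hNX q (mem_Icc.1 hq).2, hT _ (hc.NX_le q hq)]
    · rw [h₃ p hp, hPOS p (mem_Icc.1 hp).2]
    · rw [hT' p (mem_Icc.1 hp).2, h₄ p hp, hSRC p (mem_Icc.1 hp).2,
        lexCount_congr (h.src p hp).1 (fun q hq => (hT q (mem_Icc.1 hq).2).symm)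
        (fun q hq => ?_) fun _ _ => rfl]
      rw [hNX q (mem_Icc.1 hq).2]
  next p hp := by
    have hs := (mem_Icc.1 (h.src p hp).1).2
    have h₁ := hc.NX_le' hs
    have h₂ := hc.NX_le' h₁
    rw [hNX' p (mem_Icc.1 hp).2, h.next p hp, hSRC p (mem_Icc.1 hp).2, hNX _ hs, hNX _ h₁,
      hNX _ h₂, hID _ (hc.NX_le' h₂)]
  pos p hp := by
    rw [hPOS' p (mem_Icc.1 hp).2, h.pos p hp, hSRC p (mem_Icc.1 hp).2,
      hPOS _ (mem_Icc.1 (h.src p hp).1).2]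

theorem key_congr (hc : Chain n T NX POS) (hT : ∀ p ≤ n, T₂ p = T p)
    (hNX : ∀ p ≤ n, NX₂ p = NX p) {p : ℕ} (hp : p ≤ n) : key T₂ NX₂ p = key T NX p := by
  have : ∀ k, NX₂^[k] p = NX^[k] p ∧ NX^[k] p ≤ n := by
    intro k
    induction k with
    | zero => exact ⟨rfl, hp⟩
    | succ k ih =>
      rw [Function.iterate_succ_apply', Function.iterate_succ_apply', ih.1, hNX _ ih.2]
      exact ⟨rfl, hc.NX_le' ih.2⟩
  change (fun k => T₂ (NX₂^[k] p)) = fun k => T (NX^[k] p)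
  funext k
  rw [(this k).1, hT _ (this k).2]

theorem IsRank.congr {R : ℕ → ℕ} (hc : Chain n T NX POS) (h : IsRank n T₂ NX₂ R)
    (hT : ∀ p ≤ n, T₂ p = T p) (hNX : ∀ p ≤ n, NX₂ p = NX p) : IsRank n T NX R := by
  refine ⟨h.1, fun p hp => ?_⟩
  rw [h.2 p hp]
  congr 1
  refine congrArg _ (filter_congr fun q hq => ?_)
  rw [key_congr hc hT hNX (mem_Icc.1 hp).2, key_congr hc hT hNX (mem_Icc.1 hq).2]

end Congr

/-- The windows of the arrays of the state `s` at `B` contain linked lists of length `n`, and those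
at `B'` contain their reduction, of length `n'`. -/
structure Level (s : State) (B n B' n' : ℕ) : Prop where
  base : B' = B + n + 1
  chain : Chain n (s.win 20 B) (s.win 21 B) (s.win 22 B)
  reduced : Reduced n (s.win 20 B) (s.win 21 B) (s.win 22 B) n' (s.win 20 B') (s.win 21 B')
    (s.win 22 B') (s.win 24 B) (s.win 23 B')

/-- A level involves its own window and the next one, except for the array `24`: the names of the
nodes of this level lie in its own window, so there only the cells before `B'` matter. -/
theorem Level.congr {s s' : State} {B n B' n' : ℕ} (h : Level s B n B' n')
    (h₁ : ∀ A, A = 20 ∨ A = 21 ∨ A = 22 ∨ A = 23 → ∀ j ≤ B' + n', s'.arr A j = s.arr A j)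
    (h₂ : ∀ j < B', s'.arr 24 j = s.arr 24 j) : Level s' B n B' n' := by
  have hb := h.base
  have w₁ : ∀ A, A = 20 ∨ A = 21 ∨ A = 22 ∨ A = 23 → ∀ p ≤ n, s'.win A B p = s.win A B p :=
    fun A hA p hp => h₁ A hA _ (by omega)
  have w₂ : ∀ A, A = 20 ∨ A = 21 ∨ A = 22 ∨ A = 23 → ∀ p ≤ n', s'.win A B' p = s.win A B' p :=
    fun A hA p hp => h₁ A hA _ (by omega)
  exact ⟨hb, h.chain.congr (w₁ 20 (by simp)) (w₁ 21 (by simp))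
      fun p hp => w₁ 22 (by simp) p (mem_Icc.1 hp).2,
    h.reduced.congr h.chain (w₁ 20 (by simp)) (w₁ 21 (by simp)) (w₁ 22 (by simp))
      (w₂ 20 (by simp)) (w₂ 21 (by simp)) (w₂ 22 (by simp)) (fun p hp => h₂ _ (by omega))
      (w₂ 23 (by simp))⟩

/-- Rank the nodes of linked lists: labels, successors and positions are in the arrays `20`, `21`
and `22`, the number of nodes is in register `10`, and the ranks go to the array `25`. -/
def sufRank : Prog :=
  (.assign 20 0 ;; .assign 21 0 ;; .store 20 0 0 ;; .store 21 0 0) ;;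
  .loop (.reg 10) reduceProg ;; .store 25 (.reg 20) 0 ;; .loop (.reg 21) expandProg

/-- A step down adds `n + 1` to the base and lowers `6 * n` by at least `2 * n`. As `n ≥ 1` there,
base plus `6 * n` never grows and the space stays linear. The way down is paid for by a potential
proportional to the number of nodes, which drops by a third, and the way up by one proportional to
the base, which drops by `n + 1`. -/
theorem run_sufRank {w : ℕ} [hw : Fact (8 ≤ 2 ^ w)] {M : ℕ} {s₀ : State} {T NX POS : ℕ → ℕ}
    (hwf : WF w s₀) (hM : s₀.reg 10 = M) (hc : Chain M T NX POS)
    (hT : ∀ p ∈ Icc 1 M, s₀.arr 20 p = T p) (hNX : ∀ p ∈ Icc 1 M, s₀.arr 21 p = NX p)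
    (hPOS : ∀ p ∈ Icc 1 M, s₀.arr 22 p = POS p) (hbound : 16 * M + 16 < 2 ^ w) :
    ∃ s', Run w sufRank (50000 * (M + 1)) s₀ s' ∧ s'.reg 10 = M ∧ IsRank M T NX (s'.arr 25) := by
  set ini : Prog := .assign 20 0 ;; .assign 21 0 ;; .store 20 0 0 ;; .store 21 0 0 with hini
  have hr₁ := run_flat (w := w) (p := ini) rfl s₀
  set s₁ := ini.den w s₀ with hs₁
  have hwf₁ := hr₁.wf hwf
  have r₁ : s₁.reg 10 = M ∧ s₁.reg 20 = 0 ∧ s₁.reg 21 = 0 := by simp [hs₁, hini, Prog.den, hM]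
  have e20 : ∀ p ≤ M, s₁.arr 20 p = T p := by
    intro p hp
    rcases Nat.eq_zero_or_pos p with rfl | hp₀
    · simp [hs₁, hini, Prog.den, hc.T_zero]
    · simp [hs₁, hini, Prog.den, hp₀.ne', hT p (mem_Icc.2 ⟨hp₀, hp⟩)]
  have e21 : ∀ p ≤ M, s₁.arr 21 p = NX p := by
    intro p hp
    rcases Nat.eq_zero_or_pos p with rfl | hp₀
    · simp [hs₁, hini, Prog.den, hc.NX_zero]
    · simp [hs₁, hini, Prog.den, hp₀.ne', hNX p (mem_Icc.2 ⟨hp₀, hp⟩)]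
  have e22 : ∀ p ∈ Icc 1 M, s₁.arr 22 p = POS p := by
    intro p hp
    simp [hs₁, hini, Prog.den, hPOS p hp]
  obtain ⟨s₂, hr₂, ⟨hwf₂, hc₂, bs, ns, hbs₀, hns₀, hbsl, hnsl, h26, h27, hlev, hB₂, hl₂, ho20, ho21⟩,
      he₂⟩ := run_loop (w := w) (e := .reg 10) (p := reduceProg)
    (fun s => WF w s ∧
      Chain (s.reg 10) (s.win 20 (s.reg 20)) (s.win 21 (s.reg 20)) (s.win 22 (s.reg 20)) ∧
      -- `bs` and `ns` are the bases and sizes of all levels. The stack stores those of the finished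
      -- levels, while the registers hold those of the current one.
      ∃ bs ns : ℕ → ℕ, bs 0 = 0 ∧ ns 0 = M ∧ bs (s.reg 21) = s.reg 20 ∧ ns (s.reg 21) = s.reg 10 ∧
        (∀ j < s.reg 21, s.arr 26 j = ns j) ∧ (∀ j < s.reg 21, s.arr 27 j = bs j) ∧
        (∀ j < s.reg 21, Level s (bs j) (ns j) (bs (j + 1)) (ns (j + 1)) ∧
          bs (j + 1) + ns (j + 1) ≤ s.reg 20 + s.reg 10 ∧ bs (j + 1) ≤ s.reg 20) ∧
        s.reg 20 + 6 * s.reg 10 ≤ 6 * M ∧ s.reg 21 ≤ s.reg 20 ∧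
        (∀ p ≤ M, s.arr 20 p = T p) ∧ (∀ p ≤ M, s.arr 21 p = NX p))
    (fun s => 13000 * s.reg 10) (by
      rintro s ⟨hs, hc, bs, ns, hbs₀, hns₀, hbsl, hnsl, h26, h27, hlev, hB, hl, ho20, ho21⟩ he
      rw [eval_reg] at he
      obtain ⟨s', hr, hl', hB', hred, u26, u27, hA, h24⟩ := run_reduceProg hs rfl rfl rfl hc
        (by omega) (by omega)
      set n := s.reg 10 with hn
      set B := s.reg 20 with hBd
      set l := s.reg 21 with hld
      set n' := s'.reg 10 with hn'
      have hsz := hred.size_le hc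
      refine ⟨s', _, hr, ⟨hr.wf hs, ?_, fun j => if j ≤ l then bs j else B + n + 1,
        fun j => if j ≤ l then ns j else n', ?_⟩, ?_⟩
      · rw [hB']; exact hred.chain hc
      · rw [hl', hB']
        refine ⟨by simp [hbs₀], by simp [hns₀], by simp, by simp [hn'], fun j hj => ?_,
          fun j hj => ?_, fun j hj => ?_, by omega, by omega, fun p hp => ?_, fun p hp => ?_⟩
        · beta_reduce
          rw [u26, if_pos (by omega), Function.update_apply]
          split_ifs with h
          · rw [h, hnsl]
          · exact h26 j (by omega)
        · beta_reduce
          rw [u27, if_pos (by omega), Function.update_apply]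
          split_ifs with h
          · rw [h, hbsl]
          · exact h27 j (by omega)
        · beta_reduce
          rw [if_pos (by omega : j ≤ l), if_pos (by omega : j ≤ l)]
          by_cases h : j = l
          · subst h
            rw [if_neg (by omega), if_neg (by omega), hbsl, hnsl]
            refine ⟨⟨rfl, ?_, ?_⟩, le_rfl, le_rfl⟩
            · exact hc.congr (fun p hp => hA 20 (by simp) _ (by omega))
                (fun p hp => hA 21 (by simp) _ (by omega))
                (fun p hp => hA 22 (by simp) _ (by have := mem_Icc.1 hp; omega))
            · exact hred.congr hc (fun p hp => hA 20 (by simp) _ (by omega))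
                (fun p hp => hA 21 (by simp) _ (by omega))
                (fun p hp => hA 22 (by simp) _ (by omega)) (fun _ _ => rfl) (fun _ _ => rfl)
                (fun _ _ => rfl) (fun _ _ => rfl) (fun _ _ => rfl)
          · rw [if_pos (by omega), if_pos (by omega)]
            obtain ⟨h₁, h₂, h₃⟩ := hlev j (by omega)
            exact ⟨h₁.congr (fun A hA' i hi => hA A hA' i (by omega))
              (fun i hi => h24 i (by omega)), by omega, by omega⟩
        · rw [← ho20 p hp]
          refine hA 20 (by simp) p ?_
          rcases Nat.eq_zero_or_pos l with h | h
          · rw [h] at hbsl hnsl; omega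
          · have := (hlev 0 h).1.base; have := (hlev 0 h).2.2; rw [zero_add] at *; omega
        · rw [← ho21 p hp]
          refine hA 21 (by simp) p ?_
          rcases Nat.eq_zero_or_pos l with h | h
          · rw [h] at hbsl hnsl; omega
          · have := (hlev 0 h).1.base; have := (hlev 0 h).2.2; rw [zero_add] at *; omega
      · rw [cost_reg]; omega)
    s₁ ⟨hwf₁, by
      rw [r₁.1, r₁.2.1]
      exact hc.congr (fun p hp => by simpa [State.win] using e20 p hp)
        (fun p hp => by simpa [State.win] using e21 p hp)
        (fun p hp => by simpa [State.win] using e22 p hp),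
      fun _ => 0, fun _ => M, rfl, rfl, r₁.2.1.symm, r₁.1.symm,
      fun j hj => by rw [r₁.2.2] at hj; omega, fun j hj => by rw [r₁.2.2] at hj; omega,
      fun j hj => by rw [r₁.2.2] at hj; omega, by rw [r₁.1, r₁.2.1]; omega,
      by rw [r₁.2.1, r₁.2.2], e20, e21⟩
  rw [eval_reg] at he₂
  have hr₃ := Run.store (w := w) s₂ 25 (.reg 20) 0
  set s₃ := s₂.setArr 25 _ _ with hs₃
  have hwf₃ := hr₃.wf hwf₂
  set L := s₂.reg 21 with hL
  have hmono : ∀ j ≤ L, ns j ≤ M ∧ bs j ≤ s₂.reg 20 := by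
    intro j
    induction j with
    | zero => intro _; simp [hns₀, hbs₀]
    | succ j ih =>
      intro hj
      obtain ⟨h₁, h₂, h₃⟩ := hlev j (by omega)
      have := h₁.reduced.size_le h₁.chain
      have := ih (by omega)
      omega
  obtain ⟨s₄, hr₄, ⟨hwf₄, hfr, hl₄, hB₄, hn₄, hR₄⟩, he₄⟩ := run_loop (w := w) (e := .reg 21)
    (p := expandProg)
    (fun s => WF w s ∧ (∀ A, A = 20 ∨ A = 21 ∨ A = 22 ∨ A = 23 ∨ A = 24 ∨ A = 26 ∨ A = 27 →
        s.arr A = s₂.arr A) ∧ s.reg 21 ≤ L ∧ s.reg 20 = bs (s.reg 21) ∧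
      s.reg 10 = ns (s.reg 21) ∧ IsRank (ns (s.reg 21)) (s₂.win 20 (s.reg 20))
        (s₂.win 21 (s.reg 20)) (s.win 25 (s.reg 20)))
    (fun s => 5010 * s.reg 20) (by
      rintro s ⟨hs, hfr, hl, hB, hn, hR⟩ he
      rw [eval_reg] at he
      obtain ⟨l, hl'⟩ := Nat.exists_eq_succ_of_ne_zero he
      rw [Nat.succ_eq_add_one] at hl'
      obtain ⟨h₁, h₂, h₃⟩ := hlev l (by omega)
      have hm := hmono l (by omega)
      have hm' := hmono (l + 1) (by omega)
      have w : ∀ A, A = 20 ∨ A = 21 ∨ A = 22 ∨ A = 23 ∨ A = 24 → ∀ B, s.win A B = s₂.win A B :=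
        fun A hA B => by funext p; simp only [State.win]; rw [hfr A (by omega)]
      rw [hl'] at hB hn hR
      rw [hB] at hR
      obtain ⟨s', hr, r21, r20, r10, hR'⟩ := run_expandProg (n := ns l) (n' := ns (l + 1))
        (B := bs l) (B' := bs (l + 1)) (l := l) hs hB hl'
        (by rw [hfr 26 (by simp), h26 l (by omega)]) (by rw [hfr 27 (by simp), h27 l (by omega)])
        (by rw [w 20 (by simp), w 21 (by simp), w 22 (by simp)]; exact h₁.chain)
        (by
          simp only [w 20 (by simp), w 21 (by simp), w 22 (by simp), w 23 (by simp),
            w 24 (by simp)]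
          exact h₁.reduced)
        (by rw [w 20 (by simp), w 21 (by simp)]; exact hR) (by omega) (by omega)
      refine ⟨s', _, hr, ⟨hr.wf hs, fun A hA => ?_, by omega, by rw [r20, r21], by rw [r10, r21],
        ?_⟩, ?_⟩
      · rw [← hfr A hA]
        rcases hA with rfl | rfl | rfl | rfl | rfl | rfl | rfl <;> exact hr.arr_eq (by rfl)
      · rw [r20, r21]
        rw [w 20 (by simp), w 21 (by simp)] at hR'
        exact hR'
      · rw [cost_reg, r20, hB, h₁.base]
        omega)
    s₃ ⟨hwf₃, by
        rintro A (rfl | rfl | rfl | rfl | rfl | rfl | rfl) <;> exact hr₃.arr_eq (by rfl),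
      le_rfl, hbsl.symm, hnsl.symm, by
        -- The lowest level has no nodes, so writing the value 0 for the end of the lists completes
        -- its ranking.
        change IsRank (ns L) _ _ _
        rw [hnsl, he₂]
        exact ⟨by simp [State.win, hs₃], fun p hp => by simp at hp⟩⟩
  rw [eval_reg] at he₄
  rw [he₄] at hB₄ hn₄ hR₄
  rw [hbs₀] at hB₄
  rw [hns₀] at hn₄ hR₄
  rw [hB₄] at hR₄
  have hr20 : s₃.reg 20 = s₂.reg 20 := rfl
  refine ⟨s₄, (hr₁.seq (hr₂.seq (hr₃.seq hr₄))).mono ?_, hn₄, ?_⟩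
  · simp only [hini, Prog.time, cost_reg, cost_zero, hr20, r₁.1]
    omega
  · have e : s₄.win 25 0 = s₄.arr 25 := by funext p; simp [State.win]
    rw [e] at hR₄
    exact hR₄.congr hc (fun p hp => by simpa [State.win] using ho20 p hp)
      (fun p hp => by simpa [State.win] using ho21 p hp)

end CAO

/-! ### Runs of concatenations -/

namespace CAO

open Finset

section Changes

variable {α : Type} [DecidableEq α]

/-- The number of consecutive pairs of distinct elements. -/
def changes : List α → ℕ
  | [] => 0
  | [_] => 0
  | a :: b :: l => (if a = b then 0 else 1) + changes (b :: l)

theorem length_destutter' (a : α) (l : List α) :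
    (l.destutter' (· ≠ ·) a).length = changes (a :: l) + 1 := by
  induction l generalizing a with
  | nil => simp [changes]
  | cons b l ih =>
    by_cases h : a = b
    · subst h
      rw [List.destutter'_cons_neg _ (by simp), ih]
      simp [changes]
    · rw [List.destutter'_cons_pos _ h, List.length_cons, ih]
      simp [changes, h]; omega

theorem numRuns_eq {l : List α} (h : l ≠ []) : numRuns l = changes l + 1 := by
  obtain ⟨a, l, rfl⟩ := List.exists_cons_of_ne_nil h
  exact length_destutter' a l

theorem changes_append {l₁ l₂ : List α} (h₁ : l₁ ≠ []) (h₂ : l₂ ≠ []) :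
    changes (l₁ ++ l₂) + (if l₁.getLast? = l₂.head? then 1 else 0) =
      changes l₁ + changes l₂ + 1 := by
  induction l₁ with
  | nil => exact absurd rfl h₁
  | cons a l ih =>
    cases l with
    | nil =>
      obtain ⟨b, l₂, rfl⟩ := List.exists_cons_of_ne_nil h₂
      simp only [List.cons_append, List.nil_append, changes, List.getLast?_singleton,
        List.head?_cons, Option.some.injEq]
      split_ifs <;> omega
    | cons b l =>
      have := ih (by simp)
      simp only [List.cons_append, changes, List.getLast?_cons_cons] at this ⊢
      omega

theorem card_toFinset_le_changes {l : List α} (h : l ≠ []) :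
    l.toFinset.card ≤ changes l + 1 := by
  induction l with
  | nil => exact absurd rfl h
  | cons a l ih =>
    cases l with
    | nil => simp [changes]
    | cons b l =>
      have := ih (by simp)
      simp only [changes]
      by_cases hab : a = b
      · subst hab
        simp only [List.toFinset_cons, insert_idem] at this ⊢
        simpa using this
      · rw [List.toFinset_cons, if_neg hab]
        have := card_insert_le a (b :: l).toFinset
        omega

/-- The symbol at both ends is interrupted by another one, so it accounts for at least two runs. -/
theorem card_toFinset_le_changes_of_head_eq {l : List α} (h : 2 ≤ l.toFinset.card)
    (h' : l.head? = l.getLast?) : l.toFinset.card ≤ changes l := by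
  induction l with
  | nil => simp at h
  | cons a l ih =>
    cases l with
    | nil => simp at h
    | cons b l =>
      rw [List.getLast?_cons_cons] at h'
      have ha : a ∈ b :: l := List.mem_of_getLast? h'.symm
      have e : (a :: b :: l).toFinset = (b :: l).toFinset := by
        rw [List.toFinset_cons, insert_eq_self, List.mem_toFinset]; exact ha
      rw [e] at h ⊢
      simp only [changes]
      by_cases hab : a = b
      · subst hab
        simpa using ih h h'
      · have := card_toFinset_le_changes (l := b :: l) (by simp)
        rw [if_neg hab]; omega

/-- The hypothesis says that equal symbols are contiguous, so every symbol has only one run. -/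
theorem changes_lt_card_toFinset {l : List α} (hl : l ≠ [])
    (h : ∀ a b c, [a, b, c].Sublist l → a = c → a = b) : changes l + 1 ≤ l.toFinset.card := by
  induction l with
  | nil => exact absurd rfl hl
  | cons a l ih =>
    cases l with
    | nil => simp [changes]
    | cons b l =>
      have := ih (by simp) fun x y z hs => h x y z (hs.cons a)
      simp only [changes]
      by_cases hab : a = b
      · subst hab
        simp only [List.toFinset_cons, insert_idem] at this ⊢
        simpa using this
      · have ha : a ∉ b :: l := by
          intro ha
          have : a ∈ l := by simpa [hab] using ha
          exact hab (h a b a (by simpa using this) rfl)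
        rw [if_neg hab, List.toFinset_cons, card_insert_of_notMem (by simpa using ha)]
        omega

theorem insert_Icc_one_succ {k : ℕ} : insert (k + 1) (Icc 1 k) = Icc 1 (k + 1) := by
  ext x; simp; omega

/-- Runs add up over the blocks, except that equal symbols on the two sides of a boundary join two
runs into one. Boundary `k` separates the blocks `k` and `k + 1`. -/
theorem changes_flatMap {K : ℕ} (ℓ : ℕ → List α) (hℓ : ∀ k ∈ Icc 1 (K + 1), ℓ k ≠ []) :
    changes ((List.range (K + 1)).flatMap fun k => ℓ (k + 1)) + 1 +
      #{k ∈ Icc 1 K | (ℓ k).getLast? = (ℓ (k + 1)).head?} =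
      ∑ k ∈ Icc 1 (K + 1), (changes (ℓ k) + 1) := by
  induction K with
  | zero => simp
  | succ K ih =>
    have ih := ih fun k hk => hℓ k (by simp at hk ⊢; omega)
    have hK : ℓ (K + 1) ≠ [] := hℓ _ (by simp)
    have e : (List.range (K + 1)).flatMap (fun k => ℓ (k + 1)) =
        (List.range K).flatMap (fun k => ℓ (k + 1)) ++ ℓ (K + 1) := by
      rw [List.range_succ, List.flatMap_append, List.flatMap_singleton]
    have h₁ := changes_append (l₁ := (List.range (K + 1)).flatMap fun k => ℓ (k + 1))
      (l₂ := ℓ (K + 1 + 1)) (by rw [e]; simp [hK]) (hℓ _ (by simp))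
    have e' : ((List.range (K + 1)).flatMap fun k => ℓ (k + 1)).getLast? =
        (ℓ (K + 1)).getLast? := by
      rw [e, List.getLast?_append, List.getLast?_eq_some_getLast hK]; rfl
    rw [e'] at h₁
    rw [List.range_succ, List.flatMap_append, List.flatMap_singleton,
      sum_Icc_succ_top (by omega), ← ih, ← insert_Icc_one_succ,
      filter_insert]
    split_ifs with h
    · rw [card_insert_of_notMem (by simp)]
      simp only [h, if_true] at h₁
      omega
    · simp only [h, if_false] at h₁
      omega

end Changes

/-! ### Choosing the symbols at which consecutive blocks merge -/

/-- Of the symbols `c` shared by the blocks `k` and `k + 1`, at most two candidates `a₁ k` and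
`a₂ k` are kept; a symbol is ruled out if the block `k` contains several symbols and `c` is the only
candidate between the blocks `k - 1` and `k`. -/
structure Greedy (K : ℕ) (Sh : ℕ → ℕ → Prop) (Mu : ℕ → Prop) (a₁ a₂ : ℕ → ℕ) : Prop where
  zero : a₁ 0 = 0
  fst : ∀ k ∈ Icc 1 K, a₁ k ≠ 0 → Sh k (a₁ k) ∧
    (Mu k → a₁ (k - 1) = a₁ k → a₂ (k - 1) ≠ 0)
  snd : ∀ k ∈ Icc 1 K, a₂ k ≠ 0 → a₁ k ≠ 0 ∧ a₂ k ≠ a₁ k ∧ Sh k (a₂ k) ∧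
    (Mu k → a₁ (k - 1) = a₂ k → a₂ (k - 1) ≠ 0)
  full : ∀ k ∈ Icc 1 K, ∀ c, Sh k c → (Mu k → a₁ (k - 1) = c → a₂ (k - 1) ≠ 0) →
    a₂ k ≠ 0 ∨ a₁ k = c

/-! ### The candidates bound the number of merges and can all be used -/

section Greedy

variable {K : ℕ} {Sh : ℕ → ℕ → Prop} {Mu : ℕ → Prop} {a₁ a₂ : ℕ → ℕ}

/-- `fst` and `lst` are the outer symbols of the blocks of an arbitrary arrangement, `mg` its merges
and `e` the surplus runs in its blocks. A merge can beat the greedy choice only with a ruled-out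
symbol, that is, the unique candidate of the previous boundary. Either the arrangement has already
fallen behind by one, or by the second claim of the induction the block begins with that symbol as
well; then it begins and ends with the same symbol, and its surplus run pays for the merge. -/
theorem Greedy.card_le (h : Greedy K Sh Mu a₁ a₂) (hSh : ∀ k c, Sh k c → c ≠ 0)
    {fst lst e : ℕ → ℕ} {mg : ℕ → Prop} [DecidablePred mg]
    (hmg : ∀ k ∈ Icc 1 K, mg k → Sh k (lst k) ∧ fst (k + 1) = lst k)
    (he : ∀ k ∈ Icc 1 K, Mu k → fst k = lst k → lst k ≠ 0 → 1 ≤ e k) (k : ℕ) (hk : k ≤ K) :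
    #{j ∈ Icc 1 k | mg j} ≤ #{j ∈ Icc 1 k | a₁ j ≠ 0} + ∑ j ∈ Icc 1 k, e j ∧
    (#{j ∈ Icc 1 k | mg j} = #{j ∈ Icc 1 k | a₁ j ≠ 0} + ∑ j ∈ Icc 1 k, e j → a₁ k ≠ 0 →
      a₂ k ≠ 0 ∨ fst (k + 1) = a₁ k) := by
  induction k with
  | zero => simp [h.zero]
  | succ k ih =>
    obtain ⟨ih₁, ih₂⟩ := ih (by omega)
    have hk' : k + 1 ∈ Icc 1 K := by simp; omega
    have c₁ : ∀ (P : ℕ → Prop) [DecidablePred P], #{j ∈ Icc 1 (k + 1) | P j} =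
        #{j ∈ Icc 1 k | P j} + if P (k + 1) then 1 else 0 := by
      intro P _
      rw [← insert_Icc_one_succ, filter_insert]
      split_ifs
      · rw [card_insert_of_notMem (by simp)]
      · rfl
    rw [c₁, c₁, sum_Icc_succ_top (by omega)]
    by_cases hm : mg (k + 1)
    · obtain ⟨hs, hf⟩ := hmg _ hk' hm
      by_cases hall : Mu (k + 1) → a₁ k = lst (k + 1) → a₂ k ≠ 0
      · have h₁ := h.full _ hk' _ hs hall
        have ha : a₁ (k + 1) ≠ 0 := by
          rcases h₁ with h₁ | h₁
          · exact (h.snd _ hk' h₁).1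
          · rw [h₁]; exact hSh _ _ hs
        rw [if_pos hm, if_pos ha]
        refine ⟨by omega, fun _ _ => ?_⟩
        rw [hf]
        exact h₁.imp_right Eq.symm
      -- The merging symbol is ruled out: the block has several symbols, and this one is the only
      -- candidate of the boundary before it.
      · push Not at hall
        obtain ⟨hMu, hal, ha₂⟩ := hall
        have hl := hSh _ _ hs
        by_cases heq : #{j ∈ Icc 1 k | mg j} = #{j ∈ Icc 1 k | a₁ j ≠ 0} + ∑ j ∈ Icc 1 k, e j
        · have := ih₂ heq (by rw [hal]; exact hl)
          have hfk : fst (k + 1) = a₁ k := this.resolve_left (by simp [ha₂])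
          have := he _ hk' hMu (by rw [hfk, hal]) hl
          rw [if_pos hm]
          split_ifs
          · omega
          · omega
        · rw [if_pos hm]
          split_ifs
          · omega
          · omega
    · rw [if_neg hm]
      split_ifs
      · omega
      · omega

/-- The choice among the candidates. -/
structure Choice (K : ℕ) (Mu : ℕ → Prop) (a₁ a₂ ch : ℕ → ℕ) : Prop where
  last : ch (K + 1) = 0
  step : ∀ k ∈ Icc 1 K, ch k = a₁ k ∧ ¬ (a₁ k ≠ 0 ∧ Mu (k + 1) ∧ ch (k + 1) = a₁ k) ∨
    ch k = a₂ k ∧ a₁ k ≠ 0 ∧ Mu (k + 1) ∧ ch (k + 1) = a₁ k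

/-- The second candidate is taken only if the first one is also chosen for the next boundary, across
a block with several symbols. Since that symbol was admitted there, it was not the only candidate
here, so a second one exists and differs from it. -/
theorem Choice.spec {ch : ℕ → ℕ} (hc : Choice K Mu a₁ a₂ ch) (h : Greedy K Sh Mu a₁ a₂) {k : ℕ}
    (hk : k ∈ Icc 1 K) : (ch k ≠ 0 ↔ a₁ k ≠ 0) ∧ (ch k ≠ 0 → Sh k (ch k)) ∧
      (ch k ≠ 0 → Mu (k + 1) → ch k ≠ ch (k + 1)) := by
  have hk' := mem_Icc.1 hk
  rcases hc.step k hk with ⟨h₁, h₂⟩ | ⟨h₁, h₂, h₃, h₄⟩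
  · rw [h₁]
    refine ⟨Iff.rfl, fun h₀ => (h.fst k hk h₀).1, fun h₀ hMu heq => h₂ ⟨h₀, hMu, heq.symm⟩⟩
  · have hK : k + 1 ∈ Icc 1 K := by
      rcases Nat.lt_or_ge k K with h' | h'
      · simp; omega
      · have : k = K := by omega
        rw [this, hc.last] at h₄
        exact absurd (this ▸ h₄.symm) h₂
    have ha₂ : a₂ k ≠ 0 := by
      have hne : ch (k + 1) ≠ 0 := by rw [h₄]; exact h₂
      rcases hc.step _ hK with ⟨h₅, -⟩ | ⟨h₅, -⟩
      · exact (h.fst _ hK (h₅ ▸ hne)).2 h₃ (by rw [← h₅, h₄]; rfl)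
      · exact (h.snd _ hK (h₅ ▸ hne)).2.2.2 h₃ (by rw [← h₅, h₄]; rfl)
    rw [h₁]
    refine ⟨by simp [ha₂, h₂], fun _ => (h.snd k hk ha₂).2.2.1, fun _ _ heq => ?_⟩
    exact (h.snd k hk ha₂).2.1 (heq.trans h₄)

end Greedy

end CAO

/-! ### The number of runs of an arrangement of blocks -/

namespace CAO

open Finset

/-- The positions `1, …, M` carry symbols `sy`, and are divided into the blocks `1, …, K + 1`. The
number `PC p` identifies the symbol of the position `p` if it is not `0`, and otherwise the symbol
occurs only once. -/
structure Blocks {α : Type} (M K : ℕ) (sy : ℕ → α) (PC B : ℕ → ℕ) : Prop where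
  sy_iff : ∀ p ∈ Icc 1 M, ∀ q ∈ Icc 1 M, sy p = sy q ↔ p = q ∨ PC p = PC q ∧ PC p ≠ 0
  mem : ∀ p ∈ Icc 1 M, B p ∈ Icc 1 (K + 1)
  surj : ∀ k ∈ Icc 1 (K + 1), ∃ p ∈ Icc 1 M, B p = k

/-- The symbol `c` occurs in the blocks `k` and `k + 1`. -/
def Shared (M : ℕ) (PC B : ℕ → ℕ) (k c : ℕ) : Prop :=
  c ≠ 0 ∧ (∃ p ∈ Icc 1 M, B p = k ∧ PC p = c) ∧ ∃ p ∈ Icc 1 M, B p = k + 1 ∧ PC p = c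

/-- The block `k` contains several symbols. -/
def Multi {α : Type} (M : ℕ) (sy : ℕ → α) (B : ℕ → ℕ) (k : ℕ) : Prop :=
  ∃ p ∈ Icc 1 M, ∃ q ∈ Icc 1 M, B p = k ∧ B q = k ∧ sy p ≠ sy q

/-- Lists of the positions of the blocks. -/
structure Listing (M K : ℕ) (B : ℕ → ℕ) (blk : ℕ → List ℕ) : Prop where
  mem_iff : ∀ k ∈ Icc 1 (K + 1), ∀ p, p ∈ blk k ↔ p ∈ Icc 1 M ∧ B p = k
  nodup : ∀ k ∈ Icc 1 (K + 1), (blk k).Nodup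

section Blocks

variable {α : Type} {M K : ℕ} {sy : ℕ → α} {PC B : ℕ → ℕ} {blk : ℕ → List ℕ}
  {a₁ a₂ ch : ℕ → ℕ}

theorem Listing.ne_nil (hl : Listing M K B blk) (hb : Blocks M K sy PC B) {k : ℕ}
    (hk : k ∈ Icc 1 (K + 1)) : blk k ≠ [] := by
  obtain ⟨p, hp, hpk⟩ := hb.surj k hk
  exact List.ne_nil_of_mem ((hl.mem_iff k hk p).2 ⟨hp, hpk⟩)

theorem Listing.exists_head_getLast (hl : Listing M K B blk) (hb : Blocks M K sy PC B) {k : ℕ}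
    (hk : k ∈ Icc 1 (K + 1)) : ∃ p ∈ Icc 1 M, ∃ q ∈ Icc 1 M, B p = k ∧ B q = k ∧
      (blk k).head? = some p ∧ (blk k).getLast? = some q := by
  have hne := hl.ne_nil hb hk
  have h₁ := (hl.mem_iff k hk _).1 (List.head_mem hne)
  have h₂ := (hl.mem_iff k hk _).1 (List.getLast_mem hne)
  exact ⟨_, h₁.1, _, h₂.1, h₁.2, h₂.2, List.head?_eq_some_head hne,
    List.getLast?_eq_some_getLast hne⟩

variable [DecidableEq α]

theorem Listing.toFinset_map (hl : Listing M K B blk) {k : ℕ} (hk : k ∈ Icc 1 (K + 1)) :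
    ((blk k).map sy).toFinset = {p ∈ Icc 1 M | B p = k}.image sy := by
  ext a
  simp only [List.mem_toFinset, List.mem_map, mem_image, mem_filter, hl.mem_iff k hk]

/-- The lower bound for every arrangement: `Greedy.card_le` is applied with the surplus of the runs
of a block over its distinct symbols. -/
theorem Blocks.le_changes (hb : Blocks M K sy PC B) (hl : Listing M K B blk)
    (hg : Greedy K (Shared M PC B) (Multi M sy B) a₁ a₂) :
    ∑ k ∈ Icc 1 (K + 1), #({p ∈ Icc 1 M | B p = k}.image sy) ≤
      changes ((List.range (K + 1)).flatMap fun k => (blk (k + 1)).map sy) + 1 +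
        #{k ∈ Icc 1 K | a₁ k ≠ 0} := by
  have hne : ∀ k ∈ Icc 1 (K + 1), (blk k).map sy ≠ [] := fun k hk => by
    simpa using hl.ne_nil hb hk
  choose! f hf l hlm hfB hlB hfh hll using fun k hk => hl.exists_head_getLast hb (k := k) hk
  have hsum := changes_flatMap (fun k => (blk k).map sy) hne
  have hle : ∀ k ∈ Icc 1 (K + 1), #({p ∈ Icc 1 M | B p = k}.image sy) ≤
      changes ((blk k).map sy) + 1 := fun k hk => by
    rw [← hl.toFinset_map hk]; exact card_toFinset_le_changes (hne k hk)
  have hmerge : ∀ k ∈ Icc 1 K,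
      (((blk k).map sy).getLast? = ((blk (k + 1)).map sy).head? ↔ sy (l k) = sy (f (k + 1))) := by
    intro k hk
    have hk' := mem_Icc.1 hk
    rw [List.getLast?_map, List.head?_map, hll k (by simp; omega), hfh (k + 1) (by simp; omega)]
    simp
  rw [filter_congr hmerge] at hsum
  have key := (hg.card_le (fun k c h => h.1) (fst := fun k => PC (f k)) (lst := fun k => PC (l k))
    (mg := fun k => sy (l k) = sy (f (k + 1)))
    (e := fun k => changes ((blk k).map sy) + 1 - #({p ∈ Icc 1 M | B p = k}.image sy))
    (by
      intro k hk h
      have hk' := mem_Icc.1 hk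
      have m₁ : k ∈ Icc 1 (K + 1) := by simp; omega
      have m₂ : k + 1 ∈ Icc 1 (K + 1) := by simp; omega
      rcases (hb.sy_iff _ (hlm k m₁) _ (hf _ m₂)).1 h with h | ⟨h, h₀⟩
      · have := hlB k m₁
        rw [h, hfB _ m₂] at this
        omega
      · exact ⟨⟨h₀, ⟨_, hlm k m₁, hlB k m₁, rfl⟩, ⟨_, hf _ m₂, hfB _ m₂, h.symm⟩⟩, h.symm⟩)
    (by
      rintro k hk ⟨p, hp, q, hq, hpk, hqk, hpq⟩ h h₀
      have hk' := mem_Icc.1 hk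
      have m₁ : k ∈ Icc 1 (K + 1) := by simp; omega
      have := card_toFinset_le_changes_of_head_eq (l := (blk k).map sy) (by
        rw [hl.toFinset_map m₁]
        exact one_lt_card.2 ⟨sy p, mem_image_of_mem _ (by simp_all), sy q,
          mem_image_of_mem _ (by simp_all), hpq⟩) (by
        rw [List.getLast?_map, List.head?_map, hll k m₁, hfh k m₁]
        simp only [Option.map_some, Option.some.injEq]
        exact (hb.sy_iff _ (hf _ m₁) _ (hlm _ m₁)).2 (Or.inr ⟨h, by rw [h]; exact h₀⟩))
      rw [hl.toFinset_map m₁] at this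
      omega) K le_rfl).1
  have hsub : ∑ j ∈ Icc 1 K,
        (changes ((blk j).map sy) + 1 - #({p ∈ Icc 1 M | B p = j}.image sy)) ≤
      ∑ j ∈ Icc 1 (K + 1),
        (changes ((blk j).map sy) + 1 - #({p ∈ Icc 1 M | B p = j}.image sy)) :=
    sum_le_sum_of_subset (Icc_subset_Icc le_rfl (by omega))
  have hadd : ∑ j ∈ Icc 1 (K + 1), (changes ((blk j).map sy) + 1) =
      ∑ j ∈ Icc 1 (K + 1), (changes ((blk j).map sy) + 1 - #({p ∈ Icc 1 M | B p = j}.image sy)) +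
      ∑ j ∈ Icc 1 (K + 1), #({p ∈ Icc 1 M | B p = j}.image sy) := by
    rw [← sum_add_distrib]
    exact sum_congr rfl fun j hj => by have := hle j hj; omega
  omega

/-- An arrangement that attains the bound: in each block the symbol chosen for the preceding
boundary comes first, the one chosen for the following boundary comes last, and the others are
grouped between them. -/
theorem Blocks.changes_le (hb : Blocks M K sy PC B) (hl : Listing M K B blk)
    (hg : Greedy K (Shared M PC B) (Multi M sy B) a₁ a₂) (hch : Choice K (Multi M sy B) a₁ a₂ ch)
    (hch₀ : ch 0 = 0) {K₁ : ℕ → ℕ}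
    (hK₁ : ∀ p ∈ Icc 1 M, K₁ p = if PC p ≠ 0 ∧ PC p = ch (B p - 1) then 0
      else if PC p ≠ 0 ∧ PC p = ch (B p) then 2 else 1)
    (hs : ∀ k ∈ Icc 1 (K + 1),
      (blk k).Pairwise fun p q => K₁ p < K₁ q ∨ K₁ p = K₁ q ∧ PC p ≤ PC q) :
    changes ((List.range (K + 1)).flatMap fun k => (blk (k + 1)).map sy) + 1 +
        #{k ∈ Icc 1 K | a₁ k ≠ 0} ≤
      ∑ k ∈ Icc 1 (K + 1), #({p ∈ Icc 1 M | B p = k}.image sy) := by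
  have hne : ∀ k ∈ Icc 1 (K + 1), (blk k).map sy ≠ [] := fun k hk => by
    simpa using hl.ne_nil hb hk
  have hsum := changes_flatMap (fun k => (blk k).map sy) hne
  have hcard : #{k ∈ Icc 1 K | a₁ k ≠ 0} ≤
      #{k ∈ Icc 1 K | ((blk k).map sy).getLast? = ((blk (k + 1)).map sy).head?} := by
    refine card_le_card fun k hk => ?_
    obtain ⟨hk, ha⟩ := mem_filter.1 hk
    have hk' := mem_Icc.1 hk
    have m₁ : k ∈ Icc 1 (K + 1) := by simp; omega
    have m₂ : k + 1 ∈ Icc 1 (K + 1) := by simp; omega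
    obtain ⟨-, -, l, hlm, -, hlB, -, hll⟩ := hl.exists_head_getLast hb m₁
    obtain ⟨f, hf, -, -, hfB, -, hfh, -⟩ := hl.exists_head_getLast hb m₂
    obtain ⟨h₁, h₂, h₃⟩ := hch.spec hg hk
    have hc := h₁.2 ha
    obtain ⟨-, ⟨p, hp, hpB, hpc⟩, q, hq, hqB, hqc⟩ := h₂ hc
    refine mem_filter.2 ⟨hk, ?_⟩
    rw [List.getLast?_map, List.head?_map, hll, hfh]
    simp only [Option.map_some, Option.some.injEq]
    have hfc : PC f = ch k := by
      have hq' : K₁ q = 0 := by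
        rw [hK₁ q hq, hqB, if_pos ⟨by rw [hqc]; exact hc, by simpa using hqc⟩]
      obtain ⟨t, ht⟩ := List.head?_eq_some_iff.1 hfh
      have hqm := (hl.mem_iff _ m₂ q).2 ⟨hq, hqB⟩
      rw [ht] at hqm
      rcases List.mem_cons.1 hqm with rfl | hqm
      · exact hqc
      · have := hs _ m₂
        rw [ht, List.pairwise_cons] at this
        have hf₀ : K₁ f = 0 := by have := this.1 q hqm; omega
        rw [hK₁ f hf, hfB] at hf₀
        split_ifs at hf₀ with h
        simpa using h.2
    have hlc : PC l = ch k := by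
      by_cases hMu : Multi M sy B k
      · have hp' : K₁ p = 2 := by
          rw [hK₁ p hp, hpB, if_neg, if_pos ⟨by rw [hpc]; exact hc, hpc⟩]
          -- In a block with several symbols, the choices for its two boundaries differ, so `p` asks
          -- for the end and not for the beginning. For the first block this uses the default value
          -- `ch 0 = 0`.
          rintro ⟨-, h⟩
          rw [hpc] at h
          by_cases hk1 : k = 1
          · subst hk1; exact hc (h.trans hch₀)
          · have hk'' : k - 1 ∈ Icc 1 K := by simp; omega
            refine (hch.spec hg hk'').2.2 (h ▸ hc) ?_ ?_
            · rwa [Nat.sub_add_cancel hk'.1]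
            · rw [Nat.sub_add_cancel hk'.1, h]
        have hle : 2 ≤ K₁ l := by
          obtain ⟨t, ht⟩ := List.getLast?_eq_some_iff.1 hll
          have hpm := (hl.mem_iff _ m₁ p).2 ⟨hp, hpB⟩
          rw [ht] at hpm
          rcases List.mem_append.1 hpm with hpm | hpm
          · have := hs _ m₁
            rw [ht, List.pairwise_append] at this
            have := this.2.2 p hpm l (by simp)
            omega
          · rw [← List.mem_singleton.1 hpm, hp']
        rw [hK₁ l hlm, hlB] at hle
        split_ifs at hle with h h'
        · omega
        · exact h'.2
        · omega
      · have : sy p = sy l := by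
          by_contra h
          exact hMu ⟨p, hp, l, hlm, hpB, hlB, h⟩
        rcases (hb.sy_iff _ hp _ hlm).1 this with rfl | ⟨h, -⟩
        · exact hpc
        · rw [← h, hpc]
    exact (hb.sy_iff _ hlm _ hf).2 (Or.inr ⟨by rw [hlc, hfc], by rw [hlc]; exact hc⟩)
  have hle : ∑ k ∈ Icc 1 (K + 1), (changes ((blk k).map sy) + 1) ≤
      ∑ k ∈ Icc 1 (K + 1), #({p ∈ Icc 1 M | B p = k}.image sy) := by
    refine sum_le_sum fun k hk => ?_
    rw [← hl.toFinset_map hk]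
    refine changes_lt_card_toFinset (hne k hk) fun a b c habc hac => ?_
    obtain ⟨l', hl', he⟩ := List.sublist_map_iff.1 habc
    match l', he with
    | [p, q, r], he =>
      simp only [List.map_cons, List.map_nil, List.cons.injEq, and_true] at he
      obtain ⟨rfl, rfl, rfl⟩ := he
      have hm : ∀ x ∈ [p, q, r], x ∈ Icc 1 M ∧ B x = k := fun x hx =>
        (hl.mem_iff k hk x).1 (hl'.subset hx)
      have hp := hm p (by simp)
      have hq := hm q (by simp)
      have hr := hm r (by simp)
      have hnd := (hl.nodup k hk).sublist hl'
      have hpw := (hs k hk).sublist hl'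
      simp only [List.pairwise_cons, List.mem_cons, List.not_mem_nil, or_false, forall_eq_or_imp,
        forall_eq] at hpw
      simp only [List.nodup_cons, List.mem_cons, not_or] at hnd
      rcases (hb.sy_iff _ hp.1 _ hr.1).1 hac with h | ⟨h, h₀⟩
      · exact absurd h hnd.1.2.1
      -- Both sort keys of `q` are squeezed between equal values. Positions with `PC = 0` carry
      -- unique symbols, so their mutual order is irrelevant.
      · have e : K₁ p = K₁ r := by rw [hK₁ p hp.1, hK₁ r hr.1, hp.2, hr.2, h]
        exact (hb.sy_iff _ hp.1 _ hq.1).2 (Or.inr ⟨by omega, h₀⟩)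
  omega

end Blocks

end CAO

/-! ### The text -/

namespace CAO

open Finset

theorem getElem?_flatten {α : Type*} (L : List (List α)) {i j : ℕ} (hi : i < L.length)
    (hj : j < L[i].length) :
    L.flatten[((L.take i).map List.length).sum + j]? = some L[i][j] := by
  induction L generalizing i with
  | nil => simp at hi
  | cons l L ih =>
    cases i with
    | zero =>
      simp only [List.getElem_cons_zero] at hj
      simp [List.getElem?_append_left hj]
    | succ i =>
      simp only [List.getElem_cons_succ] at hj ⊢
      rw [List.take_succ_cons, List.map_cons, List.sum_cons, List.flatten_cons,
        List.getElem?_append_right (by omega), ← ih (by simpa using hi) hj]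
      congr 1
      omega

namespace Instance

variable (I : Instance)

/-- The length of the string number `i`. -/
def len (i : ℕ) : ℕ := (List.ofFn fun i => (I.T i).length).getD i 0

/-- The total length of the first `i` strings. -/
def start (i : ℕ) : ℕ := ∑ j ∈ range i, I.len j

theorem len_fin (i : Fin I.d) : I.len i = (I.T i).length := by simp [len]

theorem start_succ (i : ℕ) : I.start (i + 1) = I.start i + I.len i := sum_range_succ _ _

theorem start_d : I.start I.d = I.size := by
  rw [start, sum_range, size]
  exact sum_congr rfl fun i _ => I.len_fin i

theorem start_mono {i j : ℕ} (h : i < j) : I.start i + I.len i ≤ I.start j := by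
  rw [← start_succ]
  exact sum_le_sum_of_subset (range_mono h)

theorem sum_map_length_take {α : Type*} {n : ℕ} (f : Fin n → List α) (g : ℕ → ℕ)
    (hg : ∀ i, (f i).length = g i) {i : ℕ} (hi : i ≤ n) :
    (((List.ofFn f).take i).map List.length).sum = ∑ j ∈ range i, g j := by
  induction i with
  | zero => simp
  | succ i ih =>
    rw [List.take_add_one, List.map_append, List.sum_append, ih (by omega), sum_range_succ]
    simp [show i < n from hi, hg]

theorem getElem?_input (i : Fin I.d) {j : ℕ} (hj : j < (I.T i).length) :
    (List.ofFn I.T).flatten[I.start i + j]? = some (I.T i)[j] := by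
  have := getElem?_flatten (List.ofFn I.T) (i := i) (j := j) (by simp) (by simpa using hj)
  rw [sum_map_length_take _ I.len (fun i => (I.len_fin i).symm) i.2.le] at this
  simpa [start] using this

theorem getElem?_text (i : Fin I.d) {j : ℕ} (hj : j ≤ (I.T i).length) :
    I.text[I.start i + i + j]? =
      some (((I.T i).map Sum.inr ++ [Sum.inl i])[j]'(by simp; omega)) := by
  have := getElem?_flatten (List.ofFn fun i => (I.T i).map (Sum.inr (α := Fin I.d)) ++ [Sum.inl i])
    (i := i) (j := j) (by simp) (by simp; omega)
  rw [sum_map_length_take _ (fun i => I.len i + 1) (fun i => by simp [I.len_fin]) i.2.le,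
    sum_add_distrib] at this
  simpa [text, start] using this

theorem length_text : I.text.length = I.size + I.d := by
  simp [text, size, List.length_flatten, List.sum_ofFn, sum_add_distrib]

theorem exists_eq_start {x : ℕ} (hx : x ∈ Icc 1 (I.size + I.d)) :
    ∃ i : Fin I.d, ∃ j ≤ (I.T i).length, x = I.start i + i + j + 1 := by
  have key : ∀ n ≤ I.d, x ≤ I.start n + n → ∃ i < n, ∃ j ≤ I.len i, x = I.start i + i + j + 1 := by
    intro n
    induction n with
    | zero => intro _ h; simp [start] at h; simp at hx; omega
    | succ n ih =>
      intro hn h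
      by_cases h' : x ≤ I.start n + n
      · obtain ⟨i, hi, j, hj, e⟩ := ih (by omega) h'
        exact ⟨i, by omega, j, hj, e⟩
      · rw [start_succ] at h
        exact ⟨n, by omega, x - (I.start n + n + 1), by omega, by omega⟩
  obtain ⟨i, hi, j, hj, e⟩ := key I.d le_rfl (by rw [start_d]; exact (mem_Icc.1 hx).2)
  exact ⟨⟨i, hi⟩, j, by rw [← len_fin]; exact hj, e⟩

theorem start_inj {i j i' j' : ℕ} (hj : j ≤ I.len i) (hj' : j' ≤ I.len i')
    (h : I.start i + i + j = I.start i' + i' + j') : i = i' ∧ j = j' := by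
  rcases lt_trichotomy i i' with hi | hi | hi
  · have := I.start_mono hi; omega
  · subst hi; omega
  · have := I.start_mono hi; omega

theorem mem_of_le {i : Fin I.d} {j : ℕ} (hj : j ≤ (I.T i).length) :
    I.start i + i + j + 1 ∈ Icc 1 (I.size + I.d) := by
  have := I.start_mono i.2
  rw [I.start_d, I.len_fin] at this
  have := i.2
  simp; omega

end Instance

/-- The arrays describe the text: at position `x`, the code of the letter plus one or `0` for the
end of a string, the number of the string, the position in it, and the remaining length. -/
structure Layout (I : Instance) (CODE OWN POS REM : ℕ → ℕ) : Prop where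
  zero : CODE 0 = 0
  code : ∀ (i : Fin I.d) (j : ℕ) (hj : j < (I.T i).length),
    CODE (I.start i + i + j + 1) = (I.T i)[j] + 1
  code_end : ∀ i : Fin I.d, CODE (I.start i + i + (I.T i).length + 1) = 0
  info : ∀ (i : Fin I.d), ∀ j ≤ (I.T i).length, OWN (I.start i + i + j + 1) = i ∧
    POS (I.start i + i + j + 1) = j ∧ REM (I.start i + i + j + 1) = (I.T i).length - j

namespace Layout

variable {I : Instance} {CODE OWN POS REM : ℕ → ℕ} (h : Layout I CODE OWN POS REM)

include h

theorem getElem?_letter {x : ℕ} (hx : x ∈ Icc 1 (I.size + I.d)) (h₀ : CODE x ≠ 0) :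
    ∃ c : Fin I.σ, I.text[x - 1]? = some (Sum.inr c) ∧ CODE x = c + 1 := by
  obtain ⟨i, j, hj, rfl⟩ := I.exists_eq_start hx
  have hj' : j < (I.T i).length := lt_of_le_of_ne hj fun e => h₀ (by rw [e]; exact h.code_end i)
  refine ⟨(I.T i)[j], ?_, h.code i j hj'⟩
  rw [Nat.add_sub_cancel, I.getElem?_text i hj, List.getElem_append_left (by simpa using hj')]
  simp

theorem getElem?_end {x : ℕ} (hx : x ∈ Icc 1 (I.size + I.d)) (h₀ : CODE x = 0) :
    ∃ i : Fin I.d, I.text[x - 1]? = some (Sum.inl i) ∧ OWN x = i := by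
  obtain ⟨i, j, hj, rfl⟩ := I.exists_eq_start hx
  have hj' : j = (I.T i).length := by
    by_contra hne
    rw [h.code i j (by omega)] at h₀
    omega
  subst hj'
  refine ⟨i, ?_, (h.info i _ le_rfl).1⟩
  rw [Nat.add_sub_cancel, I.getElem?_text i hj, List.getElem_append_right (by simp)]
  simp

theorem next {x : ℕ} (hx : x ∈ Icc 1 (I.size + I.d)) (h₀ : CODE x ≠ 0) :
    x + 1 ∈ Icc 1 (I.size + I.d) ∧ OWN (x + 1) = OWN x ∧ POS (x + 1) = POS x + 1 ∧
      REM x = REM (x + 1) + 1 := by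
  obtain ⟨i, j, hj, rfl⟩ := I.exists_eq_start hx
  have hj' : j + 1 ≤ (I.T i).length :=
    lt_of_le_of_ne hj fun e => h₀ (by rw [e]; exact h.code_end i)
  have h₁ := h.info i j hj
  have h₂ := h.info i (j + 1) hj'
  refine ⟨I.mem_of_le hj', ?_, ?_, ?_⟩
  · rw [h₁.1]; exact h₂.1
  · rw [h₁.2.1]; exact h₂.2.1
  · rw [h₁.2.2, show REM (I.start i + i + j + 1 + 1) = _ from h₂.2.2]; omega

theorem rem_eq_zero_iff {x : ℕ} (hx : x ∈ Icc 1 (I.size + I.d)) : REM x = 0 ↔ CODE x = 0 := by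
  obtain ⟨i, j, hj, rfl⟩ := I.exists_eq_start hx
  rw [(h.info i j hj).2.2]
  rcases hj.lt_or_eq with hj' | rfl
  · rw [h.code i j hj']; omega
  · simp [h.code_end]

theorem pred {x : ℕ} (hx : x ∈ Icc 1 (I.size + I.d)) (h₀ : POS x ≠ 0) :
    x - 1 ∈ Icc 1 (I.size + I.d) ∧ CODE (x - 1) ≠ 0 := by
  obtain ⟨i, j, hj, rfl⟩ := I.exists_eq_start hx
  rw [(h.info i j hj).2.1] at h₀
  obtain ⟨j, rfl⟩ := Nat.exists_eq_succ_of_ne_zero h₀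
  have := h.code i j hj
  refine ⟨I.mem_of_le (i := i) (j := j) (by omega), ?_⟩
  change CODE (I.start i + i + j + 1) ≠ 0
  rw [this]; omega

/-- A position is determined by its string and its distance to the end. So a block, where these
distances agree, meets each string at most once. -/
theorem own_inj {x y : ℕ} (hx : x ∈ Icc 1 (I.size + I.d)) (hy : y ∈ Icc 1 (I.size + I.d))
    (hr : REM x = REM y) (ho : OWN x = OWN y) : x = y := by
  obtain ⟨i, j, hj, rfl⟩ := I.exists_eq_start hx
  obtain ⟨i', j', hj', rfl⟩ := I.exists_eq_start hy
  rw [(h.info i j hj).1, (h.info i' j' hj').1] at ho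
  obtain rfl := Fin.ext ho
  rw [(h.info i j hj).2.2, (h.info i j' hj').2.2] at hr
  omega

theorem exists_own (i : Fin I.d) : ∃ x ∈ Icc 1 (I.size + I.d), CODE x = 0 ∧ OWN x = i :=
  ⟨_, I.mem_of_le le_rfl, h.code_end i, (h.info i _ le_rfl).1⟩

theorem own_lt {x : ℕ} (hx : x ∈ Icc 1 (I.size + I.d)) : OWN x < I.d := by
  obtain ⟨i, j, hj, rfl⟩ := I.exists_eq_start hx
  rw [(h.info i j hj).1]
  exact i.2

theorem code_le {x : ℕ} (hx : x ∈ Icc 1 (I.size + I.d)) : CODE x ≤ I.σ := by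
  by_cases h₀ : CODE x = 0
  · omega
  · obtain ⟨c, -, hc⟩ := h.getElem?_letter hx h₀
    have := c.2
    omega

/-- The text ends with a special symbol, so the fictitious position 0 has the same code as the last
position, which is the cyclic predecessor of position 1. -/
theorem code_last : CODE (I.size + I.d) = 0 := by
  by_contra h₀
  have := (h.next (by have := I.d_pos; simp; omega) h₀).1
  simp at this

/-- Following the text from a position to the end of the string. -/
theorem add_mem {x k : ℕ} (hx : x ∈ Icc 1 (I.size + I.d)) (hk : k ≤ REM x) :
    x + k ∈ Icc 1 (I.size + I.d) ∧ OWN (x + k) = OWN x ∧ REM x = REM (x + k) + k := by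
  induction k with
  | zero => exact ⟨hx, rfl, rfl⟩
  | succ k ih =>
    obtain ⟨h₁, h₂, h₃⟩ := ih (by omega)
    obtain ⟨h₄, h₅, -, h₆⟩ := h.next h₁ fun h₀ => by
      have := (h.rem_eq_zero_iff h₁).2 h₀; omega
    exact ⟨h₄, by rw [← h₂, ← h₅, add_assoc], by rw [h₃, h₆, add_assoc x]; omega⟩

end Layout

end CAO

/-! ### The order of the rotations -/

namespace CAO

open Finset

theorem lt_of_getElem? {l₁ l₂ : List ℕ} {k a b : ℕ} (h : ∀ j < k, l₁[j]? = l₂[j]?)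
    (h₁ : l₁[k]? = some a) (h₂ : l₂[k]? = some b) (hab : a < b) : l₁ < l₂ := by
  induction k generalizing l₁ l₂ with
  | zero =>
    cases l₁ <;> cases l₂ <;> simp at h₁ h₂
    subst h₁ h₂
    exact List.cons_lt_cons_iff.2 (Or.inl hab)
  | succ k ih =>
    cases l₁ <;> cases l₂ <;> simp at h₁ h₂
    have h₀ := h 0 (by omega)
    simp only [List.getElem?_cons_zero, Option.some.injEq] at h₀
    refine List.cons_lt_cons_iff.2 (Or.inr ⟨h₀, ih (fun j hj => ?_) h₁ h₂⟩)
    simpa using h (j + 1) (by omega)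

/-- The successor of a position in its string, and `0` at the end of the string. -/
def fwd (CODE : ℕ → ℕ) (p : ℕ) : ℕ := if CODE p = 0 then 0 else p + 1

namespace Instance

variable (I : Instance)

/-- The last symbol of the rotation of the text that starts at position `p`. -/
def sy (p : ℕ) : I.Sym :=
  (I.text[(p - 1 + (I.size + I.d - 1)) % (I.size + I.d)]?).getD (Sum.inl ⟨0, I.d_pos⟩)

/-- The position that precedes `p` cyclically. -/
def prev (p : ℕ) : ℕ := if p = 1 then I.size + I.d else p - 1

variable {I}

theorem prev_mem {p : ℕ} (hp : p ∈ Icc 1 (I.size + I.d)) : I.prev p ∈ Icc 1 (I.size + I.d) := by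
  unfold prev
  have := I.d_pos
  simp at hp ⊢
  split_ifs <;> omega

theorem prev_inj {p q : ℕ} (hp : p ∈ Icc 1 (I.size + I.d)) (hq : q ∈ Icc 1 (I.size + I.d))
    (h : I.prev p = I.prev q) : p = q := by
  unfold prev at h
  simp at hp hq
  split_ifs at h <;> omega

theorem getElem?_prev {p : ℕ} (hp : p ∈ Icc 1 (I.size + I.d)) :
    I.text[I.prev p - 1]? = some (I.sy p) := by
  have e : (p - 1 + (I.size + I.d - 1)) % (I.size + I.d) = I.prev p - 1 := by
    unfold prev
    simp at hp
    split_ifs with h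
    · rw [h, Nat.mod_eq_of_lt (by omega)]; omega
    · rw [show p - 1 + (I.size + I.d - 1) = p - 1 - 1 + (I.size + I.d) by omega,
        Nat.add_mod_right, Nat.mod_eq_of_lt (by omega)]
  have hm := mem_Icc.1 (prev_mem hp)
  rw [sy, e, List.getElem?_eq_getElem (by rw [length_text]; omega)]
  rfl

theorem rank_injective (π : Equiv.Perm (Fin I.d)) : Function.Injective (I.rank π) := by
  rintro (i | c) (j | c') h
  · simp only [rank, Sum.elim_inl] at h
    rw [π.symm.injective (Fin.ext h)]
  · have := (π.symm i).2
    simp only [rank, Sum.elim_inl, Sum.elim_inr] at h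
    omega
  · have := (π.symm j).2
    simp only [rank, Sum.elim_inl, Sum.elim_inr] at h
    omega
  · simp only [rank, Sum.elim_inr] at h
    rw [Fin.ext (show (c : ℕ) = c' by omega)]

theorem getElem?_rotate_text {p j : ℕ} (hp : p ∈ Icc 1 (I.size + I.d))
    (hj : p + j ∈ Icc 1 (I.size + I.d)) : (I.text.rotate (p - 1))[j]? = I.text[p + j - 1]? := by
  simp at hp hj
  rw [List.getElem?_rotate (by rw [length_text]; omega), length_text,
    Nat.mod_eq_of_lt (by omega)]
  congr 1
  omega

/-- The Burrows-Wheeler transform read off any list of the positions in the order of the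
rotations. -/
theorem bwt_eq {rank : I.Sym → ℕ} (hrank : Function.Injective rank) {L : List ℕ} (hL : L.Nodup)
    (hmem : ∀ p, p ∈ L ↔ p ∈ Icc 1 (I.size + I.d))
    (hs : L.Pairwise fun p q =>
      (I.text.rotate (p - 1)).map rank < (I.text.rotate (q - 1)).map rank) :
    bwt rank I.text = L.map I.sy := by
  have hperm : ((List.range I.text.length).map I.text.rotate).Perm
      (L.map fun p => I.text.rotate (p - 1)) := by
    have : (List.range I.text.length).Perm (L.map fun p => p - 1) := by
      refine (List.perm_ext_iff_of_nodup List.nodup_range ?_).2 fun x => ?_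
      · refine List.Nodup.map_on (fun p hp q hq h => ?_) hL
        simp [hmem] at hp hq; omega
      · simp only [List.mem_range, length_text, List.mem_map, hmem, mem_Icc]
        constructor
        · intro hx; exact ⟨x + 1, by omega, by omega⟩
        · rintro ⟨p, hp, rfl⟩; omega
    simpa [List.map_map, Function.comp_def] using this.map I.text.rotate
  have hsort : ((List.range I.text.length).map I.text.rotate).mergeSort
      (fun x y => decide (x.map rank ≤ y.map rank)) =
      L.map fun p => I.text.rotate (p - 1) := by
    refine ((List.mergeSort_perm _ _).trans hperm).eq_of_pairwise
      (le := fun x y => x.map rank ≤ y.map rank) ?_ ?_ ?_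
    · intro x y _ _ h₁ h₂
      exact List.map_injective_iff.2 hrank (le_antisymm h₁ h₂)
    · have := List.pairwise_mergeSort (le := fun x y => decide (x.map rank ≤ y.map rank))
        (fun a b c h₁ h₂ => by simp only [decide_eq_true_eq] at *; exact h₁.trans h₂)
        (fun a b => by simpa using le_total _ _)
        ((List.range I.text.length).map I.text.rotate)
      simpa using this
    · exact List.pairwise_map.2 (hs.imp fun h => h.le)
  rw [bwt, hsort, List.filterMap_map]
  rw [← List.filterMap_eq_map]
  refine List.filterMap_congr fun p hp => ?_
  have hp := (hmem p).1 hp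
  have hp' := mem_Icc.1 hp
  simp only [Function.comp_apply]
  rw [List.getLast?_eq_getElem?, List.length_rotate, length_text,
    List.getElem?_rotate (by rw [length_text]; omega), length_text, ← getElem?_prev hp]
  congr 1
  unfold prev
  split_ifs with h
  · rw [h, Nat.mod_eq_of_lt (by omega)]; omega
  · rw [show I.size + I.d - 1 + (p - 1) = p - 1 - 1 + (I.size + I.d) by omega,
        Nat.add_mod_right, Nat.mod_eq_of_lt (by omega)]

end Instance

/-- `LR` orders the positions `1, …, M` as `CODE` does. -/
structure LetterRank (M : ℕ) (CODE LR : ℕ → ℕ) : Prop where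
  zero : LR 0 = 0
  mem : ∀ p ∈ Icc 1 M, LR p ∈ Icc 1 M
  lt_iff : ∀ p ∈ Icc 1 M, ∀ q ∈ Icc 1 M, LR p < LR q ↔ CODE p < CODE q

theorem LetterRank.eq_iff {M : ℕ} {CODE LR : ℕ → ℕ} (h : LetterRank M CODE LR) {p q : ℕ}
    (hp : p ∈ Icc 1 M) (hq : q ∈ Icc 1 M) : LR p = LR q ↔ CODE p = CODE q :=
  eq_iff_of_lt_iff (h.lt_iff p hp q hq) (h.lt_iff q hq p hp)

/-! ### From ranks of suffixes to the order of rotations and to the last column -/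

section Order

variable {I : Instance} {CODE OWN POS REM LR R : ℕ → ℕ}

theorem Layout.chain_fwd (h : Layout I CODE OWN POS REM)
    (hLR : LetterRank (I.size + I.d) CODE LR) : Chain (I.size + I.d) LR (fwd CODE) POS where
  T_zero := hLR.zero
  NX_zero := by simp [fwd, h.zero]
  T_mem := hLR.mem
  NX_le p hp := by
    unfold fwd
    split_ifs with h₀
    · omega
    · exact (mem_Icc.1 (h.next hp h₀).1).2
  pos_next p hp h₀ := by
    unfold fwd at h₀ ⊢
    split_ifs with h₁
    · simp [h₁] at h₀
    · exact (h.next hp h₁).2.2.1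
  pos_pred p hp h₀ := by
    obtain ⟨h₁, h₂⟩ := h.pred hp h₀
    have := mem_Icc.1 hp
    exact ⟨_, h₁, by rw [fwd, if_neg h₂]; omega⟩

theorem Layout.iterate_fwd (h : Layout I CODE OWN POS REM) {p : ℕ}
    (hp : p ∈ Icc 1 (I.size + I.d)) (k : ℕ) :
    (fwd CODE)^[k] p = if k ≤ REM p then p + k else 0 := by
  induction k with
  | zero => simp
  | succ k ih =>
    rw [Function.iterate_succ_apply', ih]
    by_cases hk : k ≤ REM p
    · obtain ⟨h₁, -, h₂⟩ := h.add_mem hp hk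
      have := h.rem_eq_zero_iff h₁
      rw [if_pos hk, fwd]
      split_ifs <;> omega
    · rw [if_neg hk, if_neg (by omega), fwd, if_pos h.zero]

/-- All ends of strings share one label; it is positive and differs from those of letters, while the
labels past the end are 0. So two sequences that agree up to the end of one string see the other
string end at the same time. -/
theorem Layout.rem_eq_of_forall (h : Layout I CODE OWN POS REM)
    (hLR : LetterRank (I.size + I.d) CODE LR) {p q k : ℕ} (hp : p ∈ Icc 1 (I.size + I.d))
    (hq : q ∈ Icc 1 (I.size + I.d)) (hk : REM p < k)
    (heq : ∀ j < k, LR ((fwd CODE)^[j] p) = LR ((fwd CODE)^[j] q)) : REM p = REM q := by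
  have h₁ := heq _ hk
  rw [h.iterate_fwd hp, h.iterate_fwd hq, if_pos le_rfl] at h₁
  obtain ⟨h₂, -, h₃⟩ := h.add_mem hp le_rfl
  split_ifs at h₁ with h₄
  · obtain ⟨h₅, -, h₆⟩ := h.add_mem hq h₄
    have h₇ := (hLR.eq_iff h₂ h₅).1 h₁
    have := h.rem_eq_zero_iff h₂
    have := h.rem_eq_zero_iff h₅
    omega
  · have := mem_Icc.1 (hLR.mem _ h₂)
    rw [hLR.zero] at h₁
    omega

theorem Layout.of_key_eq (h : Layout I CODE OWN POS REM)
    (hLR : LetterRank (I.size + I.d) CODE LR) {p q : ℕ} (hp : p ∈ Icc 1 (I.size + I.d))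
    (hq : q ∈ Icc 1 (I.size + I.d)) (heq : key LR (fwd CODE) p = key LR (fwd CODE) q) :
    REM p = REM q ∧ ∀ j ≤ REM p, CODE (p + j) = CODE (q + j) := by
  rw [key_eq_iff_forall] at heq
  have hr := h.rem_eq_of_forall hLR hp hq (Nat.lt_succ_self _) fun j _ => heq j
  refine ⟨hr, fun j hj => ?_⟩
  have := heq j
  rw [h.iterate_fwd hp, h.iterate_fwd hq, if_pos hj, if_pos (hr ▸ hj)] at this
  exact (hLR.eq_iff (h.add_mem hp hj).1 (h.add_mem hq (hr ▸ hj)).1).1 this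

/-- The first difference cannot lie beyond the end of either string, because the strings would then
have ended together and all later labels would be 0. -/
theorem Layout.of_key_lt (h : Layout I CODE OWN POS REM)
    (hLR : LetterRank (I.size + I.d) CODE LR) {p q : ℕ} (hp : p ∈ Icc 1 (I.size + I.d))
    (hq : q ∈ Icc 1 (I.size + I.d)) (hlt : key LR (fwd CODE) p < key LR (fwd CODE) q) :
    ∃ k ≤ REM p, k ≤ REM q ∧ (∀ j < k, CODE (p + j) = CODE (q + j)) ∧
      CODE (p + k) < CODE (q + k) := by
  obtain ⟨k, h₁, h₂⟩ := key_lt_iff_exists.1 hlt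
  have hkp : k ≤ REM p := by
    by_contra! hk
    have hr := h.rem_eq_of_forall hLR hp hq hk h₁
    rw [h.iterate_fwd hp, h.iterate_fwd hq, if_neg (by omega), if_neg (by omega)] at h₂
    omega
  have hkq : k ≤ REM q := by
    by_contra! hk
    have hr := h.rem_eq_of_forall hLR hq hp hk fun j hj => (h₁ j hj).symm
    omega
  rw [h.iterate_fwd hp, h.iterate_fwd hq, if_pos hkp, if_pos hkq,
    hLR.lt_iff _ (h.add_mem hp hkp).1 _ (h.add_mem hq hkq).1] at h₂
  refine ⟨k, hkp, hkq, fun j hj => ?_, h₂⟩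
  have := h₁ j hj
  rw [h.iterate_fwd hp, h.iterate_fwd hq, if_pos (by omega), if_pos (by omega)] at this
  exact (hLR.eq_iff (h.add_mem hp (by omega)).1 (h.add_mem hq (by omega)).1).1 this

/-- The number of the string that contains the position `p`, in the ordering `π`. -/
def stringRank (π : Equiv.Perm (Fin I.d)) (OWN : ℕ → ℕ) (p : ℕ) : ℕ :=
  if h : OWN p < I.d then (π.symm ⟨OWN p, h⟩ : ℕ) else 0

/-- The order of the rotations: first by the part up to the end of the string, then by the
string. -/
def Precedes (π : Equiv.Perm (Fin I.d)) (OWN R : ℕ → ℕ) (p q : ℕ) : Prop :=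
  R p < R q ∨ R p = R q ∧ stringRank π OWN p < stringRank π OWN q

theorem IsRank.lt_iff {n : ℕ} {T NX R : ℕ → ℕ} (h : IsRank n T NX R) {p q : ℕ}
    (hp : p ∈ Icc 1 n) (hq : q ∈ Icc 1 n) : R p < R q ↔ key T NX p < key T NX q := by
  rw [h.2 p hp, h.2 q hq, Nat.add_lt_add_iff_right, cnt_lt_iff hp trivial]

theorem IsRank.eq_iff {n : ℕ} {T NX R : ℕ → ℕ} (h : IsRank n T NX R) {p q : ℕ}
    (hp : p ∈ Icc 1 n) (hq : q ∈ Icc 1 n) : R p = R q ↔ key T NX p = key T NX q :=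
  eq_iff_of_lt_iff (h.lt_iff hp hq) (h.lt_iff hq hp)

theorem Layout.getElem?_eq_of_code (h : Layout I CODE OWN POS REM) {p q : ℕ}
    (hp : p ∈ Icc 1 (I.size + I.d)) (hq : q ∈ Icc 1 (I.size + I.d)) (heq : CODE p = CODE q)
    (h₀ : CODE p ≠ 0) : I.text[p - 1]? = I.text[q - 1]? := by
  obtain ⟨c, h₁, h₂⟩ := h.getElem?_letter hp h₀
  obtain ⟨c', h₃, h₄⟩ := h.getElem?_letter hq (heq ▸ h₀)
  rw [h₁, h₃, Fin.ext (show (c : ℕ) = c' by omega)]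

theorem Layout.rotate_lt (h : Layout I CODE OWN POS REM) (π : Equiv.Perm (Fin I.d)) {p q k : ℕ}
    (hp : p ∈ Icc 1 (I.size + I.d)) (hq : q ∈ Icc 1 (I.size + I.d)) (hkp : k ≤ REM p)
    (hkq : k ≤ REM q) (heq : ∀ j < k, CODE (p + j) = CODE (q + j)) {x y : I.Sym}
    (hx : I.text[p + k - 1]? = some x) (hy : I.text[q + k - 1]? = some y)
    (hxy : I.rank π x < I.rank π y) :
    (I.text.rotate (p - 1)).map (I.rank π) < (I.text.rotate (q - 1)).map (I.rank π) := by
  have get : ∀ {p}, p ∈ Icc 1 (I.size + I.d) → ∀ j ≤ REM p,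
      ((I.text.rotate (p - 1)).map (I.rank π))[j]? = (I.text[p + j - 1]?).map (I.rank π) :=
    fun {p} hp j hj => by
      rw [List.getElem?_map, Instance.getElem?_rotate_text hp (h.add_mem hp hj).1]
  refine lt_of_getElem? (k := k) (fun j hj => ?_) (by rw [get hp k hkp, hx]; rfl)
    (by rw [get hq k hkq, hy]; rfl) hxy
  obtain ⟨h₁, -, h₂⟩ := h.add_mem hp (show j ≤ REM p by omega)
  rw [get hp j (by omega), get hq j (by omega), h.getElem?_eq_of_code h₁
    (h.add_mem hq (by omega)).1 (heq j hj)]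
  have := h.rem_eq_zero_iff h₁
  omega

/-- If the suffixes differ, the decisive symbols are two letters or a special symbol against a
letter, and `π` does not matter. If they are equal, the two rotations first differ at the special
symbols of their strings. -/
theorem Layout.rotate_lt_of_precedes (h : Layout I CODE OWN POS REM)
    (hLR : LetterRank (I.size + I.d) CODE LR) (hR : IsRank (I.size + I.d) LR (fwd CODE) R)
    (π : Equiv.Perm (Fin I.d)) {p q : ℕ} (hp : p ∈ Icc 1 (I.size + I.d))
    (hq : q ∈ Icc 1 (I.size + I.d)) (hpq : Precedes π OWN R p q) :
    (I.text.rotate (p - 1)).map (I.rank π) < (I.text.rotate (q - 1)).map (I.rank π) := by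
  rcases hpq with hlt | ⟨heq, hlt⟩
  · obtain ⟨k, h₁, h₂, h₃, h₄⟩ := h.of_key_lt hLR hp hq ((hR.lt_iff hp hq).1 hlt)
    have m₁ := (h.add_mem hp h₁).1
    -- The larger of two codes is positive and hence belongs to a letter.
    obtain ⟨c', hc', e'⟩ := h.getElem?_letter (h.add_mem hq h₂).1 (by omega)
    by_cases h₀ : CODE (p + k) = 0
    · obtain ⟨i, hi, -⟩ := h.getElem?_end m₁ h₀
      refine h.rotate_lt π hp hq h₁ h₂ h₃ hi hc' ?_
      simp only [Instance.rank, Sum.elim_inl, Sum.elim_inr]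
      have := (π.symm i).2
      omega
    · obtain ⟨c, hc, e⟩ := h.getElem?_letter m₁ h₀
      refine h.rotate_lt π hp hq h₁ h₂ h₃ hc hc' ?_
      simp only [Instance.rank, Sum.elim_inr]
      omega
  · obtain ⟨h₁, h₂⟩ := h.of_key_eq hLR hp hq ((hR.eq_iff hp hq).1 heq)
    obtain ⟨m₁, o₁, r₁⟩ := h.add_mem hp le_rfl
    obtain ⟨m₂, o₂, r₂⟩ := h.add_mem hq h₁.le
    obtain ⟨i, hi, ei⟩ := h.getElem?_end m₁ ((h.rem_eq_zero_iff m₁).1 (by omega))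
    obtain ⟨j, hj, ej⟩ := h.getElem?_end m₂ ((h.rem_eq_zero_iff m₂).1 (by omega))
    refine h.rotate_lt π hp hq le_rfl h₁.le (fun j hj => h₂ j hj.le) hi hj ?_
    simp only [Instance.rank, Sum.elim_inl]
    rw [o₁] at ei
    rw [o₂] at ej
    simpa [stringRank, ei, ej] using hlt

/-- The numbers of the letters before the positions, and `0` for the first position of a string. -/
def prevCode (CODE LR : ℕ → ℕ) (p : ℕ) : ℕ := if CODE (p - 1) = 0 then 0 else LR (p - 1)

/-- The last symbol of a rotation is the cyclically preceding one. At the beginning of a string it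
is a special symbol, which occurs only once; there the number 0 marks a symbol equal to no other. -/
theorem Layout.sy_eq_iff (h : Layout I CODE OWN POS REM)
    (hLR : LetterRank (I.size + I.d) CODE LR) {p q : ℕ} (hp : p ∈ Icc 1 (I.size + I.d))
    (hq : q ∈ Icc 1 (I.size + I.d)) :
    I.sy p = I.sy q ↔ p = q ∨ prevCode CODE LR p = prevCode CODE LR q ∧
      prevCode CODE LR p ≠ 0 := by
  -- For `p = 1` the subtraction gives position 0 instead of the cyclic predecessor, but both have
  -- code 0.
  have pc : ∀ {p}, p ∈ Icc 1 (I.size + I.d) → prevCode CODE LR p =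
      if CODE (I.prev p) = 0 then 0 else LR (I.prev p) := by
    intro p hp
    unfold prevCode Instance.prev
    split_ifs with h₁ h₂ h₃ h₄ h₅ <;> simp_all [h.zero, h.code_last]
  have m₁ := Instance.prev_mem hp
  have m₂ := Instance.prev_mem hq
  have g₁ := Instance.getElem?_prev hp
  have g₂ := Instance.getElem?_prev hq
  rw [pc hp, pc hq]
  constructor
  · intro heq
    rw [heq, ← g₂] at g₁
    by_cases h₀ : CODE (I.prev p) = 0
    · obtain ⟨i, hi, ei⟩ := h.getElem?_end m₁ h₀
      by_cases h₁ : CODE (I.prev q) = 0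
      · obtain ⟨j, hj, ej⟩ := h.getElem?_end m₂ h₁
        rw [g₁, hj] at hi
        have : j = i := by simpa using hi
        refine Or.inl (Instance.prev_inj hp hq (h.own_inj m₁ m₂ ?_ ?_))
        · rw [(h.rem_eq_zero_iff m₁).2 h₀, (h.rem_eq_zero_iff m₂).2 h₁]
        · rw [ei, ej, this]
      · obtain ⟨c, hc, -⟩ := h.getElem?_letter m₂ h₁
        rw [g₁, hc] at hi
        simp at hi
    · obtain ⟨c, hc, ec⟩ := h.getElem?_letter m₁ h₀
      by_cases h₁ : CODE (I.prev q) = 0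
      · obtain ⟨j, hj, ej⟩ := h.getElem?_end m₂ h₁
        rw [g₁, hj] at hc
        simp at hc
      · obtain ⟨c', hc', ec'⟩ := h.getElem?_letter m₂ h₁
        rw [g₁, hc'] at hc
        have : c' = c := by simpa using hc
        rw [if_neg h₀, if_neg h₁]
        refine Or.inr ⟨(hLR.eq_iff m₁ m₂).2 (by rw [ec, ec', this]), ?_⟩
        have := mem_Icc.1 (hLR.mem _ m₁)
        omega
  · rintro (rfl | ⟨heq, h₀⟩)
    · rfl
    · by_cases h₁ : CODE (I.prev p) = 0
      · exact absurd (if_pos h₁) h₀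
      by_cases h₂ : CODE (I.prev q) = 0
      · rw [heq, if_pos h₂] at h₀
        exact absurd rfl h₀
      rw [if_neg h₁, if_neg h₂] at heq
      have := h.getElem?_eq_of_code m₁ m₂ ((hLR.eq_iff m₁ m₂).1 heq) h₁
      rw [g₁, g₂] at this
      simpa using this

end Order

end CAO

/-! ### Optimality -/

namespace CAO

open Finset

/-- The division of the positions into blocks with equal continuations up to the end of the
string. -/
structure BlockNumber (M K : ℕ) (R B : ℕ → ℕ) : Prop where
  mem : ∀ p ∈ Icc 1 M, B p ∈ Icc 1 (K + 1)
  surj : ∀ k ∈ Icc 1 (K + 1), ∃ p ∈ Icc 1 M, B p = k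
  lt_iff : ∀ p ∈ Icc 1 M, ∀ q ∈ Icc 1 M, B p < B q ↔ R p < R q

theorem BlockNumber.eq_iff {M K : ℕ} {R B : ℕ → ℕ} (h : BlockNumber M K R B) {p q : ℕ}
    (hp : p ∈ Icc 1 M) (hq : q ∈ Icc 1 M) : B p = B q ↔ R p = R q :=
  eq_iff_of_lt_iff (h.lt_iff p hp q hq) (h.lt_iff q hq p hp)

/-! ### One ordering of the strings realises all desired block orders -/

section Optimal

variable {I : Instance} {CODE OWN POS REM LR R B : ℕ → ℕ} {K : ℕ}

theorem Layout.eq_of_stringRank_eq (h : Layout I CODE OWN POS REM)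
    (hLR : LetterRank (I.size + I.d) CODE LR) (hR : IsRank (I.size + I.d) LR (fwd CODE) R)
    (π : Equiv.Perm (Fin I.d)) {p q : ℕ} (hp : p ∈ Icc 1 (I.size + I.d))
    (hq : q ∈ Icc 1 (I.size + I.d)) (heq : R p = R q)
    (hs : stringRank π OWN p = stringRank π OWN q) : p = q := by
  obtain ⟨h₁, -⟩ := h.of_key_eq hLR hp hq ((hR.eq_iff hp hq).1 heq)
  refine h.own_inj hp hq h₁ ?_
  have := π.symm.injective (Fin.ext (a := π.symm ⟨OWN p, h.own_lt hp⟩)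
    (b := π.symm ⟨OWN q, h.own_lt hq⟩) (by simpa [stringRank, h.own_lt hp, h.own_lt hq] using hs))
  simpa using this

theorem Layout.exists_listing (h : Layout I CODE OWN POS REM)
    (hLR : LetterRank (I.size + I.d) CODE LR) (hR : IsRank (I.size + I.d) LR (fwd CODE) R)
    (hB : BlockNumber (I.size + I.d) K R B) (π : Equiv.Perm (Fin I.d)) :
    ∃ blk, Listing (I.size + I.d) K B blk ∧ ∀ k ∈ Icc 1 (K + 1),
      (blk k).Pairwise fun p q => stringRank π OWN p < stringRank π OWN q := by
  refine ⟨fun k => ({p ∈ Icc 1 (I.size + I.d) | B p = k}).toList.mergeSort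
    fun p q => decide (stringRank π OWN p ≤ stringRank π OWN q), ⟨fun k _ p => ?_, fun k _ => ?_⟩,
    fun k _ => ?_⟩
  · rw [(List.mergeSort_perm _ _).mem_iff, mem_toList, mem_filter]
  · exact (List.mergeSort_perm _ _).nodup_iff.2 (nodup_toList _)
  · have h₁ := List.pairwise_mergeSort
      (le := fun p q => decide (stringRank π OWN p ≤ stringRank π OWN q))
      (fun a b c h₁ h₂ => by simp only [decide_eq_true_eq] at *; exact h₁.trans h₂)
      (fun a b => by simpa using le_total _ _)
      ({p ∈ Icc 1 (I.size + I.d) | B p = k}).toList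
    have h₂ := (List.mergeSort_perm ({p ∈ Icc 1 (I.size + I.d) | B p = k}).toList
      fun p q => decide (stringRank π OWN p ≤ stringRank π OWN q)).nodup_iff.2 (nodup_toList _)
    refine (h₁.and h₂).imp_of_mem fun {p q} hp hq hpq => ?_
    rw [(List.mergeSort_perm _ _).mem_iff, mem_toList, mem_filter] at hp hq
    refine lt_of_le_of_ne (by simpa using hpq.1) fun he => hpq.2 ?_
    exact h.eq_of_stringRank_eq hLR hR π hp.1 hq.1
      ((hB.eq_iff hp.1 hq.1).1 (by rw [hp.2, hq.2])) he

/-- Listing the blocks by number, and each block by the ranks of the strings, lists the rotations in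
increasing order. Among orderings `π`, only the lists inside the blocks vary. -/
theorem Layout.runs_eq (h : Layout I CODE OWN POS REM)
    (hLR : LetterRank (I.size + I.d) CODE LR) (hR : IsRank (I.size + I.d) LR (fwd CODE) R)
    (hB : BlockNumber (I.size + I.d) K R B) (π : Equiv.Perm (Fin I.d)) {blk : ℕ → List ℕ}
    (hl : Listing (I.size + I.d) K B blk) (hs : ∀ k ∈ Icc 1 (K + 1),
      (blk k).Pairwise fun p q => stringRank π OWN p < stringRank π OWN q) :
    I.runs π = changes ((List.range (K + 1)).flatMap fun k => (blk (k + 1)).map I.sy) + 1 := by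
  have hm : ∀ k < K + 1, ∀ p ∈ blk (k + 1), p ∈ Icc 1 (I.size + I.d) ∧ B p = k + 1 :=
    fun k hk p hp => (hl.mem_iff _ (by simp; omega) p).1 hp
  have hmem : ∀ p, p ∈ (List.range (K + 1)).flatMap (fun k => blk (k + 1)) ↔
      p ∈ Icc 1 (I.size + I.d) := by
    intro p
    simp only [List.mem_flatMap, List.mem_range]
    constructor
    · rintro ⟨k, hk, hp⟩
      exact (hm k hk p hp).1
    · intro hp
      have := mem_Icc.1 (hB.mem p hp)
      exact ⟨B p - 1, by omega, (hl.mem_iff _ (by simp; omega) p).2 ⟨hp, by omega⟩⟩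
  have hbl : ∀ {i j}, i < j → j < K + 1 → ∀ p ∈ blk (i + 1), ∀ q ∈ blk (j + 1), R p < R q := by
    intro i j hij hj p hp q hq
    have h₁ := hm i (by omega) p hp
    have h₂ := hm j hj q hq
    exact (hB.lt_iff p h₁.1 q h₂.1).1 (by omega)
  have hpw : ((List.range (K + 1)).flatMap fun k => blk (k + 1)).Pairwise
      (Precedes π OWN R) := by
    rw [List.pairwise_flatMap]
    refine ⟨fun k hk => (hs (k + 1) (by simp at hk ⊢; omega)).imp_of_mem fun {p q} hp hq hpq =>
      Or.inr ⟨?_, hpq⟩, ?_⟩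
    · have hk := List.mem_range.1 hk
      have h₁ := hm k hk p hp
      have h₂ := hm k hk q hq
      exact (hB.eq_iff h₁.1 h₂.1).1 (by omega)
    · refine (List.pairwise_lt_range (n := K + 1)).imp_of_mem fun {i j} _ hj hij p hp q hq =>
        Or.inl (hbl hij (List.mem_range.1 hj) p hp q hq)
  have hbwt := Instance.bwt_eq (Instance.rank_injective π)
    (L := (List.range (K + 1)).flatMap fun k => blk (k + 1))
    (hpw.imp fun {p q} (hpq : Precedes π OWN R p q) => by
      rintro rfl
      rcases hpq with hpq | hpq <;> omega) hmem
    (hpw.imp_of_mem fun {p q} hp hq hpq =>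
      h.rotate_lt_of_precedes hLR hR π ((hmem p).1 hp) ((hmem q).1 hq) hpq)
  rw [Instance.runs, hbwt, numRuns_eq, List.map_flatMap]
  obtain ⟨p, hp, -⟩ := hB.surj 1 (by simp)
  exact List.ne_nil_of_mem (List.mem_map_of_mem ((hmem p).2 hp))

theorem Layout.blocks (h : Layout I CODE OWN POS REM)
    (hLR : LetterRank (I.size + I.d) CODE LR) (hB : BlockNumber (I.size + I.d) K R B) :
    Blocks (I.size + I.d) K I.sy (prevCode CODE LR) B :=
  ⟨fun _ hp _ hq => h.sy_eq_iff hLR hp hq, hB.mem, hB.surj⟩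

/-- The predecessor of a position in its string, and `0` at the beginning of the string. -/
def bwd (PC : ℕ → ℕ) (p : ℕ) : ℕ := if PC p = 0 then 0 else p - 1

/-- Read backwards, a list begins at the end of a string, so the remaining length plays the role of
the position. -/
theorem Layout.chain_bwd (h : Layout I CODE OWN POS REM)
    (hLR : LetterRank (I.size + I.d) CODE LR) {T : ℕ → ℕ} (hT₀ : T 0 = 0)
    (hT : ∀ p ∈ Icc 1 (I.size + I.d), T p ∈ Icc 1 (I.size + I.d)) :
    Chain (I.size + I.d) T (bwd (prevCode CODE LR)) REM where
  T_zero := hT₀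
  NX_zero := by simp [bwd]
  T_mem := hT
  NX_le p hp := by
    have := mem_Icc.1 hp
    unfold bwd
    split_ifs <;> omega
  pos_next p hp h₀ := by
    have hp' := mem_Icc.1 hp
    unfold bwd at h₀ ⊢
    split_ifs at h₀ ⊢ with h₁
    · exact absurd rfl h₀
    · have h₂ : CODE (p - 1) ≠ 0 := fun h₂ => h₁ (by rw [prevCode, if_pos h₂])
      have := (h.next (x := p - 1) (by simp; omega) h₂).2.2.2
      rwa [Nat.sub_add_cancel hp'.1] at this
  pos_pred p hp h₀ := by
    have h₁ := (h.rem_eq_zero_iff hp).not.1 h₀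
    have h₂ := (h.next hp h₁).1
    have := mem_Icc.1 (hLR.mem p hp)
    refine ⟨p + 1, h₂, ?_⟩
    rw [bwd, prevCode, if_neg]
    · rfl
    · rw [Nat.add_sub_cancel, if_neg h₁]; omega

/-- The preferred positions of the symbols in the blocks. -/
def wish (PC B ch : ℕ → ℕ) (p : ℕ) : ℕ :=
  if PC p ≠ 0 ∧ PC p = ch (B p - 1) then 0 else if PC p ≠ 0 ∧ PC p = ch (B p) then 2 else 1

theorem lexCount_lt_iff {n : ℕ} {K₁ K₂ : ℕ → ℕ} {p q : ℕ} (hp : p ∈ Icc 1 n) :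
    lexCount n K₁ K₂ (fun _ => 1) p < lexCount n K₁ K₂ (fun _ => 1) q ↔
      K₁ p < K₁ q ∨ K₁ p = K₁ q ∧ K₂ p < K₂ q := by
  have : ∀ p, lexCount n K₁ K₂ (fun _ => 1) p =
      cnt n (fun p => toLex (K₁ p, K₂ p)) (fun _ => True) p := fun p =>
    lexCount_eq_cnt (fun _ _ => by simp) fun _ _ _ => lexLT_iff
  rw [this, this, cnt_lt_iff hp trivial, Prod.Lex.toLex_lt_toLex]

variable {a₁ a₂ ch T₂ R₂ OUT : ℕ → ℕ}

/-- `T₂` ranks each preceding symbol by its desired place in its block, and `R₂` compares the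
reversed strings by these labels. `OUT` numbers the ends of the strings accordingly, with ties, as
between equal strings, broken by the position. -/
theorem Layout.exists_isOptimal (h : Layout I CODE OWN POS REM)
    (hLR : LetterRank (I.size + I.d) CODE LR) (hR : IsRank (I.size + I.d) LR (fwd CODE) R)
    (hB : BlockNumber (I.size + I.d) K R B)
    (hg : Greedy K (Shared (I.size + I.d) (prevCode CODE LR) B) (Multi (I.size + I.d) I.sy B)
      a₁ a₂)
    (hch : Choice K (Multi (I.size + I.d) I.sy B) a₁ a₂ ch) (hch₀ : ch 0 = 0)
    (hT₂ : ∀ p ∈ Icc 1 (I.size + I.d), T₂ p = lexCount (I.size + I.d)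
      (wish (prevCode CODE LR) B ch) (prevCode CODE LR) (fun _ => 1) p + 1)
    (hR₂ : IsRank (I.size + I.d) T₂ (bwd (prevCode CODE LR)) R₂) (hOUT₀ : OUT 0 = 0)
    (hOUT : ∀ p ∈ Icc 1 (I.size + I.d), OUT p = lexCount (I.size + I.d) R₂ (fun p => p)
      (fun p => if CODE p = 0 then 1 else 0) p + 1) :
    (∀ p ∈ Icc 1 (I.size + I.d), CODE p = 0 → 1 ≤ OUT p ∧ OUT p ≤ I.d ∧
      ∀ q ∈ Icc 1 (I.size + I.d), CODE q = 0 → OUT p = OUT q → p = q) ∧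
    ∃ π : Equiv.Perm (Fin I.d), I.IsOptimal π ∧ ∀ i : Fin I.d, ∃ x ∈ Icc 1 (I.size + I.d),
      CODE x = 0 ∧ OUT x = i + 1 ∧ OWN x = π i := by
  have hlt : ∀ {p q}, p ∈ Icc 1 (I.size + I.d) → q ∈ Icc 1 (I.size + I.d) → CODE p = 0 →
      CODE q = 0 → (OUT p < OUT q ↔ R₂ p < R₂ q ∨ R₂ p = R₂ q ∧ p < q) := by
    intro p q hp hq hp₀ hq₀
    rw [lt_iff_of_lexCount (n := I.size + I.d) (P := fun p => CODE p = 0) hOUT₀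
      (fun p hp _ => hOUT p hp) (fun _ _ => rfl) hR₂.1
      (fun p hp => by rw [hR₂.2 p hp]; omega) (mem_Icc.1 hp).2 (mem_Icc.1 hq).2
      (fun _ => hp₀) (fun _ => hq₀), Prod.Lex.toLex_lt_toLex]
  have hcard : #{p ∈ Icc 1 (I.size + I.d) | CODE p = 0} ≤ I.d := by
    calc _ ≤ #(range I.d) := card_le_card_of_injOn OWN (fun p hp => by
          have hp := (mem_filter.1 hp).1
          simpa using h.own_lt hp) (fun p hp q hq he => by
            simp only [coe_filter, Set.mem_ofPred_eq] at hp hq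
            exact h.own_inj hp.1 hq.1 (by
              rw [(h.rem_eq_zero_iff hp.1).2 hp.2, (h.rem_eq_zero_iff hq.1).2 hq.2]) he)
      _ = I.d := card_range _
  have hle : ∀ p ∈ Icc 1 (I.size + I.d), CODE p = 0 → 1 ≤ OUT p ∧ OUT p ≤ I.d := by
    intro p hp hp₀
    rw [hOUT p hp, lexCount_eq_cnt (P := fun p => CODE p = 0)
      (K := fun p => toLex (R₂ p, p)) (fun _ _ => rfl) fun _ _ _ => lexLT_iff]
    refine ⟨by omega, le_trans ?_ hcard⟩
    exact card_lt_card ⟨fun x hx => by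
      rw [mem_filter] at hx ⊢; exact ⟨hx.1, hx.2.1⟩, fun hsub =>
      lt_irrefl _ (mem_filter.1 (hsub (mem_filter.2 ⟨hp, hp₀⟩))).2.2⟩
  choose xs hxs hxs₀ hxo using h.exists_own
  -- This sends a string to its place in the ordering, and its inverse is the output. Injectivity
  -- comes from the tie-breaking.
  set ρ : Fin I.d → Fin I.d := fun i => ⟨OUT (xs i) - 1, by
    have := hle _ (hxs i) (hxs₀ i); omega⟩ with hρ
  have hρi : Function.Injective ρ := by
    intro i j hij
    have h₁ := hle _ (hxs i) (hxs₀ i)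
    have h₂ := hle _ (hxs j) (hxs₀ j)
    have h₃ : OUT (xs i) - 1 = OUT (xs j) - 1 := congrArg Fin.val hij
    have h₄ := hlt (hxs i) (hxs j) (hxs₀ i) (hxs₀ j)
    have h₅ := hlt (hxs j) (hxs i) (hxs₀ j) (hxs₀ i)
    have h₆ : xs i = xs j := by omega
    exact Fin.ext (by rw [← hxo, ← hxo, h₆])
  set τ : Equiv.Perm (Fin I.d) := Equiv.ofBijective ρ (Finite.injective_iff_bijective.1 hρi)
    with hτ
  have hsr : ∀ p ∈ Icc 1 (I.size + I.d), stringRank τ.symm OWN p = OUT (p + REM p) - 1 := by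
    intro p hp
    obtain ⟨m, o, r⟩ := h.add_mem hp le_rfl
    have e : xs ⟨OWN p, h.own_lt hp⟩ = p + REM p := by
      refine h.own_inj (hxs _) m ?_ (by rw [hxo, o])
      rw [(h.rem_eq_zero_iff (hxs _)).2 (hxs₀ _)]; omega
    rw [stringRank, dif_pos (h.own_lt hp), ← e]
    rfl
  -- The order of the reversed prefixes inside a block carries over to the ends of the strings. One
  -- step forward from a common block leads to a common block with a common preceding letter, so one
  -- equal label is put in front of both backward sequences.
  have hback : ∀ m, ∀ p ∈ Icc 1 (I.size + I.d), ∀ q ∈ Icc 1 (I.size + I.d), REM p = m →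
      R p = R q → R₂ p < R₂ q → OUT (p + REM p) < OUT (q + REM q) := by
    intro m
    induction m with
    | zero =>
      intro p hp q hq hm hpq h₂
      have := (h.of_key_eq hLR hp hq ((hR.eq_iff hp hq).1 hpq)).1
      rw [hm, ← this, hm]
      exact (hlt hp hq ((h.rem_eq_zero_iff hp).1 hm)
        ((h.rem_eq_zero_iff hq).1 (by omega))).2 (Or.inl h₂)
    | succ m ih =>
      intro p hp q hq hm hpq h₂
      obtain ⟨hr, hc⟩ := h.of_key_eq hLR hp hq ((hR.eq_iff hp hq).1 hpq)
      have hp₀ : CODE p ≠ 0 := (h.rem_eq_zero_iff hp).not.1 (by omega)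
      have hq₀ : CODE q ≠ 0 := (h.rem_eq_zero_iff hq).not.1 (by omega)
      obtain ⟨hp', -, -, hpr⟩ := h.next hp hp₀
      obtain ⟨hq', -, -, hqr⟩ := h.next hq hq₀
      have hR' : R (p + 1) = R (q + 1) := by
        have := (key_eq_iff.1 ((hR.eq_iff hp hq).1 hpq)).2
        rw [fwd, fwd, if_neg hp₀, if_neg hq₀] at this
        exact (hR.eq_iff hp' hq').2 this
      have hB' := (hB.eq_iff hp' hq').2 hR'
      have hPp : prevCode CODE LR (p + 1) = LR p := by simp [prevCode, hp₀]
      have hPq : prevCode CODE LR (q + 1) = LR q := by simp [prevCode, hq₀]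
      have hLpq : LR p = LR q := (hLR.eq_iff hp hq).2 (by simpa using hc 0 (by omega))
      have hLp := mem_Icc.1 (hLR.mem p hp)
      -- The label depends only on the block and on the preceding letter; both agree here.
      have hT : T₂ (p + 1) = T₂ (q + 1) := by
        rw [hT₂ _ hp', hT₂ _ hq', lexCount, lexCount]
        simp only [LexLT, wish, hPp, hPq, hLpq, hB']
      have := ih (p + 1) hp' (q + 1) hq' (by omega) hR' (by
        rw [hR₂.lt_iff hp' hq', key_lt_iff]
        refine Or.inr ⟨hT, ?_⟩
        rw [bwd, bwd, if_neg (by omega), if_neg (by omega)]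
        exact (hR₂.lt_iff hp hq).1 h₂)
      rw [hpr, hqr]
      convert this using 2 <;> omega
  refine ⟨fun p hp hp₀ => ⟨(hle p hp hp₀).1, (hle p hp hp₀).2, fun q hq hq₀ he => ?_⟩, τ.symm,
    fun π' => ?_, fun i => ?_⟩
  · have h₁ := hlt hp hq hp₀ hq₀
    have h₂ := hlt hq hp hq₀ hp₀
    omega
  · obtain ⟨blk, hl, hs⟩ := h.exists_listing hLR hR hB τ.symm
    obtain ⟨blk', hl', hs'⟩ := h.exists_listing hLR hR hB π'
    rw [h.runs_eq hLR hR hB τ.symm hl hs, h.runs_eq hLR hR hB π' hl' hs']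
    have hb := h.blocks hLR hB
    have h₁ := hb.le_changes hl' hg
    have h₂ := hb.changes_le hl hg hch hch₀ (K₁ := wish (prevCode CODE LR) B ch)
      (fun _ _ => rfl) (fun k hk => (hs k hk).imp_of_mem fun {p q} hp hq hpq => by
        obtain ⟨hp, hpB⟩ := (hl.mem_iff k hk p).1 hp
        obtain ⟨hq, hqB⟩ := (hl.mem_iff k hk q).1 hq
        have hpq' := (hB.eq_iff hp hq).1 (by rw [hpB, hqB])
        rw [hsr p hp, hsr q hq] at hpq
        -- The ordering of the strings agrees with `R₂` inside a block, and the first label of the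
        -- backward sequence is `T₂`, so the block is sorted by the desired places.
        have h₁ : ¬ R₂ q < R₂ p := fun hlt => by
          have := hback _ q hq p hp rfl hpq'.symm hlt
          omega
        have h₂ : ¬ T₂ q < T₂ p := fun hlt =>
          h₁ ((hR₂.lt_iff hq hp).2 (key_lt_iff.2 (Or.inl hlt)))
        rw [hT₂ p hp, hT₂ q hq, Nat.add_lt_add_iff_right, lexCount_lt_iff hq] at h₂
        omega)
    omega
  · refine ⟨xs (τ.symm i), hxs _, hxs₀ _, ?_, hxo _⟩
    have h₁ := hle _ (hxs (τ.symm i)) (hxs₀ _)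
    have h₂ : τ (τ.symm i) = i := τ.apply_symm_apply i
    have h₃ : OUT (xs (τ.symm i)) - 1 = i := congrArg Fin.val h₂
    omega

end Optimal

end CAO

/-! ### Reading the input -/

namespace CAO

open Finset

/-- Write the text to the arrays `40`, `41`, `42` and `43`. -/
def parseBody : Prog :=
  .store 41 (.reg 30) (.reg 31) ;; .store 42 (.reg 30) (.reg 34) ;;
  .store 43 (.reg 30) (.reg 32) ;;
  .ite (.reg 32)
    (.store 40 (.reg 30) (.load 0 (.reg 33) + 1) ;; .assign 33 (.reg 33 + 1) ;;
      .assign 32 (.reg 32 - 1) ;; .assign 34 (.reg 34 + 1))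
    (.store 40 (.reg 30) 0 ;; .assign 31 (.reg 31 + 1) ;; .assign 32 (.load 1 (.reg 31)) ;;
      .assign 34 0)

/-- Read the input. -/
def parse : Prog := .assign 32 (.load 1 0) ;; .upto 30 10 parseBody

theorem Instance.sigma_pos (I : Instance) : 0 < I.σ := by
  have := List.length_pos_of_ne_nil (I.T_ne_nil ⟨0, I.d_pos⟩)
  exact ((I.T ⟨0, I.d_pos⟩)[0]).pos

theorem Instance.d_le_size (I : Instance) : I.d ≤ I.size := by
  have : ∑ _i : Fin I.d, 1 ≤ I.size :=
    sum_le_sum fun i _ => List.length_pos_of_ne_nil (I.T_ne_nil i)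
  simpa using this

/-- The registers `31` to `34` hold the string of the next text position, its remaining length, the
next input cell and the position in the string. After the last position the string number is `d`,
which the invariant has to allow. -/
theorem run_parse {w : ℕ} [hw : Fact (8 ≤ 2 ^ w)] {I : Instance} {s₀ : State} (hwf : WF w s₀)
    (hM : s₀.reg 10 = I.size + I.d) (hreg : ∀ x ∈ Icc 31 34, s₀.reg x = 0)
    (harr : ∀ A, A < 2 → s₀.arr A = I.init.arr A) (h40 : s₀.arr 40 0 = 0)
    (hbound : I.size + I.d < 2 ^ w) (hσ : I.σ < 2 ^ w) :
    ∃ s', Run w parse (100 * (I.size + I.d + 1)) s₀ s' ∧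
      Layout I (s'.arr 40) (s'.arr 41) (s'.arr 42) (s'.arr 43) := by
  have hr₁ := Run.assign (w := w) s₀ 32 (.load 1 0)
  set s₁ := s₀.setReg 32 _ with hs₁
  have hwf₁ := hr₁.wf hwf
  have h1 : s₀.arr 1 = I.len := harr 1 (by norm_num)
  obtain ⟨s', hr, ⟨i, j, -, -, -, -, -, -, -⟩, hz, hinfo, hcode, hend⟩ := run_upto_flat (w := w)
    (x := 30) (m := 10) (p := parseBody) (n := I.size + I.d) hwf₁ (by simp [hs₁, hM]) rfl
    (by norm_num) rfl rfl
    (fun x s => (∃ i j, I.start i + i + j = x ∧ i ≤ I.d ∧ j ≤ I.len i ∧ s.reg 31 = i ∧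
        s.reg 32 = I.len i - j ∧ s.reg 33 = I.start i + j ∧ s.reg 34 = j) ∧
      s.arr 40 0 = 0 ∧
      (∀ i : Fin I.d, ∀ j ≤ I.len i, I.start i + i + j < x →
        s.arr 41 (I.start i + i + j + 1) = i ∧ s.arr 42 (I.start i + i + j + 1) = j ∧
        s.arr 43 (I.start i + i + j + 1) = I.len i - j) ∧
      (∀ (i : Fin I.d) (j : ℕ) (hj : j < (I.T i).length), I.start i + i + j < x →
        s.arr 40 (I.start i + i + j + 1) = (I.T i)[j] + 1) ∧
      (∀ i : Fin I.d, I.start i + i + I.len i < x → s.arr 40 (I.start i + i + I.len i + 1) = 0))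
    (by
      intro x s v h
      simpa using h)
    (by
      refine ⟨⟨0, 0, by simp [Instance.start], Nat.zero_le _, Nat.zero_le _, ?_, ?_, ?_, ?_⟩, ?_,
        fun _ _ _ h => absurd h (by omega), fun _ _ _ h => absurd h (by omega),
        fun _ h => absurd h (by omega)⟩ <;>
        simp [hs₁, hreg, h1, h40, Instance.start])
    (by
      rintro x hx s hs hx30 hr ha ⟨⟨i, j, hij, hid, hj, r31, r32, r33, r34⟩, hz, hinfo, hcode,
        hend⟩
      have hid : i < I.d := by
        refine lt_of_le_of_ne hid ?_
        rintro rfl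
        rw [I.start_d] at hij
        omega
      set i' : Fin I.d := ⟨i, hid⟩ with hi'
      have hin : I.start i + I.len i ≤ I.size := by
        rw [← I.start_d]; exact I.start_mono hid
      have hlen : I.len i = (I.T i').length := I.len_fin i'
      have a0 : s.arr 0 = I.init.arr 0 := by rw [ha 0 rfl, ← harr 0 (by norm_num)]; simp [hs₁]
      have a1 : s.arr 1 = I.len := by rw [ha 1 rfl, ← h1]; simp [hs₁]
      set b := parseBody with hb
      have e41 : ∀ y, (b.den w s).arr 41 y = if y = x + 1 then i else s.arr 41 y := by
        intro y
        simp only [hb, parseBody, Prog.den]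
        split_ifs <;> simp_all
      have e42 : ∀ y, (b.den w s).arr 42 y = if y = x + 1 then j else s.arr 42 y := by
        intro y
        simp only [hb, parseBody, Prog.den]
        split_ifs <;> simp_all
      have e43 : ∀ y, (b.den w s).arr 43 y = if y = x + 1 then I.len i - j else s.arr 43 y := by
        intro y
        simp only [hb, parseBody, Prog.den]
        split_ifs <;> simp_all
      have huniq : ∀ {i₂ j₂ : ℕ}, j₂ ≤ I.len i₂ → I.start i₂ + i₂ + j₂ < x + 1 →
          I.start i₂ + i₂ + j₂ < x ∧ I.start i₂ + i₂ + j₂ + 1 ≠ x + 1 ∨ i₂ = i ∧ j₂ = j := by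
        intro i₂ j₂ hj₂ hlt
        by_cases he : I.start i₂ + i₂ + j₂ = x
        · exact Or.inr (I.start_inj hj₂ hj (he.trans hij.symm))
        · exact Or.inl ⟨by omega, by omega⟩
      have hinfo' : ∀ i : Fin I.d, ∀ j ≤ I.len i, I.start i + i + j < x + 1 →
          (b.den w s).arr 41 (I.start i + i + j + 1) = i ∧
          (b.den w s).arr 42 (I.start i + i + j + 1) = j ∧
          (b.den w s).arr 43 (I.start i + i + j + 1) = I.len i - j := by
        intro i₂ j₂ hj₂ hlt
        rw [e41, e42, e43]
        rcases huniq hj₂ hlt with ⟨h₁, h₂⟩ | ⟨h₁, h₂⟩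
        · rw [if_neg h₂, if_neg h₂, if_neg h₂]
          exact hinfo i₂ j₂ hj₂ h₁
        · rw [h₁, h₂, if_pos (by omega), if_pos (by omega), if_pos (by omega)]
          exact ⟨rfl, rfl, rfl⟩
      by_cases hjl : j = I.len i
      · have hrem : s.reg 32 = 0 := by omega
        have e40 : ∀ y, (b.den w s).arr 40 y = if y = x + 1 then 0 else s.arr 40 y := by
          intro y
          simp only [hb, parseBody, Prog.den]
          simp [hrem, hx30]
        have er : (b.den w s).reg 31 = i + 1 ∧ (b.den w s).reg 32 = I.len (i + 1) ∧
            (b.den w s).reg 33 = s.reg 33 ∧ (b.den w s).reg 34 = 0 := by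
          have : (i + 1) % 2 ^ w = i + 1 := Nat.mod_eq_of_lt (by omega)
          simp [hb, parseBody, Prog.den, hrem, r31, this, a1]
        refine ⟨⟨i + 1, 0, ?_, hid, Nat.zero_le _, er.1, er.2.1, ?_, er.2.2.2⟩, ?_, hinfo',
          fun i₂ j₂ hj₂ hlt => ?_, fun i₂ hlt => ?_⟩
        · rw [I.start_succ]; omega
        · rw [er.2.2.1, r33, I.start_succ]; omega
        · rw [e40, if_neg (by omega), hz]
        · have hj₂' : j₂ ≤ I.len i₂ := by rw [I.len_fin]; omega
          rcases huniq hj₂' hlt with ⟨h₁, h₂⟩ | ⟨h₁, h₂⟩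
          · rw [e40, if_neg h₂, hcode i₂ j₂ hj₂ h₁]
          · have : I.len i₂ = (I.T i₂).length := I.len_fin i₂
            rw [h₁] at this
            omega
        · rw [e40]
          rcases huniq le_rfl hlt with ⟨h₁, h₂⟩ | ⟨h₁, h₂⟩
          · rw [if_neg h₂, hend i₂ h₁]
          · rw [h₁] at h₂ ⊢
            rw [if_pos (by omega)]
      · have hrem : s.reg 32 ≠ 0 := by omega
        have hj' : j < (I.T i').length := by omega
        have hT : s.arr 0 (I.start i + j) = (I.T i')[j] := by
          rw [a0]
          have := I.getElem?_input i' hj'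
          simp only [Instance.init, List.getD_eq_getElem?_getD, List.getElem?_map]
          rw [show I.start i + j = I.start (i' : ℕ) + j from rfl, this]
          rfl
        have hTσ : ((I.T i')[j] : ℕ) + 1 < 2 ^ w := by
          have := ((I.T i')[j]).2
          omega
        have e40 : ∀ y, (b.den w s).arr 40 y = if y = x + 1 then ((I.T i')[j] : ℕ) + 1
            else s.arr 40 y := by
          intro y
          simp only [hb, parseBody, Prog.den]
          simp [hrem, hx30, r33, hT, Nat.mod_eq_of_lt hTσ]
        have er : (b.den w s).reg 31 = i ∧ (b.den w s).reg 32 = I.len i - j - 1 ∧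
            (b.den w s).reg 33 = I.start i + j + 1 ∧ (b.den w s).reg 34 = j + 1 := by
          have m₁ : (I.len i - j - 1) % 2 ^ w = I.len i - j - 1 := Nat.mod_eq_of_lt (by omega)
          have m₂ : (I.start i + j + 1) % 2 ^ w = I.start i + j + 1 :=
            Nat.mod_eq_of_lt (by omega)
          have m₃ : (j + 1) % 2 ^ w = j + 1 := Nat.mod_eq_of_lt (by omega)
          simp [hb, parseBody, Prog.den, hrem]
          simp [r31, r32, r33, r34, m₁, m₂, m₃]
        refine ⟨⟨i, j + 1, by omega, hid.le, by omega, er.1, by rw [er.2.1]; omega,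
          by rw [er.2.2.1]; omega, er.2.2.2⟩, ?_, hinfo', fun i₂ j₂ hj₂ hlt => ?_,
          fun i₂ hlt => ?_⟩
        · rw [e40, if_neg (by omega), hz]
        · have hj₂' : j₂ ≤ I.len i₂ := by rw [I.len_fin]; omega
          rw [e40]
          rcases huniq hj₂' hlt with ⟨h₁, h₂⟩ | ⟨h₁, h₂⟩
          · rw [if_neg h₂, hcode i₂ j₂ hj₂ h₁]
          · obtain rfl : i₂ = i' := Fin.ext h₁
            subst h₂
            rw [if_pos (by rw [← hij])]
        · rcases huniq le_rfl hlt with ⟨h₁, h₂⟩ | ⟨h₁, h₂⟩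
          · rw [e40, if_neg h₂, hend i₂ h₁]
          · rw [h₁] at h₂; omega)
  have hlt : ∀ i : Fin I.d, ∀ j ≤ (I.T i).length, I.start i + i + j < I.size + I.d := by
    intro i j hj
    have := mem_Icc.1 (I.mem_of_le hj)
    omega
  refine ⟨s', (hr₁.seq hr).mono ?_, hz, fun i j hj => hcode i j hj (hlt i j hj.le), fun i => ?_,
    fun i j hj => ?_⟩
  · simp only [parseBody, Prog.time, cost_add, cost_sub, cost_load, cost_reg, cost_zero, cost_one]
    omega
  · have := hend i (by rw [I.len_fin]; exact hlt i _ le_rfl)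
    rwa [I.len_fin] at this
  · have := hinfo i j (by rwa [I.len_fin]) (hlt i j hj)
    rwa [I.len_fin] at this

/-! ### Sorting the letters -/

/-- Rank the positions by the letters in the array `40`, digit by digit, into the array `44`. -/
def radixSort : Prog :=
  .assign 35 1 ;; .loop ((Expr.reg 35).less (.reg 2 + 1))
    (rankBy (.load 40 (.reg 11) / .reg 35 % (.reg 1 + 1)) (.load 44 (.reg 11)) 1 44 ;;
      .assign 35 (.reg 35 * (.reg 1 + 1)))

theorem lt_add_mul_iff {D r r' a a' : ℕ} (hr : r < D) (hr' : r' < D) :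
    r + D * a < r' + D * a' ↔ a < a' ∨ a = a' ∧ r < r' := by
  rcases lt_trichotomy a a' with h | rfl | h
  · have : D * (a + 1) ≤ D * a' := Nat.mul_le_mul_left D h
    rw [mul_add] at this
    constructor <;> intro <;> omega
  · constructor <;> intro <;> omega
  · have : D * (a' + 1) ≤ D * a := Nat.mul_le_mul_left D h
    rw [mul_add] at this
    constructor <;> intro <;> omega

/-- Least significant digit first in base `N + 1`: the array `44` always ranks the codes modulo the
current power in register `35`, and a pass ranks the pairs of the next digit and the old rank. The
loop ends when the power exceeds `σ`; since `σ ≤ (N + 1) ^ a`, it stays at most `(N + 1) ^ (a + 1)`.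
The exponent is not known to the program, it only enters the potential. -/
theorem run_radixSort {w : ℕ} [hw : Fact (8 ≤ 2 ^ w)] {M N σ a : ℕ} {CODE : ℕ → ℕ} {s₀ : State}
    (hwf : WF w s₀) (hM : s₀.reg 10 = M) (hN : s₀.reg 1 = N) (hσ : s₀.reg 2 = σ) (hN₀ : 1 ≤ N)
    (hNM : N ≤ M) (hσ₀ : 1 ≤ σ) (hC : ∀ p ∈ Icc 1 M, s₀.arr 40 p = CODE p)
    (hC' : ∀ p ∈ Icc 1 M, CODE p ≤ σ) (h44 : ∀ p, s₀.arr 44 p = 0) (hMw : M + 1 < 2 ^ w)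
    (ha : σ ≤ (N + 1) ^ a) (haw : (N + 1) ^ (a + 1) + 1 < 2 ^ w) :
    ∃ s', Run w radixSort ((a + 3) * (400 * (M + 1))) s₀ s' ∧ LetterRank M CODE (s'.arr 44) := by
  have hr₁ := Run.assign (w := w) s₀ 35 1
  set s₁ := s₀.setReg 35 _ with hs₁
  have hwf₁ := hr₁.wf hwf
  have hpow : ∀ k, k ≤ a + 1 → (N + 1) ^ k ≤ (N + 1) ^ (a + 1) := fun k hk =>
    Nat.pow_le_pow_right (by omega) hk
  have hNw : (N + 1) % 2 ^ w = N + 1 := Nat.mod_eq_of_lt (by omega)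
  have hσw : (σ + 1) % 2 ^ w = σ + 1 := Nat.mod_eq_of_lt (by
    have := hpow a (by omega); omega)
  obtain ⟨s', hr, ⟨-, -, -, hσ', -, hz, ⟨k, hk, hD⟩, hle, hpos, hlt⟩, he⟩ := run_loop (w := w)
    (e := (Expr.reg 35).less (.reg 2 + 1))
    (p := rankBy (.load 40 (.reg 11) / .reg 35 % (.reg 1 + 1)) (.load 44 (.reg 11)) 1 44 ;;
      .assign 35 (.reg 35 * (.reg 1 + 1)))
    (fun s => WF w s ∧ s.reg 10 = M ∧ s.reg 1 = N ∧ s.reg 2 = σ ∧ s.arr 40 = s₀.arr 40 ∧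
      s.arr 44 0 = 0 ∧ (∃ k ≤ a + 1, s.reg 35 = (N + 1) ^ k) ∧ (∀ p ∈ Icc 1 M, s.arr 44 p ≤ M) ∧
      (s.reg 35 ≠ 1 → ∀ p ∈ Icc 1 M, 1 ≤ s.arr 44 p) ∧
      ∀ p ∈ Icc 1 M, ∀ q ∈ Icc 1 M, s.arr 44 p < s.arr 44 q ↔
        CODE p % s.reg 35 < CODE q % s.reg 35)
    (fun s => (a + 1 - Nat.log (N + 1) (s.reg 35)) * (400 * (M + 1)))
    (by
      rintro s ⟨hs, r10, r1, r2, h40, hz, ⟨k, hk, hD⟩, hle, hpos, hlt⟩ he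
      have hka : k ≤ a := by
        simp only [eval_less, eval_reg, eval_add, eval_one, r2, hσw, hD, ne_eq,
          ite_eq_right_iff, one_ne_zero, imp_false, not_not] at he
        exact (Nat.pow_le_pow_iff_right (by omega : 1 < N + 1)).1 (by omega)
      have hk₁ := hpow (k + 1) (by omega)
      have hMulw : ((N + 1) ^ k * (N + 1)) % 2 ^ w = (N + 1) ^ (k + 1) := by
        rw [← pow_succ]; exact Nat.mod_eq_of_lt (by omega)
      obtain ⟨s₂, hr₂, hz₂, h₂⟩ := run_rankBy (w := w) (n := M) (A := 44) (s₀ := s)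
        (k₁ := .load 40 (.reg 11) / .reg 35 % (.reg 1 + 1)) (k₂ := .load 44 (.reg 11)) (e := 1)
        (f₁ := fun p => CODE p / (N + 1) ^ k % (N + 1)) (f₂ := s.arr 44) (W := fun _ => 1) hs r10
        (by decide)
        (by
          intro i hi s' hx hr ha
          have e₁ : s'.reg 35 = (N + 1) ^ k := by rw [hr 35 (by decide), hD]
          have e₂ : s'.reg 1 = N := by rw [hr 1 (by decide), r1]
          have e₃ : s'.arr 40 i = CODE i := by rw [ha 40 (by decide), h40, hC i hi]
          have l₁ : CODE i / (N + 1) ^ k < 2 ^ w := (Nat.div_le_self _ _).trans_lt (by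
            have := hC' i hi; have := hpow a (by omega); omega)
          simp only [eval_mod, eval_div, eval_load, eval_reg, eval_add, eval_one, hx, e₁, e₂, e₃,
            hNw, Nat.mod_eq_of_lt l₁]
          exact Nat.mod_eq_of_lt ((Nat.mod_le _ _).trans_lt l₁))
        (by
          intro i hi s' hx hr ha
          simp only [eval_load, eval_reg, hx, ha 44 (by decide)])
        (by
          intro i hi s' hx hr ha
          simp)
        (fun q hq => (Nat.lt_succ_iff.1 (Nat.mod_lt _ (by omega))).trans hNM) hle
        (fun q hq => le_rfl) hMw
      have hr₃ := Run.assign (w := w) s₂ 35 (.reg 35 * (.reg 1 + 1))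
      have fr : ∀ x, x ≠ 11 → x ≠ 12 → x ≠ 13 → s₂.reg x = s.reg x := fun x h₁ h₂ h₃ =>
        hr₂.rankBy_reg (by simp [h₁, h₂, h₃])
      have hv : (Expr.reg 35 * (.reg 1 + 1)).eval w s₂ = (N + 1) ^ (k + 1) := by
        simp [fr, hD, r1, hNw, hMulw]
      set s₃ := s₂.setReg 35 _ with hs₃
      have h35 : s₃.reg 35 = (N + 1) ^ (k + 1) := by simp [hs₃, hv]
      refine ⟨s₃, _, hr₂.seq hr₃, ⟨(hr₂.seq hr₃).wf hs, ?_, ?_, ?_, ?_, ?_, ⟨k + 1, by omega, h35⟩,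
        fun p hp => ?_, fun _ p hp => ?_, fun p hp q hq => ?_⟩, ?_⟩
      · simp [hs₃, fr, r10]
      · simp [hs₃, fr, r1]
      · simp [hs₃, fr, r2]
      · rw [← h40]; simp [hs₃]; exact hr₂.rankBy_arr (by decide) (by decide)
      · simp [hs₃, hz₂]
      · simp only [hs₃, State.setReg_arr]
        rw [h₂ p hp, lexCount_eq_cnt (P := fun _ => True) (fun _ _ => by simp)
          fun _ _ _ => lexLT_iff]
        exact cnt_lt_of_mem _ hp
      · simp only [hs₃, State.setReg_arr]
        rw [h₂ p hp]; omega
      · rw [h35]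
        simp only [hs₃, State.setReg_arr]
        rw [h₂ p hp, h₂ q hq, Nat.add_lt_add_iff_right, lexCount_lt_iff hp, hlt p hp q hq, hD,
          pow_succ, Nat.mod_mul, Nat.mod_mul, lt_add_mul_iff (Nat.mod_lt _ (by positivity))
          (Nat.mod_lt _ (by positivity))]
      · rw [h35, hD, Nat.log_pow (by omega), Nat.log_pow (by omega)]
        have : a + 1 - k = (a + 1 - (k + 1)) + 1 := by omega
        rw [this, add_mul (a + 1 - (k + 1)) 1, one_mul]
        simp only [cost_load, cost_reg, cost_div, cost_mod, cost_add, cost_one, cost_mul,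
          cost_less]
        omega)
    s₁ ⟨hwf₁, by simp [hs₁, hM], by simp [hs₁, hN], by simp [hs₁, hσ], by simp [hs₁],
      by simp [hs₁, h44], ⟨0, by omega, by simp [hs₁]⟩, by simp [hs₁, h44],
      by simp [hs₁], by simp [hs₁, h44, Nat.mod_one]⟩
  simp only [eval_less, eval_reg, eval_add, eval_one, hσ', hσw, ite_eq_right_iff, one_ne_zero,
    imp_false, not_lt] at he
  -- As `σ ≥ 1`, the final power is not 1, so at least one pass has replaced the initial zeros by
  -- positive ranks.
  refine ⟨s', (hr₁.seq hr).mono ?_, hz, fun p hp => mem_Icc.2 ⟨hpos (by omega) p hp, hle p hp⟩,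
    fun p hp q hq => ?_⟩
  · have : a + 1 - Nat.log (N + 1) (s₁.reg 35) ≤ a + 1 := Nat.sub_le _ _
    have := Nat.mul_le_mul_right (400 * (M + 1)) this
    have e : (a + 3) * (400 * (M + 1)) = (a + 1) * (400 * (M + 1)) + 2 * (400 * (M + 1)) := by
      ring
    rw [e]
    simp only [cost_less, cost_add, cost_reg, cost_one]
    omega
  · have := hC' p hp
    have := hC' q hq
    rw [hlt p hp q hq, Nat.mod_eq_of_lt (by omega), Nat.mod_eq_of_lt (by omega)]

end CAO

/-! ### Dividing the sorted positions into blocks -/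

namespace CAO

open Finset

/-- `S` lists the positions in the order of their ranks `R`. -/
structure Sorted (M : ℕ) (R S : ℕ → ℕ) : Prop where
  mem : ∀ i ∈ Icc 1 M, S i ∈ Icc 1 M
  surj : ∀ p ∈ Icc 1 M, ∃ i ∈ Icc 1 M, S i = p
  inj : ∀ i ∈ Icc 1 M, ∀ j ∈ Icc 1 M, S i = S j → i = j
  mono : ∀ i ∈ Icc 1 M, ∀ j ∈ Icc 1 M, i ≤ j → R (S i) ≤ R (S j)

/-- Sort the positions by their ranks in the array `46` into the array `48`. -/
def sortRanks : Prog :=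
  rankBy (.load 46 (.reg 11)) (.reg 11) 1 47 ;; .fill 30 10 48 (.load 47 (.reg 30)) (.reg 30)

/-- Ties are broken by the position, so the new ranks form a permutation, and inverting it lists the
positions in order. -/
theorem run_sortRanks {w : ℕ} [hw : Fact (8 ≤ 2 ^ w)] {M : ℕ} {R : ℕ → ℕ} {s₀ : State}
    (hwf : WF w s₀) (hM : s₀.reg 10 = M) (hR : ∀ p ∈ Icc 1 M, s₀.arr 46 p = R p)
    (hR' : ∀ p ∈ Icc 1 M, R p ≤ M) (h48 : s₀.arr 48 0 = 0) (hMw : M + 1 < 2 ^ w) :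
    ∃ s', Run w sortRanks (500 * (M + 1)) s₀ s' ∧ s'.arr 48 0 = 0 ∧
      Sorted M R (s'.arr 48) := by
  obtain ⟨s₁, hr₁, -, h₁⟩ := run_rankBy (w := w) (n := M) (A := 47) (s₀ := s₀)
    (k₁ := .load 46 (.reg 11)) (k₂ := .reg 11) (e := 1) (f₁ := R) (f₂ := fun p => p)
    (W := fun _ => 1) hwf hM (by decide)
    (fun i hi s hx hr ha => by simp only [eval_load, eval_reg, hx, ha 46 (by decide), hR i hi])
    (fun i hi s hx hr ha => by simp only [eval_reg, hx])
    (fun i hi s hx hr ha => by simp) hR' (fun q hq => (mem_Icc.1 hq).2) (fun _ _ => le_rfl) hMw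
  have hlt : ∀ p ∈ Icc 1 M, ∀ q ∈ Icc 1 M,
      s₁.arr 47 p < s₁.arr 47 q ↔ R p < R q ∨ R p = R q ∧ p < q := by
    intro p hp q hq
    rw [h₁ p hp, h₁ q hq, Nat.add_lt_add_iff_right, lexCount_lt_iff hp]
  have hmem : ∀ p ∈ Icc 1 M, s₁.arr 47 p ∈ Icc 1 M := by
    intro p hp
    rw [h₁ p hp, lexCount_eq_cnt (P := fun _ => True) (fun _ _ => by simp)
      fun _ _ _ => lexLT_iff]
    have := cnt_lt_of_mem (K := fun q => toLex (R q, q)) (fun _ => True) hp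
    exact mem_Icc.2 ⟨by omega, this⟩
  have hinj : Set.InjOn (s₁.arr 47) (Set.Icc 1 M) := by
    intro p hp q hq he
    have h₂ := hlt p (by simpa using hp) q (by simpa using hq)
    have h₃ := hlt q (by simpa using hq) p (by simpa using hp)
    omega
  have hsurj : ∀ i ∈ Icc 1 M, ∃ p ∈ Icc 1 M, s₁.arr 47 p = i := by
    have : (Icc 1 M).image (s₁.arr 47) = Icc 1 M := by
      apply eq_of_subset_of_card_le
      · intro x hx
        obtain ⟨q, hq, rfl⟩ := mem_image.1 hx
        exact hmem q hq
      · rw [card_image_of_injOn (by simpa using hinj)]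
    intro i hi
    rw [← this] at hi
    simpa using hi
  obtain ⟨s', hr', hS, hS'⟩ := run_fill (w := w) (x := 30) (m := 10) (A := 48) (n := M)
    (i := .load 47 (.reg 30)) (e := .reg 30) (hr₁.wf hwf)
    (by rw [hr₁.rankBy_reg (by decide), hM]) (by norm_num) (s₁.arr 47) (fun p => p) hinj
    (fun k hk s hx hr ha _ _ => by simp [hx, ha 47])
  have hS : ∀ p ∈ Icc 1 M, s'.arr 48 (s₁.arr 47 p) = p := fun p hp => hS p (by simpa using hp)
  refine ⟨s', (hr₁.seq hr').mono ?_, ?_, fun i hi => ?_, fun p hp => ⟨_, hmem p hp, hS p hp⟩,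
    fun i hi j hj he => ?_, fun i hi j hj hij => ?_⟩
  · simp only [cost_load, cost_reg, cost_one]
    omega
  · rw [hS' 0 fun k hk => ?_, hr₁.rankBy_arr (by decide) (by decide), h48]
    have := mem_Icc.1 (hmem k (by simpa using hk))
    omega
  · obtain ⟨p, hp, rfl⟩ := hsurj i hi
    rwa [hS p hp]
  · obtain ⟨p, hp, rfl⟩ := hsurj i hi
    obtain ⟨q, hq, rfl⟩ := hsurj j hj
    rw [hS p hp, hS q hq] at he
    rw [he]
  · obtain ⟨p, hp, rfl⟩ := hsurj i hi
    obtain ⟨q, hq, rfl⟩ := hsurj j hj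
    rw [hS p hp, hS q hq]
    have := hlt q hq p hp
    omega

/-- Number the blocks of equal ranks, and mark those with different preceding symbols. -/
def blockBody : Prog :=
  .assign 37 (.load 48 (.reg 30)) ;; .assign 38 (.load 48 (.reg 30 - 1)) ;;
  .ite ((Expr.load 46 (.reg 37)).same (.load 46 (.reg 38)))
    (.ite ((Expr.load 45 (.reg 37)).same (.load 45 (.reg 38)) * Expr.less 0 (.load 45 (.reg 37)))
      .skip (.store 50 (.reg 36) 1))
    (.assign 36 (.reg 36 + 1)) ;;
  .store 49 (.reg 37) (.reg 36)

/-- The invariant of the loop that numbers the blocks. -/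
structure BlockInv (i : ℕ) (PC R S DB MU : ℕ → ℕ) (kk : ℕ) : Prop where
  le : kk ≤ i
  last : DB (S i) = kk ∨ i = 0
  mem : ∀ j ∈ Icc 1 i, DB (S j) ∈ Icc 1 kk
  surj : ∀ k ∈ Icc 1 kk, ∃ j ∈ Icc 1 i, DB (S j) = k
  lt_iff : ∀ j ∈ Icc 1 i, ∀ j' ∈ Icc 1 i, DB (S j) < DB (S j') ↔ R (S j) < R (S j')
  multi : ∀ k, MU k ≠ 0 ↔ ∃ j ∈ Icc 1 i, ∃ j' ∈ Icc 1 i, DB (S j) = k ∧ DB (S j') = k ∧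
    ¬ (j = j' ∨ PC (S j) = PC (S j') ∧ PC (S j) ≠ 0)

/-- It suffices to compare each position with the one before it in sorted order: if no neighbours in
a block carry different symbols, then the whole block carries one symbol. -/
theorem BlockInv.step {M i kk kk' : ℕ} {PC R S DB MU DB' MU' : ℕ → ℕ}
    (h : BlockInv i PC R S DB MU kk) (hi : i < M) (hS : Sorted M R S) (hS₀ : i = 0 → R (S 0) = 0)
    (hR : ∀ p ∈ Icc 1 M, 1 ≤ R p) (hkk' : kk' = if R (S (i + 1)) = R (S i) then kk else kk + 1)
    (hDB : ∀ p, DB' p = if p = S (i + 1) then kk' else DB p)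
    (hMU : ∀ k, MU' k = if R (S (i + 1)) = R (S i) ∧
      ¬ (PC (S (i + 1)) = PC (S i) ∧ PC (S (i + 1)) ≠ 0) ∧ k = kk then 1 else MU k) :
    BlockInv (i + 1) PC R S DB' MU' kk' := by
  have hi' : i + 1 ∈ Icc 1 M := by simp; omega
  have hDB₁ : DB' (S (i + 1)) = kk' := by rw [hDB, if_pos rfl]
  have hDB₂ : ∀ j ∈ Icc 1 i, DB' (S j) = DB (S j) := by
    intro j hj
    have hj' := mem_Icc.1 hj
    rw [hDB, if_neg fun he => ?_]
    have := hS.inj j (by simp; omega) (i + 1) hi' he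
    omega
  have hsplit : ∀ j, j ∈ Icc 1 (i + 1) ↔ j = i + 1 ∨ j ∈ Icc 1 i := by
    intro j; simp; omega
  have hR₁ := hR _ (hS.mem _ hi')
  -- The entry with index 0 has rank 0, below all positions, so the first position always opens a
  -- new block.
  have hpos : R (S (i + 1)) = R (S i) → i ∈ Icc 1 i ∧ DB (S i) = kk := by
    intro he
    rcases Nat.eq_zero_or_pos i with h₀ | h₀
    · have := hS₀ h₀
      rw [h₀] at he hR₁
      omega
    · exact ⟨by simp; omega, h.last.resolve_right (by omega)⟩
  have hmono : ∀ j ∈ Icc 1 i, R (S j) ≤ R (S i) ∧ R (S i) ≤ R (S (i + 1)) ∧ DB (S i) = kk ∧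
      i ∈ Icc 1 i := by
    intro j hj
    have hj' := mem_Icc.1 hj
    exact ⟨hS.mono _ (by simp; omega) _ (by simp; omega) hj'.2,
      hS.mono _ (by simp; omega) _ hi' (by omega), h.last.resolve_right (by omega),
      by simp; omega⟩
  have hcmp : ∀ j ∈ Icc 1 i, (DB (S j) < kk' ↔ R (S j) < R (S (i + 1))) ∧ DB (S j) ≤ kk' := by
    intro j hj
    obtain ⟨h₁, h₂, h₃, h₄⟩ := hmono j hj
    have h₅ := mem_Icc.1 (h.mem j hj)
    have h₆ := h.lt_iff j hj i h₄
    rw [hkk']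
    split_ifs with he
    · omega
    · omega
  refine ⟨?_, Or.inl hDB₁, fun j hj => ?_, fun k hk => ?_, fun j hj j' hj' => ?_, fun k => ?_⟩
  · have := h.le
    rw [hkk']; split_ifs <;> omega
  · rcases (hsplit j).1 hj with rfl | hj
    · rw [hDB₁, hkk', mem_Icc]
      split_ifs with he
      · obtain ⟨h₁, h₂⟩ := hpos he
        have := mem_Icc.1 (h.mem i h₁)
        omega
      · omega
    · have := (hcmp j hj).2
      have := mem_Icc.1 (h.mem j hj)
      rw [hDB₂ j hj, mem_Icc]
      omega
  · by_cases hk' : k = kk'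
    · exact ⟨i + 1, by simp, by rw [hDB₁, hk']⟩
    · obtain ⟨j, hj, he⟩ := h.surj k (by
        rw [mem_Icc] at hk ⊢
        rw [hkk'] at hk hk'
        split_ifs at hk hk' <;> omega)
      exact ⟨j, (hsplit j).2 (Or.inr hj), by rw [hDB₂ j hj, he]⟩
  · rcases (hsplit j).1 hj with rfl | hj <;> rcases (hsplit j').1 hj' with rfl | hj'
    · simp
    · rw [hDB₁, hDB₂ j' hj']
      have := hcmp j' hj'
      obtain ⟨h₁, h₂, -⟩ := hmono j' hj'
      omega
    · rw [hDB₁, hDB₂ j hj]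
      exact (hcmp j hj).1
    · rw [hDB₂ j hj, hDB₂ j' hj']
      exact h.lt_iff j hj j' hj'
  · have hm := h.multi k
    constructor
    · intro hk
      rw [hMU] at hk
      split_ifs at hk with hc
      · obtain ⟨hc₁, hc₂, hc₃⟩ := hc
        obtain ⟨h₁, h₂⟩ := hpos hc₁
        refine ⟨i + 1, by simp, i, (hsplit i).2 (Or.inr h₁), ?_, ?_, ?_⟩
        · rw [hDB₁, hkk', if_pos hc₁, hc₃]
        · rw [hDB₂ i h₁, h₂, hc₃]
        · rintro (h₃ | h₃)
          · omega
          · exact hc₂ h₃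
      · obtain ⟨j, hj, j', hj', h₁, h₂, h₃⟩ := hm.1 hk
        exact ⟨j, (hsplit j).2 (Or.inr hj), j', (hsplit j').2 (Or.inr hj'),
          by rw [hDB₂ j hj, h₁], by rw [hDB₂ j' hj', h₂], h₃⟩
    · rintro ⟨j, hj, j', hj', h₁, h₂, h₃⟩
      rw [hMU]
      split_ifs with hc
      · exact one_ne_zero
      -- If the new symbol differs from an older one of its block but equals its neighbour, then the
      -- neighbour differs from that older one, and the block was marked before.
      have hnew : ∀ j' ∈ Icc 1 i, DB' (S (i + 1)) = k → DB' (S j') = k →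
          ¬ (PC (S (i + 1)) = PC (S j') ∧ PC (S (i + 1)) ≠ 0) → MU k ≠ 0 := by
        intro j' hj' h₁ h₂ h₃
        rw [hDB₁] at h₁
        rw [hDB₂ j' hj'] at h₂
        have he : R (S (i + 1)) = R (S i) := by
          by_contra he
          rw [if_neg he] at hkk'
          have := mem_Icc.1 (h.mem j' hj')
          omega
        obtain ⟨h₄, h₅⟩ := hpos he
        rw [if_pos he] at hkk'
        have hc' : PC (S (i + 1)) = PC (S i) ∧ PC (S (i + 1)) ≠ 0 := by
          by_contra hc'
          exact hc ⟨he, hc', by omega⟩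
        refine hm.2 ⟨i, h₄, j', hj', by omega, h₂, ?_⟩
        rintro (rfl | h₆)
        · exact h₃ hc'
        · exact h₃ ⟨hc'.1.trans h₆.1, hc'.2⟩
      rcases (hsplit j).1 hj with rfl | hj <;> rcases (hsplit j').1 hj' with rfl | hj'
      · exact absurd (Or.inl rfl) h₃
      · exact hnew j' hj' h₁ h₂ fun h => h₃ (Or.inr h)
      · exact hnew j hj h₂ h₁ fun h => h₃ (Or.inr ⟨h.1.symm, h.1 ▸ h.2⟩)
      · rw [hDB₂ j hj] at h₁
        rw [hDB₂ j' hj'] at h₂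
        exact hm.2 ⟨j, hj, j', hj', h₁, h₂, h₃⟩

theorem run_blockBody {w : ℕ} [hw : Fact (8 ≤ 2 ^ w)] {M : ℕ} {PC R S : ℕ → ℕ} {s₀ : State}
    (hwf : WF w s₀) (hM : s₀.reg 10 = M) (hPC : ∀ p ∈ Icc 1 M, s₀.arr 45 p = PC p)
    (hR : ∀ p ≤ M, s₀.arr 46 p = R p) (hS : ∀ i ≤ M, s₀.arr 48 i = S i) (hS₀ : S 0 = 0)
    (hR₀ : R 0 = 0) (hR₁ : ∀ p ∈ Icc 1 M, 1 ≤ R p) (hSs : Sorted M R S) (h36 : s₀.reg 36 = 0)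
    (h50 : ∀ k, s₀.arr 50 k = 0) (hMw : M + 1 < 2 ^ w) :
    ∃ s', Run w (.upto 30 10 blockBody) (100 * (M + 1)) s₀ s' ∧
      BlockInv M PC R S (s'.arr 49) (s'.arr 50) (s'.reg 36) := by
  obtain ⟨s', hr, h⟩ := run_upto_flat (w := w) (x := 30) (m := 10) (p := blockBody) hwf hM rfl
    (by norm_num) rfl rfl (fun i s => BlockInv i PC R S (s.arr 49) (s.arr 50) (s.reg 36))
    (fun i s v h => by simpa using h)
    ⟨by omega, Or.inr rfl, by simp, by simp [h36], by simp, fun k => by simp [h50]⟩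
    (by
      intro i hi s hs hx hr ha h
      have hle := h.le
      have hSi : S i ≤ M := by
        rcases Nat.eq_zero_or_pos i with h₀ | h₀
        · rw [h₀, hS₀]; omega
        · exact (mem_Icc.1 (hSs.mem i (by simp; omega))).2
      have hSi' := hSs.mem (i + 1) (by simp; omega)
      have hSi₂ := (mem_Icc.1 hSi').2
      have m₁ : i % 2 ^ w = i := Nat.mod_eq_of_lt (by omega)
      have m₂ : (s.reg 36 + 1) % 2 ^ w = s.reg 36 + 1 := Nat.mod_eq_of_lt (by omega)
      have a48 : s.arr 48 (i + 1) = S (i + 1) ∧ s.arr 48 i = S i := by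
        rw [ha 48 rfl, hS _ (by omega), hS _ (by omega)]; exact ⟨rfl, rfl⟩
      have a46 : s.arr 46 (S (i + 1)) = R (S (i + 1)) ∧ s.arr 46 (S i) = R (S i) := by
        rw [ha 46 rfl, hR _ hSi₂, hR _ hSi]; exact ⟨rfl, rfl⟩
      have a45 : s.arr 45 (S (i + 1)) = PC (S (i + 1)) := by rw [ha 45 rfl, hPC _ hSi']
      have a45' : R (S (i + 1)) = R (S i) → s.arr 45 (S i) = PC (S i) := by
        intro he
        rw [ha 45 rfl, hPC _ (mem_Icc.2 ⟨?_, hSi⟩)]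
        by_contra h₀
        have := hR₁ _ hSi'
        rw [he, show S i = 0 by omega, hR₀] at this
        omega
      set b := blockBody with hb
      by_cases he : R (S (i + 1)) = R (S i)
      · by_cases hc : PC (S (i + 1)) = PC (S i) ∧ PC (S (i + 1)) ≠ 0
        · have hden : b.den w s = ((s.setReg 37 (S (i + 1))).setReg 38 (S i)).setArr 49
              (S (i + 1)) (s.reg 36) := by
            have hc' : PC (S i) ≠ 0 := hc.1 ▸ hc.2
            simp only [he] at a46
            simp [hb, blockBody, Prog.den, hx, m₁, a48, a46, a45' he, a45, hc.1,
              Nat.pos_of_ne_zero hc', Nat.mod_eq_of_lt (show 1 < 2 ^ w by omega)]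
          rw [hden]
          refine h.step hi hSs (fun h₀ => by rw [hS₀, hR₀]) hR₁ (by rw [if_pos he]; simp)
            (fun p => by simp) fun k => ?_
          rw [if_neg (by tauto)]
          simp
        · have hden : b.den w s = (((s.setReg 37 (S (i + 1))).setReg 38 (S i)).setArr 50
              (s.reg 36) 1).setArr 49 (S (i + 1)) (s.reg 36) := by
            simp only [he] at a46
            have hc' : (if PC (S (i + 1)) = PC (S i) then 1 else 0) *
                (if 0 < PC (S (i + 1)) then 1 else 0) = 0 := by
              rcases not_and_or.1 hc with h₁ | h₁
              · simp [h₁]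
              · simp [not_not.1 h₁]
            simp [hb, blockBody, Prog.den, hx, m₁, a48, a46, a45' he, a45, -mul_ite, -ite_mul,
              hc', -mul_eq_zero]
          rw [hden]
          refine h.step hi hSs (fun h₀ => by rw [hS₀, hR₀]) hR₁ (by rw [if_pos he]; simp)
            (fun p => by simp) fun k => ?_
          simp [he]
          grind
      · have hden : b.den w s = (((s.setReg 37 (S (i + 1))).setReg 38 (S i)).setReg 36
            (s.reg 36 + 1)).setArr 49 (S (i + 1)) (s.reg 36 + 1) := by
          simp [hb, blockBody, Prog.den, hx, m₁, m₂, a48, a46, he]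
        rw [hden]
        refine h.step hi hSs (fun h₀ => by rw [hS₀, hR₀]) hR₁ (by rw [if_neg he]; simp)
          (fun p => by simp) fun k => ?_
        rw [if_neg (by tauto)]
        simp)
  refine ⟨s', hr.mono ?_, h⟩
  simp only [blockBody, Prog.time, cost_add, cost_sub, cost_load, cost_reg, cost_zero, cost_one,
    cost_same, cost_mul, cost_less]
  omega

theorem BlockInv.blockNumber {M K : ℕ} {PC R S DB MU : ℕ → ℕ}
    (h : BlockInv M PC R S DB MU (K + 1)) (hS : Sorted M R S) : BlockNumber M K R DB where
  mem p hp := by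
    obtain ⟨i, hi, rfl⟩ := hS.surj p hp
    exact h.mem i hi
  surj k hk := by
    obtain ⟨i, hi, rfl⟩ := h.surj k hk
    exact ⟨_, hS.mem i hi, rfl⟩
  lt_iff p hp q hq := by
    obtain ⟨i, hi, rfl⟩ := hS.surj p hp
    obtain ⟨j, hj, rfl⟩ := hS.surj q hq
    exact h.lt_iff i hi j hj

theorem BlockInv.multi_iff {α : Type} {M kk : ℕ} {sy : ℕ → α} {PC R S DB MU : ℕ → ℕ}
    (h : BlockInv M PC R S DB MU kk) (hS : Sorted M R S)
    (hsy : ∀ p ∈ Icc 1 M, ∀ q ∈ Icc 1 M, sy p = sy q ↔ p = q ∨ PC p = PC q ∧ PC p ≠ 0) (k : ℕ) :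
    MU k ≠ 0 ↔ Multi M sy DB k := by
  rw [h.multi]
  constructor
  · rintro ⟨i, hi, j, hj, h₁, h₂, h₃⟩
    refine ⟨S i, hS.mem i hi, S j, hS.mem j hj, h₁, h₂, ?_⟩
    rw [ne_eq, hsy _ (hS.mem i hi) _ (hS.mem j hj)]
    exact fun h' => h₃ (h'.imp_left (hS.inj i hi j hj))
  · rintro ⟨p, hp, q, hq, h₁, h₂, h₃⟩
    obtain ⟨i, hi, rfl⟩ := hS.surj p hp
    obtain ⟨j, hj, rfl⟩ := hS.surj q hq
    refine ⟨i, hi, j, hj, h₁, h₂, fun h' => h₃ ?_⟩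
    rw [hsy _ hp _ hq]
    exact h'.imp_left (congrArg S)

end CAO

/-! ### Choosing the symbols at which blocks merge -/

namespace CAO

open Finset

theorem Greedy.congr {K : ℕ} {Sh Sh' : ℕ → ℕ → Prop} {Mu Mu' : ℕ → Prop} {a₁ a₂ : ℕ → ℕ}
    (h : Greedy K Sh Mu a₁ a₂) (hSh : ∀ k ∈ Icc 1 K, ∀ c, Sh' k c ↔ Sh k c)
    (hMu : ∀ k, Mu' k ↔ Mu k) : Greedy K Sh' Mu' a₁ a₂ where
  zero := h.zero
  fst k hk h₀ := by rw [hSh k hk, hMu]; exact h.fst k hk h₀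
  snd k hk h₀ := by rw [hSh k hk, hMu]; exact h.snd k hk h₀
  full k hk c hc := by rw [hMu]; exact h.full k hk c ((hSh k hk c).1 hc)

/-- A newly discovered shared symbol that is ruled out, or that is already the first candidate,
requires no change. -/
theorem Greedy.mono {K k c : ℕ} {Sh Sh' : ℕ → ℕ → Prop} {Mu : ℕ → Prop} {a₁ a₂ : ℕ → ℕ}
    (h : Greedy K Sh Mu a₁ a₂)
    (hSh : ∀ k' ∈ Icc 1 K, ∀ c', Sh' k' c' ↔ Sh k' c' ∨ k' = k ∧ c' = c)
    (hall : ¬ ((Mu k → a₁ (k - 1) = c → a₂ (k - 1) ≠ 0) ∧ a₁ k ≠ c)) :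
    Greedy K Sh' Mu a₁ a₂ where
  zero := h.zero
  fst k' hk' h₀ := ⟨(hSh k' hk' _).2 (Or.inl (h.fst k' hk' h₀).1), (h.fst k' hk' h₀).2⟩
  snd k' hk' h₀ := by
    obtain ⟨h₁, h₂, h₃, h₄⟩ := h.snd k' hk' h₀
    exact ⟨h₁, h₂, (hSh k' hk' _).2 (Or.inl h₃), h₄⟩
  full k' hk' c' hc' ha := by
    rcases (hSh k' hk' c').1 hc' with h₁ | ⟨rfl, rfl⟩
    · exact h.full k' hk' c' h₁ ha
    · by_contra hcon
      exact hall ⟨ha, fun h' => hcon (Or.inr h')⟩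

/-- Any two distinct admissible symbols serve equally well, so a third one may simply overwrite the
second. As no shared symbol is known yet at the next boundary (`hnext`), no earlier decision
depended on the entries that change. -/
theorem Greedy.insert {K k c : ℕ} {Sh Sh' : ℕ → ℕ → Prop} {Mu : ℕ → Prop} {a₁ a₂ : ℕ → ℕ}
    (h : Greedy K Sh Mu a₁ a₂) (hk : k ∈ Icc 1 K)
    (hSh : ∀ k' ∈ Icc 1 K, ∀ c', Sh' k' c' ↔ Sh k' c' ∨ k' = k ∧ c' = c)
    (hSh₀ : ∀ k c, Sh k c → c ≠ 0) (hnext : ∀ c', ¬ Sh (k + 1) c') (hc : c ≠ 0)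
    (hall : Mu k → a₁ (k - 1) = c → a₂ (k - 1) ≠ 0) (hne : a₁ k ≠ c) :
    Greedy K Sh' Mu (if a₁ k = 0 then Function.update a₁ k c else a₁)
      (if a₁ k = 0 then a₂ else Function.update a₂ k c) := by
  have hk' := mem_Icc.1 hk
  have hn₁ : k + 1 ∈ Icc 1 K → a₁ (k + 1) = 0 ∧ a₂ (k + 1) = 0 := fun hm => by
    constructor
    · by_contra h₀
      exact hnext _ (h.fst _ hm h₀).1
    · by_contra h₀
      exact hnext _ (h.snd _ hm h₀).2.2.1
  have hs : ∀ {k' c'}, k' ∈ Icc 1 K → Sh k' c' → Sh' k' c' := fun hm hc =>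
    (hSh _ hm _).2 (Or.inl hc)
  have hkc : Sh' k c := (hSh k hk c).2 (Or.inr ⟨rfl, rfl⟩)
  have hks : k - 1 ≠ k := by omega
  split_ifs with h₀
  · have ha₂ : a₂ k = 0 := by
      by_contra hh
      exact (h.snd k hk hh).1 h₀
    refine ⟨?_, fun k' hm h₁ => ?_, fun k' hm h₁ => ?_, fun k' hm c' hc' ha => ?_⟩
    · rw [Function.update_of_ne (by omega), h.zero]
    · by_cases e : k' = k
      · subst e
        rw [Function.update_self, Function.update_of_ne hks]
        exact ⟨hkc, hall⟩
      · rw [Function.update_of_ne e] at h₁ ⊢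
        have e' : k' ≠ k + 1 := by
          rintro rfl; exact h₁ (hn₁ hm).1
        rw [Function.update_of_ne (by omega)]
        obtain ⟨h₂, h₃⟩ := h.fst k' hm h₁
        exact ⟨hs hm h₂, h₃⟩
    · have e : k' ≠ k := by rintro rfl; exact h₁ ha₂
      have e' : k' ≠ k + 1 := by
        rintro rfl; exact h₁ (hn₁ hm).2
      rw [Function.update_of_ne e, Function.update_of_ne (by omega)]
      obtain ⟨h₂, h₃, h₄, h₅⟩ := h.snd k' hm h₁
      exact ⟨h₂, h₃, hs hm h₄, h₅⟩
    · rcases (hSh k' hm c').1 hc' with h₁ | ⟨rfl, rfl⟩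
      · have e' : k' ≠ k + 1 := by
          rintro rfl; exact hnext _ h₁
        rw [Function.update_of_ne (by have := mem_Icc.1 hm; omega)] at ha
        by_cases e : k' = k
        · subst e
          rcases h.full k' hm c' h₁ ha with h₂ | h₂
          · exact Or.inl h₂
          · rw [h₀] at h₂
            exact absurd h₂.symm (hSh₀ _ _ h₁)
        · rw [Function.update_of_ne e]
          exact h.full k' hm c' h₁ ha
      · exact Or.inr (Function.update_self ..)
  · refine ⟨h.zero, fun k' hm h₁ => ?_, fun k' hm h₁ => ?_, fun k' hm c' hc' ha => ?_⟩
    · have e' : k' ≠ k + 1 := by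
        rintro rfl; exact h₁ (hn₁ hm).1
      rw [Function.update_of_ne (by have := mem_Icc.1 hm; omega)]
      obtain ⟨h₂, h₃⟩ := h.fst k' hm h₁
      exact ⟨hs hm h₂, h₃⟩
    · by_cases e : k' = k
      · subst e
        rw [Function.update_self, Function.update_of_ne hks]
        exact ⟨h₀, fun e => hne e.symm, hkc, hall⟩
      · rw [Function.update_of_ne e] at h₁ ⊢
        have e' : k' ≠ k + 1 := by
          rintro rfl; exact h₁ (hn₁ hm).2
        rw [Function.update_of_ne (by have := mem_Icc.1 hm; omega)]
        obtain ⟨h₂, h₃, h₄, h₅⟩ := h.snd k' hm h₁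
        exact ⟨h₂, h₃, hs hm h₄, h₅⟩
    · by_cases e : k' = k
      · subst e
        rw [Function.update_self]
        exact Or.inl hc
      · rw [Function.update_of_ne e]
        rcases (hSh k' hm c').1 hc' with h₁ | h₁
        · have e' : k' ≠ k + 1 := by
            rintro rfl; exact hnext _ h₁
          rw [Function.update_of_ne (by have := mem_Icc.1 hm; omega)] at ha
          exact h.full k' hm c' h₁ ha
        · exact absurd h₁.1 e


/-- The conjunction of two tests. -/
def Expr.both (e₁ e₂ : Expr) : Expr := Expr.less 0 e₁ * Expr.less 0 e₂

/-- The negation of a test. -/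
def Expr.fails (e : Expr) : Expr := e.same 0

/-! ### Evaluation of composite tests -/

section Tests

variable {w : ℕ} {s : State} [hw : Fact (8 ≤ 2 ^ w)]

@[simp] theorem eval_both (a b : Expr) :
    (a.both b).eval w s = if a.eval w s ≠ 0 ∧ b.eval w s ≠ 0 then 1 else 0 := by
  simp only [Expr.both, eval_mul, eval_less, eval_zero, Nat.pos_iff_ne_zero]
  rw [small_mod (by split_ifs <;> norm_num)]
  split_ifs <;> simp_all

@[simp] theorem eval_fails (a : Expr) :
    a.fails.eval w s = if a.eval w s = 0 then 1 else 0 := by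
  simp [Expr.fails]

end Tests

@[simp] theorem cost_both (a b : Expr) : (a.both b).cost = a.cost + b.cost + 5 := by
  simp [Expr.both]; omega

@[simp] theorem cost_fails (a : Expr) : a.fails.cost = a.cost + 2 := rfl

/-- The test whether the symbol in register `38` becomes a candidate for the boundary before the
block in register `39`. -/
def candTest : Expr :=
  (Expr.less 1 (.reg 39)).both ((Expr.reg 38).both
    (((Expr.load 51 (.reg 38) + 1).same (.reg 39)).both
      ((((Expr.load 50 (.reg 39 - 1)).both (((Expr.load 52 (.reg 39 - 2)).same (.reg 38)).both
        (Expr.load 53 (.reg 39 - 2)).fails)).fails).both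
          ((Expr.load 52 (.reg 39 - 1)).same (.reg 38)).fails)))

/-- Determine the candidates for the boundary before a block. -/
def candBody : Prog :=
  .assign 37 (.load 48 (.reg 30)) ;; .assign 38 (.load 45 (.reg 37)) ;;
  .assign 39 (.load 49 (.reg 37)) ;;
  .ite candTest (.ite (.load 52 (.reg 39 - 1)) (.store 53 (.reg 39 - 1) (.reg 38))
    (.store 52 (.reg 39 - 1) (.reg 38))) .skip ;;
  .store 51 (.reg 38) (.reg 39)

/-- The symbol `c` occurs in the blocks `k` and `k + 1`, among the first `i` positions. -/
def SharedUpTo (PC S DB : ℕ → ℕ) (i k c : ℕ) : Prop :=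
  c ≠ 0 ∧ (∃ j ∈ Icc 1 i, DB (S j) = k ∧ PC (S j) = c) ∧
    ∃ j ∈ Icc 1 i, DB (S j) = k + 1 ∧ PC (S j) = c

/-- The invariant of the loop that determines the candidates. -/
structure CandInv (K : ℕ) (PC S DB : ℕ → ℕ) (Mu : ℕ → Prop) (i : ℕ) (LAST a₁ a₂ : ℕ → ℕ) :
    Prop where
  le_last : ∀ j ∈ Icc 1 i, PC (S j) ≠ 0 → DB (S j) ≤ LAST (PC (S j))
  last : ∀ c ≠ 0, LAST c ≠ 0 → ∃ j ∈ Icc 1 i, PC (S j) = c ∧ DB (S j) = LAST c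
  greedy : Greedy K (SharedUpTo PC S DB i) Mu a₁ a₂
  out : ∀ k, K < k → a₁ k = 0

/-- The positions come in the order of their blocks. So a symbol of block `d` is newly found to be
shared at the boundary `d - 1` exactly if it was last seen in block `d - 1`, and the candidates of
the boundary `d - 2` are final by then. -/
theorem CandInv.step {K i d c : ℕ} {PC S DB LAST a₁ a₂ LAST' a₁' a₂' : ℕ → ℕ} {Mu : ℕ → Prop}
    (h : CandInv K PC S DB Mu i LAST a₁ a₂) (hd : DB (S (i + 1)) = d) (hc : PC (S (i + 1)) = c)
    (hdK : d ∈ Icc 1 (K + 1)) (hmono : ∀ j ∈ Icc 1 i, DB (S j) ≤ d)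
    (hL : ∀ x, LAST' x = if x = c then d else LAST x)
    (hpos : 1 < d ∧ c ≠ 0 ∧ LAST c + 1 = d ∧
        ¬ (Mu (d - 1) ∧ a₁ (d - 2) = c ∧ a₂ (d - 2) = 0) ∧ a₁ (d - 1) ≠ c →
      a₁' = (if a₁ (d - 1) = 0 then Function.update a₁ (d - 1) c else a₁) ∧
      a₂' = if a₁ (d - 1) = 0 then a₂ else Function.update a₂ (d - 1) c)
    (hneg : ¬ (1 < d ∧ c ≠ 0 ∧ LAST c + 1 = d ∧
        ¬ (Mu (d - 1) ∧ a₁ (d - 2) = c ∧ a₂ (d - 2) = 0) ∧ a₁ (d - 1) ≠ c) →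
      a₁' = a₁ ∧ a₂' = a₂) :
    CandInv K PC S DB Mu (i + 1) LAST' a₁' a₂' := by
  have hdK := mem_Icc.1 hdK
  have hsplit : ∀ j, j ∈ Icc 1 (i + 1) ↔ j = i + 1 ∨ j ∈ Icc 1 i := by
    intro j; simp; omega
  have hd₂ : d - 1 - 1 = d - 2 := by omega
  have hsh : ∀ k c', SharedUpTo PC S DB (i + 1) k c' ↔ SharedUpTo PC S DB i k c' ∨
      k + 1 = d ∧ c' = c ∧ c ≠ 0 ∧ ∃ j ∈ Icc 1 i, DB (S j) = k ∧ PC (S j) = c := by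
    intro k c'
    constructor
    · rintro ⟨h₀, ⟨j, hj, h₁, h₂⟩, j', hj', h₃, h₄⟩
      rcases (hsplit j').1 hj' with rfl | hj'
      · rcases (hsplit j).1 hj with rfl | hj
        · omega
        · have e : c' = c := h₄.symm.trans hc
          exact Or.inr ⟨by omega, e, e ▸ h₀, j, hj, h₁, h₂.trans e⟩
      · rcases (hsplit j).1 hj with rfl | hj
        · have := hmono j' hj'
          omega
        · exact Or.inl ⟨h₀, ⟨j, hj, h₁, h₂⟩, j', hj', h₃, h₄⟩
    · rintro (⟨h₀, ⟨j, hj, h₁, h₂⟩, j', hj', h₃, h₄⟩ | ⟨h₀, rfl, h₂, j, hj, h₃, h₄⟩)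
      · exact ⟨h₀, ⟨j, (hsplit j).2 (Or.inr hj), h₁, h₂⟩, j', (hsplit j').2 (Or.inr hj'), h₃, h₄⟩
      · exact ⟨h₂, ⟨j, (hsplit j).2 (Or.inr hj), h₃, h₄⟩, i + 1, by simp, by omega, hc⟩
  have hnext : ∀ c', ¬ SharedUpTo PC S DB i (d - 1 + 1) c' := by
    rintro c' ⟨-, -, j, hj, h₁, -⟩
    have := hmono j hj
    omega
  refine ⟨fun j hj h₀ => ?_, fun c' hc' h₀ => ?_, ?_, fun k hk => ?_⟩
  · rw [hL]
    rcases (hsplit j).1 hj with rfl | hj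
    · rw [if_pos hc, hd]
    · split_ifs
      · exact hmono j hj
      · exact h.le_last j hj h₀
  · rw [hL] at h₀ ⊢
    split_ifs at h₀ ⊢ with e
    · exact ⟨i + 1, by simp, by rw [hc, e], hd⟩
    · obtain ⟨j, hj, h₁⟩ := h.last c' hc' h₀
      exact ⟨j, (hsplit j).2 (Or.inr hj), h₁⟩
  · by_cases hE : 1 < d ∧ c ≠ 0 ∧ ∃ j ∈ Icc 1 i, DB (S j) = d - 1 ∧ PC (S j) = c
    · obtain ⟨h₁, h₂, j, hj, h₃, h₄⟩ := hE
      have hlast := h.le_last j hj (h₄ ▸ h₂)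
      rw [h₄] at hlast
      obtain ⟨j', hj', h₅, h₆⟩ := h.last c h₂ (by omega)
      have := hmono j' hj'
      have hsh' : ∀ k ∈ Icc 1 K, ∀ c', SharedUpTo PC S DB (i + 1) k c' ↔
          SharedUpTo PC S DB i k c' ∨ k = d - 1 ∧ c' = c := by
        intro k hk c'
        rw [hsh]
        refine or_congr_right ⟨fun hh => ⟨by omega, hh.2.1⟩, fun hh => ⟨by omega, hh.2, h₂, j, hj,
          by omega, h₄⟩⟩
      by_cases hl : LAST c + 1 = d
      · by_cases hcond : ¬ (Mu (d - 1) ∧ a₁ (d - 2) = c ∧ a₂ (d - 2) = 0) ∧ a₁ (d - 1) ≠ c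
        · obtain ⟨e₁, e₂⟩ := hpos ⟨h₁, h₂, hl, hcond⟩
          rw [e₁, e₂]
          exact h.greedy.insert (by simp; omega) hsh' (fun _ _ hh => hh.1) hnext h₂
            (by rw [hd₂]; tauto) hcond.2
        · obtain ⟨e₁, e₂⟩ := hneg fun hh => hcond hh.2.2.2
          rw [e₁, e₂]
          exact h.greedy.mono hsh' (by rw [hd₂]; tauto)
      -- Here the symbol was last seen in block `d` itself, so it was known to be shared before and
      -- nothing changes.
      · obtain ⟨e₁, e₂⟩ := hneg fun hh => hl hh.2.2.1
        rw [e₁, e₂]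
        refine h.greedy.congr (fun k hk c' => ?_) fun _ => Iff.rfl
        rw [hsh' k hk c']
        refine ⟨fun hh => hh.elim id ?_, Or.inl⟩
        rintro ⟨rfl, rfl⟩
        exact ⟨h₂, ⟨j, hj, h₃, h₄⟩, j', hj', by omega, h₅⟩
    · have hcond : ¬ (1 < d ∧ c ≠ 0 ∧ LAST c + 1 = d ∧
          ¬ (Mu (d - 1) ∧ a₁ (d - 2) = c ∧ a₂ (d - 2) = 0) ∧ a₁ (d - 1) ≠ c) := by
        rintro ⟨h₁, h₂, h₃, -⟩
        obtain ⟨j, hj, h₄, h₅⟩ := h.last c h₂ (by omega)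
        exact hE ⟨h₁, h₂, j, hj, by omega, h₄⟩
      obtain ⟨e₁, e₂⟩ := hneg hcond
      rw [e₁, e₂]
      refine h.greedy.congr (fun k hk c' => ?_) fun _ => Iff.rfl
      rw [hsh]
      refine ⟨fun hh => hh.elim id ?_, Or.inl⟩
      rintro ⟨h₁, -, h₂, j, hj, h₃, h₄⟩
      have := mem_Icc.1 hk
      exact absurd ⟨by omega, h₂, j, hj, by omega, h₄⟩ hE
  · have ho := h.out k hk
    by_cases hcond : 1 < d ∧ c ≠ 0 ∧ LAST c + 1 = d ∧
        ¬ (Mu (d - 1) ∧ a₁ (d - 2) = c ∧ a₂ (d - 2) = 0) ∧ a₁ (d - 1) ≠ c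
    · rw [(hpos hcond).1]
      split_ifs
      · rw [Function.update_of_ne (by omega), ho]
      · exact ho
    · rw [(hneg hcond).1, ho]

theorem run_candBody {w : ℕ} [hw : Fact (8 ≤ 2 ^ w)] {M K : ℕ} {PC R S DB MU : ℕ → ℕ}
    {s₀ : State} (hwf : WF w s₀) (hM : s₀.reg 10 = M) (hPC : ∀ p ∈ Icc 1 M, s₀.arr 45 p = PC p)
    (hS : ∀ i ≤ M, s₀.arr 48 i = S i) (hSs : Sorted M R S) (hDB : s₀.arr 49 = DB)
    (hB : BlockNumber M K R DB) (hMU : s₀.arr 50 = MU)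
    (hzero : ∀ A ∈ Icc 51 53, ∀ k, s₀.arr A k = 0) (hKM : K + 1 ≤ M) (hMw : M + 1 < 2 ^ w) :
    ∃ s', Run w (.upto 30 10 candBody) (200 * (M + 1)) s₀ s' ∧
      CandInv K PC S DB (fun k => MU k ≠ 0) M (s'.arr 51) (s'.arr 52) (s'.arr 53) := by
  obtain ⟨s', hr, h, -⟩ := run_upto_flat (w := w) (x := 30) (m := 10) (p := candBody) hwf hM rfl
    (by norm_num) rfl rfl
    (fun i s => CandInv K PC S DB (fun k => MU k ≠ 0) i (s.arr 51) (s.arr 52) (s.arr 53) ∧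
      ∀ c, s.arr 51 c ≤ K + 1)
    (fun i s v h => by simpa using h)
    ⟨⟨by simp, by simp [hzero], ⟨by simp [hzero], by simp [hzero], by simp [hzero], fun k hk c hc => by
        obtain ⟨-, ⟨j, hj, -⟩, -⟩ := hc
        simp at hj⟩, by simp [hzero]⟩, by simp [hzero]⟩
    (by
      rintro i hi s hs hx hr ha ⟨h, hlK⟩
      have hSi' := hSs.mem (i + 1) (by simp; omega)
      set x := S (i + 1) with hxd
      set c := PC x with hcd
      set d := DB x with hdd
      have hd := hB.mem x hSi'
      have hd' := mem_Icc.1 hd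
      have a48 : s.arr 48 (i + 1) = x := by rw [ha 48 rfl, hS _ (by omega)]
      have a45 : s.arr 45 x = c := by rw [ha 45 rfl, hPC _ hSi']
      have a49 : s.arr 49 x = d := by rw [ha 49 rfl, hDB]
      have a50 : s.arr 50 = MU := by rw [ha 50 rfl, hMU]
      have m₁ : (d - 1) % 2 ^ w = d - 1 := Nat.mod_eq_of_lt (by omega)
      have m₂ : (d - 2) % 2 ^ w = d - 2 := Nat.mod_eq_of_lt (by omega)
      have m₃ : (s.arr 51 c + 1) % 2 ^ w = s.arr 51 c + 1 := Nat.mod_eq_of_lt (by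
        have := hlK c; omega)
      set s₁ := ((s.setReg 37 x).setReg 38 c).setReg 39 d with hs₁
      have htest : candTest.eval w s₁ = if 1 < d ∧ c ≠ 0 ∧ s.arr 51 c + 1 = d ∧
          ¬ (MU (d - 1) ≠ 0 ∧ s.arr 52 (d - 2) = c ∧ s.arr 53 (d - 2) = 0) ∧
          s.arr 52 (d - 1) ≠ c then 1 else 0 := by
        simp [candTest, hs₁, a50, m₁, m₂, m₃]
      have hden : candBody.den w s = ((Prog.ite candTest
          (.ite (.load 52 (.reg 39 - 1)) (.store 53 (.reg 39 - 1) (.reg 38))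
            (.store 52 (.reg 39 - 1) (.reg 38))) .skip).den w s₁).setArr 51 c d := by
        have e : (Prog.assign 39 (.load 49 (.reg 37))).den w ((Prog.assign 38
            (.load 45 (.reg 37))).den w ((Prog.assign 37 (.load 48 (.reg 30))).den w s)) = s₁ := by
          simp [Prog.den, hx, a48, a45, a49, hs₁]
        change (Prog.store 51 (.reg 38) (.reg 39)).den w (Prog.den w _ (Prog.den w _ (Prog.den w _
          (Prog.den w _ s)))) = _
        rw [e]
        have hf := run_flat (w := w) (p := .ite candTest (.ite (.load 52 (.reg 39 - 1))
          (.store 53 (.reg 39 - 1) (.reg 38)) (.store 52 (.reg 39 - 1) (.reg 38))) .skip) rfl s₁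
        have f₁ := hf.reg_eq (x := 38) (by rfl)
        have f₂ := hf.reg_eq (x := 39) (by rfl)
        rw [Prog.den, eval_reg, eval_reg, f₁, f₂]
        simp [hs₁]
      have hmono : ∀ j ∈ Icc 1 i, DB (S j) ≤ d := by
        intro j hj
        have hj' := mem_Icc.1 hj
        have h₁ : R (S j) ≤ R x := hSs.mono j (by simp; omega) (i + 1) (by simp; omega) (by omega)
        have h₂ : d < DB (S j) ↔ R x < R (S j) := hB.lt_iff _ hSi' _ (hSs.mem j (by simp; omega))
        omega
      by_cases hcond : 1 < d ∧ c ≠ 0 ∧ s.arr 51 c + 1 = d ∧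
          ¬ (MU (d - 1) ≠ 0 ∧ s.arr 52 (d - 2) = c ∧ s.arr 53 (d - 2) = 0) ∧
          s.arr 52 (d - 1) ≠ c
      · rw [if_pos hcond] at htest
        have hden' : candBody.den w s = (if s.arr 52 (d - 1) = 0 then s₁.setArr 52 (d - 1) c
            else s₁.setArr 53 (d - 1) c).setArr 51 c d := by
          rw [hden]
          simp only [Prog.den, htest, one_ne_zero, if_false]
          congr 1
          simp [hs₁, m₁]
        rw [hden']
        refine ⟨h.step rfl rfl hd hmono (fun y => ?_) (fun _ => ⟨?_, ?_⟩) (fun hn => absurd hcond hn),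
          fun y => ?_⟩
        · split_ifs <;> simp_all
        · split_ifs <;> simp [State.setArr_arr, hs₁] <;> rfl
        · split_ifs <;> simp [State.setArr_arr, hs₁] <;> rfl
        · have := hlK y
          split_ifs <;> simp [hs₁] <;> split_ifs <;> omega
      · rw [if_neg hcond] at htest
        have hden' : candBody.den w s = s₁.setArr 51 c d := by
          rw [hden]
          simp only [Prog.den, htest, if_true]
        rw [hden']
        refine ⟨h.step rfl rfl hd hmono (fun y => by simp [hs₁]; rfl)
          (fun hn => absurd hn hcond) (fun _ => ?_), fun y => ?_⟩
        · simp [State.setArr_arr, hs₁]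
        · have := hlK y
          simp [hs₁]; split_ifs <;> omega)
  refine ⟨s', hr.mono ?_, h⟩
  simp only [candBody, candTest, Prog.time, cost_add, cost_sub, cost_load, cost_reg, cost_one,
    cost_two, cost_same, cost_both, cost_fails, cost_less]
  omega

theorem CandInv.greedy_shared {M K : ℕ} {PC R S DB LAST a₁ a₂ : ℕ → ℕ} {Mu Mu' : ℕ → Prop}
    (h : CandInv K PC S DB Mu M LAST a₁ a₂) (hS : Sorted M R S) (hMu : ∀ k, Mu' k ↔ Mu k) :
    Greedy K (Shared M PC DB) Mu' a₁ a₂ := by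
  have hex : ∀ P : ℕ → Prop, (∃ p ∈ Icc 1 M, P p) ↔ ∃ j ∈ Icc 1 M, P (S j) := by
    intro P
    constructor
    · rintro ⟨p, hp, h⟩
      obtain ⟨j, hj, rfl⟩ := hS.surj p hp
      exact ⟨j, hj, h⟩
    · rintro ⟨j, hj, h⟩
      exact ⟨_, hS.mem j hj, h⟩
  refine h.greedy.congr (fun k _ c => ?_) hMu
  rw [Shared, SharedUpTo, hex fun p => DB p = k ∧ PC p = c, hex fun p => DB p = k + 1 ∧ PC p = c]

/-- Choose among the candidates of a boundary, given the choice for the next one. -/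
def choiceBody : Prog :=
  .assign 37 (.reg 10 - .reg 30) ;;
  .ite ((Expr.load 52 (.reg 37)).both ((Expr.load 50 (.reg 37 + 1)).both
      ((Expr.load 54 (.reg 37 + 1)).same (.load 52 (.reg 37)))))
    (.store 54 (.reg 37) (.load 53 (.reg 37))) (.store 54 (.reg 37) (.load 52 (.reg 37)))

/-- The loop runs downwards over `M - 1, …, 0`, although there are only `K` boundaries: beyond `K`
the first candidates are 0, so the choices are 0 too, which provides the end value at `K + 1`. -/
theorem run_choiceBody {w : ℕ} [hw : Fact (8 ≤ 2 ^ w)] {M K : ℕ} {MU a₁ a₂ : ℕ → ℕ}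
    {s₀ : State} (hwf : WF w s₀) (hM : s₀.reg 10 = M) (hMU : s₀.arr 50 = MU)
    (ha₁ : s₀.arr 52 = a₁) (ha₂ : s₀.arr 53 = a₂) (h54 : ∀ k, s₀.arr 54 k = 0)
    (hz : a₁ 0 = 0) (hout : ∀ k, K < k → a₁ k = 0) (hKM : K + 1 ≤ M) (hMw : M + 1 < 2 ^ w) :
    ∃ s', Run w (.upto 30 10 choiceBody) (100 * (M + 1)) s₀ s' ∧ s'.arr 54 0 = 0 ∧
      Choice K (fun k => MU k ≠ 0) a₁ a₂ (s'.arr 54) := by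
  obtain ⟨s', hr, h₁, h₂⟩ := run_upto_flat (w := w) (x := 30) (m := 10) (p := choiceBody) hwf hM
    rfl (by norm_num) rfl rfl
    (fun i s => s.arr 54 M = 0 ∧ ∀ j < M, M - i ≤ j → s.arr 54 j =
      if a₁ j ≠ 0 ∧ MU (j + 1) ≠ 0 ∧ s.arr 54 (j + 1) = a₁ j then a₂ j else a₁ j)
    (fun i s v h => h)
    ⟨h54 M, fun j hj hj' => absurd hj (by omega)⟩
    (by
      rintro i hi s hs hx hr ha ⟨h₁, h₂⟩
      have r10 : s.reg 10 = M := by rw [hr 10 (by norm_num) rfl, hM]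
      have a50 : s.arr 50 = MU := by rw [ha 50 rfl, hMU]
      have a52 : s.arr 52 = a₁ := by rw [ha 52 rfl, ha₁]
      have a53 : s.arr 53 = a₂ := by rw [ha 53 rfl, ha₂]
      have m₁ : (M - (i + 1)) % 2 ^ w = M - (i + 1) := Nat.mod_eq_of_lt (by omega)
      set k := M - (i + 1) with hk
      have m₂ : (k + 1) % 2 ^ w = k + 1 := Nat.mod_eq_of_lt (by omega)
      have hden : ∀ j, (choiceBody.den w s).arr 54 j = if j = k then
          (if a₁ k ≠ 0 ∧ MU (k + 1) ≠ 0 ∧ s.arr 54 (k + 1) = a₁ k then a₂ k else a₁ k)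
          else s.arr 54 j := by
        intro j
        by_cases hc : a₁ k ≠ 0 ∧ MU (k + 1) ≠ 0 ∧ s.arr 54 (k + 1) = a₁ k
        · obtain ⟨c₁, c₂, c₃⟩ := hc
          simp [choiceBody, Prog.den, r10, hx, ← hk, a50, a52, a53, m₁, m₂, c₁, c₂, c₃]
        · rw [if_neg hc]
          simp only [choiceBody, Prog.den, eval_sub, eval_reg, r10, hx, ← hk, m₁, eval_both, eval_load,
            eval_same, eval_add, eval_one, State.setReg_reg, State.setReg_arr, if_true, m₂, a50,
            a52]
          rw [if_pos (by simpa using hc)]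
          simp
      refine ⟨?_, fun j hj hj' => ?_⟩
      · rw [hden, if_neg (by omega), h₁]
      · rw [hden, hden (j + 1), if_neg (by omega : j + 1 ≠ k)]
        by_cases e : j = k
        · subst e; rw [if_pos rfl]
        · rw [if_neg e, h₂ j hj (by omega)])
  have h₀ : s'.arr 54 0 = 0 := by
    rw [h₂ 0 (by omega) (by omega), if_neg (by simp [hz]), hz]
  refine ⟨s', hr.mono ?_, h₀, ?_, fun k hk => ?_⟩
  · simp only [choiceBody, Prog.time, cost_add, cost_sub, cost_load, cost_reg, cost_one, cost_same,
      cost_both]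
    omega
  · rcases hKM.lt_or_eq with h | h
    · rw [h₂ _ h (by omega), hout (K + 1) (by omega), if_neg (by simp)]
    · rw [h, h₁]
  · have := mem_Icc.1 hk
    rw [h₂ k (by omega) (by omega)]
    split_ifs with hc
    · exact Or.inr ⟨rfl, hc⟩
    · exact Or.inl ⟨rfl, hc⟩

end CAO

/-! ### The program -/

namespace CAO

open Finset

theorem run_map {w : ℕ} [hw : Fact (8 ≤ 2 ^ w)] {A n : ℕ} {e : Expr} {s₀ : State} (f : ℕ → ℕ)
    (hwf : WF w s₀) (hn : s₀.reg 10 = n)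
    (hev : ∀ k ∈ Icc 1 n, ∀ s, s.reg 30 = k → (∀ y, y ≠ 30 → s.reg y = s₀.reg y) →
      (∀ B, B ≠ A → s.arr B = s₀.arr B) → e.eval w s = f k) :
    ∃ s', Run w (.fill 30 10 A (.reg 30) e) (n * (e.cost + 10) + 6) s₀ s' ∧
      (∀ k ∈ Icc 1 n, s'.arr A k = f k) ∧ s'.arr A 0 = s₀.arr A 0 := by
  obtain ⟨s', hr, h₁, h₂⟩ := run_fill (w := w) (x := 30) (m := 10) (A := A) (n := n)
    (i := .reg 30) (e := e) hwf hn (by norm_num) id f Function.injective_id.injOn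
    fun k hk s hx hr ha _ _ => ⟨by simp [hx], hev k (by simpa using hk) s hx hr ha⟩
  refine ⟨s', hr.mono ?_, fun k hk => h₁ k (by simpa using hk), h₂ 0 fun k hk h => ?_⟩
  · rw [cost_reg, show 1 + e.cost + 9 = e.cost + 10 by omega]
  · simp at hk h; omega

/-- Read the input and rank the letters. -/
def readProg : Prog := .assign 10 (.reg 0 + .reg 1) ;; parse ;; radixSort

theorem Instance.wf_init (I : Instance) {w : ℕ} (hw : I.size + I.d < 2 ^ w)
    (hσ : I.σ < 2 ^ w) : WF w I.init := by
  refine ⟨fun x => ?_, fun A i => ?_⟩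
  · match x with
    | 0 => exact (by omega : I.d < 2 ^ w)
    | 1 => exact (by omega : I.size < 2 ^ w)
    | 2 => exact hσ
    | _ + 3 => exact (by positivity : 0 < 2 ^ w)
  · match A with
    | 0 =>
      change ((List.ofFn I.T).flatten.map Fin.val).getD i 0 < 2 ^ w
      rw [List.getD_eq_getElem?_getD, List.getElem?_map]
      rcases (List.ofFn I.T).flatten[i]? with _ | c
      · exact (by positivity : 0 < 2 ^ w)
      · exact c.2.trans hσ
    | 1 =>
      change I.len i < 2 ^ w
      by_cases h : i < I.d
      · have := I.start_mono h
        rw [I.start_d] at this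
        omega
      · rw [Instance.len, List.getD_eq_getElem?_getD, List.getElem?_eq_none (by simpa using h)]
        exact (by positivity : 0 < 2 ^ w)
    | _ + 2 => exact (by positivity : 0 < 2 ^ w)

theorem run_readProg {w : ℕ} [hw : Fact (8 ≤ 2 ^ w)] {I : Instance} {a : ℕ}
    (hM : I.size + I.d + 1 < 2 ^ w) (ha : I.σ ≤ (I.size + 1) ^ a)
    (haw : (I.size + 1) ^ (a + 1) + 1 < 2 ^ w) :
    ∃ s, Run w readProg ((400 * a + 1400) * (I.size + I.d + 1)) I.init s ∧ WF w s ∧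
      s.reg 10 = I.size + I.d ∧ s.reg 0 = I.d ∧ s.reg 36 = 0 ∧ (∀ A ∈ Icc 45 54, ∀ k, s.arr A k = 0) ∧
      Layout I (s.arr 40) (s.arr 41) (s.arr 42) (s.arr 43) ∧
      LetterRank (I.size + I.d) (s.arr 40) (s.arr 44) := by
  have hσw : I.σ < 2 ^ w := by
    have := Nat.pow_le_pow_right (by omega : 0 < I.size + 1) (by omega : a ≤ a + 1)
    omega
  have hwf := I.wf_init (w := w) (by omega) hσw
  have hr₁ := Run.assign (w := w) I.init 10 (.reg 0 + .reg 1)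
  have e₁ : (Expr.reg 0 + Expr.reg 1).eval w I.init = I.size + I.d := by
    change (I.d + I.size) % 2 ^ w = _
    rw [Nat.mod_eq_of_lt (by omega), add_comm]
  rw [e₁] at hr₁
  set s₁ := I.init.setReg 10 (I.size + I.d) with hs₁
  obtain ⟨s₂, hr₂, hL⟩ := run_parse (hr₁.wf hwf) (by simp [hs₁]) (fun x hx => by
      have := mem_Icc.1 hx
      obtain ⟨y, rfl⟩ := Nat.exists_eq_add_of_le' (by omega : 3 ≤ x)
      rw [hs₁, State.setReg_reg, if_neg (by omega)]; rfl) (fun A _ => rfl) rfl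
    (by omega) hσw
  have hr₁₂ := hr₁.seq hr₂
  obtain ⟨s₃, hr₃, hLR⟩ := run_radixSort (CODE := s₂.arr 40) (M := I.size + I.d) (N := I.size)
    (σ := I.σ) (a := a) (hr₁₂.wf hwf) (by rw [hr₂.reg_eq (by rfl)]; simp [hs₁])
    (by rw [hr₁₂.reg_eq (by rfl)]; rfl) (by rw [hr₁₂.reg_eq (by rfl)]; rfl)
    (I.d_pos.trans_le I.d_le_size) (by omega) I.sigma_pos (fun _ _ => rfl)
    (fun p hp => hL.code_le hp) (fun p => by rw [hr₁₂.arr_eq (by rfl)]; rfl) hM ha haw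
  have hr := hr₁₂.seq hr₃
  have f : ∀ A, radixSort.writesArr A = false → s₃.arr A = s₂.arr A := fun A hA => hr₃.arr_eq hA
  refine ⟨s₃, (hr₁.seq (hr₂.seq hr₃)).mono ?_, hr.wf hwf, ?_, ?_, ?_, fun A hA k => ?_, ?_, ?_⟩
  · simp only [cost_add, cost_reg]
    have : (a + 3) * (400 * (I.size + I.d + 1)) = (400 * a + 1200) * (I.size + I.d + 1) := by ring
    rw [this, show 400 * a + 1400 = (400 * a + 1200) + 200 by omega, add_mul _ 200]
    omega
  · rw [hr₃.reg_eq (by rfl), hr₂.reg_eq (by rfl)]; simp [hs₁]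
  · rw [hr.reg_eq (by rfl)]; rfl
  · rw [hr.reg_eq (by rfl)]; rfl
  · have e : s₃.arr A = I.init.arr A := by
      fin_cases hA <;> exact hr.arr_eq (by rfl)
    have := mem_Icc.1 hA
    obtain ⟨B, rfl⟩ := Nat.exists_eq_add_of_le' (by omega : 2 ≤ A)
    rw [e]; rfl
  · rw [f 40 (by rfl), f 41 (by rfl), f 42 (by rfl), f 43 (by rfl)]; exact hL
  · rw [f 40 (by rfl)]; exact hLR

/-- Rank the positions by the continuation of the text up to the end of the string, into the
array `46`. -/
def rankProg : Prog :=
  .fill 30 10 45 (.reg 30)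
    (Expr.less 0 (.load 40 (.reg 30 - 1)) * .load 44 (.reg 30 - 1)) ;;
  .fill 30 10 20 (.reg 30) (.load 44 (.reg 30)) ;;
  .fill 30 10 21 (.reg 30) (Expr.less 0 (.load 40 (.reg 30)) * (.reg 30 + 1)) ;;
  .fill 30 10 22 (.reg 30) (.load 42 (.reg 30)) ;;
  sufRank ;;
  .fill 30 10 46 (.reg 30) (.load 25 (.reg 30))

theorem run_rankProg {w : ℕ} [hw : Fact (8 ≤ 2 ^ w)] {I : Instance} {s : State} (hwf : WF w s)
    (hM : s.reg 10 = I.size + I.d) (h46 : s.arr 46 0 = 0)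
    (hL : Layout I (s.arr 40) (s.arr 41) (s.arr 42) (s.arr 43))
    (hLR : LetterRank (I.size + I.d) (s.arr 40) (s.arr 44))
    (hbound : 16 * (I.size + I.d) + 16 < 2 ^ w) :
    ∃ s', Run w rankProg (51000 * (I.size + I.d + 1)) s s' ∧ s'.reg 10 = I.size + I.d ∧
      (∀ p ∈ Icc 1 (I.size + I.d), s'.arr 45 p = prevCode (s.arr 40) (s.arr 44) p) ∧
      IsRank (I.size + I.d) (s.arr 44) (fwd (s.arr 40)) (s'.arr 46) := by
  set M := I.size + I.d with hMd
  have ml : ∀ k ∈ Icc 1 M, k - 1 < 2 ^ w ∧ k + 1 < 2 ^ w := fun k hk => by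
    have := mem_Icc.1 hk; omega
  obtain ⟨s₁, hr₁, h₁, -⟩ := run_map (A := 45) (e := Expr.less 0 (.load 40 (.reg 30 - 1)) *
      .load 44 (.reg 30 - 1)) (prevCode (s.arr 40) (s.arr 44)) hwf hM (by
    intro k hk t hx hr ha
    simp only [eval_mul, eval_less, eval_zero, eval_load, eval_sub, eval_reg, eval_one, hx,
      Nat.mod_eq_of_lt (ml k hk).1, ha 40 (by norm_num), ha 44 (by norm_num), prevCode]
    by_cases h₀ : s.arr 40 (k - 1) = 0
    · simp [h₀]
    · rw [if_pos (by omega), if_neg h₀, one_mul, Nat.mod_eq_of_lt (hwf.arr _ _)])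
  obtain ⟨s₂, hr₂, h₂, -⟩ := run_map (A := 20) (e := .load 44 (.reg 30)) (s.arr 44) (hr₁.wf hwf)
    (by rw [hr₁.reg_eq (by rfl), hM]) (by
    intro k hk t hx hr ha
    simp only [eval_load, eval_reg, hx, ha 44 (by norm_num)]
    rw [hr₁.arr_eq (by rfl)])
  have hr₁₂ := hr₁.seq hr₂
  obtain ⟨s₃, hr₃, h₃, -⟩ := run_map (A := 21)
    (e := Expr.less 0 (.load 40 (.reg 30)) * (.reg 30 + 1)) (fwd (s.arr 40)) (hr₁₂.wf hwf)
    (by rw [hr₁₂.reg_eq (by rfl), hM]) (by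
    intro k hk t hx hr ha
    have e : t.arr 40 = s.arr 40 := by rw [ha 40 (by norm_num), hr₁₂.arr_eq (by rfl)]
    simp only [eval_mul, eval_less, eval_zero, eval_load, eval_add, eval_reg, eval_one, hx,
      Nat.mod_eq_of_lt (ml k hk).2, e, fwd]
    by_cases h₀ : s.arr 40 k = 0
    · simp [h₀]
    · rw [if_pos (by omega), if_neg h₀, one_mul, Nat.mod_eq_of_lt (ml k hk).2])
  have hr₁₃ := hr₁₂.seq hr₃
  obtain ⟨s₄, hr₄, h₄, -⟩ := run_map (A := 22) (e := .load 42 (.reg 30)) (s.arr 42) (hr₁₃.wf hwf)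
    (by rw [hr₁₃.reg_eq (by rfl), hM]) (by
    intro k hk t hx hr ha
    simp only [eval_load, eval_reg, hx, ha 42 (by norm_num)]
    rw [hr₁₃.arr_eq (by rfl)])
  have hr₁₄ := hr₁₃.seq hr₄
  obtain ⟨s₅, hr₅, h10, hR⟩ := run_sufRank (M := M) (hr₁₄.wf hwf)
    (by rw [hr₁₄.reg_eq (by rfl), hM]) (hL.chain_fwd hLR)
    (fun p hp => by rw [hr₄.arr_eq (by rfl), hr₃.arr_eq (by rfl), h₂ p hp])
    (fun p hp => by rw [hr₄.arr_eq (by rfl), h₃ p hp]) h₄ hbound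
  have hr₁₅ := hr₁₄.seq hr₅
  obtain ⟨s₆, hr₆, h₆, h₆'⟩ := run_map (A := 46) (e := .load 25 (.reg 30)) (s₅.arr 25)
    (hr₁₅.wf hwf) h10 (by
    intro k hk t hx hr ha
    simp only [eval_load, eval_reg, hx, ha 25 (by norm_num)])
  refine ⟨s₆, (hr₁.seq (hr₂.seq (hr₃.seq (hr₄.seq (hr₅.seq hr₆))))).mono ?_, ?_, fun p hp => ?_,
    ?_, fun p hp => ?_⟩
  · simp only [cost_add, cost_sub, cost_load, cost_reg, cost_zero, cost_one, cost_mul, cost_less]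
    omega
  · rw [hr₆.reg_eq (by rfl), h10]
  · rw [hr₆.arr_eq (by rfl), hr₅.arr_eq (by rfl), hr₄.arr_eq (by rfl), hr₃.arr_eq (by rfl),
      hr₂.arr_eq (by rfl), h₁ p hp]
  · rw [h₆', hr₁₅.arr_eq (by rfl), h46]
  · rw [h₆ p hp, hR.2 p hp]

/-- Divide the positions into blocks and choose the symbols at which blocks merge. -/
def groupProg : Prog :=
  sortRanks ;; .upto 30 10 blockBody ;; .upto 30 10 candBody ;; .upto 30 10 choiceBody

theorem run_groupProg {w : ℕ} [hw : Fact (8 ≤ 2 ^ w)] {M : ℕ} {α : Type} {sy : ℕ → α}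
    {PC R : ℕ → ℕ} {s : State} (hwf : WF w s) (hM : s.reg 10 = M) (hM₁ : 1 ≤ M)
    (h36 : s.reg 36 = 0) (hzero : ∀ A ∈ Icc 47 54, ∀ k, s.arr A k = 0)
    (hPC : ∀ p ∈ Icc 1 M, s.arr 45 p = PC p)
    (hsy : ∀ p ∈ Icc 1 M, ∀ q ∈ Icc 1 M, sy p = sy q ↔ p = q ∨ PC p = PC q ∧ PC p ≠ 0)
    (hR : s.arr 46 = R) (hR₀ : R 0 = 0) (hR₁ : ∀ p ∈ Icc 1 M, 1 ≤ R p ∧ R p ≤ M)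
    (hMw : M + 1 < 2 ^ w) :
    ∃ s' K, Run w groupProg (1000 * (M + 1)) s s' ∧ BlockNumber M K R (s'.arr 49) ∧
      Greedy K (Shared M PC (s'.arr 49)) (Multi M sy (s'.arr 49)) (s'.arr 52) (s'.arr 53) ∧
      Choice K (Multi M sy (s'.arr 49)) (s'.arr 52) (s'.arr 53) (s'.arr 54) ∧
      s'.arr 54 0 = 0 := by
  obtain ⟨s₁, hr₁, hS₀, hS⟩ := run_sortRanks (R := R) hwf hM (fun p _ => by rw [hR])
    (fun p hp => (hR₁ p hp).2) (hzero 48 (by decide) 0) hMw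
  have hwf₁ := hr₁.wf hwf
  obtain ⟨s₂, hr₂, hB⟩ := run_blockBody (M := M) (PC := PC) (R := R) (S := s₁.arr 48) hwf₁
    (by rw [hr₁.reg_eq (by rfl), hM]) (fun p hp => by rw [hr₁.arr_eq (by rfl), hPC p hp])
    (fun p _ => by rw [hr₁.arr_eq (by rfl), hR]) (fun _ _ => rfl) hS₀ hR₀
    (fun p hp => (hR₁ p hp).1) hS (by rw [hr₁.reg_eq (by rfl), h36])
    (fun k => by rw [hr₁.arr_eq (by rfl), hzero 50 (by decide)]) hMw
  have hr₁₂ := hr₁.seq hr₂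
  obtain ⟨K, hK⟩ : ∃ K, s₂.reg 36 = K + 1 := by
    have := mem_Icc.1 (hB.mem 1 (by simp; omega))
    exact ⟨s₂.reg 36 - 1, by omega⟩
  rw [hK] at hB
  have hBN := hB.blockNumber hS
  have hKM := hB.le
  have hMu := hB.multi_iff hS hsy
  have e48 : s₂.arr 48 = s₁.arr 48 := hr₂.arr_eq (by rfl)
  obtain ⟨s₃, hr₃, hC⟩ := run_candBody (M := M) (K := K) (PC := PC) (R := R) (S := s₁.arr 48)
    (DB := s₂.arr 49) (MU := s₂.arr 50) (hr₁₂.wf hwf)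
    (by rw [hr₁₂.reg_eq (by rfl), hM]) (fun p hp => by rw [hr₁₂.arr_eq (by rfl), hPC p hp])
    (fun i _ => by rw [e48]) hS rfl hBN rfl (fun A hA k => by
      have : s₂.arr A = s.arr A := by fin_cases hA <;> exact hr₁₂.arr_eq (by rfl)
      rw [this, hzero A (by simp at hA ⊢; omega)]) hKM hMw
  have hr₁₃ := hr₁₂.seq hr₃
  obtain ⟨s₄, hr₄, hz, hch⟩ := run_choiceBody (M := M) (K := K) (MU := s₂.arr 50)
    (a₁ := s₃.arr 52) (a₂ := s₃.arr 53) (hr₁₃.wf hwf) (by rw [hr₁₃.reg_eq (by rfl), hM])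
    (hr₃.arr_eq (by rfl)) rfl rfl (fun k => by
      rw [hr₁₃.arr_eq (by rfl), hzero 54 (by decide)]) hC.greedy.zero hC.out hKM hMw
  have hMu' : (fun k => s₂.arr 50 k ≠ 0) = Multi M sy (s₂.arr 49) := funext fun k =>
    propext (hMu k)
  have e49 : s₄.arr 49 = s₂.arr 49 := (hr₃.seq hr₄).arr_eq (by rfl)
  have e52 : s₄.arr 52 = s₃.arr 52 := hr₄.arr_eq (by rfl)
  have e53 : s₄.arr 53 = s₃.arr 53 := hr₄.arr_eq (by rfl)
  rw [hMu'] at hch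
  refine ⟨s₄, K, (hr₁.seq (hr₂.seq (hr₃.seq hr₄))).mono (by omega), ?_, ?_, ?_, hz⟩
  · rw [e49]; exact hBN
  · rw [e49, e52, e53]
    exact hC.greedy_shared hS fun k => (hMu k).symm
  · rw [e49, e52, e53]; exact hch

/-- The expression for `wish`. -/
def wishExpr : Expr :=
  ((Expr.load 45 (.reg 11)).both
    ((Expr.load 45 (.reg 11)).same (.load 54 (.load 49 (.reg 11) - 1)))).fails *
  (1 + (Expr.load 45 (.reg 11)).both ((Expr.load 45 (.reg 11)).same (.load 54 (.load 49 (.reg 11)))))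

/-- Order the strings and write the output. -/
def orderProg : Prog :=
  rankBy wishExpr (.load 45 (.reg 11)) 1 20 ;;
  .fill 30 10 21 (.reg 30) (Expr.less 0 (.load 45 (.reg 30)) * (.reg 30 - 1)) ;;
  .fill 30 10 22 (.reg 30) (.load 43 (.reg 30)) ;;
  sufRank ;;
  rankBy (.load 25 (.reg 11)) (.reg 11) (Expr.load 40 (.reg 11)).fails 56 ;;
  .fill 30 10 2 ((Expr.load 40 (.reg 30)).fails * (.load 56 (.reg 30) - 1) +
    Expr.less 0 (.load 40 (.reg 30)) * (.reg 0 + .reg 30)) (.load 41 (.reg 30))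

theorem run_orderProg {w : ℕ} [hw : Fact (8 ≤ 2 ^ w)] {I : Instance} {s : State} {K : ℕ}
    {CODE OWN POS REM LR R B a₁ a₂ : ℕ → ℕ} (hwf : WF w s) (hM : s.reg 10 = I.size + I.d)
    (hd : s.reg 0 = I.d) (h40 : s.arr 40 = CODE) (h41 : s.arr 41 = OWN) (h43 : s.arr 43 = REM)
    (h45 : ∀ p ∈ Icc 1 (I.size + I.d), s.arr 45 p = prevCode CODE LR p) (h49 : s.arr 49 = B)
    (hL : Layout I CODE OWN POS REM)
    (hLR : LetterRank (I.size + I.d) CODE LR) (hR : IsRank (I.size + I.d) LR (fwd CODE) R)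
    (hB : BlockNumber (I.size + I.d) K R B)
    (hg : Greedy K (Shared (I.size + I.d) (prevCode CODE LR) B) (Multi (I.size + I.d) I.sy B)
      a₁ a₂)
    (hch : Choice K (Multi (I.size + I.d) I.sy B) a₁ a₂ (s.arr 54)) (hch₀ : s.arr 54 0 = 0)
    (hbound : 16 * (I.size + I.d) + 16 < 2 ^ w) :
    ∃ s' π, Run w orderProg (52000 * (I.size + I.d + 1)) s s' ∧ I.Outputs s' π ∧
      I.IsOptimal π := by
  set M := I.size + I.d with hMd
  set PC := prevCode CODE LR with hPCd
  have hdM : I.d ≤ M := by omega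
  have hM₂ : 2 ≤ M := by
    have := I.d_pos
    have := I.d_le_size
    omega
  have hPC : ∀ p ∈ Icc 1 M, PC p ≤ M := by
    intro p hp
    have := mem_Icc.1 hp
    rw [hPCd, prevCode]
    split_ifs with h₀
    · omega
    · by_cases h₁ : p = 1
      · rw [h₁] at h₀; exact absurd hL.zero h₀
      · exact (mem_Icc.1 (hLR.mem _ (mem_Icc.2 ⟨by omega, by omega⟩))).2
  obtain ⟨s₁, hr₁, hT₀, hT⟩ := run_rankBy (w := w) (n := M) (A := 20) (s₀ := s) (k₁ := wishExpr)
    (k₂ := .load 45 (.reg 11)) (e := 1) (f₁ := wish PC B (s.arr 54)) (f₂ := PC)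
    (W := fun _ => 1) hwf hM (by decide) (by
      intro i hi t hx hr ha
      have hBi : (B i - 1) % 2 ^ w = B i - 1 := Nat.mod_eq_of_lt (by
        have : B i < 2 ^ w := by rw [← h49]; exact hwf.arr _ _
        omega)
      have m₁ : (1 + 1) % 2 ^ w = 2 := small_mod (by norm_num)
      have m₂ : 2 % 2 ^ w = 2 := small_mod (by norm_num)
      have m₃ : 1 % 2 ^ w = 1 := small_mod (by norm_num)
      simp only [wishExpr, eval_mul, eval_fails, eval_both, eval_load, eval_same, eval_sub,
        eval_reg, eval_one, eval_add, hx, ha 45 (by decide), ha 49 (by decide), ha 54 (by decide),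
        h45 i hi, h49, hBi, wish]
      by_cases c₁ : PC i ≠ 0 ∧ PC i = s.arr 54 (B i - 1)
      · simp [c₁.1, ← c₁.2]
      · by_cases c₂ : PC i ≠ 0 ∧ PC i = s.arr 54 (B i)
        · rw [if_neg c₁, if_pos c₂]
          have : ¬ PC i = s.arr 54 (B i - 1) := fun h => c₁ ⟨c₂.1, h⟩
          simp [c₂.1, ← c₂.2, this, m₂]
        · rw [if_neg c₁, if_neg c₂]
          have c₁' : ¬ (PC i ≠ 0 ∧ (if PC i = s.arr 54 (B i - 1) then 1 else 0) ≠ 0) := by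
            simpa using c₁
          have c₂' : ¬ (PC i ≠ 0 ∧ (if PC i = s.arr 54 (B i) then 1 else 0) ≠ 0) := by
            simpa using c₂
          rw [if_neg c₁', if_neg c₂']
          simp [m₃])
    (fun i hi t hx hr ha => by simp only [eval_load, eval_reg, hx, ha 45 (by decide), h45 i hi])
    (fun i hi t hx hr ha => by simp) (fun q hq => by unfold wish; split_ifs <;> omega) hPC
    (fun _ _ => le_rfl) (by omega)
  have hTm : ∀ p ∈ Icc 1 M, s₁.arr 20 p ∈ Icc 1 M := by
    intro p hp
    rw [hT p hp, lexCount_eq_cnt (P := fun _ => True) (fun _ _ => by simp)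
      fun _ _ _ => lexLT_iff]
    have := cnt_lt_of_mem (K := fun q => toLex (wish PC B (s.arr 54) q, PC q)) (fun _ => True) hp
    exact mem_Icc.2 ⟨by omega, this⟩
  obtain ⟨s₂, hr₂, h₂, -⟩ := run_map (A := 21)
    (e := Expr.less 0 (.load 45 (.reg 30)) * (.reg 30 - 1)) (bwd PC) (hr₁.wf hwf)
    (by rw [hr₁.reg_eq (by rfl), hM]) (by
    intro k hk t hx hr ha
    have e : t.arr 45 k = PC k := by rw [ha 45 (by norm_num), hr₁.arr_eq (by rfl), h45 k hk]
    have hk' := mem_Icc.1 hk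
    have m : (k - 1) % 2 ^ w = k - 1 := Nat.mod_eq_of_lt (by omega)
    simp only [eval_mul, eval_less, eval_zero, eval_load, eval_sub, eval_reg, eval_one, hx, m, e,
      bwd]
    by_cases h₀ : PC k = 0
    · simp [h₀]
    · rw [if_pos (by omega), if_neg h₀, one_mul, m])
  have hr₁₂ := hr₁.seq hr₂
  obtain ⟨s₃, hr₃, h₃, -⟩ := run_map (A := 22) (e := .load 43 (.reg 30)) REM (hr₁₂.wf hwf)
    (by rw [hr₁₂.reg_eq (by rfl), hM]) (by
    intro k hk t hx hr ha
    simp only [eval_load, eval_reg, hx, ha 43 (by norm_num)]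
    rw [hr₁₂.arr_eq (by rfl), h43])
  have hr₁₃ := hr₁₂.seq hr₃
  obtain ⟨s₄, hr₄, h10, hR₂⟩ := run_sufRank (M := M) (hr₁₃.wf hwf)
    (by rw [hr₁₃.reg_eq (by rfl), hM]) (hL.chain_bwd hLR hT₀ hTm)
    (fun p hp => by rw [hr₃.arr_eq (by rfl), hr₂.arr_eq (by rfl)])
    (fun p hp => by rw [hr₃.arr_eq (by rfl), h₂ p hp]) h₃ hbound
  have hr₁₄ := hr₁₃.seq hr₄
  have e40 : s₄.arr 40 = CODE := by rw [hr₁₄.arr_eq (by rfl), h40]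
  obtain ⟨s₅, hr₅, hO₀, hO⟩ := run_rankBy (w := w) (n := M) (A := 56) (s₀ := s₄)
    (k₁ := .load 25 (.reg 11)) (k₂ := .reg 11) (e := (Expr.load 40 (.reg 11)).fails)
    (f₁ := s₄.arr 25) (f₂ := fun p => p) (W := fun p => if CODE p = 0 then 1 else 0)
    (hr₁₄.wf hwf) h10 (by decide)
    (fun i hi t hx hr ha => by simp only [eval_load, eval_reg, hx, ha 25 (by decide)])
    (fun i hi t hx hr ha => by simp only [eval_reg, hx])
    (fun i hi t hx hr ha => by
      simp only [eval_fails, eval_load, eval_reg, hx, ha 40 (by decide), e40])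
    (fun q hq => by rw [hR₂.2 q hq]; exact cnt_lt_of_mem _ hq)
    (fun q hq => (mem_Icc.1 hq).2) (fun q hq => by split_ifs <;> omega) (by omega)
  have hr₁₅ := hr₁₄.seq hr₅
  obtain ⟨hinj, π, hπ, hout⟩ := hL.exists_isOptimal hLR hR hB hg hch hch₀ hT hR₂ hO₀ hO
  obtain ⟨s₆, hr₆, h₆, -⟩ := run_fill (w := w) (x := 30) (m := 10) (A := 2) (n := M)
    (i := (Expr.load 40 (.reg 30)).fails * (.load 56 (.reg 30) - 1) +
      Expr.less 0 (.load 40 (.reg 30)) * (.reg 0 + .reg 30)) (e := .load 41 (.reg 30))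
    (hr₁₅.wf hwf) (by rw [hr₅.reg_eq (by rfl), h10]) (by norm_num)
    -- The end of a string writes the number of the string to its place in the ordering. All other
    -- positions write to cells of their own behind the `d` cells of the output, so that one loop
    -- with injective targets suffices.
    (fun x => if CODE x = 0 then s₅.arr 56 x - 1 else I.d + x) OWN (by
      intro x hx y hy he
      have hx : x ∈ Icc 1 M := by simpa using hx
      have hy : y ∈ Icc 1 M := by simpa using hy
      have hx' := mem_Icc.1 hx
      have hy' := mem_Icc.1 hy
      beta_reduce at he
      split_ifs at he with c₁ c₂ c₂
      · obtain ⟨h₁, h₂, h₃⟩ := hinj x hx c₁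
        obtain ⟨h₄, -⟩ := hinj y hy c₂
        exact h₃ y hy c₂ (by omega)
      · have := hinj x hx c₁
        omega
      · have := hinj y hy c₂
        omega
      · omega) (by
      intro k hk t hx hr ha _ _
      have hk : k ∈ Icc 1 M := by simpa using hk
      have hk' := mem_Icc.1 hk
      have t0 : t.reg 0 = I.d := by rw [hr 0 (by norm_num), hr₁₅.reg_eq (by rfl), hd]
      have t40 : t.arr 40 = CODE := by rw [ha 40 (by norm_num), hr₅.arr_eq (by rfl), e40]
      have t41 : t.arr 41 = OWN := by rw [ha 41 (by norm_num), hr₁₅.arr_eq (by rfl), h41]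
      have m₁ : (I.d + k) % 2 ^ w = I.d + k := Nat.mod_eq_of_lt (by omega)
      simp only [eval_add, eval_mul, eval_fails, eval_sub, eval_less, eval_load, eval_reg,
        eval_zero, eval_one, hx, t0, t40, t41, m₁, ha 56 (by norm_num), and_true]
      by_cases c : CODE k = 0
      · have := hinj k hk c
        have m₂ : (s₅.arr 56 k - 1) % 2 ^ w = s₅.arr 56 k - 1 := Nat.mod_eq_of_lt (by omega)
        simp [c, m₂]
      · simp [c, m₁, Nat.pos_of_ne_zero c])
  refine ⟨s₆, π, (hr₁.seq (hr₂.seq (hr₃.seq (hr₄.seq (hr₅.seq hr₆))))).mono ?_, fun i => ?_, hπ⟩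
  · simp only [wishExpr, cost_add, cost_sub, cost_load, cost_reg, cost_zero, cost_one, cost_mul,
      cost_less, cost_fails, cost_both, cost_same]
    omega
  · obtain ⟨x, hx, hx₀, hxO, hxπ⟩ := hout i
    have := h₆ x (by simpa using hx)
    rw [if_pos hx₀, hxO, Nat.add_sub_cancel] at this
    rw [this, hxπ]

/-- The program that solves Constrained Alphabet Ordering. -/
def solver : Prog := readProg ;; rankProg ;; groupProg ;; orderProg

/-- Since `d ≤ N` and `1 ≤ N`, the text length plus one is at most `3 * N`, which turns the bounds
in the text length into bounds in `N`. -/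
theorem solver_solves (a : ℕ) :
    SolvesInTime solver a (a + 6) fun N => 3 * (400 * a + 200000) * N := by
  intro I hσ w hw
  have hN : 1 ≤ I.size := I.d_pos.trans_le I.d_le_size
  have hdN := I.d_le_size
  -- Five extra factors `N + 1 ≥ 2` yield the factor 32. The word length thus accommodates both `16
  -- * (N + d) + 16` for the addresses and the power `(N + 1) ^ (a + 1)` of the radix sort.
  have h₁ : 32 * (I.size + 1) < (I.size + 1) ^ (a + 6) + 1 := by
    calc 32 * (I.size + 1) ≤ (I.size + 1) ^ 5 * (I.size + 1) :=
          Nat.mul_le_mul_right _ (by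
            calc 32 = 2 ^ 5 := by norm_num
              _ ≤ _ := Nat.pow_le_pow_left (by omega) 5)
      _ = (I.size + 1) ^ 6 := by ring
      _ ≤ (I.size + 1) ^ (a + 6) := Nat.pow_le_pow_right (by omega) (by omega)
      _ < _ := Nat.lt_succ_self _
  have h₂ : (I.size + 1) ^ (a + 1) + 1 < 2 ^ w := by
    have : (I.size + 1) ^ (a + 1) * 2 ^ 5 ≤ (I.size + 1) ^ (a + 6) := by
      rw [show a + 6 = (a + 1) + 5 by omega, pow_add (I.size + 1) (a + 1) 5]
      exact Nat.mul_le_mul_left _ (Nat.pow_le_pow_left (by omega) 5)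
    have h₃ : 0 < (I.size + 1) ^ (a + 1) := by positivity
    omega
  have hbound : 16 * (I.size + I.d) + 16 < 2 ^ w := by omega
  have : Fact (8 ≤ 2 ^ w) := ⟨by omega⟩
  obtain ⟨s₁, hr₁, hwf₁, h10, h0, h36, hz, hL, hLR⟩ := run_readProg (I := I) (by omega) hσ h₂
  obtain ⟨s₂, hr₂, h10', h45, hR⟩ := run_rankProg hwf₁ h10 (hz 46 (by decide) 0) hL hLR hbound
  have hwf₂ := hr₂.wf hwf₁
  obtain ⟨s₃, K, hr₃, hB, hg, hch, hch₀⟩ := run_groupProg (sy := I.sy)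
    (PC := prevCode (s₁.arr 40) (s₁.arr 44)) hwf₂ h10' (by omega)
    (by rw [hr₂.reg_eq (by rfl), h36]) (fun A hA k => by
      have : s₂.arr A = s₁.arr A := by fin_cases hA <;> exact hr₂.arr_eq (by rfl)
      rw [this, hz A (by simp at hA ⊢; omega)]) h45
    (fun p hp q hq => hL.sy_eq_iff hLR hp hq) rfl hR.1
    (fun p hp => by rw [hR.2 p hp]; exact ⟨by omega, cnt_lt_of_mem _ hp⟩) (by omega)
  have hr₂₃ := hr₂.seq hr₃
  obtain ⟨s₄, π, hr₄, hout, hπ⟩ := run_orderProg (I := I) (hr₃.wf hwf₂)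
    (by rw [hr₃.reg_eq (by rfl), h10']) (by rw [hr₂₃.reg_eq (by rfl), h0])
    (hr₂₃.arr_eq (by rfl)) (hr₂₃.arr_eq (by rfl)) (hr₂₃.arr_eq (by rfl))
    (fun p hp => by rw [hr₃.arr_eq (by rfl), h45 p hp]) rfl hL hLR hR hB hg hch hch₀ hbound
  obtain ⟨t, ht, he⟩ := hr₁.seq (hr₂.seq (hr₃.seq hr₄))
  refine ⟨t, s₄, π, he, ht.trans ?_, hout, hπ⟩
  calc _ = (400 * a + 105400) * (I.size + I.d + 1) := by ring
    _ ≤ (400 * a + 200000) * (3 * I.size) := Nat.mul_le_mul (by omega) (by omega)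
    _ = _ := by ring

end CAO

/-! ### The lower bound -/

namespace CAO

open Finset

/-- Only `store` changes arrays, one cell at a time, and changes along consecutive executions are
subadditive. -/
theorem Exec.card_ne_le {w t : ℕ} {p : Prog} {s s' : State} (h : Exec w p s t s') (A : ℕ)
    (F : Finset ℕ) : #{i ∈ F | s'.arr A i ≠ s.arr A i} ≤ t := by
  have trans : ∀ (s₁ s₂ s₃ : State), #{i ∈ F | s₃.arr A i ≠ s₁.arr A i} ≤
      #{i ∈ F | s₂.arr A i ≠ s₁.arr A i} + #{i ∈ F | s₃.arr A i ≠ s₂.arr A i} := by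
    intro s₁ s₂ s₃
    refine (card_le_card fun i hi => ?_).trans (card_union_le _ _)
    simp only [mem_filter, mem_union] at hi ⊢
    by_cases h : s₂.arr A i = s₁.arr A i
    · exact Or.inr ⟨hi.1, by rw [h]; exact hi.2⟩
    · exact Or.inl ⟨hi.1, h⟩
  induction h with
  | skip => simp
  | assign => simp
  | store s B i e =>
    refine (card_le_card (t := {i.eval w s}) fun j hj => ?_).trans (by simp)
    by_contra hne
    rw [mem_singleton] at hne
    simp [hne] at hj
  | seq _ _ h₁ h₂ => exact (trans _ _ _).trans (add_le_add h₁ h₂)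
  | ite_true _ _ h => omega
  | ite_false _ _ h => omega
  | loop_true _ _ _ h₁ h₂ => exact (trans _ _ _).trans ((add_le_add h₁ h₂).trans (by omega))
  | loop_false => simp

/-- The instance with `n` strings that consist of the only letter. -/
def unaryInstance (n : ℕ) (hn : 0 < n) : Instance where
  d := n
  σ := 1
  T _ := [0]
  d_pos := hn
  T_ne_nil _ := by simp

/-- For `n` strings of length one, the output array is initially zero, and a permutation has exactly
one entry 0. All other `n - 1` cells must be written; optimality of the ordering plays no role. -/
theorem SolvesInTime.le {P : Prog} {a b : ℕ} {f : ℕ → ℕ} (h : SolvesInTime P a b f) {n : ℕ}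
    (hn : 0 < n) : n ≤ f n + 1 := by
  have hsize : (unaryInstance n hn).size = n := by
    change ∑ _i : Fin n, ([0] : List (Fin 1)).length = n
    simp
  -- The bound holds on every admissible machine, so any sufficiently large word length will do.
  have hw : (n + 1) ^ b ≤ 2 ^ (n * b) := by
    rw [pow_mul]
    exact Nat.pow_le_pow_left Nat.lt_two_pow_self b
  obtain ⟨t, s, π, he, ht, hout, -⟩ := h (unaryInstance n hn)
    (by rw [hsize]; exact Nat.one_le_pow _ _ (by omega)) (n * b) (by rwa [hsize])
  rw [hsize] at ht
  have hcard := he.card_ne_le 2 (range n)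
  obtain ⟨x, hx⟩ : ∃ x : Fin n, π x = ⟨0, hn⟩ := π.surjective _
  have hsub : (range n).erase x ⊆
      {i ∈ range n | s.arr 2 i ≠ (unaryInstance n hn).init.arr 2 i} := by
    intro i hi
    rw [mem_erase, mem_range] at hi
    refine mem_filter.2 ⟨mem_range.2 hi.2, ?_⟩
    rw [show (unaryInstance n hn).init.arr 2 i = 0 from rfl, hout ⟨i, hi.2⟩]
    intro h₀
    refine hi.1 ?_
    exact congrArg Fin.val (π.injective ((Fin.ext h₀ : π ⟨i, hi.2⟩ = ⟨0, hn⟩).trans hx.symm))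
  have := card_le_card hsub
  rw [card_erase_of_mem (mem_range.2 x.2), card_range] at this
  omega

end CAO

/-- Constrained Alphabet Ordering is solvable in linear time on a word RAM (one program, for all
polynomially bounded alphabets), and linear time is optimal. -/
theorem theorem4 :
    (∃ P : CAO.Prog, ∀ a : ℕ, ∃ b C : ℕ, CAO.SolvesInTime P a b (fun N => C * N)) ∧
    (∀ (P : CAO.Prog) (a b : ℕ) (f : ℕ → ℕ), CAO.SolvesInTime P a b f →
      ∃ c : ℝ, 0 < c ∧ ∀ᶠ N : ℕ in Filter.atTop, c * (N : ℝ) ≤ (f N : ℝ)) := by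
  refine ⟨⟨CAO.solver, fun a => ⟨a + 6, _, CAO.solver_solves a⟩⟩, fun P a b f h =>
    ⟨1 / 2, by norm_num, ?_⟩⟩
  filter_upwards [Filter.eventually_ge_atTop 2] with n hn
  have h₁ : (n : ℝ) ≤ f n + 1 := by exact_mod_cast h.le (by omega)
  have h₂ : (2 : ℝ) ≤ n := by exact_mod_cast hn
  linarith
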